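/- All manifolds are smooth, compact, Hausdorff and without boundary. A $C^1$ diffeomorphism $f:M\to M$ is \emph{partially hyperbolic} with splitting $TM=E^s\oplus E^c\oplus E^u$ (continuous, $Df$-invariant; each bundle may be trivial) if for some continuous Riemannian metric and every $x$ $$\|D_xf|_{E^s}\|<\min\{1,\,m(D_xf|_{E^c})\},\qquad m(D_xf|_{E^u})>\max\{1,\,\|D_xf|_{E^c}\|\},$$ where $m$ denotes the conorm (a map on a trivial bundle has norm $0$ and conorm $+\infty$; in the second inequality a trivial $E^u$ imposes no condition). Let $W^{ss}(x)$ and $W^{uu}(x)$ be the sets of points that can be joined to $x$ by a $C^1$ curve tangent to $E^s$, respectively to $E^u$ (the leaves of the strong stable and strong unstable foliations). For a $C^1$ function $\varphi:M\to\mathbb R$ put $$\operatorname{Hol}_x^{y}\varphi=\sum_{n\ge 0}\bigl(\varphi(f^nx)-\varphi(f^ny)\bigr)\ \ (y\in W^{ss}(x)),\qquad \operatorname{Hol}_x^{y}\varphi=-\sum_{n\ge 1}\bigl(\varphi(f^{-n}x)-\varphi(f^{-n}y)\bigr)\ \ (y\in W^{uu}(x)).$$ An $su$-sequence is a sequence $(x_0,\dots,x_k)$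 with $x_j\in W^{ss}(x_{j-1})$ or $x_j\in W^{uu}(x_{j-1})$ for each $j$ (a choice of one of the two being part of the data), and $\varphi$ has \emph{trivial periodic cycle functionals} if $\sum_{j=1}^k\operatorname{Hol}_{x_{j-1}}^{x_j}\varphi=0$ for every $su$-sequence with $x_0=x_k$. Fix $R\in\{1,2,\dots,\infty\}$. We say that \emph{the cohomological equation is solvable} for $f$ if for every $\varphi\in C^R(M)$ with trivial periodic cycle functionals there are a continuous $u:M\to\mathbb R$ and a constant $K$ with $\varphi=u\circ f-u+K$. We say that $f$ is \emph{cocycle stable} if the cohomological equation is solvable for $f$ and moreover the set of coboundaries $\{\varphi\in C^R(M):\varphi=u\circ f-u \text{ for some continuous } u\}$ is closed in $C^R(M)$, even for the $C^1$ topology. \textbf{Theorem.} Let $f:M\to M$ be partially hyperbolic with splitting $E^s\oplus E^c\oplus E^u$, and suppose that the cohomological equation is solvable for $f$. Let $N$ be connected and let $\tilde f:M\times N\to M\times N$ be a $C^1$ diffeomorphism of the form $\tilde f(x,y)=(fx,g_xy)$, with $C^1$ diffeomorphisms $g_x:N\to N$, which is a hyperbolic extension dominating the centre of $f$: there is a splitting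 $T_yN=V^s(x,y)\oplus V^u(x,y)$, depending continuously on $(x,y)\in M\times N$, with $D_yg_x\,V^{\sigma}(x,y)=V^{\sigma}(fx,g_xy)$ for $\sigma=s,u$, such that for every $(x,y)$ $$\|D_yg_x|_{V^s}\|<\min\{1,\,m(D_xf|_{E^c})\},\qquad m(D_yg_x|_{V^u})>\max\{1,\,\|D_xf|_{E^c}\|\},$$ where $E^c$ is measured with a metric on $M$ for which $f$ satisfies the inequalities of partial hyperbolicity, and vectors tangent to the fibres with some continuous Riemannian metric on $M\times N$. Suppose that some Borel probability measure $\mu$ on $N$ is preserved by $g_x$ for every $x\in M$. Then $\tilde f$ is partially hyperbolic with a splitting $\tilde E^s\oplus\tilde E^c\oplus\tilde E^u$ of $T(M\times N)$ whose bundles project onto $E^s,E^c,E^u$ respectively and meet the vertical directions $0\times T_yN$ in $V^s$, $0$ and $V^u$ respectively, and, with respect to this splitting, $\tilde f$ is cocycle stable. -/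

import Mathlib

open Set MeasureTheory Bundle
open scoped Manifold ContDiff UniformConvergence Topology

namespace PHCocycle

/-! ### Metrics and partially hyperbolic splittings -/

section General

variable {E : Type*} [NormedAddCommGroup E] [NormedSpace ℝ E]
  {H : Type*} [TopologicalSpace H] (I : ModelWithCorners ℝ E H)
  (M : Type*) [TopologicalSpace M] [ChartedSpace H M]

/-- A continuous Riemannian metric on `M`. -/
abbrev Metric [IsManifold I 1 M] : Type _ :=
  ContinuousRiemannianMetric E (TangentSpace I : M → Type _)

/-- Three families of subspaces of the tangent spaces: stable, central and unstable. -/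
structure Splitting where
  /-- stable subspaces -/
  s : ∀ x : M, Submodule ℝ (TangentSpace I x)
  /-- central subspaces -/
  c : ∀ x : M, Submodule ℝ (TangentSpace I x)
  /-- unstable subspaces -/
  u : ∀ x : M, Submodule ℝ (TangentSpace I x)

variable {I M}

/-- The length of a tangent vector. -/
noncomputable def Metric.len [IsManifold I 1 M] (g : Metric I M) {x : M}
    (v : TangentSpace I x) : ℝ :=
  Real.sqrt (g.inner x v v)

/-- A family of subspaces of the tangent spaces is closed if the vectors that lie in it form a
closed subset of the tangent bundle. If `TM` is the direct sum of finitely many such families (in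
finite dimension), each of them is a continuous subbundle: dimensions are upper semicontinuous
and add up to a locally constant number. -/
def IsClosedFamily [IsManifold I 1 M] (D : ∀ x : M, Submodule ℝ (TangentSpace I x)) : Prop :=
  IsClosed {v : TangentBundle I M | v.2 ∈ D v.1}

/-- `f` is partially hyperbolic with respect to the splitting `TM = Eˢ ⊕ Eᶜ ⊕ Eᵘ` and the metric
`g`. The norm and conorm inequalities are written with vectors: in finite dimension
`‖A‖ < m(B)` says that `‖A v‖ / ‖v‖ < ‖B w‖ / ‖w‖` for all nonzero `v`, `w`. -/
structure IsPartiallyHyperbolicFor [IsManifold I 1 M] (g : Metric I M)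
    (f : M ≃ₘ^1⟮I, I⟯ M) (S : Splitting I M) : Prop where
  closed_s : IsClosedFamily S.s
  closed_c : IsClosedFamily S.c
  closed_u : IsClosedFamily S.u
  disjoint_cu : ∀ x, Disjoint (S.c x) (S.u x)
  compl_s : ∀ x, IsCompl (S.s x) (S.c x ⊔ S.u x)
  invariant_s : ∀ x, (S.s x).map (mfderiv I I f x).toLinearMap = S.s (f x)
  invariant_c : ∀ x, (S.c x).map (mfderiv I I f x).toLinearMap = S.c (f x)
  invariant_u : ∀ x, (S.u x).map (mfderiv I I f x).toLinearMap = S.u (f x)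
  contracts : ∀ x, ∀ v ∈ S.s x, v ≠ 0 → g.len (mfderiv I I f x v) < g.len v
  expands : ∀ x, ∀ v ∈ S.u x, v ≠ 0 → g.len v < g.len (mfderiv I I f x v)
  dominated_s : ∀ x, ∀ v ∈ S.s x, ∀ w ∈ S.c x, v ≠ 0 → w ≠ 0 →
    g.len (mfderiv I I f x v) / g.len v < g.len (mfderiv I I f x w) / g.len w
  dominated_u : ∀ x, ∀ v ∈ S.u x, ∀ w ∈ S.c x, v ≠ 0 → w ≠ 0 →
    g.len (mfderiv I I f x w) / g.len w < g.len (mfderiv I I f x v) / g.len v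

/-- `f` is partially hyperbolic with splitting `S` (for some metric). -/
def IsPartiallyHyperbolic [IsManifold I 1 M] (f : M ≃ₘ^1⟮I, I⟯ M) (S : Splitting I M) : Prop :=
  ∃ g : Metric I M, IsPartiallyHyperbolicFor g f S

/-! ### Leaves, `su`-sequences and periodic cycle functionals -/

/-- `y` lies on the integral leaf through `x` of the family `D`: some `C¹` curve tangent to `D`
goes from `x` to `y`. For `D = Eˢ` or `Eᵘ` of a partially hyperbolic diffeomorphism these are the
leaves of the strong stable and of the strong unstable foliation. -/
def InLeaf (D : ∀ x : M, Submodule ℝ (TangentSpace I x)) (x y : M) : Prop :=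
  ∃ γ : ℝ → M, ContMDiff 𝓘(ℝ, ℝ) I 1 γ ∧ γ 0 = x ∧ γ 1 = y ∧
    ∀ t ∈ Icc (0 : ℝ) 1, mfderiv 𝓘(ℝ, ℝ) I γ t (1 : ℝ) ∈ D (γ t)

/-- The holonomy functional from `x` to a point `y` of its strong stable leaf. -/
noncomputable def holS (f : M ≃ₘ^1⟮I, I⟯ M) (φ : M → ℝ) (x y : M) : ℝ :=
  ∑' n : ℕ, (φ (f^[n] x) - φ (f^[n] y))

/-- The holonomy functional from `x` to a point `y` of its strong unstable leaf. -/
noncomputable def holU (f : M ≃ₘ^1⟮I, I⟯ M) (φ : M → ℝ) (x y : M) : ℝ :=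
  -∑' n : ℕ, (φ (f.symm^[n + 1] x) - φ (f.symm^[n + 1] y))

/-- The two kinds of legs of an `su`-sequence. -/
inductive Leg
  | stable
  | unstable

/-- `p 0, …, p k` is an `su`-sequence whose `j`-th leg, from `p j` to `p (j + 1)`, is of kind
`σ j`. -/
def IsSUSequence (S : Splitting I M) (k : ℕ) (p : ℕ → M) (σ : ℕ → Leg) : Prop :=
  ∀ j < k, match σ j with
    | .stable => InLeaf S.s (p j) (p (j + 1))
    | .unstable => InLeaf S.u (p j) (p (j + 1))

/-- The holonomy functional along an `su`-sequence. -/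
noncomputable def hol (f : M ≃ₘ^1⟮I, I⟯ M) (φ : M → ℝ) (k : ℕ) (p : ℕ → M) (σ : ℕ → Leg) : ℝ :=
  ∑ j ∈ Finset.range k, match σ j with
    | .stable => holS f φ (p j) (p (j + 1))
    | .unstable => holU f φ (p j) (p (j + 1))

/-- `φ` has trivial periodic cycle functionals: its holonomy along every closed `su`-sequence
vanishes. -/
def TrivialPCF (f : M ≃ₘ^1⟮I, I⟯ M) (S : Splitting I M) (φ : M → ℝ) : Prop :=
  ∀ (k : ℕ) (p : ℕ → M) (σ : ℕ → Leg), IsSUSequence S k p σ → p 0 = p k → hol f φ k p σ = 0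

/-! ### The cohomological equation and cocycle stability -/

/-- Every `C^R` function with trivial periodic cycle functionals is cohomologous to a constant,
with a continuous transfer function. -/
def CohomologicalEquationSolvable (R : ℕ∞) (f : M ≃ₘ^1⟮I, I⟯ M) (S : Splitting I M) : Prop :=
  ∀ φ : M → ℝ, ContMDiff I 𝓘(ℝ, ℝ) R φ → TrivialPCF f S φ →
    ∃ (u : M → ℝ) (K : ℝ), Continuous u ∧ ∀ x, φ x = u (f x) - u x + K

/-- `φ` is a coboundary with a continuous transfer function. -/
def IsCoboundary (f : M ≃ₘ^1⟮I, I⟯ M) (φ : M → ℝ) : Prop :=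
  ∃ u : M → ℝ, Continuous u ∧ ∀ x, φ x = u (f x) - u x

/-- The `C¹` topology on the space of `C^R` functions: uniform convergence of the functions, and
uniform convergence on compact subsets of the tangent bundle of their differentials. -/
noncomputable abbrev c1Topology [IsManifold I 1 M] (R : ℕ∞) :
    TopologicalSpace (ContMDiffMap I 𝓘(ℝ, ℝ) M ℝ R) :=
  TopologicalSpace.induced
    (fun φ => ((UniformFun.ofFun φ : M →ᵤ ℝ),
      (UniformOnFun.ofFun {C | IsCompact C}
        (fun v : TangentBundle I M => (mfderiv I 𝓘(ℝ, ℝ) φ v.1 v.2 : ℝ)) :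
        TangentBundle I M →ᵤ[{C | IsCompact C}] ℝ)))
    inferInstance

/-- Cocycle stability among `C^R` functions: the obstructions to solving the cohomological equation
are exactly the periodic cycle functionals, and the set of coboundaries is closed. Closedness is
asked for in the `C¹` topology, hence it holds in the finer `C^R` topology (`R ≥ 1`) too. -/
structure IsCocycleStable [IsManifold I 1 M] (R : ℕ∞) (f : M ≃ₘ^1⟮I, I⟯ M)
    (S : Splitting I M) : Prop where
  solvable : CohomologicalEquationSolvable R f S
  closed : IsClosed[c1Topology R] {φ : ContMDiffMap I 𝓘(ℝ, ℝ) M ℝ R | IsCoboundary f φ}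

end General

/-! ### Hyperbolic extensions -/

section Extension

variable {E : Type*} [NormedAddCommGroup E] [NormedSpace ℝ E]
  {H : Type*} [TopologicalSpace H] {I : ModelWithCorners ℝ E H}
  {M : Type*} [TopologicalSpace M] [ChartedSpace H M]
  {F : Type*} [NormedAddCommGroup F] [NormedSpace ℝ F]
  {H' : Type*} [TopologicalSpace H'] {J : ModelWithCorners ℝ F H'}
  {N : Type*} [TopologicalSpace N] [ChartedSpace H' N]

/-- The vector `(0, w)` tangent to `M × N` at `(x, y)`. -/
noncomputable def vertical (x : M) (y : N) :
    TangentSpace J y →L[ℝ] TangentSpace (I.prod J) (x, y) :=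
  mfderiv J (I.prod J) (fun y' : N => (x, y')) y

/-- The differential at `p` of the projection `M × N → M`. -/
noncomputable def horizontalProj (p : M × N) :
    TangentSpace (I.prod J) p →L[ℝ] TangentSpace I p.1 :=
  mfderiv (I.prod J) I (Prod.fst : M × N → M) p

variable [IsManifold I 1 M] [IsManifold J 1 N]

/-- The fibre maps `g x : {x} × N → {f x} × N` are hyperbolic, with fibre splitting
`T_y N = Vˢ(x, y) ⊕ Vᵘ(x, y)`, and they dominate the central direction of `f`. Fibre vectors are
measured with the metric `h` of `M × N`, vectors tangent to `M` with the metric `m`. -/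
structure IsDominatingHyperbolicFibre (m : Metric I M) (h : Metric (I.prod J) (M × N))
    (f : M ≃ₘ^1⟮I, I⟯ M) (S : Splitting I M) (g : M → N ≃ₘ^1⟮J, J⟯ N)
    (Vs Vu : M → ∀ y : N, Submodule ℝ (TangentSpace J y)) : Prop where
  closed_s : IsClosed {q : M × TangentBundle J N | q.2.2 ∈ Vs q.1 q.2.1}
  closed_u : IsClosed {q : M × TangentBundle J N | q.2.2 ∈ Vu q.1 q.2.1}
  isCompl : ∀ x y, IsCompl (Vs x y) (Vu x y)
  invariant_s : ∀ x y, (Vs x y).map (mfderiv J J (g x) y).toLinearMap = Vs (f x) (g x y)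
  invariant_u : ∀ x y, (Vu x y).map (mfderiv J J (g x) y).toLinearMap = Vu (f x) (g x y)
  contracts : ∀ x y, ∀ v ∈ Vs x y, v ≠ 0 →
    h.len (vertical (I := I) (f x) (g x y) (mfderiv J J (g x) y v)) <
      h.len (vertical (I := I) x y v)
  expands : ∀ x y, ∀ v ∈ Vu x y, v ≠ 0 →
    h.len (vertical (I := I) x y v) <
      h.len (vertical (I := I) (f x) (g x y) (mfderiv J J (g x) y v))
  dominates_s : ∀ x y, ∀ v ∈ Vs x y, ∀ w ∈ S.c x, v ≠ 0 → w ≠ 0 →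
    h.len (vertical (I := I) (f x) (g x y) (mfderiv J J (g x) y v)) /
        h.len (vertical (I := I) x y v) <
      m.len (mfderiv I I f x w) / m.len w
  dominates_u : ∀ x y, ∀ v ∈ Vu x y, ∀ w ∈ S.c x, v ≠ 0 → w ≠ 0 →
    m.len (mfderiv I I f x w) / m.len w <
      h.len (vertical (I := I) (f x) (g x y) (mfderiv J J (g x) y v)) /
        h.len (vertical (I := I) x y v)

/-- The splitting `T` of `T(M × N)` is induced by the splitting `S` of `TM` and by the fibre
splitting `Vˢ ⊕ Vᵘ`: each of its bundles projects onto the corresponding bundle of `S`, and its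
stable, central and unstable vertical vectors are those of `Vˢ`, `0` and `Vᵘ`. -/
structure Splitting.IsInduced (T : Splitting (I.prod J) (M × N)) (S : Splitting I M)
    (Vs Vu : M → ∀ y : N, Submodule ℝ (TangentSpace J y)) : Prop where
  proj_s : ∀ p, (T.s p).map (horizontalProj p).toLinearMap = S.s p.1
  proj_c : ∀ p, (T.c p).map (horizontalProj p).toLinearMap = S.c p.1
  proj_u : ∀ p, (T.u p).map (horizontalProj p).toLinearMap = S.u p.1
  vert_s : ∀ x y, (T.s (x, y)).comap (vertical (I := I) x y).toLinearMap = Vs x y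
  vert_c : ∀ x y, (T.c (x, y)).comap (vertical (I := I) x y).toLinearMap = ⊥
  vert_u : ∀ x y, (T.u (x, y)).comap (vertical (I := I) x y).toLinearMap = Vu x y

end Extension

end PHCocycle

set_option linter.unusedSectionVars false

namespace PHCocycle

section Framing

variable {E : Type*} [NormedAddCommGroup E] [NormedSpace ℝ E]
  {H : Type*} [TopologicalSpace H] {I : ModelWithCorners ℝ E H}
  {X : Type*} [TopologicalSpace X] [ChartedSpace H X]
  {W : Type*} [NormedAddCommGroup W] [NormedSpace ℝ W]
  {V : Type*} [NormedAddCommGroup V] [NormedSpace ℝ V]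

variable (I) in
/-- The differential of a function with values in a vector space. -/
noncomputable def vderiv (K : X → V) (p : X) : TangentSpace I p →L[ℝ] V :=
  mfderiv I 𝓘(ℝ, V) K p

variable (I X W) in
/-- An injective immersion of `X` in a vector space, with left inverses of its differentials that
depend continuously on the point. -/
structure Framing [IsManifold I 1 X] where
  /-- the immersion -/
  ι : X → W
  contMDiff : ContMDiff I 𝓘(ℝ, W) 1 ι
  inj : Function.Injective ι
  /-- left inverses of the differentials -/
  ρ : ∀ p : X, W →L[ℝ] TangentSpace I p
  left_inv : ∀ p (v : TangentSpace I p), ρ p (vderiv I ι p v) = v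
  cont : Continuous fun q : X × W => (⟨q.1, ρ q.1 q.2⟩ : TangentBundle I X)

variable [IsManifold I 1 X]

theorem continuous_vderiv {K : X → V} (hK : ContMDiff I 𝓘(ℝ, V) 1 K) :
    Continuous fun v : TangentBundle I X => vderiv I K v.1 v.2 := by
  have h1 := hK.continuous_tangentMap le_rfl
  have h2 := (contMDiff_snd_tangentBundle_modelSpace (n := 0) V 𝓘(ℝ, V)).continuous
  exact h2.comp h1

section Existence

variable [FiniteDimensional ℝ E]

theorem continuousOn_vderiv_symmL {ι : X → W} (hι : ContMDiff I 𝓘(ℝ, W) 1 ι) (p₀ : X) :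
    ContinuousOn (fun p => vderiv I ι p ∘L
      (trivializationAt E (TangentSpace I : X → Type _) p₀).symmL ℝ p)
      (trivializationAt E (TangentSpace I : X → Type _) p₀).baseSet := by
  set T := trivializationAt E (TangentSpace I : X → Type _) p₀ with hT
  refine continuousOn_clm_apply.2 fun v => ?_
  have h1 : ContinuousOn (fun p : X => (⟨p, T.symm p v⟩ : TangentBundle I X)) T.baseSet :=
    T.continuousOn_symm.comp (f := fun p : X => (p, v)) (by fun_prop)
      (fun p hp => ⟨hp, mem_univ _⟩)
  refine ((continuous_vderiv hι).comp_continuousOn h1).congr fun p hp => ?_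
  exact congrArg (vderiv I ι p) (T.symmL_apply (R := ℝ) hp v)

theorem exists_local_left_inverse [FiniteDimensional ℝ W] {ι : X → W}
    (hι : ContMDiff I 𝓘(ℝ, W) 1 ι) (hinj : ∀ p, Function.Injective (vderiv I ι p)) (p₀ : X) :
    ∃ U ∈ 𝓝 p₀, U ⊆ (trivializationAt E (TangentSpace I : X → Type _) p₀).baseSet ∧
      ∃ D : X → W →L[ℝ] E, ContinuousOn D U ∧ ∀ p ∈ U, ∀ v : TangentSpace I p,
        D p (vderiv I ι p v) =
          (trivializationAt E (TangentSpace I : X → Type _) p₀).continuousLinearMapAt ℝ p v := by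
  set T := trivializationAt E (TangentSpace I : X → Type _) p₀ with hT
  let B : X → E →L[ℝ] W := fun p => vderiv I ι p ∘L T.symmL ℝ p
  have hB : ContinuousOn B T.baseSet := continuousOn_vderiv_symmL hι p₀
  have hp₀ : p₀ ∈ T.baseSet := FiberBundle.mem_baseSet_trivializationAt' p₀
  have hTnhds : T.baseSet ∈ 𝓝 p₀ := T.open_baseSet.mem_nhds hp₀
  have hBinj : Function.Injective (B p₀) := by
    refine (hinj p₀).comp ?_
    have h := (T.continuousLinearEquivAt ℝ p₀ hp₀).symm.injective
    rw [T.symm_continuousLinearEquivAt_eq hp₀] at h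
    exact h
  obtain ⟨k, hk⟩ := LinearMap.exists_leftInverse_of_injective (B p₀).toLinearMap
    (LinearMap.ker_eq_bot.2 hBinj)
  let Kc : W →L[ℝ] E := LinearMap.toContinuousLinearMap k
  let U : X → E →L[ℝ] E := fun p => Kc ∘L B p
  have hU : ContinuousOn U T.baseSet := continuousOn_const.clm_comp hB
  have hU₀ : U p₀ = 1 := by
    ext v
    exact LinearMap.congr_fun hk v
  have hunit : ∀ᶠ p in 𝓝 p₀, IsUnit (U p) := by
    refine (hU.continuousAt hTnhds).eventually ?_
    rw [hU₀]
    exact (Units.isOpen (R := E →L[ℝ] E)).mem_nhds isUnit_one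
  refine ⟨T.baseSet ∩ {p | IsUnit (U p)}, Filter.inter_mem hTnhds hunit, inter_subset_left,
    fun p => Ring.inverse (U p) ∘L Kc, ?_, ?_⟩
  · have hinvc : ContinuousOn (fun p => Ring.inverse (U p)) (T.baseSet ∩ {p | IsUnit (U p)}) := by
      intro p hp
      obtain ⟨u, hu⟩ := hp.2
      have h2 : ContinuousAt Ring.inverse (U p) := hu ▸ NormedRing.inverse_continuousAt u
      exact h2.comp_continuousWithinAt ((hU p hp.1).mono inter_subset_left)
    exact hinvc.clm_comp continuousOn_const
  · rintro p ⟨hp, hpu⟩ v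
    set e := T.continuousLinearMapAt ℝ p v with he
    have hv : vderiv I ι p v = B p e := by
      change _ = vderiv I ι p (T.symmL ℝ p (T.continuousLinearMapAt ℝ p v))
      rw [T.symmL_continuousLinearMapAt hp]
    rw [hv]
    have h3 : Ring.inverse (U p) * U p = 1 := Ring.inverse_mul_cancel _ hpu
    exact congrArg (fun A : E →L[ℝ] E => A e) h3

theorem exists_framing_of_immersion [FiniteDimensional ℝ W] [CompactSpace X] [T2Space X]
    {ι : X → W} (hι : ContMDiff I 𝓘(ℝ, W) 1 ι) (hι_inj : Function.Injective ι)
    (hinj : ∀ p, Function.Injective (vderiv I ι p)) :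
    ∃ Φ : Framing I X W, Φ.ι = ι := by
  let t : X → Set (W →L[ℝ] W) := fun p => {P |
      (∀ v : TangentSpace I p, P (vderiv I ι p v) = vderiv I ι p v) ∧
      ∀ w, ∃ v : TangentSpace I p, P w = vderiv I ι p v}
  obtain ⟨P, hP⟩ := exists_continuous_forall_mem_convex_of_local (t := t)
    (by
      rintro p P hP Q hQ a b - - hab
      refine ⟨fun v => ?_, fun w => ?_⟩
      · have h1 := hP.1 v
        have h2 := hQ.1 v
        simp only [add_apply, smul_apply, h1, h2]
        rw [← add_smul, hab, one_smul]
      · obtain ⟨v, hv⟩ := hP.2 w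
        obtain ⟨v', hv'⟩ := hQ.2 w
        exact ⟨a • v + b • v', by simp [hv, hv']⟩)
    (fun p₀ => by
      obtain ⟨U, hU, hUT, D, hD, h⟩ := exists_local_left_inverse hι hinj p₀
      set T := trivializationAt E (TangentSpace I : X → Type _) p₀ with hT
      refine ⟨U, hU, fun p => (vderiv I ι p ∘L T.symmL ℝ p) ∘L D p,
        ((continuousOn_vderiv_symmL hι p₀).mono hUT).clm_comp hD, fun p hp => ⟨fun v => ?_,
          fun w => ⟨T.symmL ℝ p (D p w), rfl⟩⟩⟩
      change vderiv I ι p (T.symmL ℝ p (D p (vderiv I ι p v))) = _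
      rw [h p hp, T.symmL_continuousLinearMapAt (hUT hp)])
  have hex : ∀ p : X, ∃ r : W →L[ℝ] TangentSpace I p, ∀ w, vderiv I ι p (r w) = P p w := by
    intro p
    obtain ⟨k, hk⟩ := LinearMap.exists_leftInverse_of_injective (vderiv I ι p).toLinearMap
      (LinearMap.ker_eq_bot.2 (hinj p))
    refine ⟨(LinearMap.toContinuousLinearMap k) ∘L (P p), fun w => ?_⟩
    obtain ⟨v, hv⟩ := (hP p).2 w
    have : k (vderiv I ι p v) = v := LinearMap.congr_fun hk v
    have h2 : k (P p w) = v := by rw [hv]; exact this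
    change vderiv I ι p (k (P p w)) = _
    rw [h2, hv]
  choose r hr using hex
  refine ⟨⟨ι, hι, hι_inj, r, fun p v => hinj p ?_, ?_⟩, rfl⟩
  · rw [hr, (hP p).1]
  rw [continuous_iff_continuousAt]
  rintro ⟨p₀, w₀⟩
  rw [FiberBundle.continuousAt_totalSpace]
  refine ⟨continuous_fst.continuousAt, ?_⟩
  obtain ⟨U, hU, hUT, D, hD, h⟩ := exists_local_left_inverse hι hinj p₀
  set T := trivializationAt E (TangentSpace I : X → Type _) p₀ with hT
  have hmain : ContinuousAt (fun q : X × W => D q.1 (P q.1 q.2)) (p₀, w₀) := by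
    have h1 : ContinuousAt (fun q : X × W => D q.1) (p₀, w₀) :=
      ContinuousAt.comp (f := Prod.fst) (g := D) (hD.continuousAt hU) continuous_fst.continuousAt
    exact h1.clm_apply
      ((P.continuous.comp continuous_fst).clm_apply continuous_snd).continuousAt
  refine hmain.congr ?_
  filter_upwards [(continuous_fst.continuousAt (x := (p₀, w₀))).eventually hU] with q hq
  rw [← hr, h q.1 hq, T.continuousLinearMapAt_apply_of_mem ℝ (hUT hq)]

end Existence

theorem exists_framing (I : ModelWithCorners ℝ E H) (X : Type*) [TopologicalSpace X]
    [ChartedSpace H X] [IsManifold I ∞ X] [FiniteDimensional ℝ E] [CompactSpace X] [T2Space X] :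
    ∃ n : ℕ, Nonempty (Framing I X (EuclideanSpace ℝ (Fin n))) := by
  obtain ⟨n, e, h1, h2, h3⟩ := exists_embedding_euclidean_of_compact (I := I) (M := X)
  obtain ⟨Φ, -⟩ := exists_framing_of_immersion (h1.of_le (by exact_mod_cast le_top)) h2.injective h3
  exact ⟨n, ⟨Φ⟩⟩

end Framing

end PHCocycle

namespace PHCocycle

section ClosedFamilies

variable {B : Type*} [TopologicalSpace B] {W : Type*} [NormedAddCommGroup W] [NormedSpace ℝ W]

/-- A family of subspaces of a fixed vector space with closed total space. -/
def ClosedSubspaces (A : B → Submodule ℝ W) : Prop := IsClosed {q : B × W | q.2 ∈ A q.1}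

variable [FiniteDimensional ℝ W] {A A' : B → Submodule ℝ W}

theorem ClosedSubspaces.exists_norm_le [CompactSpace B] (hA : ClosedSubspaces A)
    (hA' : ClosedSubspaces A') (hd : ∀ p, Disjoint (A p) (A' p)) :
    ∃ C : ℝ, 0 < C ∧ ∀ p, ∀ a ∈ A p, ∀ b ∈ A' p, ‖a‖ ≤ C * ‖a + b‖ := by
  have : ProperSpace W := FiniteDimensional.proper ℝ W
  let K : Set (B × W × W) :=
    {q | q.2.1 ∈ A q.1 ∧ q.2.2 ∈ A' q.1} ∩
      (univ ×ˢ (Metric.sphere 0 1 ×ˢ Metric.closedBall 0 2))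
  have hK : IsCompact K := by
    refine IsCompact.inter_left ?_ ?_
    · exact isCompact_univ.prod ((isCompact_sphere _ _).prod (isCompact_closedBall _ _))
    · exact (hA.preimage (f := fun q : B × W × W => (q.1, q.2.1)) (by fun_prop)).inter
        (hA'.preimage (f := fun q : B × W × W => (q.1, q.2.2)) (by fun_prop))
  obtain ⟨c, hc, hcK⟩ : ∃ c : ℝ, 0 < c ∧ ∀ q ∈ K, c ≤ ‖q.2.1 + q.2.2‖ := by
    refine hK.exists_forall_le' (f := fun q => ‖q.2.1 + q.2.2‖) (by fun_prop) (a := 0) ?_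
    rintro ⟨p, a, b⟩ ⟨⟨ha, hb⟩, -, ha1, -⟩
    refine norm_pos_iff.2 fun h0 => ?_
    have h0' : a + b = 0 := h0
    have hab : a = -b := eq_neg_of_add_eq_zero_left h0'
    have : a = 0 := (Submodule.disjoint_def.1 (hd p)) a ha (hab ▸ (A' p).neg_mem hb)
    simp [this] at ha1
  refine ⟨1 / min c 1, by positivity, fun p a ha b hb => ?_⟩
  rcases eq_or_ne a 0 with rfl | ha0
  · simp; positivity
  have hn : 0 < ‖a‖ := norm_pos_iff.2 ha0
  have key : min c 1 ≤ ‖a‖⁻¹ * ‖a + b‖ := by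
    have e1 : ‖a‖⁻¹ * ‖a + b‖ = ‖‖a‖⁻¹ • a + ‖a‖⁻¹ • b‖ := by
      rw [← smul_add, norm_smul, norm_inv, norm_norm]
    have e2 : ‖‖a‖⁻¹ • a‖ = 1 := by
      rw [norm_smul, norm_inv, norm_norm, inv_mul_cancel₀ hn.ne']
    rw [e1]
    rcases le_total ‖‖a‖⁻¹ • b‖ 2 with h | h
    · refine (min_le_left _ _).trans (hcK (p, ‖a‖⁻¹ • a, ‖a‖⁻¹ • b) ⟨⟨?_, ?_⟩, mem_univ _, ?_, ?_⟩)
      · exact (A p).smul_mem _ ha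
      · exact (A' p).smul_mem _ hb
      · simpa using e2
      · simpa using h
    · refine (min_le_right _ _).trans ?_
      have := norm_sub_norm_le (‖a‖⁻¹ • b) (-(‖a‖⁻¹ • a))
      rw [norm_neg, e2, sub_neg_eq_add, add_comm (‖a‖⁻¹ • b)] at this
      linarith
  rw [one_div, inv_mul_eq_div, le_div_iff₀ (by positivity)]
  calc ‖a‖ * min c 1 ≤ ‖a‖ * (‖a‖⁻¹ * ‖a + b‖) := by gcongr
    _ = ‖a + b‖ := by field_simp

/-- Components in disjoint closed families of subspaces converge along ultrafilters. -/
theorem ClosedSubspaces.tendsto_components [CompactSpace B] (hA : ClosedSubspaces A)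
    (hA' : ClosedSubspaces A') (hd : ∀ p, Disjoint (A p) (A' p)) {Z : Type*} (u : Ultrafilter Z)
    {p : Z → B} {a c : Z → W} {p₀ : B} {c₀ : W} (hp : Filter.Tendsto p u (𝓝 p₀))
    (hc : Filter.Tendsto c u (𝓝 c₀)) (ha : ∀ᶠ z in (u : Filter Z), a z ∈ A (p z))
    (hb : ∀ᶠ z in (u : Filter Z), c z - a z ∈ A' (p z)) :
    ∃ a₀ ∈ A p₀, c₀ - a₀ ∈ A' p₀ ∧ Filter.Tendsto a u (𝓝 a₀) := by
  have : ProperSpace W := FiniteDimensional.proper ℝ W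
  obtain ⟨C, hC, hb'⟩ := hA.exists_norm_le hA' hd
  have hbd : ∀ᶠ z in (u : Filter Z), a z ∈ Metric.closedBall (0 : W) (C * (‖c₀‖ + 1)) := by
    have h1 : ∀ᶠ z in (u : Filter Z), ‖c z‖ < ‖c₀‖ + 1 :=
      hc.norm.eventually_lt_const (lt_add_one _)
    filter_upwards [ha, hb, h1] with z h2 h3 h4
    have := hb' (p z) (a z) h2 _ h3
    rw [add_sub_cancel] at this
    simpa using this.trans (by gcongr)
  obtain ⟨a₀, -, ha₀⟩ := (isCompact_closedBall (0 : W) (C * (‖c₀‖ + 1))).ultrafilter_le_nhds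
    (u.map a) (Filter.le_principal_iff.2 hbd)
  have ha₀ : Filter.Tendsto a u (𝓝 a₀) := ha₀
  refine ⟨a₀, ?_, ?_, ha₀⟩
  · exact IsClosed.mem_of_tendsto (s := {q : B × W | q.2 ∈ A q.1}) hA (hp.prodMk_nhds ha₀) ha
  · exact IsClosed.mem_of_tendsto (s := {q : B × W | q.2 ∈ A' q.1}) hA'
      (hp.prodMk_nhds (hc.sub ha₀)) hb

theorem ClosedSubspaces.sup [CompactSpace B] (hA : ClosedSubspaces A)
    (hA' : ClosedSubspaces A') (hd : ∀ p, Disjoint (A p) (A' p)) :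
    ClosedSubspaces fun p => A p ⊔ A' p := by
  refine isClosed_iff_ultrafilter.2 ?_
  rintro ⟨p₀, c₀⟩ u hu hmem
  have h : ∀ q : B × W, ∃ a : W, q.2 ∈ A q.1 ⊔ A' q.1 → a ∈ A q.1 ∧ q.2 - a ∈ A' q.1 := by
    intro q
    by_cases hq : q.2 ∈ A q.1 ⊔ A' q.1
    · obtain ⟨a, ha, b, hb, hab⟩ := Submodule.mem_sup.1 hq
      exact ⟨a, fun _ => ⟨ha, by rw [← hab]; simpa using hb⟩⟩
    · exact ⟨0, fun h => (hq h).elim⟩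
  choose a ha using h
  have hu1 : Filter.Tendsto (fun q : B × W => q.1) u (𝓝 p₀) :=
    (continuous_fst.tendsto (p₀, c₀)).mono_left hu
  have hu2 : Filter.Tendsto (fun q : B × W => q.2) u (𝓝 c₀) :=
    (continuous_snd.tendsto (p₀, c₀)).mono_left hu
  obtain ⟨a₀, h1, h2, -⟩ := hA.tendsto_components hA' hd u hu1 hu2 (a := a)
    (Filter.mem_of_superset hmem fun q hq => (ha q hq).1)
    (Filter.mem_of_superset hmem fun q hq => (ha q hq).2)
  exact Submodule.mem_sup.2 ⟨a₀, h1, c₀ - a₀, h2, by simp⟩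

theorem ClosedSubspaces.exists_projection [CompactSpace B] (hA : ClosedSubspaces A)
    (hA' : ClosedSubspaces A') (hd : ∀ p, Disjoint (A p) (A' p)) {Q : B → W →L[ℝ] W}
    (hQ : Continuous Q) (hQA : ∀ p w, Q p w ∈ A p ⊔ A' p) :
    ∃ P : B → W →L[ℝ] W, Continuous P ∧ ∀ p w, P p w ∈ A p ∧ Q p w - P p w ∈ A' p := by
  have h : ∀ p, ∃ P : W →L[ℝ] W, ∀ w, P w ∈ A p ∧ Q p w - P w ∈ A' p := by
    intro p
    have h1 : ∀ w, ∃ a, a ∈ A p ∧ Q p w - a ∈ A' p := by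
      intro w
      obtain ⟨a, ha, b, hb, hab⟩ := Submodule.mem_sup.1 (hQA p w)
      exact ⟨a, ha, by rw [← hab]; simpa using hb⟩
    choose a ha ha' using h1
    have huniq : ∀ w x, x ∈ A p → Q p w - x ∈ A' p → x = a w := by
      intro w x hx hx'
      have h2 : x - a w ∈ A p := (A p).sub_mem hx (ha w)
      have h3 : x - a w ∈ A' p := by
        have := (A' p).sub_mem (ha' w) hx'
        simpa using this
      exact sub_eq_zero.1 ((Submodule.disjoint_def.1 (hd p)) _ h2 h3)
    let L : W →ₗ[ℝ] W :=
      { toFun := a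
        map_add' := fun w w' => by
          refine (huniq _ _ ((A p).add_mem (ha w) (ha w')) ?_).symm
          have := (A' p).add_mem (ha' w) (ha' w')
          rw [map_add]
          convert this using 1
          abel
        map_smul' := fun t w => by
          refine (huniq _ _ ((A p).smul_mem t (ha w)) ?_).symm
          have := (A' p).smul_mem t (ha' w)
          rw [map_smul]
          simpa [smul_sub] using this }
    exact ⟨LinearMap.toContinuousLinearMap L, fun w => ⟨ha w, ha' w⟩⟩
  choose P hP using h
  refine ⟨P, continuous_clm_apply.2 fun w => continuous_iff_ultrafilter.2 fun p₀ u hu => ?_, hP⟩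
  have hc : Filter.Tendsto (fun p => Q p w) u (𝓝 (Q p₀ w)) :=
    ((hQ.clm_apply continuous_const).tendsto p₀).mono_left hu
  obtain ⟨a₀, h1, h2, h3⟩ := hA.tendsto_components hA' hd u (p := id) hu hc
    (a := fun p => P p w) (Filter.Eventually.of_forall fun p => (hP p w).1)
    (Filter.Eventually.of_forall fun p => (hP p w).2)
  convert h3
  have h4 : P p₀ w - a₀ ∈ A p₀ := (A p₀).sub_mem (hP p₀ w).1 h1
  have h5 : P p₀ w - a₀ ∈ A' p₀ := by
    have := (A' p₀).sub_mem h2 (hP p₀ w).2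
    simpa using this
  exact sub_eq_zero.1 ((Submodule.disjoint_def.1 (hd p₀)) _ h4 h5)

theorem ClosedSubspaces.exists_projection₃ [CompactSpace B] {S C U : B → Submodule ℝ W}
    (hS : ClosedSubspaces S) (hC : ClosedSubspaces C) (hU : ClosedSubspaces U)
    (hCU : ∀ p, Disjoint (C p) (U p)) (hSCU : ∀ p, Disjoint (S p) (C p ⊔ U p))
    {Q : B → W →L[ℝ] W} (hQ : Continuous Q) (hQA : ∀ p w, Q p w ∈ S p ⊔ (C p ⊔ U p)) :
    ∃ Ps Pc Pu : B → W →L[ℝ] W, Continuous Ps ∧ Continuous Pc ∧ Continuous Pu ∧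
      ∀ p w, Ps p w ∈ S p ∧ Pc p w ∈ C p ∧ Pu p w ∈ U p ∧ Ps p w + Pc p w + Pu p w = Q p w := by
  obtain ⟨Ps, h1, h2⟩ := hS.exists_projection (hC.sup hU hCU) hSCU hQ hQA
  obtain ⟨Pc, h3, h4⟩ := hC.exists_projection hU hCU (hQ.sub h1) (fun p w => (h2 p w).2)
  exact ⟨Ps, Pc, fun p => Q p - Ps p - Pc p, h1, h3, (hQ.sub h1).sub h3, fun p w =>
    ⟨(h2 p w).1, (h4 p w).1, (h4 p w).2, by simp⟩⟩

end ClosedFamilies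

end PHCocycle

namespace PHCocycle

theorem exists_norm_le_of_compact {X : Type*} [TopologicalSpace X] [CompactSpace X] {Z : Type*}
    [SeminormedAddCommGroup Z] {g : X → Z} (hg : Continuous g) :
    ∃ K : ℝ, 0 ≤ K ∧ ∀ p, ‖g p‖ ≤ K := by
  obtain ⟨K, hK⟩ := (isCompact_range hg).isBounded.exists_norm_le
  exact ⟨max K 0, le_max_right _ _, fun p => (hK _ (mem_range_self p)).trans (le_max_left _ _)⟩

/-- A bundle map `L` that is invariant under a dominated cocycle, as the sum of a series. -/
theorem exists_invariant_section {X : Type*} [TopologicalSpace X] [CompactSpace X]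
    {V W : Type*} [NormedAddCommGroup V] [NormedSpace ℝ V]
    [NormedAddCommGroup W] [NormedSpace ℝ W] [FiniteDimensional ℝ W]
    {F : X → X} (hF : Continuous F) {α : X → V →L[ℝ] V} (hα : Continuous α)
    {β : X → W →L[ℝ] W} (hβ : Continuous β) {A : X → V →L[ℝ] W} (hA : Continuous A)
    {pr : X → V →L[ℝ] V} (hpr : Continuous pr)
    {𝒱 : X → Submodule ℝ V} {𝒲 : X → Submodule ℝ W}
    (hpr𝒱 : ∀ p v, pr p v ∈ 𝒱 p) (hpr_id : ∀ p, ∀ v ∈ 𝒱 p, pr p v = v)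
    (hα𝒱 : ∀ p, ∀ v ∈ 𝒱 p, α p v ∈ 𝒱 (F p)) (hβ𝒲 : ∀ p, ∀ w ∈ 𝒲 (F p), β p w ∈ 𝒲 p)
    (hA𝒲 : ∀ p, ∀ v ∈ 𝒱 p, A p v ∈ 𝒲 (F p))
    {nV : X → V → ℝ} {nW : X → W → ℝ} {c C : ℝ} (hc : 0 < c)
    (hnV : ∀ p, ∀ v ∈ 𝒱 p, c * ‖v‖ ≤ nV p v ∧ nV p v ≤ C * ‖v‖)
    (hnW : ∀ p, ∀ w ∈ 𝒲 p, c * ‖w‖ ≤ nW p w ∧ nW p w ≤ C * ‖w‖)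
    {θ : ℝ} (hθ0 : 0 ≤ θ) (hθ : θ < 1)
    (hdom : ∀ p, ∀ v ∈ 𝒱 p, ∀ w ∈ 𝒲 (F p),
      nW p (β p w) * nV (F p) (α p v) ≤ θ * (nW (F p) w * nV p v)) :
    ∃ L : X → V →L[ℝ] W, Continuous L ∧ (∀ p v, L p v ∈ 𝒲 p) ∧
      ∀ p, ∀ v ∈ 𝒱 p, L p v = β p (L (F p) (α p v) - A p v) := by
  let t : ℕ → X → V →L[ℝ] W := fun n => Nat.rec (fun p => -(β p ∘L A p ∘L pr p))
    (fun _ t p => β p ∘L t (F p) ∘L α p ∘L pr p) n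
  have t0 : ∀ p v, t 0 p v = -(β p (A p (pr p v))) := fun p v => rfl
  have ts : ∀ n p v, t (n + 1) p v = β p (t n (F p) (α p (pr p v))) := fun n p v => rfl
  have htc : ∀ n, Continuous (t n) := by
    intro n
    induction n with
    | zero => exact (hβ.clm_comp (hA.clm_comp hpr)).neg
    | succ n ih => exact hβ.clm_comp ((ih.comp hF).clm_comp (hα.clm_comp hpr))
  have htW : ∀ n p v, t n p v ∈ 𝒲 p := by
    intro n
    induction n with
    | zero => exact fun p v => (𝒲 p).neg_mem (hβ𝒲 _ _ (hA𝒲 _ _ (hpr𝒱 p v)))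
    | succ n ih => exact fun p v => hβ𝒲 _ _ (ih _ _)
  obtain ⟨K, hK0, hK⟩ := exists_norm_le_of_compact (hβ.clm_comp hA)
  obtain ⟨K', hK'0, hK'⟩ := exists_norm_le_of_compact hpr
  have hCc : ∀ p, ∀ v ∈ 𝒱 p, ‖v‖ ≤ c⁻¹ * nV p v := by
    intro p v hv
    rw [inv_mul_eq_div, le_div_iff₀ hc, mul_comm]
    exact (hnV p v hv).1
  have hnV0 : ∀ p, ∀ v ∈ 𝒱 p, 0 ≤ nV p v := fun p v hv =>
    le_trans (by positivity) (hnV p v hv).1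
  have hnW0 : ∀ p, ∀ v ∈ 𝒲 p, 0 ≤ nW p v := fun p v hv =>
    le_trans (by positivity) (hnW p v hv).1
  set D : ℝ := |C| * (K * c⁻¹) with hD
  have hD0 : 0 ≤ D := by positivity
  have hbound : ∀ n p, ∀ v ∈ 𝒱 p, nW p (t n p v) ≤ D * θ ^ n * nV p v := by
    intro n
    induction n with
    | zero =>
      intro p v hv
      calc nW p (t 0 p v) ≤ C * ‖t 0 p v‖ := (hnW _ _ (htW 0 p v)).2
        _ ≤ |C| * ‖t 0 p v‖ := by gcongr; exact le_abs_self C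
        _ = |C| * ‖(β p ∘L A p) v‖ := by rw [t0, norm_neg, hpr_id p v hv]; rfl
        _ ≤ |C| * (K * (c⁻¹ * nV p v)) := by
          gcongr
          exact ((β p ∘L A p).le_of_opNorm_le (hK p) v).trans (by gcongr; exact hCc p v hv)
        _ = D * θ ^ 0 * nV p v := by rw [hD]; ring
    | succ n ih =>
      intro p v hv
      rw [ts, hpr_id p v hv]
      have h1 := ih (F p) _ (hα𝒱 p v hv)
      have h2 := hdom p v hv _ (htW n (F p) (α p v))
      rcases (hnV0 _ _ (hα𝒱 p v hv)).eq_or_lt with h0 | h0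
      · have : α p v = 0 := by
          have := hCc _ _ (hα𝒱 p v hv)
          rw [← h0, mul_zero] at this
          exact norm_le_zero_iff.1 this
        rw [this, map_zero, map_zero]
        have := (hnW p 0 (𝒲 p).zero_mem).2
        rw [norm_zero, mul_zero] at this
        exact this.trans (mul_nonneg (by positivity) (hnV0 p v hv))
      · refine le_of_mul_le_mul_right ?_ h0
        refine h2.trans ?_
        calc θ * (nW (F p) (t n (F p) (α p v)) * nV p v)
            ≤ θ * ((D * θ ^ n * nV (F p) (α p v)) * nV p v) := by
              gcongr
              exact hnV0 p v hv
          _ = _ := by ring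
  have hnorm : ∀ n p, ‖t n p‖ ≤ c⁻¹ * (D * (|C| * K')) * θ ^ n := by
    intro n p
    refine ContinuousLinearMap.opNorm_le_bound _ (by positivity) fun v => ?_
    have e : t n p v = t n p (pr p v) := by
      cases n with
      | zero => rw [t0, t0, hpr_id p _ (hpr𝒱 p v)]
      | succ n => rw [ts, ts, hpr_id p _ (hpr𝒱 p v)]
    have h1 := (hnW _ _ (htW n p (pr p v))).1
    rw [e]
    calc ‖t n p (pr p v)‖ = c⁻¹ * (c * ‖t n p (pr p v)‖) := by field_simp
      _ ≤ c⁻¹ * (D * θ ^ n * (|C| * (K' * ‖v‖))) := by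
        refine mul_le_mul_of_nonneg_left ?_ (by positivity)
        refine h1.trans ((hbound n p _ (hpr𝒱 p v)).trans ?_)
        gcongr
        refine (hnV _ _ (hpr𝒱 p v)).2.trans ?_
        gcongr
        · exact le_abs_self C
        · exact (pr p).le_of_opNorm_le (hK' p) v
      _ = _ := by ring
  have hsum : Summable fun n : ℕ => c⁻¹ * (D * (|C| * K')) * θ ^ n :=
    (summable_geometric_of_lt_one hθ0 hθ).mul_left _
  have hs : ∀ p, Summable fun n => t n p := fun p =>
    Summable.of_norm_bounded hsum fun n => hnorm n p
  have hap : ∀ p v, (∑' n, t n p) v = ∑' n, t n p v := fun p v =>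
    ContinuousLinearMap.map_tsum (ContinuousLinearMap.apply ℝ W v) (hs p)
  have hsv : ∀ p v, Summable fun n => t n p v := fun p v =>
    (hs p).mapL (ContinuousLinearMap.apply ℝ W v)
  refine ⟨fun p => ∑' n, t n p, continuous_tsum htc hsum hnorm, fun p v => ?_, fun p v hv => ?_⟩
  · rw [hap]
    exact (𝒲 p).closed_of_finiteDimensional.mem_of_tendsto (hsv p v).hasSum.tendsto_sum_nat
      (Filter.Eventually.of_forall fun n => (𝒲 p).sum_mem fun i _ => htW i p v)
  · rw [hap, (hsv p v).tsum_eq_zero_add, t0, hpr_id p v hv, hap, map_sub, (β p).map_tsum (hsv _ _)]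
    simp only [ts, hpr_id p v hv]
    abel

end PHCocycle

namespace PHCocycle

section Peano

variable {E : Type*} [NormedAddCommGroup E] [NormedSpace ℝ E]

/-- Euler's polygonal approximation with step `1 / (n + 1)`. -/
noncomputable def eulerStep (G : ℝ → E → E) (y₀ : E) (n : ℕ) : ℕ → E
  | 0 => y₀
  | k + 1 => eulerStep G y₀ n k +
      ((1 : ℝ) / (n + 1)) • G ((k : ℝ) / (n + 1)) (eulerStep G y₀ n k)

theorem eulerStep_sub_le {G : ℝ → E → E} {y₀ : E} {n : ℕ} {v : E} {ε : ℝ} {a b : ℕ} (hab : a ≤ b)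
    (h : ∀ k, a ≤ k → k < b → ‖G ((k : ℝ) / (n + 1)) (eulerStep G y₀ n k) - v‖ ≤ ε) :
    ‖eulerStep G y₀ n b - eulerStep G y₀ n a - (((b : ℝ) - a) / (n + 1)) • v‖ ≤
      ε * (((b : ℝ) - a) / (n + 1)) := by
  induction b, hab using Nat.le_induction with
  | base => simp
  | succ b hab ih =>
    have ih := ih fun k h1 h2 => h k h1 (by omega)
    have h1 := h b hab (by omega)
    have hn : (0 : ℝ) < n + 1 := by positivity
    have e : eulerStep G y₀ n (b + 1) - eulerStep G y₀ n a - ((((b + 1 : ℕ) : ℝ) - a) / (n + 1)) • v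
        = (eulerStep G y₀ n b - eulerStep G y₀ n a - (((b : ℝ) - a) / (n + 1)) • v) +
          ((1 : ℝ) / (n + 1)) • (G ((b : ℝ) / (n + 1)) (eulerStep G y₀ n b) - v) := by
      have : ((((b + 1 : ℕ) : ℝ) - a) / (n + 1)) = (((b : ℝ) - a) / (n + 1)) + 1 / (n + 1) := by
        push_cast; ring
      rw [this, add_smul, smul_sub]
      simp only [eulerStep]
      abel
    rw [e]
    refine (norm_add_le _ _).trans ?_
    rw [norm_smul, Real.norm_of_nonneg (by positivity)]
    calc _ ≤ ε * (((b : ℝ) - a) / (n + 1)) + 1 / (n + 1) * ε := by gcongr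
      _ = _ := by push_cast; ring

/-- **Peano's existence theorem** for a bounded continuous right-hand side, with the solution
continued to negative times as an affine function. -/
theorem exists_solution_of_continuous [FiniteDimensional ℝ E] {G : ℝ → E → E}
    (hG : Continuous fun q : ℝ × E => G q.1 q.2) {K : ℝ} (hK : ∀ t y, ‖G t y‖ ≤ K) (y₀ : E) :
    ∃ y : ℝ → E, y 0 = y₀ ∧ ContDiff ℝ 1 y ∧ (∀ t, 0 ≤ t → HasDerivAt y (G t (y t)) t) ∧
      ∀ t, ‖y t - y₀‖ ≤ K * |t| := by
  have : ProperSpace E := FiniteDimensional.proper ℝ E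
  have hK0 : 0 ≤ K := (norm_nonneg _).trans (hK 0 0)
  let U : Ultrafilter ℕ := Filter.hyperfilter ℕ
  have hU : (U : Filter ℕ) ≤ Filter.atTop := by
    rw [← Nat.cofinite_eq_atTop]; exact Filter.hyperfilter_le_cofinite
  let z : ℕ → ℝ → E := fun n t => eulerStep G y₀ n ⌊t * (n + 1)⌋₊
  have hdiff : ∀ n : ℕ, ∀ s t : ℝ, 0 ≤ s → s ≤ t →
      ‖z n t - z n s‖ ≤ K * (t - s + 1 / (n + 1)) := by
    intro n s t hs hst
    have hn : (0 : ℝ) < n + 1 := by positivity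
    have h1 := eulerStep_sub_le (G := G) (y₀ := y₀) (n := n) (v := 0) (ε := K)
      (Nat.floor_mono (show s * (n + 1) ≤ t * (n + 1) by gcongr)) (fun k _ _ => by simpa using hK _ _)
    rw [smul_zero, sub_zero] at h1
    refine h1.trans ?_
    gcongr
    rw [div_le_iff₀ hn]
    have h2 := Nat.floor_le (show 0 ≤ t * ((n : ℝ) + 1) by nlinarith)
    have h3 := Nat.lt_floor_add_one (s * ((n : ℝ) + 1))
    have : (t - s + 1 / ((n : ℝ) + 1)) * (n + 1) = t * (n + 1) - s * (n + 1) + 1 := by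
      field_simp
    linarith
  have hlim : ∀ t : ℝ, ∃ y : E, 0 ≤ t → Filter.Tendsto (fun n => z n t) U (𝓝 y) := by
    intro t
    by_cases ht : 0 ≤ t
    swap
    · exact ⟨0, fun h => (ht h).elim⟩
    have hb : ∀ n, z n t ∈ Metric.closedBall y₀ (K * (t + 1)) := by
      intro n
      have h1 := hdiff n 0 t le_rfl ht
      have h0 : z n 0 = y₀ := by simp [z, eulerStep]
      rw [h0] at h1
      rw [Metric.mem_closedBall, dist_eq_norm]
      refine h1.trans ?_
      gcongr
      · linarith
      · rw [div_le_one (by positivity)]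
        have : (0 : ℝ) ≤ n := by positivity
        linarith
    obtain ⟨y, -, hy⟩ := (isCompact_closedBall y₀ (K * (t + 1))).ultrafilter_le_nhds
      (U.map fun n => z n t) (Filter.le_principal_iff.2
        (Filter.Eventually.of_forall (f := (U : Filter ℕ)) hb))
    exact ⟨y, fun _ => hy⟩
  choose y hy using hlim
  have hinv : Filter.Tendsto (fun n : ℕ => (1 : ℝ) / (n + 1)) U (𝓝 0) :=
    tendsto_one_div_add_atTop_nhds_zero_nat.mono_left hU
  have hlip : ∀ s t : ℝ, 0 ≤ s → s ≤ t → ‖y t - y s‖ ≤ K * (t - s) := by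
    intro s t hs hst
    have h1 := ((hy t (hs.trans hst)).sub (hy s hs)).norm
    have h2 : Filter.Tendsto (fun n : ℕ => K * (t - s + 1 / ((n : ℝ) + 1))) U
        (𝓝 (K * (t - s + 0))) := (hinv.const_add _).const_mul _
    rw [add_zero] at h2
    exact le_of_tendsto_of_tendsto h1 h2 (Filter.Eventually.of_forall fun n => hdiff n s t hs hst)
  have hy0 : y 0 = y₀ := by
    refine tendsto_nhds_unique (hy 0 le_rfl) ?_
    simp [z, eulerStep]
  have hlip' : ∀ s t : ℝ, 0 ≤ s → 0 ≤ t → ‖y t - y s‖ ≤ K * |t - s| := by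
    intro s t hs ht
    rcases le_total s t with h | h
    · rw [abs_of_nonneg (by linarith)]; exact hlip s t hs h
    · rw [norm_sub_rev, abs_sub_comm, abs_of_nonneg (by linarith)]; exact hlip t s ht h
  -- increments of the limit
  have hinc : ∀ (t₀ : ℝ), 0 ≤ t₀ → ∀ ε > 0, ∃ δ > 0, ∀ s t : ℝ, 0 ≤ s → s ≤ t →
      |s - t₀| < δ → |t - t₀| < δ →
      ‖y t - y s - (t - s) • G t₀ (y t₀)‖ ≤ ε * (t - s) := by
    intro t₀ ht₀ ε hε
    obtain ⟨δ, hδ, hGδ⟩ := Metric.continuousAt_iff.1 (hG.continuousAt (x := (t₀, y t₀))) ε hε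
    refine ⟨min (δ / 2) (δ / (4 * (K + 1))), by positivity, fun s t hs hst hs' ht' => ?_⟩
    have hK1 : 0 < K + 1 := by linarith
    have hev : ∀ᶠ n : ℕ in (U : Filter ℕ), ‖z n t - z n s -
        (((⌊t * (n + 1)⌋₊ : ℝ) - ⌊s * (n + 1)⌋₊) / (n + 1)) • G t₀ (y t₀)‖ ≤
        ε * (((⌊t * (n + 1)⌋₊ : ℝ) - ⌊s * (n + 1)⌋₊) / (n + 1)) := by
      have h1 : ∀ᶠ n : ℕ in (U : Filter ℕ), ‖z n t₀ - y t₀‖ < δ / 4 := by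
        have := (hy t₀ ht₀).eventually (Metric.ball_mem_nhds (y t₀) (show 0 < δ / 4 by positivity))
        simpa [dist_eq_norm] using this
      have h2 : ∀ᶠ n : ℕ in (U : Filter ℕ), (1 : ℝ) / (n + 1) <
          min (δ / 4) (δ / (16 * (K + 1))) :=
        hinv.eventually_lt_const (by positivity)
      filter_upwards [h1, h2] with n h1 h2
      have hn : (0 : ℝ) < n + 1 := by positivity
      have h2a := h2.trans_le (min_le_left _ _)
      have h2b := h2.trans_le (min_le_right _ _)
      refine eulerStep_sub_le (Nat.floor_mono (by gcongr)) fun k hk1 hk2 => ?_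
      have hk1' : s - 1 / (n + 1) ≤ (k : ℝ) / (n + 1) := by
        have h3 := Nat.lt_floor_add_one (s * ((n : ℝ) + 1))
        have h4 : ((⌊s * ((n : ℝ) + 1)⌋₊ : ℕ) : ℝ) ≤ k := by exact_mod_cast hk1
        rw [le_div_iff₀ hn]
        have : (s - 1 / ((n : ℝ) + 1)) * (n + 1) = s * (n + 1) - 1 := by field_simp
        linarith
      have hk2' : (k : ℝ) / (n + 1) ≤ t := by
        have h3 := Nat.floor_le (show 0 ≤ t * ((n : ℝ) + 1) by nlinarith)
        have h4 : (k : ℝ) ≤ (⌊t * ((n : ℝ) + 1)⌋₊ : ℕ) := by exact_mod_cast hk2.le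
        rw [div_le_iff₀ hn]
        linarith
      have hkt : |(k : ℝ) / (n + 1) - t₀| < min (δ / 2) (δ / (4 * (K + 1))) + 1 / (n + 1) := by
        have h0 : 0 < 1 / ((n : ℝ) + 1) := by positivity
        rw [abs_lt] at hs' ht' ⊢
        constructor <;> linarith
      have hkz : eulerStep G y₀ n k = z n ((k : ℝ) / (n + 1)) := by
        simp only [z]
        rw [div_mul_cancel₀ _ hn.ne', Nat.floor_natCast]
      rw [hkz]
      have hz : ‖z n ((k : ℝ) / (n + 1)) - z n t₀‖ ≤ K * (|(k : ℝ) / (n + 1) - t₀| + 1 / (n + 1)) := by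
        have hk0 : 0 ≤ (k : ℝ) / (n + 1) := by positivity
        rcases le_total t₀ ((k : ℝ) / (n + 1)) with h | h
        · rw [abs_of_nonneg (by linarith)]; exact hdiff n _ _ ht₀ h
        · rw [norm_sub_rev, abs_sub_comm, abs_of_nonneg (by linarith)]; exact hdiff n _ _ hk0 h
      have hz2 : ‖z n ((k : ℝ) / (n + 1)) - y t₀‖ < δ := by
        have e1 := norm_sub_le_norm_sub_add_norm_sub (z n ((k : ℝ) / (n + 1))) (z n t₀) (y t₀)
        have e2 : K * (|(k : ℝ) / (n + 1) - t₀| + 1 / (n + 1)) ≤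
            (K + 1) * (δ / (4 * (K + 1)) + 2 * (δ / (16 * (K + 1)))) := by
          have := min_le_right (δ / 2) (δ / (4 * (K + 1)))
          refine mul_le_mul (by linarith) ?_ (by positivity) hK1.le
          linarith
        have e3 : (K + 1) * (δ / (4 * (K + 1)) + 2 * (δ / (16 * (K + 1)))) = 3 * δ / 8 := by
          field_simp; ring
        linarith
      have hfin := hGδ (x := ((k : ℝ) / (n + 1), z n ((k : ℝ) / (n + 1)))) (by
        rw [Prod.dist_eq, max_lt_iff]
        refine ⟨?_, by rw [dist_eq_norm]; exact hz2⟩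
        have := min_le_left (δ / 2) (δ / (4 * (K + 1)))
        rw [Real.dist_eq]
        show |(k : ℝ) / (n + 1) - t₀| < δ
        linarith)
      rw [dist_eq_norm] at hfin
      exact hfin.le
    have hfl : Filter.Tendsto (fun n : ℕ =>
        ((⌊t * ((n : ℝ) + 1)⌋₊ : ℝ) - ⌊s * ((n : ℝ) + 1)⌋₊) / (n + 1)) U (𝓝 (t - s)) := by
      have hone : ∀ r : ℝ, 0 ≤ r → Filter.Tendsto (fun n : ℕ =>
          (⌊r * ((n : ℝ) + 1)⌋₊ : ℝ) / (n + 1)) U (𝓝 r) := by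
        intro r hr
        have h1 : Filter.Tendsto (fun n : ℕ => (n : ℝ) + 1) Filter.atTop Filter.atTop :=
          Filter.tendsto_atTop_add_const_right _ _ tendsto_natCast_atTop_atTop
        exact ((tendsto_nat_floor_mul_div_atTop hr).comp h1).mono_left hU
      simpa only [sub_div] using (hone t (hs.trans hst)).sub (hone s hs)
    exact le_of_tendsto_of_tendsto
      (((hy t (hs.trans hst)).sub (hy s hs)).sub (hfl.smul_const _)).norm (hfl.const_mul ε) hev
  -- extension to negative times
  let w : ℝ → E := fun t => if 0 ≤ t then y t else y₀ + t • G 0 y₀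
  have hwpos : ∀ t, 0 ≤ t → w t = y t := fun t ht => if_pos ht
  have hwneg : ∀ t, t ≤ 0 → w t = y₀ + t • G 0 y₀ := by
    intro t ht
    rcases ht.eq_or_lt with rfl | ht
    · simp [w, hy0]
    · exact if_neg (not_le.2 ht)
  have hcont : ∀ s t : ℝ, 0 ≤ s → HasDerivWithinAt w (G s (y s)) (Ici 0) s := by
    intro s _ hs
    rw [hasDerivWithinAt_iff_isLittleO, Asymptotics.isLittleO_iff]
    intro ε hε
    obtain ⟨δ, hδ, h⟩ := hinc s hs ε hε
    rw [eventually_nhdsWithin_iff]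
    filter_upwards [Metric.ball_mem_nhds s hδ] with t ht ht0
    have ht' : |t - s| < δ := ht
    rw [hwpos t ht0, hwpos s hs]
    rcases le_total s t with hst | hst
    · rw [Real.norm_of_nonneg (by linarith)]
      exact h s t hs hst (by simpa using hδ) ht'
    · have := h t s ht0 hst ht' (by simpa using hδ)
      rw [Real.norm_of_nonpos (by linarith)]
      calc _ = ‖y s - y t - (s - t) • G s (y s)‖ := by
            rw [← norm_neg]; congr 1; rw [sub_smul, sub_smul]; abel
        _ ≤ _ := this
        _ = _ := by ring
  have hder : ∀ t, 0 ≤ t → HasDerivAt w (G t (y t)) t := by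
    intro t ht
    rcases ht.eq_or_lt with rfl | ht
    · have h1 := hcont 0 0 le_rfl
      have h2 : HasDerivWithinAt w (G 0 (y 0)) (Iic 0) 0 := by
        rw [hy0]
        have h3 : HasDerivAt (fun t : ℝ => y₀ + t • G 0 y₀) (G 0 y₀) 0 := by
          simpa using ((hasDerivAt_id (0 : ℝ)).smul_const (G 0 y₀)).const_add y₀
        exact h3.hasDerivWithinAt.congr (fun t ht => hwneg t ht) (hwneg 0 le_rfl)
      have := h2.union h1
      rwa [Iic_union_Ici, hasDerivWithinAt_univ] at this
    · exact (hcont t t ht.le).hasDerivAt (Ici_mem_nhds ht)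
  have hderneg : ∀ t, t < 0 → HasDerivAt w (G 0 y₀) t := by
    intro t ht
    have h3 : HasDerivAt (fun t : ℝ => y₀ + t • G 0 y₀) (G 0 y₀) t := by
      simpa using ((hasDerivAt_id t).smul_const (G 0 y₀)).const_add y₀
    refine h3.congr_of_eventuallyEq ?_
    filter_upwards [Iio_mem_nhds ht] with s hs
    exact hwneg s (le_of_lt hs)
  have hw0 : w 0 = y₀ := by rw [hwpos 0 le_rfl, hy0]
  have hderall : ∀ t, HasDerivAt w (G (max t 0) (w (max t 0))) t := by
    intro t
    rcases le_or_gt 0 t with ht | ht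
    · rw [max_eq_left ht, hwpos t ht]; exact hder t ht
    · rw [max_eq_right ht.le, hw0]; exact hderneg t ht
  have hwc : Continuous w := continuous_iff_continuousAt.2 fun t => (hderall t).continuousAt
  refine ⟨w, hw0, ?_, fun t ht => by rw [hwpos t ht]; exact hder t ht, fun t => ?_⟩
  · rw [contDiff_one_iff_deriv]
    refine ⟨fun t => (hderall t).differentiableAt, ?_⟩
    have : deriv w = fun t => G (max t 0) (w (max t 0)) := funext fun t => (hderall t).deriv
    rw [this]
    have hm : Continuous fun t : ℝ => max t 0 := by fun_prop
    exact hG.comp (hm.prodMk (hwc.comp hm))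
  · rcases le_total 0 t with ht | ht
    · rw [hwpos t ht, ← hy0]
      simpa using hlip' 0 t le_rfl ht
    · rw [hwneg t ht, add_sub_cancel_left, norm_smul, Real.norm_eq_abs, mul_comm]
      gcongr
      exact hK _ _

end Peano

end PHCocycle

namespace PHCocycle

section FramingTools

variable {E : Type*} [NormedAddCommGroup E] [NormedSpace ℝ E]
  {H : Type*} [TopologicalSpace H] {I : ModelWithCorners ℝ E H}
  {X : Type*} [TopologicalSpace X] [ChartedSpace H X] [IsManifold I 1 X]
  {W : Type*} [NormedAddCommGroup W] [NormedSpace ℝ W]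
  {V : Type*} [NormedAddCommGroup V] [NormedSpace ℝ V]

namespace Framing

variable (Φ : Framing I X W)

/-- The differential of the immersion. -/
noncomputable def d (p : X) : TangentSpace I p →L[ℝ] W := vderiv I Φ.ι p

@[simp] theorem ρ_d (p : X) (v : TangentSpace I p) : Φ.ρ p (Φ.d p v) = v := Φ.left_inv p v

theorem d_injective (p : X) : Function.Injective (Φ.d p) :=
  Function.LeftInverse.injective (Φ.ρ_d p)

theorem continuous_d : Continuous fun v : TangentBundle I X => Φ.d v.1 v.2 :=
  continuous_vderiv Φ.contMDiff

theorem continuous_total : Continuous fun v : TangentBundle I X => (v.1, Φ.d v.1 v.2) :=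
  (FiberBundle.continuous_proj E (TangentSpace I : X → Type _)).prodMk Φ.continuous_d

/-- The differential of a vector-valued function, read in the framing. -/
noncomputable def hat (K : X → V) (p : X) : W →L[ℝ] V := vderiv I K p ∘L Φ.ρ p

@[simp] theorem hat_d (K : X → V) (p : X) (v : TangentSpace I p) :
    Φ.hat K p (Φ.d p v) = vderiv I K p v := by simp [hat]

theorem continuous_hat [FiniteDimensional ℝ W] {K : X → V} (hK : ContMDiff I 𝓘(ℝ, V) 1 K) :
    Continuous (Φ.hat K) := by
  refine continuous_clm_apply.2 fun w => ?_
  exact (continuous_vderiv hK).comp (Φ.cont.comp (by fun_prop : Continuous fun p : X => (p, w)))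

/-- A family of subspaces of the tangent spaces, read in the framing. -/
noncomputable def img (D : ∀ x : X, Submodule ℝ (TangentSpace I x)) (p : X) : Submodule ℝ W :=
  (D p).map (Φ.d p).toLinearMap

theorem d_mem_img {D : ∀ x : X, Submodule ℝ (TangentSpace I x)} {p : X} {v : TangentSpace I p} :
    Φ.d p v ∈ Φ.img D p ↔ v ∈ D p := by
  constructor
  · rintro ⟨v', hv', h⟩
    exact Φ.d_injective p h ▸ hv'
  · exact fun h => ⟨v, h, rfl⟩

theorem mem_img_iff {D : ∀ x : X, Submodule ℝ (TangentSpace I x)} {p : X} {w : W} :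
    w ∈ Φ.img D p ↔ Φ.ρ p w ∈ D p ∧ Φ.d p (Φ.ρ p w) = w := by
  constructor
  · rintro ⟨v, hv, rfl⟩
    exact ⟨by simpa using hv, by simp⟩
  · rintro ⟨h1, h2⟩
    exact ⟨_, h1, h2⟩

theorem closedSubspaces_img [T2Space X] {D : ∀ x : X, Submodule ℝ (TangentSpace I x)}
    (hD : IsClosedFamily D) : ClosedSubspaces (Φ.img D) := by
  have : IsClosed ({q : X × W | Φ.ρ q.1 q.2 ∈ D q.1} ∩ {q : X × W | Φ.d q.1 (Φ.ρ q.1 q.2) = q.2}) :=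
    (IsClosed.preimage Φ.cont hD).inter
      (isClosed_eq (Φ.continuous_d.comp Φ.cont) continuous_snd)
  have e : {q : X × W | q.2 ∈ Φ.img D q.1} = _ := Set.ext fun q => Φ.mem_img_iff
  exact (congrArg IsClosed e).mpr this

/-- The projection on the tangent spaces, read in the framing. -/
noncomputable def proj (p : X) : W →L[ℝ] W := Φ.d p ∘L Φ.ρ p

theorem continuous_proj [FiniteDimensional ℝ W] : Continuous Φ.proj :=
  continuous_clm_apply.2 fun w =>
    Φ.continuous_d.comp (Φ.cont.comp (by fun_prop : Continuous fun p : X => (p, w)))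

@[simp] theorem proj_d (p : X) (v : TangentSpace I p) : Φ.proj p (Φ.d p v) = Φ.d p v := by
  simp [proj]

end Framing

theorem Metric.continuous_inner (g : Metric I X) {Z : Type*} [TopologicalSpace Z] {b : Z → X}
    {v w : ∀ z, TangentSpace I (b z)} (hv : Continuous fun z => (⟨b z, v z⟩ : TangentBundle I X))
    (hw : Continuous fun z => (⟨b z, w z⟩ : TangentBundle I X)) :
    Continuous fun z => g.inner (b z) (v z) (w z) := by
  have hb : Continuous b := (FiberBundle.continuous_proj E (TangentSpace I : X → Type _)).comp hv
  rw [continuous_iff_continuousAt]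
  intro z
  have : ContinuousAt (fun m ↦ TotalSpace.mk' ℝ (E := Bundle.Trivial X ℝ) (b m)
      (g.inner (b m) (v m) (w m))) z :=
    (ContinuousAt.comp (f := b) (g.continuous.continuousAt (x := b z)) hb.continuousAt).clm_bundle_apply₂
      (F₁ := E) (F₂ := E) hv.continuousAt hw.continuousAt
  rw [FiberBundle.continuousAt_totalSpace] at this
  exact this.2

theorem Metric.continuous_len (g : Metric I X) :
    Continuous fun v : TangentBundle I X => g.len v.2 :=
  Real.continuous_sqrt.comp (g.continuous_inner continuous_id continuous_id)

theorem Metric.inner_nonneg (g : Metric I X) {p : X} (v : TangentSpace I p) :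
    0 ≤ g.inner p v v := by
  rcases eq_or_ne v 0 with rfl | h
  · simp
  · exact (g.pos p v h).le

theorem Metric.len_pos (g : Metric I X) {p : X} {v : TangentSpace I p} (h : v ≠ 0) :
    0 < g.len v := Real.sqrt_pos.2 (g.pos p v h)

theorem Metric.len_nonneg (g : Metric I X) {p : X} (v : TangentSpace I p) :
    0 ≤ g.len v := Real.sqrt_nonneg _

theorem Metric.sq_len (g : Metric I X) {p : X} (v : TangentSpace I p) :
    g.len v ^ 2 = g.inner p v v := Real.sq_sqrt (g.inner_nonneg v)

@[simp] theorem Metric.len_zero (g : Metric I X) {p : X} : g.len (0 : TangentSpace I p) = 0 := by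
  simp [Metric.len]

theorem Metric.len_smul (g : Metric I X) {p : X} (t : ℝ) (v : TangentSpace I p) :
    g.len (t • v) = |t| * g.len v := by
  have : g.inner p (t • v) (t • v) = t ^ 2 * g.inner p v v := by simp; ring
  rw [Metric.len, this, Real.sqrt_mul (sq_nonneg t), Real.sqrt_sq_eq_abs, Metric.len]

theorem Metric.len_add_le (g : Metric I X) {p : X} (v w : TangentSpace I p) :
    g.len (v + w) ≤ g.len v + g.len w := by
  have hcs : g.inner p v w ≤ g.len v * g.len w := by
    rcases eq_or_ne w 0 with rfl | hw
    · simp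
    have hpos := g.pos p w hw
    have h0 := g.inner_nonneg (g.inner p w w • v - g.inner p v w • w)
    simp only [map_sub, map_smul, sub_apply, smul_apply, smul_eq_mul, g.symm p w v] at h0
    have h1 : g.inner p v w ^ 2 ≤ g.inner p v v * g.inner p w w := by
      have : 0 ≤ g.inner p w w * (g.inner p v v * g.inner p w w - g.inner p v w ^ 2) := by
        nlinarith
      have := nonneg_of_mul_nonneg_right this hpos
      linarith
    rw [Metric.len, Metric.len, ← Real.sqrt_mul (g.inner_nonneg v)]
    exact Real.le_sqrt_of_sq_le h1
  rw [← abs_of_nonneg (add_nonneg (g.len_nonneg v) (g.len_nonneg w))]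
  refine abs_le_of_sq_le_sq' ?_ (abs_nonneg _) |>.2
  rw [sq_abs, Metric.sq_len, add_sq, Metric.sq_len, Metric.sq_len]
  simp only [map_add, add_apply, g.symm p w v]
  linarith

theorem isVonNBounded_of_posDef {E : Type*} [NormedAddCommGroup E] [NormedSpace ℝ E]
    [FiniteDimensional ℝ E] (b : E →L[ℝ] E →L[ℝ] ℝ) (hb : ∀ v, v ≠ 0 → 0 < b v v) :
    Bornology.IsVonNBounded ℝ {v : E | b v v < 1} := by
  have : ProperSpace E := FiniteDimensional.proper ℝ E
  have hcont : Continuous fun v : E => b v v := b.continuous.clm_apply continuous_id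
  obtain ⟨c, hc, hcK⟩ : ∃ c : ℝ, 0 < c ∧ ∀ v ∈ Metric.sphere (0 : E) 1, c ≤ b v v := by
    refine (isCompact_sphere (0 : E) 1).exists_forall_le' (f := fun v => b v v)
      hcont.continuousOn (a := 0) fun v hv => hb v ?_
    rintro rfl
    simp at hv
  refine (NormedSpace.isVonNBounded_iff (𝕜 := ℝ) (E := E)).2 ?_
  refine (Metric.isBounded_iff_subset_closedBall (0 : E)).2 ⟨Real.sqrt (1 / c), fun v hv => ?_⟩
  have hv : b v v < 1 := hv
  rw [mem_closedBall_zero_iff]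
  rcases eq_or_ne v 0 with rfl | h0
  · simp
  have hn : 0 < ‖v‖ := norm_pos_iff.2 h0
  have h1 := hcK (‖v‖⁻¹ • v) (by
    rw [mem_sphere_zero_iff_norm, norm_smul, norm_inv, norm_norm, inv_mul_cancel₀ hn.ne'])
  have h2 : b (‖v‖⁻¹ • v) (‖v‖⁻¹ • v) = ‖v‖⁻¹ ^ 2 * b v v := by
    simp; ring
  rw [h2, inv_pow, inv_mul_eq_div, le_div_iff₀ (by positivity)] at h1
  refine Real.le_sqrt_of_sq_le ?_
  rw [le_div_iff₀ hc]
  linarith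

theorem exists_metric_of_form [FiniteDimensional ℝ E] (Φ : Framing I X W)
    {B : X → W →L[ℝ] W →L[ℝ] ℝ} (hB : Continuous B) (hsymm : ∀ p v w, B p v w = B p w v)
    (hpos : ∀ p (v : TangentSpace I p), v ≠ 0 → 0 < B p (Φ.d p v) (Φ.d p v)) :
    ∃ g : Metric I X, ∀ p (v w : TangentSpace I p), g.inner p v w = B p (Φ.d p v) (Φ.d p w) := by
  let b : ∀ p : X, TangentSpace I p →L[ℝ] TangentSpace I p →L[ℝ] ℝ := fun p =>
    ((Φ.d p).precomp ℝ) ∘L (B p ∘L Φ.d p)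
  have hb : ∀ p v w, b p v w = B p (Φ.d p v) (Φ.d p w) := fun p v w => rfl
  refine ⟨⟨b, fun p v w => hsymm _ _ _, fun p v hv => hpos p v hv, fun p => ?_, ?_⟩, hb⟩
  · exact isVonNBounded_of_posDef (E := E) (b p) fun v hv => hpos p v hv
  · rw [continuous_iff_continuousAt]
    intro p₀
    rw [continuousAt_hom_bundle]
    refine ⟨continuousAt_id, ?_⟩
    set T := trivializationAt E (TangentSpace I : X → Type _) p₀ with hT
    have hp₀ : p₀ ∈ T.baseSet := FiberBundle.mem_baseSet_trivializationAt' p₀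
    have hTnhds : T.baseSet ∈ 𝓝 p₀ := T.open_baseSet.mem_nhds hp₀
    have hsec : ∀ v : E, ContinuousOn (fun p : X => Φ.d p (T.symm p v)) T.baseSet := by
      intro v
      have h1 : ContinuousOn (fun p : X => (⟨p, T.symm p v⟩ : TangentBundle I X)) T.baseSet :=
        T.continuousOn_symm.comp (f := fun p : X => (p, v)) (by fun_prop)
          (fun p hp => ⟨hp, mem_univ _⟩)
      exact Φ.continuous_d.comp_continuousOn h1
    have key : ContinuousOn (fun p => ContinuousLinearMap.inCoordinates E (TangentSpace I : X → Type _)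
        (E →L[ℝ] ℝ) (fun x : X => TangentSpace I x →L[ℝ] Bundle.Trivial X ℝ x) p₀ p p₀ p (b p))
        T.baseSet := by
      refine continuousOn_clm_apply.2 fun v => continuousOn_clm_apply.2 fun w => ?_
      refine (((hB.continuousOn.clm_apply (hsec v)).clm_apply (hsec w))).congr fun p hp => ?_
      rw [inCoordinates_apply_eq₂ hp hp (mem_univ _)]
      simp [hb]
      rfl
    exact key.continuousAt hTnhds

end FramingTools

section Product

variable {E : Type*} [NormedAddCommGroup E] [NormedSpace ℝ E]
  {H : Type*} [TopologicalSpace H] {I : ModelWithCorners ℝ E H}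
  {M : Type*} [TopologicalSpace M] [ChartedSpace H M]
  {F : Type*} [NormedAddCommGroup F] [NormedSpace ℝ F]
  {H' : Type*} [TopologicalSpace H'] {J : ModelWithCorners ℝ F H'}
  {N : Type*} [TopologicalSpace N] [ChartedSpace H' N]
  {W : Type*} [NormedAddCommGroup W] [NormedSpace ℝ W]
  {W' : Type*} [NormedAddCommGroup W'] [NormedSpace ℝ W']
  {V : Type*} [NormedAddCommGroup V] [NormedSpace ℝ V]

/-- The differential at `p` of the projection `M × N → N`. -/
noncomputable def verticalProj (p : M × N) :
    TangentSpace (I.prod J) p →L[ℝ] TangentSpace J p.2 :=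
  mfderiv (I.prod J) J (Prod.snd : M × N → N) p

/-- The vector tangent to `M × N` with given components. -/
noncomputable def tpair (p : M × N) :
    (TangentSpace I p.1 × TangentSpace J p.2) →L[ℝ] TangentSpace (I.prod J) p :=
  ContinuousLinearMap.id ℝ (E × F)

@[simp] theorem horizontalProj_tpair (p : M × N) (v : TangentSpace I p.1) (w : TangentSpace J p.2) :
    horizontalProj p (tpair p (v, w)) = v := by
  rw [horizontalProj, mfderiv_fst]; rfl

@[simp] theorem verticalProj_tpair (p : M × N) (v : TangentSpace I p.1) (w : TangentSpace J p.2) :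
    verticalProj p (tpair p (v, w)) = w := by
  rw [verticalProj, mfderiv_snd]; rfl

@[simp] theorem tpair_proj (p : M × N) (ξ : TangentSpace (I.prod J) p) :
    tpair p (horizontalProj p ξ, verticalProj p ξ) = ξ := by
  rw [horizontalProj, verticalProj, mfderiv_snd, mfderiv_fst]; rfl

theorem tangent_ext {p : M × N} {ξ η : TangentSpace (I.prod J) p}
    (h1 : horizontalProj p ξ = horizontalProj p η) (h2 : verticalProj p ξ = verticalProj p η) :
    ξ = η := by
  rw [← tpair_proj p ξ, ← tpair_proj p η, h1, h2]

theorem vertical_eq_tpair (x : M) (y : N) (w : TangentSpace J y) :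
    vertical (I := I) x y w = tpair (x, y) (0, w) := by
  rw [vertical, mfderiv_prod_right]; rfl

theorem vderiv_tpair {K : M × N → V} {L : M → V} {p : M × N} (hK : K = fun q => L q.1)
    (hL : MDifferentiableAt I 𝓘(ℝ, V) L p.1) (ξ : TangentSpace (I.prod J) p) :
    vderiv (I.prod J) K p ξ = vderiv I L p.1 (horizontalProj p ξ) := by
  subst hK
  have := mfderiv_comp (I := I.prod J) (I' := I) (I'' := 𝓘(ℝ, V)) p hL
    (mdifferentiableAt_fst (I := I) (I' := J) (x := p))
  exact congrArg (fun A : TangentSpace (I.prod J) p →L[ℝ] V => A ξ) this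

theorem vderiv_tpair' {K : M × N → V} {L : N → V} {p : M × N} (hK : K = fun q => L q.2)
    (hL : MDifferentiableAt J 𝓘(ℝ, V) L p.2) (ξ : TangentSpace (I.prod J) p) :
    vderiv (I.prod J) K p ξ = vderiv J L p.2 (verticalProj p ξ) := by
  subst hK
  have := mfderiv_comp (I := I.prod J) (I' := J) (I'' := 𝓘(ℝ, V)) p hL
    (mdifferentiableAt_snd (I := I) (I' := J) (x := p))
  exact congrArg (fun A : TangentSpace (I.prod J) p →L[ℝ] V => A ξ) this

theorem vderiv_clm_comp (A : V →L[ℝ] W) {K : M → V} {p : M}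
    (hK : MDifferentiableAt I 𝓘(ℝ, V) K p) (v : TangentSpace I p) :
    vderiv I (fun q => A (K q)) p v = A (vderiv I K p v) := by
  have h := A.hasMFDerivAt (x := K p) |>.comp p hK.hasMFDerivAt
  exact congrArg (fun A : TangentSpace I p →L[ℝ] W => A v) h.mfderiv

theorem vderiv_prodMk {K : M → V} {L : M → W} {p : M} (hK : MDifferentiableAt I 𝓘(ℝ, V) K p)
    (hL : MDifferentiableAt I 𝓘(ℝ, W) L p) (v : TangentSpace I p) :
    vderiv I (fun q => (K q, L q)) p v = (vderiv I K p v, vderiv I L p v) := by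
  have h := hK.prodMk_space hL
  exact Prod.ext (vderiv_clm_comp (ContinuousLinearMap.fst ℝ V W) h v).symm
    (vderiv_clm_comp (ContinuousLinearMap.snd ℝ V W) h v).symm

variable [IsManifold I 1 M] [IsManifold J 1 N]

theorem continuous_tpair : Continuous fun q : TangentBundle I M × TangentBundle J N =>
    (⟨(q.1.1, q.2.1), tpair (q.1.1, q.2.1) (q.1.2, q.2.2)⟩ : TangentBundle (I.prod J) (M × N)) :=
  (contMDiff_equivTangentBundleProd_symm (n := 0) (I := I) (M := M) (I' := J) (M' := N)).continuous

/-- The framing of a product. -/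
noncomputable def Framing.prod (Φ : Framing I M W) (Ψ : Framing J N W') :
    Framing (I.prod J) (M × N) (W × W') where
  ι := fun p => (Φ.ι p.1, Ψ.ι p.2)
  contMDiff := (Φ.contMDiff.comp contMDiff_fst).prodMk_space (Ψ.contMDiff.comp contMDiff_snd)
  inj := fun p q h => Prod.ext (Φ.inj (Prod.ext_iff.1 h).1) (Ψ.inj (Prod.ext_iff.1 h).2)
  ρ := fun p => tpair p ∘L ((Φ.ρ p.1).prodMap (Ψ.ρ p.2))
  left_inv := fun p ξ => by
    have h1 : MDifferentiableAt I 𝓘(ℝ, W) Φ.ι p.1 := Φ.contMDiff.mdifferentiableAt one_ne_zero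
    have h2 : MDifferentiableAt J 𝓘(ℝ, W') Ψ.ι p.2 := Ψ.contMDiff.mdifferentiableAt one_ne_zero
    rw [vderiv_prodMk (K := fun p : M × N => Φ.ι p.1) (L := fun p : M × N => Ψ.ι p.2)
      (h1.comp p mdifferentiableAt_fst) (h2.comp p mdifferentiableAt_snd),
      vderiv_tpair (L := Φ.ι) rfl h1, vderiv_tpair' (L := Ψ.ι) rfl h2]
    exact (congrArg (tpair p) (Prod.ext (Φ.left_inv _ _) (Ψ.left_inv _ _))).trans (tpair_proj p ξ)
  cont := continuous_tpair.comp (f := fun q : (M × N) × W × W' =>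
    ((⟨q.1.1, Φ.ρ q.1.1 q.2.1⟩, ⟨q.1.2, Ψ.ρ q.1.2 q.2.2⟩) : TangentBundle I M × TangentBundle J N))
    ((Φ.cont.comp (f := fun q : (M × N) × W × W' => (q.1.1, q.2.1)) (by fun_prop)).prodMk
    (Ψ.cont.comp (f := fun q : (M × N) × W × W' => (q.1.2, q.2.2)) (by fun_prop)))

theorem Framing.prod_d (Φ : Framing I M W) (Ψ : Framing J N W') (p : M × N)
    (ξ : TangentSpace (I.prod J) p) :
    (Φ.prod Ψ).d p ξ = (Φ.d p.1 (horizontalProj p ξ), Ψ.d p.2 (verticalProj p ξ)) := by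
  have h1 : MDifferentiableAt I 𝓘(ℝ, W) Φ.ι p.1 := Φ.contMDiff.mdifferentiableAt one_ne_zero
  have h2 : MDifferentiableAt J 𝓘(ℝ, W') Ψ.ι p.2 := Ψ.contMDiff.mdifferentiableAt one_ne_zero
  change vderiv (I.prod J) (fun p : M × N => (Φ.ι p.1, Ψ.ι p.2)) p ξ = _
  rw [vderiv_prodMk (K := fun p : M × N => Φ.ι p.1) (L := fun p : M × N => Ψ.ι p.2)
      (h1.comp p mdifferentiableAt_fst) (h2.comp p mdifferentiableAt_snd),
      vderiv_tpair (L := Φ.ι) rfl h1, vderiv_tpair' (L := Ψ.ι) rfl h2]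
  rfl

theorem Framing.prod_ρ (Φ : Framing I M W) (Ψ : Framing J N W') (p : M × N) (w : W × W') :
    (Φ.prod Ψ).ρ p w = tpair p (Φ.ρ p.1 w.1, Ψ.ρ p.2 w.2) := rfl

end Product

end PHCocycle

namespace PHCocycle

section Homogeneous

variable {B : Type*} [TopologicalSpace B] [CompactSpace B]
  {V : Type*} [NormedAddCommGroup V] [NormedSpace ℝ V] [FiniteDimensional ℝ V]
  {W : Type*} [NormedAddCommGroup W] [NormedSpace ℝ W] [FiniteDimensional ℝ W]

theorem exists_le_norm_of_homogeneous {n : B → V → ℝ} (hn : Continuous fun q : B × V => n q.1 q.2)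
    (hhom : ∀ p t v, n p (t • v) = |t| * n p v) :
    ∃ C : ℝ, 0 < C ∧ ∀ p v, n p v ≤ C * ‖v‖ := by
  have : ProperSpace V := FiniteDimensional.proper ℝ V
  obtain ⟨C, hC⟩ := (isCompact_univ.prod (isCompact_sphere (0 : V) 1)).exists_bound_of_continuousOn
    (f := fun q : B × V => n q.1 q.2) hn.continuousOn
  refine ⟨max C 1, by positivity, fun p v => ?_⟩
  rcases eq_or_ne v 0 with rfl | hv
  · have := hhom p 0 0
    simp at this
    simp [this]
  have hv' : 0 < ‖v‖ := norm_pos_iff.2 hv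
  have h1 := hC (p, ‖v‖⁻¹ • v) ⟨mem_univ _, by
    rw [mem_sphere_zero_iff_norm, norm_smul, norm_inv, norm_norm, inv_mul_cancel₀ hv'.ne']⟩
  have h2 : n p v = ‖v‖ * n p (‖v‖⁻¹ • v) := by
    rw [hhom, abs_of_pos (inv_pos.2 hv'), mul_inv_cancel_left₀ hv'.ne']
  rw [h2, mul_comm]
  gcongr
  exact (le_abs_self _).trans (h1.trans (le_max_left _ _))

theorem exists_norm_le_of_homogeneous {n : B → V → ℝ} (hn : Continuous fun q : B × V => n q.1 q.2)
    (hhom : ∀ p t v, n p (t • v) = |t| * n p v) {𝒱 : B → Submodule ℝ V} (h𝒱 : ClosedSubspaces 𝒱)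
    (hpos : ∀ p, ∀ v ∈ 𝒱 p, v ≠ 0 → 0 < n p v) :
    ∃ c : ℝ, 0 < c ∧ ∀ p, ∀ v ∈ 𝒱 p, c * ‖v‖ ≤ n p v := by
  have : ProperSpace V := FiniteDimensional.proper ℝ V
  have hK : IsCompact ({q : B × V | q.2 ∈ 𝒱 q.1} ∩ (univ ×ˢ Metric.sphere (0 : V) 1)) :=
    (isCompact_univ.prod (isCompact_sphere (0 : V) 1)).inter_left h𝒱
  obtain ⟨c, hc, h⟩ := hK.exists_forall_le' (f := fun q => n q.1 q.2) hn.continuousOn (a := 0)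
    (fun q hq => hpos _ _ hq.1 (by
      intro h0
      have := hq.2.2
      rw [h0] at this
      simp at this))
  refine ⟨c, hc, fun p v hv => ?_⟩
  rcases eq_or_ne v 0 with rfl | hv0
  · have := hhom p 0 0
    simp at this
    simp [this]
  have hv' : 0 < ‖v‖ := norm_pos_iff.2 hv0
  have h1 := h (p, ‖v‖⁻¹ • v) ⟨(𝒱 p).smul_mem _ hv, mem_univ _, by
    rw [mem_sphere_zero_iff_norm, norm_smul, norm_inv, norm_norm, inv_mul_cancel₀ hv'.ne']⟩
  have h2 : n p v = ‖v‖ * n p (‖v‖⁻¹ • v) := by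
    rw [hhom, abs_of_pos (inv_pos.2 hv'), mul_inv_cancel_left₀ hv'.ne']
  rw [h2, mul_comm]
  gcongr

theorem exists_ratio_lt_one {α β : B → V → W → ℝ}
    (hα : Continuous fun q : B × V × W => α q.1 q.2.1 q.2.2)
    (hβ : Continuous fun q : B × V × W => β q.1 q.2.1 q.2.2)
    (hαh : ∀ p s t v w, α p (s • v) (t • w) = |s| * |t| * α p v w)
    (hβh : ∀ p s t v w, β p (s • v) (t • w) = |s| * |t| * β p v w)
    {𝒱 : B → Submodule ℝ V} (h𝒱 : ClosedSubspaces 𝒱) {𝒲 : B → Submodule ℝ W}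
    (h𝒲 : ClosedSubspaces 𝒲) (hα0 : ∀ p v w, 0 ≤ α p v w)
    (hlt : ∀ p, ∀ v ∈ 𝒱 p, ∀ w ∈ 𝒲 p, v ≠ 0 → w ≠ 0 → α p v w < β p v w) :
    ∃ θ : ℝ, 0 < θ ∧ θ < 1 ∧ ∀ θ', θ ≤ θ' → ∀ p, ∀ v ∈ 𝒱 p, ∀ w ∈ 𝒲 p,
      α p v w ≤ θ' * β p v w := by
  have : ProperSpace V := FiniteDimensional.proper ℝ V
  have : ProperSpace W := FiniteDimensional.proper ℝ W
  let K : Set (B × V × W) := {q | q.2.1 ∈ 𝒱 q.1 ∧ q.2.2 ∈ 𝒲 q.1} ∩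
    (univ ×ˢ (Metric.sphere (0 : V) 1 ×ˢ Metric.sphere (0 : W) 1))
  have hK : IsCompact K := by
    refine (isCompact_univ.prod ((isCompact_sphere _ _).prod (isCompact_sphere _ _))).inter_left ?_
    exact (h𝒱.preimage (f := fun q : B × V × W => (q.1, q.2.1)) (by fun_prop)).inter
      (h𝒲.preimage (f := fun q : B × V × W => (q.1, q.2.2)) (by fun_prop))
  have hne : ∀ {Z : Type _} [NormedAddCommGroup Z] {z : Z}, z ∈ Metric.sphere (0 : Z) 1 → z ≠ 0 := by
    rintro Z _ z hz rfl
    simp at hz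
  have hne' : ∀ {Z : Type _} [NormedAddCommGroup Z] {z : Z}, z ∈ Metric.sphere (0 : Z) 1 → z ≠ 0 := by
    rintro Z _ z hz rfl
    simp at hz
  have hltK : ∀ q ∈ K, α q.1 q.2.1 q.2.2 < β q.1 q.2.1 q.2.2 := fun q hq =>
    hlt _ _ hq.1.1 _ hq.1.2 (hne hq.2.2.1) (hne' hq.2.2.2)
  have hβ0 : ∀ q ∈ K, 0 < β q.1 q.2.1 q.2.2 := fun q hq => (hα0 _ _ _).trans_lt (hltK q hq)
  obtain ⟨c, hc, h⟩ := hK.exists_forall_le' (a := 0)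
    (f := fun q => 1 - α q.1 q.2.1 q.2.2 / β q.1 q.2.1 q.2.2)
    (continuousOn_const.sub (hα.continuousOn.div hβ.continuousOn fun q hq => (hβ0 q hq).ne'))
    (fun q hq => by
      have := (div_lt_one (hβ0 q hq)).2 (hltK q hq)
      linarith)
  refine ⟨max (1 - c) (1 / 2), by positivity, max_lt (by linarith) (by norm_num), ?_⟩
  intro θ' hθ' p v hv w hw
  rcases eq_or_ne v 0 with rfl | hv0
  · have h1 := hαh p 0 1 0 w
    have h2 := hβh p 0 1 0 w
    simp at h1 h2
    simp [h1, h2]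
  rcases eq_or_ne w 0 with rfl | hw0
  · have h1 := hαh p 1 0 v 0
    have h2 := hβh p 1 0 v 0
    simp at h1 h2
    simp [h1, h2]
  have hv' : 0 < ‖v‖ := norm_pos_iff.2 hv0
  have hw' : 0 < ‖w‖ := norm_pos_iff.2 hw0
  have hq : (p, ‖v‖⁻¹ • v, ‖w‖⁻¹ • w) ∈ K := ⟨⟨(𝒱 p).smul_mem _ hv, (𝒲 p).smul_mem _ hw⟩,
    mem_univ _, by
      rw [mem_sphere_zero_iff_norm, norm_smul, norm_inv, norm_norm, inv_mul_cancel₀ hv'.ne'], by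
      rw [mem_sphere_zero_iff_norm, norm_smul, norm_inv, norm_norm, inv_mul_cancel₀ hw'.ne']⟩
  have h1 := h _ hq
  have h2 := hβ0 _ hq
  have h3 : α p (‖v‖⁻¹ • v) (‖w‖⁻¹ • w) / β p (‖v‖⁻¹ • v) (‖w‖⁻¹ • w) ≤ θ' := by
    have := (le_max_left (1 - c) (1 / 2)).trans hθ'
    simp only at h1
    linarith
  rw [div_le_iff₀ h2, hαh, hβh, abs_of_pos (inv_pos.2 hv'), abs_of_pos (inv_pos.2 hw')] at h3
  have h4 : 0 < ‖v‖⁻¹ * ‖w‖⁻¹ := by positivity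
  refine le_of_mul_le_mul_left ?_ h4
  linarith

end Homogeneous

/-- The linear data of a hyperbolic extension: over a homeomorphism `F`, a partially hyperbolic
cocycle `a` on `es ⊕ ec ⊕ eu`, a hyperbolic cocycle `c` on `vs ⊕ vu`, and the triangular cocycle
`(w, w') ↦ (a w, b w + c w')`, together with its inverse. -/
structure LinExt (X W W' : Type*) [TopologicalSpace X] [NormedAddCommGroup W] [NormedSpace ℝ W]
    [NormedAddCommGroup W'] [NormedSpace ℝ W'] where
  F : X ≃ₜ X
  (es ec eu : X → Submodule ℝ W)
  (vs vu : X → Submodule ℝ W')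
  (a a' : X → W →L[ℝ] W)
  (c c' : X → W' →L[ℝ] W')
  (b b' : X → W →L[ℝ] W')
  (Ps Pc Pu : X → W →L[ℝ] W)
  (Qs Qu : X → W' →L[ℝ] W')
  mm : X → W →L[ℝ] W →L[ℝ] ℝ
  hh : X → W' →L[ℝ] W' →L[ℝ] ℝ
  closed_es : ClosedSubspaces es
  closed_ec : ClosedSubspaces ec
  closed_eu : ClosedSubspaces eu
  closed_vs : ClosedSubspaces vs
  closed_vu : ClosedSubspaces vu
  cont_a : Continuous a
  cont_a' : Continuous a'
  cont_b : Continuous b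
  cont_b' : Continuous b'
  cont_c : Continuous c
  cont_c' : Continuous c'
  cont_Ps : Continuous Ps
  cont_Pc : Continuous Pc
  cont_Pu : Continuous Pu
  cont_Qs : Continuous Qs
  cont_Qu : Continuous Qu
  cont_mm : Continuous mm
  cont_hh : Continuous hh
  Ps_mem : ∀ p w, Ps p w ∈ es p
  Pc_mem : ∀ p w, Pc p w ∈ ec p
  Pu_mem : ∀ p w, Pu p w ∈ eu p
  Qs_mem : ∀ p w, Qs p w ∈ vs p
  Qu_mem : ∀ p w, Qu p w ∈ vu p
  P_s : ∀ p, ∀ w ∈ es p, Ps p w = w ∧ Pc p w = 0 ∧ Pu p w = 0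
  P_c : ∀ p, ∀ w ∈ ec p, Ps p w = 0 ∧ Pc p w = w ∧ Pu p w = 0
  P_u : ∀ p, ∀ w ∈ eu p, Ps p w = 0 ∧ Pc p w = 0 ∧ Pu p w = w
  Q_s : ∀ p, ∀ w ∈ vs p, Qs p w = w ∧ Qu p w = 0
  Q_u : ∀ p, ∀ w ∈ vu p, Qs p w = 0 ∧ Qu p w = w
  a_s : ∀ p, ∀ w ∈ es p, a p w ∈ es (F p)
  a_c : ∀ p, ∀ w ∈ ec p, a p w ∈ ec (F p)
  a_u : ∀ p, ∀ w ∈ eu p, a p w ∈ eu (F p)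
  a'_s : ∀ p, ∀ w ∈ es p, a' p w ∈ es (F.symm p)
  a'_c : ∀ p, ∀ w ∈ ec p, a' p w ∈ ec (F.symm p)
  a'_u : ∀ p, ∀ w ∈ eu p, a' p w ∈ eu (F.symm p)
  c_s : ∀ p, ∀ w ∈ vs p, c p w ∈ vs (F p)
  c_u : ∀ p, ∀ w ∈ vu p, c p w ∈ vu (F p)
  c'_s : ∀ p, ∀ w ∈ vs p, c' p w ∈ vs (F.symm p)
  c'_u : ∀ p, ∀ w ∈ vu p, c' p w ∈ vu (F.symm p)
  b_mem : ∀ p, ∀ w ∈ es p ⊔ (ec p ⊔ eu p), Qs (F p) (b p w) + Qu (F p) (b p w) = b p w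
  b'_mem : ∀ p, ∀ w ∈ es p ⊔ (ec p ⊔ eu p),
    Qs (F.symm p) (b' p w) + Qu (F.symm p) (b' p w) = b' p w
  a'_a : ∀ p, ∀ w ∈ es p ⊔ (ec p ⊔ eu p), a' (F p) (a p w) = w
  a_a' : ∀ p, ∀ w ∈ es p ⊔ (ec p ⊔ eu p), a (F.symm p) (a' p w) = w
  c'_c : ∀ p, ∀ w ∈ vs p ⊔ vu p, c' (F p) (c p w) = w
  c_c' : ∀ p, ∀ w ∈ vs p ⊔ vu p, c (F.symm p) (c' p w) = w
  b'_a : ∀ p, ∀ w ∈ es p ⊔ (ec p ⊔ eu p), b' (F p) (a p w) + c' (F p) (b p w) = 0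
  b_a' : ∀ p, ∀ w ∈ es p ⊔ (ec p ⊔ eu p), b (F.symm p) (a' p w) + c (F.symm p) (b' p w) = 0
  mm_symm : ∀ p v w, mm p v w = mm p w v
  hh_symm : ∀ p v w, hh p v w = hh p w v
  mm_pos : ∀ p, ∀ w ∈ es p ⊔ (ec p ⊔ eu p), w ≠ 0 → 0 < mm p w w
  hh_pos : ∀ p, ∀ w ∈ vs p ⊔ vu p, w ≠ 0 → 0 < hh p w w
  hh_nonneg : ∀ p w, 0 ≤ hh p w w
  hh_add : ∀ p v w, √(hh p (v + w) (v + w)) ≤ √(hh p v v) + √(hh p w w)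
  contr_e : ∀ p, ∀ w ∈ es p, w ≠ 0 → √(mm (F p) (a p w) (a p w)) < √(mm p w w)
  contr_v : ∀ p, ∀ w ∈ vs p, w ≠ 0 → √(hh (F p) (c p w) (c p w)) < √(hh p w w)
  dom_e : ∀ p, ∀ w ∈ es p, ∀ η ∈ ec p, w ≠ 0 → η ≠ 0 →
    √(mm (F p) (a p w) (a p w)) * √(mm p η η) < √(mm (F p) (a p η) (a p η)) * √(mm p w w)
  dom_v : ∀ p, ∀ w ∈ vs p, ∀ η ∈ ec p, w ≠ 0 → η ≠ 0 →
    √(hh (F p) (c p w) (c p w)) * √(mm p η η) < √(mm (F p) (a p η) (a p η)) * √(hh p w w)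
  contr_e' : ∀ p, ∀ w ∈ eu p, w ≠ 0 → √(mm (F.symm p) (a' p w) (a' p w)) < √(mm p w w)
  contr_v' : ∀ p, ∀ w ∈ vu p, w ≠ 0 → √(hh (F.symm p) (c' p w) (c' p w)) < √(hh p w w)
  dom_e' : ∀ p, ∀ w ∈ eu p, ∀ η ∈ ec p, w ≠ 0 → η ≠ 0 →
    √(mm (F.symm p) (a' p w) (a' p w)) * √(mm p η η) <
      √(mm (F.symm p) (a' p η) (a' p η)) * √(mm p w w)
  dom_v' : ∀ p, ∀ w ∈ vu p, ∀ η ∈ ec p, w ≠ 0 → η ≠ 0 →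
    √(hh (F.symm p) (c' p w) (c' p w)) * √(mm p η η) <
      √(mm (F.symm p) (a' p η) (a' p η)) * √(hh p w w)

namespace LinExt

variable {X W W' : Type*} [TopologicalSpace X] [NormedAddCommGroup W] [NormedSpace ℝ W]
    [NormedAddCommGroup W'] [NormedSpace ℝ W']

theorem sup_swap {V : Type*} [AddCommGroup V] [Module ℝ V] (A B C : Submodule ℝ V) :
    C ⊔ (B ⊔ A) = A ⊔ (B ⊔ C) := by
  rw [sup_comm, sup_comm B A, sup_assoc]

/-- The inverse extension, with the roles of stable and unstable directions exchanged. -/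
def symm (D : LinExt X W W') : LinExt X W W' where
  F := D.F.symm
  es := D.eu
  ec := D.ec
  eu := D.es
  vs := D.vu
  vu := D.vs
  a := D.a'
  a' := D.a
  c := D.c'
  c' := D.c
  b := D.b'
  b' := D.b
  Ps := D.Pu
  Pc := D.Pc
  Pu := D.Ps
  Qs := D.Qu
  Qu := D.Qs
  mm := D.mm
  hh := D.hh
  closed_es := D.closed_eu
  closed_ec := D.closed_ec
  closed_eu := D.closed_es
  closed_vs := D.closed_vu
  closed_vu := D.closed_vs
  cont_a := D.cont_a'
  cont_a' := D.cont_a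
  cont_b := D.cont_b'
  cont_b' := D.cont_b
  cont_c := D.cont_c'
  cont_c' := D.cont_c
  cont_Ps := D.cont_Pu
  cont_Pc := D.cont_Pc
  cont_Pu := D.cont_Ps
  cont_Qs := D.cont_Qu
  cont_Qu := D.cont_Qs
  cont_mm := D.cont_mm
  cont_hh := D.cont_hh
  Ps_mem := D.Pu_mem
  Pc_mem := D.Pc_mem
  Pu_mem := D.Ps_mem
  Qs_mem := D.Qu_mem
  Qu_mem := D.Qs_mem
  P_s := fun p w hw => ⟨(D.P_u p w hw).2.2, (D.P_u p w hw).2.1, (D.P_u p w hw).1⟩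
  P_c := fun p w hw => ⟨(D.P_c p w hw).2.2, (D.P_c p w hw).2.1, (D.P_c p w hw).1⟩
  P_u := fun p w hw => ⟨(D.P_s p w hw).2.2, (D.P_s p w hw).2.1, (D.P_s p w hw).1⟩
  Q_s := fun p w hw => ⟨(D.Q_u p w hw).2, (D.Q_u p w hw).1⟩
  Q_u := fun p w hw => ⟨(D.Q_s p w hw).2, (D.Q_s p w hw).1⟩
  a_s := D.a'_u
  a_c := D.a'_c
  a_u := D.a'_s
  a'_s := D.a_u
  a'_c := D.a_c
  a'_u := D.a_s
  c_s := D.c'_u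
  c_u := D.c'_s
  c'_s := D.c_u
  c'_u := D.c_s
  b_mem := fun p w hw => by rw [add_comm]; exact D.b'_mem p w (by rwa [sup_swap] at hw)
  b'_mem := fun p w hw => by rw [add_comm]; exact D.b_mem p w (by rwa [sup_swap] at hw)
  a'_a := fun p w hw => D.a_a' p w (by rwa [sup_swap] at hw)
  a_a' := fun p w hw => D.a'_a p w (by rwa [sup_swap] at hw)
  c'_c := fun p w hw => D.c_c' p w (by rwa [sup_comm] at hw)
  c_c' := fun p w hw => D.c'_c p w (by rwa [sup_comm] at hw)
  b'_a := fun p w hw => D.b_a' p w (by rwa [sup_swap] at hw)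
  b_a' := fun p w hw => D.b'_a p w (by rwa [sup_swap] at hw)
  mm_symm := D.mm_symm
  hh_symm := D.hh_symm
  mm_pos := fun p w hw => D.mm_pos p w (by rwa [sup_swap] at hw)
  hh_pos := fun p w hw => D.hh_pos p w (by rwa [sup_comm] at hw)
  hh_nonneg := D.hh_nonneg
  hh_add := D.hh_add
  contr_e := D.contr_e'
  contr_v := D.contr_v'
  dom_e := D.dom_e'
  dom_v := D.dom_v'
  contr_e' := D.contr_e
  contr_v' := D.contr_v
  dom_e' := D.dom_e
  dom_v' := D.dom_v

variable (D : LinExt X W W')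

/-- The length of horizontal vectors. -/
noncomputable def nm (p : X) (w : W) : ℝ := √(D.mm p w w)

/-- The length of vertical vectors. -/
noncomputable def nh (p : X) (w : W') : ℝ := √(D.hh p w w)

theorem nm_nonneg (p : X) (w : W) : 0 ≤ D.nm p w := Real.sqrt_nonneg _

theorem nh_nonneg (p : X) (w : W') : 0 ≤ D.nh p w := Real.sqrt_nonneg _

theorem nm_smul (p : X) (t : ℝ) (w : W) : D.nm p (t • w) = |t| * D.nm p w := by
  have : D.mm p (t • w) (t • w) = t ^ 2 * D.mm p w w := by simp; ring
  rw [nm, this, Real.sqrt_mul (sq_nonneg t), Real.sqrt_sq_eq_abs, nm]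

theorem nh_smul (p : X) (t : ℝ) (w : W') : D.nh p (t • w) = |t| * D.nh p w := by
  have : D.hh p (t • w) (t • w) = t ^ 2 * D.hh p w w := by simp; ring
  rw [nh, this, Real.sqrt_mul (sq_nonneg t), Real.sqrt_sq_eq_abs, nh]

theorem nm_pos {p : X} {w : W} (hw : w ∈ D.es p ⊔ (D.ec p ⊔ D.eu p)) (h : w ≠ 0) : 0 < D.nm p w :=
  Real.sqrt_pos.2 (D.mm_pos p w hw h)

theorem nh_pos {p : X} {w : W'} (hw : w ∈ D.vs p ⊔ D.vu p) (h : w ≠ 0) : 0 < D.nh p w :=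
  Real.sqrt_pos.2 (D.hh_pos p w hw h)

theorem mem_of_s {p : X} {w : W} (h : w ∈ D.es p) : w ∈ D.es p ⊔ (D.ec p ⊔ D.eu p) :=
  le_sup_left (a := D.es p) h

theorem mem_of_c {p : X} {w : W} (h : w ∈ D.ec p) : w ∈ D.es p ⊔ (D.ec p ⊔ D.eu p) :=
  (le_sup_left.trans le_sup_right : D.ec p ≤ _) h

theorem mem_of_u {p : X} {w : W} (h : w ∈ D.eu p) : w ∈ D.es p ⊔ (D.ec p ⊔ D.eu p) :=
  (le_sup_right.trans le_sup_right : D.eu p ≤ _) h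

theorem mem_of_vs {p : X} {w : W'} (h : w ∈ D.vs p) : w ∈ D.vs p ⊔ D.vu p :=
  le_sup_left (a := D.vs p) h

theorem mem_of_vu {p : X} {w : W'} (h : w ∈ D.vu p) : w ∈ D.vs p ⊔ D.vu p :=
  le_sup_right (a := D.vs p) h

theorem continuous_nm {Z : Type*} [TopologicalSpace Z] {p : Z → X} {w : Z → W}
    (hp : Continuous p) (hw : Continuous w) : Continuous fun z => D.nm (p z) (w z) :=
  Real.continuous_sqrt.comp (((D.cont_mm.comp hp).clm_apply hw).clm_apply hw)

theorem continuous_nh {Z : Type*} [TopologicalSpace Z] {p : Z → X} {w : Z → W'}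
    (hp : Continuous p) (hw : Continuous w) : Continuous fun z => D.nh (p z) (w z) :=
  Real.continuous_sqrt.comp (((D.cont_hh.comp hp).clm_apply hw).clm_apply hw)

theorem continuous_nm_a {Z : Type*} [TopologicalSpace Z] {p : Z → X} {w : Z → W}
    (hp : Continuous p) (hw : Continuous w) :
    Continuous fun z => D.nm (D.F (p z)) (D.a (p z) (w z)) :=
  D.continuous_nm (D.F.continuous.comp hp) ((D.cont_a.comp hp).clm_apply hw)

theorem continuous_nh_c {Z : Type*} [TopologicalSpace Z] {p : Z → X} {w : Z → W'}
    (hp : Continuous p) (hw : Continuous w) :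
    Continuous fun z => D.nh (D.F (p z)) (D.c (p z) (w z)) :=
  D.continuous_nh (D.F.continuous.comp hp) ((D.cont_c.comp hp).clm_apply hw)

variable [CompactSpace X] [FiniteDimensional ℝ W] [FiniteDimensional ℝ W']

theorem exists_uniform : ∃ θ : ℝ, 0 < θ ∧ θ < 1 ∧
    (∀ p, ∀ w ∈ D.es p, D.nm (D.F p) (D.a p w) ≤ θ * D.nm p w) ∧
    (∀ p, ∀ w ∈ D.vs p, D.nh (D.F p) (D.c p w) ≤ θ * D.nh p w) ∧
    (∀ p, ∀ w ∈ D.es p, ∀ η ∈ D.ec p,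
      D.nm (D.F p) (D.a p w) * D.nm p η ≤ θ * (D.nm (D.F p) (D.a p η) * D.nm p w)) ∧
    (∀ p, ∀ w ∈ D.vs p, ∀ η ∈ D.ec p,
      D.nh (D.F p) (D.c p w) * D.nm p η ≤ θ * (D.nm (D.F p) (D.a p η) * D.nh p w)) := by
  have htop : ClosedSubspaces fun _ : X => (⊤ : Submodule ℝ ℝ) := by
    simp [ClosedSubspaces]
  obtain ⟨θ₁, h10, h11, h1⟩ := exists_ratio_lt_one (B := X) (V := W) (W := ℝ)
    (α := fun p w t => D.nm (D.F p) (D.a p w) * |t|) (β := fun p w t => D.nm p w * |t|)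
    ((D.continuous_nm_a (by fun_prop) (by fun_prop)).mul (by fun_prop))
    ((D.continuous_nm (by fun_prop) (by fun_prop)).mul (by fun_prop))
    (fun p s t v w => by simp only [map_smul, nm_smul, smul_eq_mul, abs_mul]; ring)
    (fun p s t v w => by simp only [nm_smul, smul_eq_mul, abs_mul]; ring)
    D.closed_es htop
    (fun p v w => mul_nonneg (D.nm_nonneg _ _) (abs_nonneg _))
    (fun p v hv w _ hv0 hw0 => mul_lt_mul_of_pos_right (D.contr_e p v hv hv0) (abs_pos.2 hw0))
  obtain ⟨θ₂, h20, h21, h2⟩ := exists_ratio_lt_one (B := X) (V := W') (W := ℝ)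
    (α := fun p w t => D.nh (D.F p) (D.c p w) * |t|) (β := fun p w t => D.nh p w * |t|)
    ((D.continuous_nh_c (by fun_prop) (by fun_prop)).mul (by fun_prop))
    ((D.continuous_nh (by fun_prop) (by fun_prop)).mul (by fun_prop))
    (fun p s t v w => by simp only [map_smul, nh_smul, smul_eq_mul, abs_mul]; ring)
    (fun p s t v w => by simp only [nh_smul, smul_eq_mul, abs_mul]; ring)
    D.closed_vs htop
    (fun p v w => mul_nonneg (D.nh_nonneg _ _) (abs_nonneg _))
    (fun p v hv w _ hv0 hw0 => mul_lt_mul_of_pos_right (D.contr_v p v hv hv0) (abs_pos.2 hw0))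
  obtain ⟨θ₃, h30, h31, h3⟩ := exists_ratio_lt_one (B := X) (V := W) (W := W)
    (α := fun p w η => D.nm (D.F p) (D.a p w) * D.nm p η)
    (β := fun p w η => D.nm (D.F p) (D.a p η) * D.nm p w)
    ((D.continuous_nm_a (by fun_prop) (by fun_prop)).mul (D.continuous_nm (by fun_prop) (by fun_prop)))
    ((D.continuous_nm_a (by fun_prop) (by fun_prop)).mul (D.continuous_nm (by fun_prop) (by fun_prop)))
    (fun p s t v w => by simp only [map_smul, nm_smul]; ring)
    (fun p s t v w => by simp only [map_smul, nm_smul]; ring)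
    D.closed_es D.closed_ec
    (fun p v w => mul_nonneg (D.nm_nonneg _ _) (D.nm_nonneg _ _))
    (fun p v hv w hw hv0 hw0 => D.dom_e p v hv w hw hv0 hw0)
  obtain ⟨θ₄, h40, h41, h4⟩ := exists_ratio_lt_one (B := X) (V := W') (W := W)
    (α := fun p w η => D.nh (D.F p) (D.c p w) * D.nm p η)
    (β := fun p w η => D.nm (D.F p) (D.a p η) * D.nh p w)
    ((D.continuous_nh_c (by fun_prop) (by fun_prop)).mul (D.continuous_nm (by fun_prop) (by fun_prop)))
    ((D.continuous_nm_a (by fun_prop) (by fun_prop)).mul (D.continuous_nh (by fun_prop) (by fun_prop)))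
    (fun p s t v w => by simp only [map_smul, nm_smul, nh_smul]; ring)
    (fun p s t v w => by simp only [map_smul, nm_smul, nh_smul]; ring)
    D.closed_vs D.closed_ec
    (fun p v w => mul_nonneg (D.nh_nonneg _ _) (D.nm_nonneg _ _))
    (fun p v hv w hw hv0 hw0 => D.dom_v p v hv w hw hv0 hw0)
  refine ⟨max (max θ₁ θ₂) (max θ₃ θ₄), by positivity, by simp [*], fun p w hw => ?_, fun p w hw => ?_,
    fun p w hw η hη => h3 _ (by simp) p w hw η hη, fun p w hw η hη => h4 _ (by simp) p w hw η hη⟩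
  · simpa using h1 (max (max θ₁ θ₂) (max θ₃ θ₄)) (by simp) p w hw 1 trivial
  · simpa using h2 (max (max θ₁ θ₂) (max θ₃ θ₄)) (by simp) p w hw 1 trivial

end LinExt

end PHCocycle

namespace PHCocycle
namespace LinExt

variable {X W W' : Type*} [TopologicalSpace X] [NormedAddCommGroup W] [NormedSpace ℝ W]
    [NormedAddCommGroup W'] [NormedSpace ℝ W'] (D : LinExt X W W')

theorem eq_add_of_mem {p : X} {w : W} (hw : w ∈ D.es p ⊔ (D.ec p ⊔ D.eu p)) :
    w = D.Ps p w + (D.Pc p w + D.Pu p w) := by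
  obtain ⟨x, hx, y, hy, rfl⟩ := Submodule.mem_sup.1 hw
  obtain ⟨y, hy', z, hz, rfl⟩ := Submodule.mem_sup.1 hy
  simp [D.P_s p x hx, D.P_c p y hy', D.P_u p z hz]

theorem eq_add_of_mem' {p : X} {w : W'} (hw : w ∈ D.vs p ⊔ D.vu p) :
    w = D.Qs p w + D.Qu p w := by
  obtain ⟨x, hx, y, hy, rfl⟩ := Submodule.mem_sup.1 hw
  simp [D.Q_s p x hx, D.Q_u p y hy]

theorem eq_zero_of_mem {p : X} {w : W'} (hs : w ∈ D.vs p) (hu : w ∈ D.vu p) : w = 0 :=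
  (D.Q_s p w hs).1.symm.trans (D.Q_u p w hu).1

theorem b_mem' {p : X} {w : W} (hw : w ∈ D.es p ⊔ (D.ec p ⊔ D.eu p)) :
    D.b p w ∈ D.vs (D.F p) ⊔ D.vu (D.F p) := by
  rw [← D.b_mem p w hw]
  exact Submodule.add_mem_sup (D.Qs_mem _ _) (D.Qu_mem _ _)

theorem a_mem {p : X} {w : W} (hw : w ∈ D.es p ⊔ (D.ec p ⊔ D.eu p)) :
    D.a p w ∈ D.es (D.F p) ⊔ (D.ec (D.F p) ⊔ D.eu (D.F p)) := by
  obtain ⟨x, hx, y, hy, rfl⟩ := Submodule.mem_sup.1 hw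
  obtain ⟨y, hy', z, hz, rfl⟩ := Submodule.mem_sup.1 hy
  simp only [map_add]
  exact Submodule.add_mem_sup (D.a_s p x hx) (Submodule.add_mem_sup (D.a_c p y hy') (D.a_u p z hz))

theorem c_mem {p : X} {w : W'} (hw : w ∈ D.vs p ⊔ D.vu p) :
    D.c p w ∈ D.vs (D.F p) ⊔ D.vu (D.F p) := by
  obtain ⟨x, hx, y, hy, rfl⟩ := Submodule.mem_sup.1 hw
  rw [map_add]
  exact Submodule.add_mem_sup (D.c_s p x hx) (D.c_u p y hy)

/-- The vertical defect of invariance of the graph of `L`. -/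
def defect (L : X → W →L[ℝ] W') (p : X) : W →L[ℝ] W' :=
  D.b p + D.c p ∘L L p - L (D.F p) ∘L D.a p

theorem defect_apply (L : X → W →L[ℝ] W') (p : X) (v : W) :
    D.defect L p v = D.b p v + D.c p (L p v) - L (D.F p) (D.a p v) := rfl

/-- A field of graphs `L` that is invariant over the central direction, and invariant modulo
`vs`, respectively `vu`, over the stable and the unstable directions. -/
structure IsGraph (L : X → W →L[ℝ] W') : Prop where
  cont : Continuous L
  mem : ∀ p w, L p w ∈ D.vs p ⊔ D.vu p
  defect_s : ∀ p, ∀ v ∈ D.es p, D.defect L p v ∈ D.vs (D.F p)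
  defect_c : ∀ p, ∀ v ∈ D.ec p, D.defect L p v = 0
  defect_u : ∀ p, ∀ v ∈ D.eu p, D.defect L p v ∈ D.vu (D.F p)

variable {D}

theorem defect_symm {L : X → W →L[ℝ] W'} (hmem : ∀ p w, L p w ∈ D.vs p ⊔ D.vu p)
    {p : X} {v : W} (hv : v ∈ D.es p ⊔ (D.ec p ⊔ D.eu p)) :
    D.symm.defect L p v = -D.c' p (D.defect L (D.F.symm p) (D.a' p v)) := by
  have hp : D.F (D.F.symm p) = p := D.F.apply_symm_apply p
  have h1 := D.b_a' p v hv
  have h2 := D.c'_c (D.F.symm p) _ (hmem (D.F.symm p) (D.a' p v))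
  have h3 := D.c'_c (D.F.symm p) (D.b' p v) (by
    have := D.symm.b_mem' (p := p) (w := v) (by rw [← sup_swap] at hv; exact hv)
    rw [sup_comm]
    exact this)
  have h4 := D.a_a' p v hv
  rw [hp] at h2 h3
  rw [defect_apply, defect_apply, hp, h4, map_sub, map_add, eq_neg_of_add_eq_zero_left h1,
    map_neg, h3, h2]
  change D.b' p v + D.c' p (L p v) - L (D.F.symm p) (D.a' p v) = _
  abel

theorem IsGraph.symm {L : X → W →L[ℝ] W'} (h : D.IsGraph L) : D.symm.IsGraph L where
  cont := h.cont
  mem p w := by rw [sup_comm]; exact h.mem p w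
  defect_s p v hv := by
    rw [defect_symm h.mem (D.mem_of_u hv)]
    have := h.defect_u _ _ (D.a'_u p v hv)
    rw [D.F.apply_symm_apply] at this
    exact Submodule.neg_mem _ (D.c'_u p _ this)
  defect_c p v hv := by
    rw [defect_symm h.mem (D.mem_of_c hv), h.defect_c _ _ (D.a'_c p v hv), map_zero, neg_zero]
  defect_u p v hv := by
    rw [defect_symm h.mem (D.mem_of_s hv)]
    have := h.defect_s _ _ (D.a'_s p v hv)
    rw [D.F.apply_symm_apply] at this
    exact Submodule.neg_mem _ (D.c'_s p _ this)

variable (D)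
theorem disjoint_es_ec (p : X) : Disjoint (D.es p) (D.ec p) :=
  Submodule.disjoint_def.2 fun w hs hc => (D.P_s p w hs).1.symm.trans (D.P_c p w hc).1

variable [CompactSpace X] [FiniteDimensional ℝ W] [FiniteDimensional ℝ W']

theorem exists_section_u : ∃ L : X → W →L[ℝ] W', Continuous L ∧ (∀ p w, L p w ∈ D.vu p) ∧
    ∀ p, ∀ v ∈ D.es p ⊔ D.ec p, D.defect L p v ∈ D.vs (D.F p) := by
  obtain ⟨θ, hθ0, hθ1, h1, -, -, -⟩ := D.exists_uniform
  obtain ⟨θ', hθ'0, hθ'1, -, h2, -, h4⟩ := D.symm.exists_uniform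
  let nV : X → W → ℝ := fun p v => max (D.nm p (D.Ps p v)) (D.nm p (D.Pc p v))
  have hsplit : ∀ p, ∀ v ∈ D.es p ⊔ D.ec p, v = D.Ps p v + D.Pc p v ∧
      D.Ps (D.F p) (D.a p v) = D.a p (D.Ps p v) ∧ D.Pc (D.F p) (D.a p v) = D.a p (D.Pc p v) := by
    intro p v hv
    obtain ⟨x, hx, y, hy, rfl⟩ := Submodule.mem_sup.1 hv
    simp [D.P_s p x hx, D.P_c p y hy, D.P_s _ _ (D.a_s p x hx), D.P_c _ _ (D.a_c p y hy)]
  have hnVc : Continuous fun q : X × W => nV q.1 q.2 :=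
    (D.continuous_nm continuous_fst ((D.cont_Ps.comp continuous_fst).clm_apply continuous_snd)).max
    (D.continuous_nm continuous_fst ((D.cont_Pc.comp continuous_fst).clm_apply continuous_snd))
  have hnVh : ∀ p t v, nV p (t • v) = |t| * nV p v := fun p t v => by
    simp only [nV, map_smul, nm_smul, mul_max_of_nonneg _ _ (abs_nonneg t)]
  have hnh : Continuous fun q : X × W' => D.nh q.1 q.2 :=
    D.continuous_nh continuous_fst continuous_snd
  have hcl : ClosedSubspaces fun p => D.es p ⊔ D.ec p := D.closed_es.sup D.closed_ec D.disjoint_es_ec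
  obtain ⟨C₁, hC₁, hV1⟩ := exists_le_norm_of_homogeneous hnVc hnVh
  obtain ⟨C₂, hC₂, hW1⟩ := exists_le_norm_of_homogeneous hnh D.nh_smul
  obtain ⟨c₁, hc₁, hV2⟩ := exists_norm_le_of_homogeneous hnVc hnVh hcl (by
    intro p v hv hv0
    rw [lt_max_iff]
    by_contra! hcon
    have hs : D.Ps p v = 0 := by
      by_contra h
      exact absurd (D.nm_pos (D.mem_of_s (D.Ps_mem p v)) h) (not_lt.2 hcon.1)
    have hc : D.Pc p v = 0 := by
      by_contra h
      exact absurd (D.nm_pos (D.mem_of_c (D.Pc_mem p v)) h) (not_lt.2 hcon.2)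
    exact hv0 (by rw [(hsplit p v hv).1, hs, hc, add_zero]))
  obtain ⟨c₂, hc₂, hW2⟩ := exists_norm_le_of_homogeneous hnh D.nh_smul D.closed_vu
    fun p v hv hv0 => D.nh_pos (D.mem_of_vu hv) hv0
  obtain ⟨L, hLc, hLm, hL⟩ := exists_invariant_section (F := D.F) D.F.continuous
    (α := D.a) D.cont_a (β := fun p => D.c' (D.F p) ∘L D.Qu (D.F p))
    ((D.cont_c'.comp D.F.continuous).clm_comp (D.cont_Qu.comp D.F.continuous))
    (A := fun p => D.Qu (D.F p) ∘L D.b p)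
    ((D.cont_Qu.comp D.F.continuous).clm_comp D.cont_b)
    (pr := fun p => D.Ps p + D.Pc p) (D.cont_Ps.add D.cont_Pc)
    (𝒱 := fun p => D.es p ⊔ D.ec p) (𝒲 := D.vu)
    (fun p v => Submodule.add_mem_sup (D.Ps_mem p v) (D.Pc_mem p v))
    (fun p v hv => (hsplit p v hv).1.symm)
    (fun p v hv => by
      obtain ⟨x, hx, y, hy, rfl⟩ := Submodule.mem_sup.1 hv
      rw [map_add]
      exact Submodule.add_mem_sup (D.a_s p x hx) (D.a_c p y hy))
    (fun p w hw => by
      have := D.c'_u _ _ (D.Qu_mem (D.F p) w)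
      rwa [D.F.symm_apply_apply] at this)
    (fun p v hv => D.Qu_mem _ _)
    (nV := nV) (nW := D.nh) (c := min c₁ c₂) (C := max C₁ C₂) (lt_min hc₁ hc₂)
    (fun p v hv => ⟨(mul_le_mul_of_nonneg_right (min_le_left _ _) (norm_nonneg _)).trans
      (hV2 p v hv), (hV1 p v).trans (mul_le_mul_of_nonneg_right (le_max_left _ _)
        (norm_nonneg _))⟩)
    (fun p v hv => ⟨(mul_le_mul_of_nonneg_right (min_le_right _ _) (norm_nonneg _)).trans
      (hW2 p v hv), (hW1 p v).trans (mul_le_mul_of_nonneg_right (le_max_right _ _)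
        (norm_nonneg _))⟩)
    (θ := θ') hθ'0.le hθ'1 (by
      intro p v hv w hw
      have e1 := h2 (D.F p) w hw
      have e2 := h4 (D.F p) w hw (D.a p (D.Pc p v)) (D.a_c p _ (D.Pc_mem p v))
      have e3 := h1 p (D.Ps p v) (D.Ps_mem p v)
      change D.nh (D.F.symm (D.F p)) (D.c' (D.F p) w) ≤ θ' * D.nh (D.F p) w at e1
      change D.nh (D.F.symm (D.F p)) (D.c' (D.F p) w) * D.nm (D.F p) (D.a p (D.Pc p v)) ≤
        θ' * (D.nm (D.F.symm (D.F p)) (D.a' (D.F p) (D.a p (D.Pc p v))) * D.nh (D.F p) w) at e2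
      rw [D.F.symm_apply_apply] at e1 e2
      rw [D.a'_a p _ (D.mem_of_c (D.Pc_mem p v))] at e2
      have hw' : (D.c' (D.F p) ∘L D.Qu (D.F p)) w = D.c' (D.F p) w :=
        congrArg _ (D.Q_u _ w hw).2
      rw [hw']
      simp only [nV]
      rw [(hsplit p v hv).2.1, (hsplit p v hv).2.2, mul_max_of_nonneg _ _ (D.nh_nonneg _ _)]
      have hn := D.nh_nonneg (D.F p) w
      refine max_le ?_ ?_
      · calc D.nh p (D.c' (D.F p) w) * D.nm (D.F p) (D.a p (D.Ps p v))
            ≤ (θ' * D.nh (D.F p) w) * D.nm p (D.Ps p v) := by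
              refine mul_le_mul e1 (e3.trans ?_) (D.nm_nonneg _ _) (by positivity)
              exact mul_le_of_le_one_left (D.nm_nonneg _ _) hθ1.le
          _ = θ' * (D.nh (D.F p) w * D.nm p (D.Ps p v)) := mul_assoc _ _ _
          _ ≤ _ := by gcongr; exact le_max_left _ _
      · refine e2.trans ?_
        rw [mul_comm (D.nm p _)]
        gcongr
        exact le_max_right _ _)
  refine ⟨L, hLc, hLm, fun p v hv => ?_⟩
  have hv' : v ∈ D.es p ⊔ (D.ec p ⊔ D.eu p) := by
    rw [← sup_assoc]
    exact le_sup_left (a := D.es p ⊔ D.ec p) hv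
  have h := hL p v hv
  have h5 : D.Qu (D.F p) (L (D.F p) (D.a p v)) = L (D.F p) (D.a p v) := (D.Q_u _ _ (hLm _ _)).2
  have h5' : D.Qu (D.F p) (D.Qu (D.F p) (D.b p v)) = D.Qu (D.F p) (D.b p v) :=
    (D.Q_u _ _ (D.Qu_mem _ _)).2
  have h6 : L p v = D.c' (D.F p) (L (D.F p) (D.a p v) - D.Qu (D.F p) (D.b p v)) := by
    rw [h]
    change D.c' (D.F p) (D.Qu (D.F p) (L (D.F p) (D.a p v) - D.Qu (D.F p) (D.b p v))) = _
    rw [map_sub (D.Qu (D.F p)), h5, h5']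
  have h7 : D.c p (L p v) = L (D.F p) (D.a p v) - D.Qu (D.F p) (D.b p v) := by
    have := D.c_c' (D.F p) (L (D.F p) (D.a p v) - D.Qu (D.F p) (D.b p v))
      (Submodule.sub_mem _ (D.mem_of_vu (hLm _ _)) (D.mem_of_vu (D.Qu_mem _ _)))
    rw [D.F.symm_apply_apply] at this
    rw [h6, this]
  have h8 := D.b_mem p v hv'
  have : D.defect L p v = D.Qs (D.F p) (D.b p v) := by
    rw [defect_apply, h7, eq_sub_of_add_eq h8]
    abel
  rw [this]
  exact D.Qs_mem _ _

theorem exists_isGraph : ∃ L : X → W →L[ℝ] W', D.IsGraph L := by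
  obtain ⟨Lu, hu, hum, hud⟩ := D.exists_section_u
  obtain ⟨Ls, hs, hsm, hsd⟩ := D.symm.exists_section_u
  have hsm : ∀ p w, Ls p w ∈ D.vs p := hsm
  have hsm' : ∀ p w, Ls p w ∈ D.vs p ⊔ D.vu p := fun p w => D.mem_of_vs (hsm p w)
  have hsd' : ∀ p, ∀ v ∈ D.eu p ⊔ D.ec p, D.defect Ls p v ∈ D.vu (D.F p) := by
    intro p v hv
    have hv' : v ∈ D.es p ⊔ (D.ec p ⊔ D.eu p) := by
      rw [sup_comm (D.eu p)] at hv
      exact le_sup_right (a := D.es p) hv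
    have hav : D.a p v ∈ D.eu (D.F p) ⊔ D.ec (D.F p) := by
      obtain ⟨x, hx, y, hy, rfl⟩ := Submodule.mem_sup.1 hv
      rw [map_add]
      exact Submodule.add_mem_sup (D.a_u p x hx) (D.a_c p y hy)
    have h := hsd (D.F p) (D.a p v) hav
    rw [defect_symm hsm' (D.a_mem hv'), D.F.symm_apply_apply, D.a'_a p v hv'] at h
    change -_ ∈ D.vu (D.F.symm (D.F p)) at h
    rw [D.F.symm_apply_apply, Submodule.neg_mem_iff] at h
    have h9 := D.c_u p _ h
    have h10 := D.c_c' (D.F p) (D.defect Ls p v) (Submodule.sub_mem _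
      (Submodule.add_mem _ (D.b_mem' hv') (D.c_mem (hsm' _ _))) (hsm' _ _))
    rw [D.F.symm_apply_apply] at h10
    rwa [h10] at h9
  refine ⟨fun p => Lu p ∘L (D.Ps p + D.Pc p) + Ls p ∘L (D.Pc p + D.Pu p),
    (hu.clm_comp (D.cont_Ps.add D.cont_Pc)).add (hs.clm_comp (D.cont_Pc.add D.cont_Pu)),
    fun p w => Submodule.add_mem _ (D.mem_of_vu (hum _ _)) (hsm' _ _), ?_, ?_, ?_⟩
  · intro p v hv
    have h1 := D.P_s p v hv
    have h2 := D.P_s _ _ (D.a_s p v hv)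
    have h3 := hud p v (le_sup_left (a := D.es p) hv)
    rw [defect_apply] at h3 ⊢
    simpa [h1, h2] using h3
  · intro p v hv
    have h1 := D.P_c p v hv
    have h2 := D.P_c _ _ (D.a_c p v hv)
    have h3 := hud p v (le_sup_right (a := D.es p) hv)
    have h4 := hsd' p v (le_sup_right (a := D.eu p) hv)
    rw [defect_apply] at h3 h4 ⊢
    have hx : D.c p (Lu p v) - Lu (D.F p) (D.a p v) ∈ D.vu (D.F p) :=
      Submodule.sub_mem _ (D.c_u p _ (hum _ _)) (hum _ _)
    have hy : D.c p (Ls p v) - Ls (D.F p) (D.a p v) ∈ D.vs (D.F p) :=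
      Submodule.sub_mem _ (D.c_s p _ (hsm _ _)) (hsm _ _)
    have e1 := Submodule.add_mem _ h3 hy
    have e2 := Submodule.add_mem _ h4 hx
    have e : D.b p v + D.c p (Ls p v) - Ls (D.F p) (D.a p v) +
        (D.c p (Lu p v) - Lu (D.F p) (D.a p v)) = D.b p v + D.c p (Lu p v) -
        Lu (D.F p) (D.a p v) + (D.c p (Ls p v) - Ls (D.F p) (D.a p v)) := by abel
    rw [e] at e2
    refine Eq.trans ?_ (D.eq_zero_of_mem e1 e2)
    simp [h1, h2]
    abel
  · intro p v hv
    have h1 := D.P_u p v hv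
    have h2 := D.P_u _ _ (D.a_u p v hv)
    have h3 := hsd' p v (le_sup_left (a := D.eu p) hv)
    rw [defect_apply] at h3 ⊢
    simpa [h1, h2] using h3

theorem sq_add_sq_lt {A A' Z Z' θ C Λ : ℝ} (hA' : 0 ≤ A') (hZ' : 0 ≤ Z')
    (hθ0 : 0 < θ) (hθ1 : θ < 1) (h1 : A' ≤ θ * A) (h2 : Z' ≤ C * A + θ * Z)
    (hΛ : C ^ 2 < Λ * ((1 - θ) * (1 - θ ^ 2))) (hpos : 0 < A ∨ 0 < Z) :
    Λ * A' ^ 2 + Z' ^ 2 < Λ * A ^ 2 + Z ^ 2 := by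
  have hθ2 : 0 < 1 - θ := by linarith
  have hθ3 : 0 < 1 - θ ^ 2 := by nlinarith
  have hΛ0 : 0 < Λ := by
    by_contra! h
    have : 0 ≤ C ^ 2 := sq_nonneg C
    nlinarith [mul_pos hθ2 hθ3]
  have e1 : A' ^ 2 ≤ θ ^ 2 * A ^ 2 := by nlinarith
  have e2 : Z' ^ 2 ≤ (C * A + θ * Z) ^ 2 := pow_le_pow_left₀ hZ' h2 2
  have e3 : (1 - θ) * (C * A + θ * Z) ^ 2 ≤ C ^ 2 * A ^ 2 + (1 - θ) * (θ * Z ^ 2) := by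
    nlinarith [mul_nonneg hθ0.le (sq_nonneg (C * A - (1 - θ) * Z))]
  have e4 : C ^ 2 * A ^ 2 ≤ Λ * ((1 - θ) * (1 - θ ^ 2)) * A ^ 2 := by gcongr
  have e5 : (1 - θ) * (Λ * A' ^ 2 + Z' ^ 2) < (1 - θ) * (Λ * A ^ 2 + Z ^ 2) := by
    have e6 : (1 - θ) * (Λ * A' ^ 2) ≤ (1 - θ) * (Λ * (θ ^ 2 * A ^ 2)) := by gcongr
    have e7 : (1 - θ) * Z' ^ 2 ≤ (1 - θ) * (C * A + θ * Z) ^ 2 := by gcongr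
    rcases hpos with h | h
    · have e8 : C ^ 2 * A ^ 2 < Λ * ((1 - θ) * (1 - θ ^ 2)) * A ^ 2 := by gcongr
      nlinarith [mul_nonneg (mul_nonneg hθ2.le hθ2.le) (sq_nonneg Z)]
    · nlinarith [mul_pos (mul_pos hθ2 hθ2) (pow_pos h 2)]
  exact lt_of_mul_lt_mul_left e5 hθ2.le

variable {D}

theorem IsGraph.exists_estimate {L : X → W →L[ℝ] W'} (h : D.IsGraph L) :
    ∃ Λ₀ : ℝ, ∀ Λ, Λ₀ ≤ Λ → ∀ p, ∀ v ∈ D.es p, ∀ ζ ∈ D.vs p, (v ≠ 0 ∨ ζ ≠ 0) →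
      Λ * D.nm (D.F p) (D.a p v) ^ 2 + D.nh (D.F p) (D.defect L p v + D.c p ζ) ^ 2 <
          Λ * D.nm p v ^ 2 + D.nh p ζ ^ 2 ∧
        ∀ η ∈ D.ec p, η ≠ 0 →
          (Λ * D.nm (D.F p) (D.a p v) ^ 2 + D.nh (D.F p) (D.defect L p v + D.c p ζ) ^ 2) *
              D.nm p η ^ 2 <
            D.nm (D.F p) (D.a p η) ^ 2 * (Λ * D.nm p v ^ 2 + D.nh p ζ ^ 2) := by
  obtain ⟨θ, hθ0, hθ1, h1, h2, h3, h4⟩ := D.exists_uniform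
  have hdc : Continuous (D.defect L) := (D.cont_b.add (D.cont_c.clm_comp h.cont)).sub
    ((h.cont.comp D.F.continuous).clm_comp D.cont_a)
  obtain ⟨C₁, hC₁, hd⟩ := exists_le_norm_of_homogeneous
    (n := fun p v => D.nh (D.F p) (D.defect L p v))
    (D.continuous_nh (D.F.continuous.comp continuous_fst)
      ((hdc.comp continuous_fst).clm_apply continuous_snd))
    (fun p t v => by simp only [map_smul, nh_smul])
  obtain ⟨c₁, hc₁, hs⟩ := exists_norm_le_of_homogeneous
    (D.continuous_nm continuous_fst continuous_snd) D.nm_smul D.closed_es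
    (fun p v hv hv0 => D.nm_pos (D.mem_of_s hv) hv0)
  obtain ⟨C₂, hC₂, hm⟩ := exists_le_norm_of_homogeneous
    (D.continuous_nm continuous_fst continuous_snd) D.nm_smul
  obtain ⟨c₂, hc₂, ha⟩ := exists_norm_le_of_homogeneous
    (D.continuous_nm_a continuous_fst continuous_snd)
    (fun p t v => by simp only [map_smul, nm_smul]) D.closed_ec
    (fun p v hv hv0 => D.nm_pos (D.mem_of_c (D.a_c p v hv)) (by
      intro h0
      have := D.a'_a p v (D.mem_of_c hv)
      rw [h0, map_zero] at this
      exact hv0 this.symm))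
  let K : ℝ := C₁ / c₁ * max 1 (C₂ / c₂)
  have hK : 0 < K := by positivity
  have hK1 : ∀ p, ∀ v ∈ D.es p, D.nh (D.F p) (D.defect L p v) ≤ C₁ / c₁ * D.nm p v := by
    intro p v hv
    rw [div_mul_eq_mul_div, le_div_iff₀ hc₁]
    calc _ ≤ C₁ * ‖v‖ * c₁ := by gcongr; exact hd p v
      _ = C₁ * (c₁ * ‖v‖) := by ring
      _ ≤ _ := by gcongr; exact hs p v hv
  have hK2 : ∀ p, ∀ η ∈ D.ec p, D.nm p η ≤ C₂ / c₂ * D.nm (D.F p) (D.a p η) := by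
    intro p η hη
    rw [div_mul_eq_mul_div, le_div_iff₀ hc₂]
    calc _ ≤ C₂ * ‖η‖ * c₂ := by gcongr; exact hm p η
      _ = C₂ * (c₂ * ‖η‖) := by ring
      _ ≤ _ := by gcongr; exact ha p η hη
  have hθ2 : 0 < (1 - θ) * (1 - θ ^ 2) := by
    have : θ ^ 2 < 1 := by nlinarith
    exact mul_pos (by linarith) (by linarith)
  refine ⟨(K ^ 2 + 1) / ((1 - θ) * (1 - θ ^ 2)), fun Λ hΛ p v hv ζ hζ hne => ?_⟩
  have hΛ' : K ^ 2 < Λ * ((1 - θ) * (1 - θ ^ 2)) := by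
    rw [div_le_iff₀ hθ2] at hΛ
    linarith
  have hadd : D.nh (D.F p) (D.defect L p v + D.c p ζ) ≤
      D.nh (D.F p) (D.defect L p v) + D.nh (D.F p) (D.c p ζ) := D.hh_add _ _ _
  have hpos : 0 < D.nm p v ∨ 0 < D.nh p ζ := hne.imp (D.nm_pos (D.mem_of_s hv))
    (D.nh_pos (D.mem_of_vs hζ))
  have n1 := D.nm_nonneg p v
  refine ⟨sq_add_sq_lt (D.nm_nonneg _ _) (D.nh_nonneg _ _) hθ0 hθ1 (h1 p v hv) ?_ hΛ' hpos, fun η hη hη0 => ?_⟩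
  · refine hadd.trans (add_le_add ((hK1 p v hv).trans ?_) (h2 p ζ hζ))
    gcongr
    exact le_mul_of_one_le_right (by positivity) (le_max_left _ _)
  have hη1 : 0 < D.nm p η := D.nm_pos (D.mem_of_c hη) hη0
  have hη2 : 0 < D.nm (D.F p) (D.a p η) :=
    lt_of_lt_of_le (by have := norm_pos_iff.2 hη0; positivity) (ha p η hη)
  have key := sq_add_sq_lt (A := D.nm (D.F p) (D.a p η) * D.nm p v)
    (A' := D.nm (D.F p) (D.a p v) * D.nm p η) (Z := D.nm (D.F p) (D.a p η) * D.nh p ζ)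
    (Z' := D.nh (D.F p) (D.defect L p v + D.c p ζ) * D.nm p η)
    (mul_nonneg (D.nm_nonneg _ _) hη1.le) (mul_nonneg (D.nh_nonneg _ _) hη1.le) hθ0 hθ1
    (h3 p v hv η hη) ?_ hΛ' (hpos.imp (mul_pos hη2) (mul_pos hη2))
  · linarith [key]
  · calc _ ≤ (D.nh (D.F p) (D.defect L p v) + D.nh (D.F p) (D.c p ζ)) * D.nm p η := by gcongr
      _ = D.nh (D.F p) (D.defect L p v) * D.nm p η + D.nh (D.F p) (D.c p ζ) * D.nm p η := by ring
      _ ≤ C₁ / c₁ * D.nm p v * (max 1 (C₂ / c₂) * D.nm (D.F p) (D.a p η)) +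
          θ * (D.nm (D.F p) (D.a p η) * D.nh p ζ) := by
        refine add_le_add (mul_le_mul (hK1 p v hv) ((hK2 p η hη).trans ?_) hη1.le (by positivity))
          (h4 p ζ hζ η hη)
        gcongr
        exact le_max_right _ _
      _ = _ := by simp only [K]; ring

end LinExt
end PHCocycle

namespace PHCocycle
namespace LinExt

section Vert

variable {X W W' : Type*} [NormedAddCommGroup W] [NormedSpace ℝ W] [NormedAddCommGroup W']
  [NormedSpace ℝ W'] (L : X → W →L[ℝ] W')

/-- The vertical component of a vector relative to the graph. -/
def vert (p : X) : W × W' →L[ℝ] W' :=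
  ContinuousLinearMap.snd ℝ W W' - L p ∘L ContinuousLinearMap.fst ℝ W W'

theorem vert_apply (p : X) (ξ : W × W') : vert L p ξ = ξ.2 - L p ξ.1 := rfl

variable {L}

theorem vert_mk (p : X) (w : W) (ζ : W') : vert L p (w, L p w + ζ) = ζ := by
  rw [vert_apply]; exact add_sub_cancel_left _ _

theorem eq_zero_of_fst_vert {p : X} {ξ : W × W'} (h1 : ξ.1 = 0) (h2 : vert L p ξ = 0) : ξ = 0 := by
  refine Prod.ext h1 ?_
  rwa [vert_apply, h1, map_zero, sub_zero] at h2

end Vert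

variable {X W W' : Type*} [TopologicalSpace X] [NormedAddCommGroup W] [NormedSpace ℝ W]
    [NormedAddCommGroup W'] [NormedSpace ℝ W'] (D : LinExt X W W')

/-- The triangular cocycle. -/
def coc (p : X) (ξ : W × W') : W × W' := (D.a p ξ.1, D.b p ξ.1 + D.c p ξ.2)

/-- All tangent vectors. -/
def tot (p : X) : Submodule ℝ (W × W') := (D.es p ⊔ (D.ec p ⊔ D.eu p)).prod (D.vs p ⊔ D.vu p)

variable (L : X → W →L[ℝ] W')

/-- The stable subspaces of the extension. -/
def gs (p : X) : Submodule ℝ (W × W') :=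
  (D.es p).comap (LinearMap.fst ℝ W W') ⊓ (D.vs p).comap (vert L p).toLinearMap

/-- The central subspaces of the extension. -/
def gc (p : X) : Submodule ℝ (W × W') :=
  (D.ec p).comap (LinearMap.fst ℝ W W') ⊓ LinearMap.ker (vert L p).toLinearMap

/-- The unstable subspaces of the extension. -/
def gu (p : X) : Submodule ℝ (W × W') :=
  (D.eu p).comap (LinearMap.fst ℝ W W') ⊓ (D.vu p).comap (vert L p).toLinearMap

variable {L}

theorem mem_gs {p : X} {ξ : W × W'} : ξ ∈ D.gs L p ↔ ξ.1 ∈ D.es p ∧ vert L p ξ ∈ D.vs p := Iff.rfl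

theorem mem_gc {p : X} {ξ : W × W'} : ξ ∈ D.gc L p ↔ ξ.1 ∈ D.ec p ∧ vert L p ξ = 0 := Iff.rfl

theorem mem_gu {p : X} {ξ : W × W'} : ξ ∈ D.gu L p ↔ ξ.1 ∈ D.eu p ∧ vert L p ξ ∈ D.vu p := Iff.rfl

theorem mem_tot {p : X} {ξ : W × W'} :
    ξ ∈ D.tot p ↔ ξ.1 ∈ D.es p ⊔ (D.ec p ⊔ D.eu p) ∧ ξ.2 ∈ D.vs p ⊔ D.vu p := Iff.rfl

theorem vert_coc (L : X → W →L[ℝ] W') (p : X) (ξ : W × W') :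
    vert L (D.F p) (D.coc p ξ) = D.defect L p ξ.1 + D.c p (vert L p ξ) := by
  rw [vert_apply, vert_apply, defect_apply, map_sub, coc]
  dsimp only
  abel

variable {D}

theorem IsGraph.vert_mem (h : D.IsGraph L) {p : X} {ξ : W × W'} (hξ : ξ ∈ D.tot p) :
    vert L p ξ ∈ D.vs p ⊔ D.vu p := Submodule.sub_mem _ hξ.2 (h.mem _ _)

theorem IsGraph.mem_tot_of (h : D.IsGraph L) {p : X} {ξ : W × W'}
    (h1 : ξ.1 ∈ D.es p ⊔ (D.ec p ⊔ D.eu p)) (h2 : vert L p ξ ∈ D.vs p ⊔ D.vu p) : ξ ∈ D.tot p := by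
  refine ⟨h1, ?_⟩
  have := Submodule.add_mem _ h2 (h.mem p ξ.1)
  rwa [vert_apply, sub_add_cancel] at this

theorem IsGraph.coc_gs (h : D.IsGraph L) {p : X} {ξ : W × W'} (hξ : ξ ∈ D.gs L p) :
    D.coc p ξ ∈ D.gs L (D.F p) := by
  rw [mem_gs] at hξ ⊢
  rw [vert_coc]
  exact ⟨D.a_s _ _ hξ.1, Submodule.add_mem _ (h.defect_s _ _ hξ.1) (D.c_s _ _ hξ.2)⟩

theorem IsGraph.coc_gc (h : D.IsGraph L) {p : X} {ξ : W × W'} (hξ : ξ ∈ D.gc L p) :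
    D.coc p ξ ∈ D.gc L (D.F p) := by
  rw [mem_gc] at hξ ⊢
  rw [vert_coc, h.defect_c _ _ hξ.1, hξ.2, map_zero, add_zero]
  exact ⟨D.a_c _ _ hξ.1, rfl⟩

theorem IsGraph.coc_gu (h : D.IsGraph L) {p : X} {ξ : W × W'} (hξ : ξ ∈ D.gu L p) :
    D.coc p ξ ∈ D.gu L (D.F p) := by
  rw [mem_gu] at hξ ⊢
  rw [vert_coc]
  exact ⟨D.a_u _ _ hξ.1, Submodule.add_mem _ (h.defect_u _ _ hξ.1) (D.c_u _ _ hξ.2)⟩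

theorem IsGraph.gs_le (h : D.IsGraph L) (p : X) : D.gs L p ≤ D.tot p := fun _ hξ =>
  h.mem_tot_of (D.mem_of_s hξ.1) (D.mem_of_vs hξ.2)

theorem IsGraph.gc_le (h : D.IsGraph L) (p : X) : D.gc L p ≤ D.tot p := fun ξ hξ =>
  h.mem_tot_of (D.mem_of_c hξ.1) (by rw [(D.mem_gc.1 hξ).2]; exact Submodule.zero_mem _)

theorem IsGraph.gu_le (h : D.IsGraph L) (p : X) : D.gu L p ≤ D.tot p := fun _ hξ =>
  h.mem_tot_of (D.mem_of_u hξ.1) (D.mem_of_vu hξ.2)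

theorem IsGraph.sup_eq (h : D.IsGraph L) (p : X) :
    D.gs L p ⊔ (D.gc L p ⊔ D.gu L p) = D.tot p := by
  refine le_antisymm (sup_le (h.gs_le p) (sup_le (h.gc_le p) (h.gu_le p))) fun ξ hξ => ?_
  have h1 := D.eq_add_of_mem hξ.1
  have h2 := D.eq_add_of_mem' (h.vert_mem hξ)
  have : ξ = (D.Ps p ξ.1, L p (D.Ps p ξ.1) + D.Qs p (vert L p ξ)) +
      ((D.Pc p ξ.1, L p (D.Pc p ξ.1) + 0) +
      (D.Pu p ξ.1, L p (D.Pu p ξ.1) + D.Qu p (vert L p ξ))) := by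
    refine Prod.ext h1 ?_
    have h3 : ξ.2 = L p ξ.1 + vert L p ξ := by rw [vert_apply]; abel
    have h4 := congrArg (L p) h1
    rw [map_add, map_add] at h4
    refine h3.trans ?_
    rw [h4]
    nth_rewrite 1 [h2]
    change _ = L p (D.Ps p ξ.1) + D.Qs p (vert L p ξ) + (L p (D.Pc p ξ.1) + 0 +
      (L p (D.Pu p ξ.1) + D.Qu p (vert L p ξ)))
    abel
  rw [this]
  exact Submodule.add_mem_sup (D.mem_gs.2 ⟨D.Ps_mem _ _, by rw [vert_mk]; exact D.Qs_mem _ _⟩)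
    (Submodule.add_mem_sup (D.mem_gc.2 ⟨D.Pc_mem _ _, vert_mk _ _ _⟩)
      (D.mem_gu.2 ⟨D.Pu_mem _ _, by rw [vert_mk]; exact D.Qu_mem _ _⟩))

variable (D)

theorem disjoint_gc_gu (p : X) : Disjoint (D.gc L p) (D.gu L p) :=
  Submodule.disjoint_def.2 fun _ hc hu => eq_zero_of_fst_vert
    ((D.P_c p _ hc.1).2.1.symm.trans (D.P_u p _ hu.1).2.1) (D.mem_gc.1 hc).2

theorem disjoint_gs (p : X) : Disjoint (D.gs L p) (D.gc L p ⊔ D.gu L p) := by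
  refine Submodule.disjoint_def.2 fun ξ hs hcu => ?_
  obtain ⟨x, hx, y, hy, rfl⟩ := Submodule.mem_sup.1 hcu
  refine eq_zero_of_fst_vert (L := L) (p := p) ((D.P_s p _ hs.1).1.symm.trans ?_) ?_
  · change D.Ps p (x.1 + y.1) = 0
    rw [map_add, (D.P_c p _ (D.mem_gc.1 hx).1).1, (D.P_u p _ (D.mem_gu.1 hy).1).1, add_zero]
  · refine D.eq_zero_of_mem (D.mem_gs.1 hs).2 ?_
    change vert L p (x + y) ∈ D.vu p
    rw [map_add, (D.mem_gc.1 hx).2, zero_add]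
    exact (D.mem_gu.1 hy).2

/-- The adapted inner product. -/
noncomputable def gform (L : X → W →L[ℝ] W') (Λ : ℝ) (p : X) :
    W × W' →L[ℝ] W × W' →L[ℝ] ℝ :=
  (D.mm p).bilinearComp (D.Pc p ∘L ContinuousLinearMap.fst ℝ W W')
      (D.Pc p ∘L ContinuousLinearMap.fst ℝ W W') +
    Λ • ((D.mm p).bilinearComp (D.Ps p ∘L ContinuousLinearMap.fst ℝ W W')
      (D.Ps p ∘L ContinuousLinearMap.fst ℝ W W') +
    (D.mm p).bilinearComp (D.Pu p ∘L ContinuousLinearMap.fst ℝ W W')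
      (D.Pu p ∘L ContinuousLinearMap.fst ℝ W W')) +
    ((D.hh p).bilinearComp (D.Qs p ∘L vert L p) (D.Qs p ∘L vert L p) +
    (D.hh p).bilinearComp (D.Qu p ∘L vert L p) (D.Qu p ∘L vert L p))

theorem gform_apply (L : X → W →L[ℝ] W') (Λ : ℝ) (p : X) (ξ ξ' : W × W') :
    D.gform L Λ p ξ ξ' = D.mm p (D.Pc p ξ.1) (D.Pc p ξ'.1) +
      Λ * (D.mm p (D.Ps p ξ.1) (D.Ps p ξ'.1) + D.mm p (D.Pu p ξ.1) (D.Pu p ξ'.1)) +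
      (D.hh p (D.Qs p (vert L p ξ)) (D.Qs p (vert L p ξ')) +
        D.hh p (D.Qu p (vert L p ξ)) (D.Qu p (vert L p ξ'))) := rfl

theorem gform_symm (L : X → W →L[ℝ] W') (Λ : ℝ) (p : X) (ξ ξ' : W × W') :
    D.gform L Λ p ξ ξ' = D.gform L Λ p ξ' ξ := by
  simp only [gform_apply, D.mm_symm p (D.Pc p ξ.1), D.mm_symm p (D.Ps p ξ.1),
    D.mm_symm p (D.Pu p ξ.1), D.hh_symm p (D.Qs p (vert L p ξ)), D.hh_symm p (D.Qu p (vert L p ξ))]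

theorem sq_nm {p : X} {w : W} (hw : w ∈ D.es p ⊔ (D.ec p ⊔ D.eu p)) :
    D.nm p w ^ 2 = D.mm p w w := by
  refine Real.sq_sqrt ?_
  rcases eq_or_ne w 0 with rfl | h
  · simp
  · exact (D.mm_pos p w hw h).le

theorem sq_nh (p : X) (w : W') : D.nh p w ^ 2 = D.hh p w w := Real.sq_sqrt (D.hh_nonneg _ _)

theorem gform_gs (Λ : ℝ) {p : X} {ξ : W × W'} (hξ : ξ ∈ D.gs L p) :
    D.gform L Λ p ξ ξ = Λ * D.nm p ξ.1 ^ 2 + D.nh p (vert L p ξ) ^ 2 := by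
  have hξ := D.mem_gs.1 hξ
  have h1 := D.P_s p _ hξ.1
  have h2 := D.Q_s p _ hξ.2
  rw [gform_apply, h1.1, h1.2.1, h1.2.2, D.sq_nm (D.mem_of_s hξ.1), D.sq_nh]
  rw [h2.1, h2.2]
  simp

theorem gform_gc (Λ : ℝ) {p : X} {ξ : W × W'} (hξ : ξ ∈ D.gc L p) :
    D.gform L Λ p ξ ξ = D.nm p ξ.1 ^ 2 := by
  have hξ := D.mem_gc.1 hξ
  have h1 := D.P_c p _ hξ.1
  rw [gform_apply, h1.1, h1.2.1, h1.2.2, D.sq_nm (D.mem_of_c hξ.1), hξ.2]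
  simp

theorem continuous_gform (hL : Continuous L) (Λ : ℝ) [FiniteDimensional ℝ W]
    [FiniteDimensional ℝ W'] : Continuous (D.gform L Λ) := by
  have hv : ∀ ξ, Continuous fun p => vert L p ξ := fun ξ =>
    continuous_const.sub (hL.clm_apply continuous_const)
  refine continuous_clm_apply.2 fun ξ => continuous_clm_apply.2 fun ξ' => ?_
  simp only [gform_apply]
  have key : ∀ {P : X → W →L[ℝ] W}, Continuous P →
      Continuous fun p => D.mm p (P p ξ.1) (P p ξ'.1) := fun hP =>
    (D.cont_mm.clm_apply (hP.clm_apply continuous_const)).clm_apply (hP.clm_apply continuous_const)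
  have key' : ∀ {Q : X → W' →L[ℝ] W'}, Continuous Q →
      Continuous fun p => D.hh p (Q p (vert L p ξ)) (Q p (vert L p ξ')) := fun hQ =>
    (D.cont_hh.clm_apply (hQ.clm_apply (hv ξ))).clm_apply (hQ.clm_apply (hv ξ'))
  exact ((key D.cont_Pc).add (continuous_const.mul ((key D.cont_Ps).add (key D.cont_Pu)))).add
    ((key' D.cont_Qs).add (key' D.cont_Qu))

variable {D}

theorem IsGraph.gform_pos (h : D.IsGraph L) {Λ : ℝ} (hΛ : 0 < Λ) {p : X} {ξ : W × W'}
    (hξ : ξ ∈ D.tot p) (h0 : ξ ≠ 0) : 0 < D.gform L Λ p ξ ξ := by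
  have h1 := D.eq_add_of_mem hξ.1
  have h2 := D.eq_add_of_mem' (h.vert_mem hξ)
  have hs := D.mem_of_s (D.Ps_mem p ξ.1)
  have hc := D.mem_of_c (D.Pc_mem p ξ.1)
  have hu := D.mem_of_u (D.Pu_mem p ξ.1)
  rw [gform_apply, ← D.sq_nm hs, ← D.sq_nm hc, ← D.sq_nm hu, ← D.sq_nh, ← D.sq_nh]
  by_contra! hle
  have z : ∀ x y z w v : ℝ, x ^ 2 + Λ * (y ^ 2 + z ^ 2) + (w ^ 2 + v ^ 2) ≤ 0 →
      x = 0 ∧ y = 0 ∧ z = 0 ∧ w = 0 ∧ v = 0 := by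
    intro x y z w v hxy
    have e1 := mul_nonneg hΛ.le (sq_nonneg y)
    have e2 := mul_nonneg hΛ.le (sq_nonneg z)
    have e3 := sq_nonneg x
    have e4 := sq_nonneg w
    have e5 := sq_nonneg v
    have f1 : Λ * y ^ 2 = 0 := by linarith
    have f2 : Λ * z ^ 2 = 0 := by linarith
    refine ⟨pow_eq_zero_iff two_ne_zero |>.1 (by linarith),
      pow_eq_zero_iff two_ne_zero |>.1 ((mul_eq_zero.1 f1).resolve_left hΛ.ne'),
      pow_eq_zero_iff two_ne_zero |>.1 ((mul_eq_zero.1 f2).resolve_left hΛ.ne'),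
      pow_eq_zero_iff two_ne_zero |>.1 (by linarith),
      pow_eq_zero_iff two_ne_zero |>.1 (by linarith)⟩
  obtain ⟨z1, z2, z3, z4, z5⟩ := z _ _ _ _ _ hle
  have nz : ∀ {w : W}, w ∈ D.es p ⊔ (D.ec p ⊔ D.eu p) → D.nm p w = 0 → w = 0 := fun hw hn => by
    by_contra hne
    exact (D.nm_pos hw hne).ne' hn
  have nz' : ∀ {w : W'}, w ∈ D.vs p ⊔ D.vu p → D.nh p w = 0 → w = 0 := fun hw hn => by
    by_contra hne
    exact (D.nh_pos hw hne).ne' hn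
  rw [nz hs z2, nz hc z1, nz hu z3] at h1
  rw [nz' (D.mem_of_vs (D.Qs_mem _ _)) z4, nz' (D.mem_of_vu (D.Qu_mem _ _)) z5] at h2
  exact h0 (eq_zero_of_fst_vert (by simpa using h1) (by simpa using h2))

theorem symm_coc {p : X} {ξ : W × W'} (hξ : ξ ∈ D.tot p) :
    D.symm.coc (D.F p) (D.coc p ξ) = ξ := by
  refine Prod.ext (D.a'_a p _ hξ.1) ?_
  change D.b' (D.F p) (D.a p ξ.1) + D.c' (D.F p) (D.b p ξ.1 + D.c p ξ.2) = ξ.2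
  rw [map_add, D.c'_c p _ hξ.2, ← add_assoc, D.b'_a p _ hξ.1, zero_add]

variable (D) in
theorem closed_gs (hL : Continuous L) : ClosedSubspaces (D.gs L) := by
  have h1 : IsClosed {q : X × W × W' | q.2.1 ∈ D.es q.1} :=
    D.closed_es.preimage (f := fun q : X × W × W' => (q.1, q.2.1)) (by fun_prop)
  have h2 : IsClosed {q : X × W × W' | vert L q.1 q.2 ∈ D.vs q.1} :=
    D.closed_vs.preimage (f := fun q : X × W × W' => (q.1, vert L q.1 q.2))
      (continuous_fst.prodMk ((continuous_snd.comp continuous_snd).sub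
        ((hL.comp continuous_fst).clm_apply (continuous_fst.comp continuous_snd))))
  exact h1.inter h2

variable (D) in
theorem closed_gc (hL : Continuous L) : ClosedSubspaces (D.gc L) := by
  have h1 : IsClosed {q : X × W × W' | q.2.1 ∈ D.ec q.1} :=
    D.closed_ec.preimage (f := fun q : X × W × W' => (q.1, q.2.1)) (by fun_prop)
  have h2 : IsClosed {q : X × W × W' | vert L q.1 q.2 = 0} :=
    isClosed_eq ((continuous_snd.comp continuous_snd).sub
        ((hL.comp continuous_fst).clm_apply (continuous_fst.comp continuous_snd))) continuous_const
  exact h1.inter h2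

theorem gform_symm_ext (Λ : ℝ) (p : X) (ξ : W × W') :
    D.symm.gform L Λ p ξ ξ = D.gform L Λ p ξ ξ := by
  rw [gform_apply, gform_apply, add_comm (D.mm p (D.Ps p ξ.1) _),
    add_comm (D.hh p (D.Qs p (vert L p ξ)) _)]
  rfl

variable [CompactSpace X] [FiniteDimensional ℝ W] [FiniteDimensional ℝ W']

theorem IsGraph.exists_gform_lt (h : D.IsGraph L) : ∃ Λ₀ : ℝ, ∀ Λ, Λ₀ ≤ Λ → ∀ p, ∀ ξ ∈ D.gs L p,
    ξ ≠ 0 → D.gform L Λ (D.F p) (D.coc p ξ) (D.coc p ξ) < D.gform L Λ p ξ ξ ∧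
    ∀ η ∈ D.gc L p, η ≠ 0 →
      D.gform L Λ (D.F p) (D.coc p ξ) (D.coc p ξ) * D.gform L Λ p η η <
        D.gform L Λ (D.F p) (D.coc p η) (D.coc p η) * D.gform L Λ p ξ ξ := by
  obtain ⟨Λ₀, hΛ⟩ := h.exists_estimate
  refine ⟨Λ₀, fun Λ hle p ξ hξ hξ0 => ?_⟩
  have hne : ξ.1 ≠ 0 ∨ vert L p ξ ≠ 0 := by
    by_contra! hc
    exact hξ0 (eq_zero_of_fst_vert hc.1 hc.2)
  obtain ⟨h1, h2⟩ := hΛ Λ hle p ξ.1 hξ.1 _ hξ.2 hne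
  rw [gform_gs _ _ hξ, gform_gs _ _ (h.coc_gs hξ), vert_coc]
  refine ⟨h1, fun η hη hη0 => ?_⟩
  rw [gform_gc _ _ hη, gform_gc _ _ (h.coc_gc hη)]
  exact h2 η.1 hη.1 fun h0 => hη0 (eq_zero_of_fst_vert h0 (D.mem_gc.1 hη).2)

theorem IsGraph.exists_gform_gt (h : D.IsGraph L) : ∃ Λ₀ : ℝ, ∀ Λ, Λ₀ ≤ Λ → ∀ p, ∀ ξ ∈ D.gu L p,
    ξ ≠ 0 → D.gform L Λ p ξ ξ < D.gform L Λ (D.F p) (D.coc p ξ) (D.coc p ξ) ∧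
    ∀ η ∈ D.gc L p, η ≠ 0 →
      D.gform L Λ (D.F p) (D.coc p η) (D.coc p η) * D.gform L Λ p ξ ξ <
        D.gform L Λ (D.F p) (D.coc p ξ) (D.coc p ξ) * D.gform L Λ p η η := by
  obtain ⟨Λ₀, hΛ⟩ := h.symm.exists_gform_lt
  refine ⟨Λ₀, fun Λ hle p ξ hξ hξ0 => ?_⟩
  have e1 : D.symm.F (D.F p) = p := D.F.symm_apply_apply p
  have n0 : ∀ {ξ : W × W'}, ξ ∈ D.tot p → ξ ≠ 0 → D.coc p ξ ≠ 0 := by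
    intro ξ hξ h0 hz
    have := symm_coc hξ
    rw [hz] at this
    refine h0 (this.symm.trans ?_)
    simp [coc]
  obtain ⟨h1, h2⟩ := hΛ Λ hle (D.F p) (D.coc p ξ) (h.coc_gu hξ) (n0 (h.gu_le p hξ) hξ0)
  rw [e1, symm_coc (h.gu_le p hξ), gform_symm_ext, gform_symm_ext] at h1
  refine ⟨h1, fun η hη hη0 => ?_⟩
  have h3 := h2 (D.coc p η) (h.coc_gc hη) (n0 (h.gc_le p hη) hη0)
  rw [e1, symm_coc (h.gu_le p hξ), symm_coc (h.gc_le p hη)] at h3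
  simp only [gform_symm_ext] at h3
  linarith

end LinExt
end PHCocycle

namespace PHCocycle

section Lift

variable {E : Type*} [NormedAddCommGroup E] [NormedSpace ℝ E]
  {H : Type*} [TopologicalSpace H] {I : ModelWithCorners ℝ E H}
  {X : Type*} [TopologicalSpace X] [ChartedSpace H X] [IsManifold I 1 X]
  {W : Type*} [NormedAddCommGroup W] [NormedSpace ℝ W]
  {V : Type*} [NormedAddCommGroup V] [NormedSpace ℝ V]

namespace Framing

theorem mfderiv_symm_apply {X : Type*} [TopologicalSpace X] [ChartedSpace H X] (f : X ≃ₘ^1⟮I, I⟯ X) (p : X) (v : TangentSpace I p) :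
    HEq (mfderiv I I f.symm (f p) (mfderiv I I f p v)) v := by
  have h := mfderiv_comp p (f.symm.contMDiff.mdifferentiableAt one_ne_zero (x := f p))
    (f.contMDiff.mdifferentiableAt one_ne_zero (x := p))
  have h2 : (f.symm ∘ f : X → X) = id := funext f.symm_apply_apply
  rw [h2, mfderiv_id] at h
  exact heq_of_eq (congrArg (fun A : E →L[ℝ] E => A v) h).symm

variable (Φ : Framing I X W)

/-- The differential of a self-map, read in the framing. -/
noncomputable def lift (f : X → X) (p : X) : W →L[ℝ] W := Φ.hat (Φ.ι ∘ f) p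

theorem lift_d {f : X → X} {p : X} (hf : MDifferentiableAt I I f p) (v : TangentSpace I p) :
    Φ.lift f p (Φ.d p v) = Φ.d (f p) (mfderiv I I f p v) := by
  rw [lift, hat_d]
  exact congrArg (fun A : TangentSpace I p →L[ℝ] W => A v)
    (mfderiv_comp p (Φ.contMDiff.mdifferentiableAt one_ne_zero) hf)

theorem continuous_lift [FiniteDimensional ℝ W] {f : X → X} (hf : ContMDiff I I 1 f) :
    Continuous (Φ.lift f) := Φ.continuous_hat (Φ.contMDiff.comp hf)

theorem map_lift {f : X → X} {p : X} (hf : MDifferentiableAt I I f p)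
    {D : ∀ x : X, Submodule ℝ (TangentSpace I x)}
    (hD : (D p).map (mfderiv I I f p).toLinearMap = D (f p)) :
    (Φ.img D p).map (Φ.lift f p).toLinearMap = Φ.img D (f p) := by
  rw [img, img, ← hD, ← Submodule.map_comp, ← Submodule.map_comp]
  congr 1
  ext v
  exact Φ.lift_d hf v

theorem lift_symm_lift (f : X ≃ₘ^1⟮I, I⟯ X) (p : X) {w : W} (hw : w ∈ Φ.img (fun _ => ⊤) p) :
    Φ.lift f.symm (f p) (Φ.lift f p w) = w := by
  obtain ⟨v, -, rfl⟩ := hw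
  have h1 := Φ.lift_d (f.contMDiff.mdifferentiableAt one_ne_zero (x := p)) v
  have h2 := Φ.lift_d (f.symm.contMDiff.mdifferentiableAt one_ne_zero (x := f p))
    (mfderiv I I f p v)
  refine (congrArg _ h1).trans (h2.trans ?_)
  have h3 := mfderiv_symm_apply f p v
  have key : ∀ (q : X) (u : TangentSpace I q), q = p → HEq u v → Φ.d q u = Φ.d p v := by
    rintro q u rfl h
    rw [eq_of_heq h]
  exact key _ _ (f.symm_apply_apply p) h3

/-- A metric, read in the framing. -/
noncomputable def form (m : Metric I X) (p : X) : W →L[ℝ] W →L[ℝ] ℝ :=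
  (Φ.ρ p).precomp ℝ ∘L (m.inner p ∘L Φ.ρ p)

theorem sqrt_form (m : Metric I X) (p : X) (w : W) :
    √(Φ.form m p w w) = m.len (Φ.ρ p w) := rfl

theorem continuous_form [FiniteDimensional ℝ W] (m : Metric I X) : Continuous (Φ.form m) := by
  refine continuous_clm_apply.2 fun v => continuous_clm_apply.2 fun w => ?_
  exact m.continuous_inner (b := fun p => p)
    (Φ.cont.comp (f := fun p : X => (p, v)) (by fun_prop))
    (Φ.cont.comp (f := fun p : X => (p, w)) (by fun_prop))

theorem img_sup (D D' : ∀ x : X, Submodule ℝ (TangentSpace I x)) (p : X) :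
    Φ.img (fun x => D x ⊔ D' x) p = Φ.img D p ⊔ Φ.img D' p := Submodule.map_sup _ _ _

theorem disjoint_img {D D' : ∀ x : X, Submodule ℝ (TangentSpace I x)} {p : X}
    (h : Disjoint (D p) (D' p)) : Disjoint (Φ.img D p) (Φ.img D' p) :=
  (Submodule.disjoint_map (Φ.d_injective p) h)

theorem proj_mem_img_top (p : X) (w : W) : Φ.proj p w ∈ Φ.img (fun _ => ⊤) p :=
  ⟨Φ.ρ p w, trivial, rfl⟩

theorem proj_eq {p : X} {w : W} (hw : w ∈ Φ.img (fun _ => ⊤) p) : Φ.proj p w = w :=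
  (Φ.mem_img_iff.1 hw).2

theorem img_mono {D D' : ∀ x : X, Submodule ℝ (TangentSpace I x)} {p : X} (h : D p ≤ D' p) :
    Φ.img D p ≤ Φ.img D' p := Submodule.map_mono h

theorem ρ_ne_zero {p : X} {w : W} (hw : w ∈ Φ.img (fun _ => ⊤) p) (h : w ≠ 0) : Φ.ρ p w ≠ 0 := by
  intro h0
  have := Φ.proj_eq hw
  rw [proj, ContinuousLinearMap.comp_apply, h0, map_zero] at this
  exact h this.symm

end Framing

end Lift

section Skew

variable {E : Type*} [NormedAddCommGroup E] [NormedSpace ℝ E]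
  {H : Type*} [TopologicalSpace H] {I : ModelWithCorners ℝ E H}
  {M : Type*} [TopologicalSpace M] [ChartedSpace H M] [IsManifold I 1 M]
  {F : Type*} [NormedAddCommGroup F] [NormedSpace ℝ F]
  {H' : Type*} [TopologicalSpace H'] {J : ModelWithCorners ℝ F H'}
  {N : Type*} [TopologicalSpace N] [ChartedSpace H' N] [IsManifold J 1 N]
  {W : Type*} [NormedAddCommGroup W] [NormedSpace ℝ W]
  {W' : Type*} [NormedAddCommGroup W'] [NormedSpace ℝ W']
  (Φ : Framing I M W) (Ψ : Framing J N W')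

/-- The differential of the vertical component of a map of the product, read in the framing. -/
noncomputable def fibreHat (ft : M × N → M × N) (p : M × N) : W × W' →L[ℝ] W' :=
  (Φ.prod Ψ).hat (fun q => Ψ.ι (ft q).2) p

theorem continuous_fibreHat [FiniteDimensional ℝ W] [FiniteDimensional ℝ W'] {ft : M × N → M × N}
    (hft : ContMDiff (I.prod J) (I.prod J) 1 ft) : Continuous (fibreHat Φ Ψ ft) :=
  (Φ.prod Ψ).continuous_hat (Ψ.contMDiff.comp (contMDiff_snd.comp hft))

theorem lift_prod {ft : M × N → M × N} (hft : ContMDiff (I.prod J) (I.prod J) 1 ft)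
    {f : M → M} (hf : ContMDiff I I 1 f) (h : ∀ p, (ft p).1 = f p.1) (p : M × N) (ξ : W × W') :
    (Φ.prod Ψ).lift ft p ξ = (Φ.lift f p.1 ξ.1, fibreHat Φ Ψ ft p ξ) := by
  have h1 : MDifferentiableAt (I.prod J) 𝓘(ℝ, W) (fun q : M × N => Φ.ι (ft q).1) p :=
    (Φ.contMDiff.comp (contMDiff_fst.comp hft)).mdifferentiableAt one_ne_zero
  have h2 : MDifferentiableAt (I.prod J) 𝓘(ℝ, W') (fun q : M × N => Ψ.ι (ft q).2) p :=
    (Ψ.contMDiff.comp (contMDiff_snd.comp hft)).mdifferentiableAt one_ne_zero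
  refine (vderiv_prodMk h1 h2 ((Φ.prod Ψ).ρ p ξ)).trans (Prod.ext ?_ rfl)
  refine (vderiv_tpair (L := Φ.ι ∘ f) (funext fun q => congrArg Φ.ι (h q))
    ((Φ.contMDiff.comp hf).mdifferentiableAt one_ne_zero) _).trans ?_
  rw [Framing.prod_ρ, horizontalProj_tpair]
  rfl

theorem prod_d_vertical (x : M) (y : N) (w : TangentSpace J y) :
    (Φ.prod Ψ).d (x, y) (vertical (I := I) x y w) = (0, Ψ.d y w) := by
  rw [vertical_eq_tpair, Framing.prod_d, horizontalProj_tpair, verticalProj_tpair, map_zero]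

theorem fibreHat_inr {ft : M × N → M × N} (hft : ContMDiff (I.prod J) (I.prod J) 1 ft)
    {x : M} {g : N → N} (hg : ContMDiff J J 1 g) (h : ∀ y, (ft (x, y)).2 = g y) (y : N)
    (w : TangentSpace J y) :
    fibreHat Φ Ψ ft (x, y) (0, Ψ.d y w) = Ψ.d (g y) (mfderiv J J g y w) := by
  rw [fibreHat, ← prod_d_vertical Φ Ψ x y w, Framing.hat_d]
  have h1 := mfderiv_comp (I := J) (I' := I.prod J) (I'' := 𝓘(ℝ, W')) y
    (g := fun q : M × N => Ψ.ι (ft q).2) (f := fun y' : N => (x, y'))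
    ((Ψ.contMDiff.comp (contMDiff_snd.comp hft)).mdifferentiableAt one_ne_zero)
    ((contMDiff_const.prodMk contMDiff_id).mdifferentiableAt one_ne_zero)
  have h2 : (fun q : M × N => Ψ.ι (ft q).2) ∘ (fun y' : N => (x, y')) = Ψ.ι ∘ g :=
    funext fun y => congrArg Ψ.ι (h y)
  rw [h2] at h1
  refine (congrArg (fun A : TangentSpace J y →L[ℝ] W' => A w) h1).symm.trans ?_
  exact congrArg (fun A : TangentSpace J y →L[ℝ] W' => A w)
    (mfderiv_comp y (Ψ.contMDiff.mdifferentiableAt one_ne_zero) (hg.mdifferentiableAt one_ne_zero))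

/-- The metric along the fibres, read in the framing. -/
noncomputable def fibreForm (h : Metric (I.prod J) (M × N)) (p : M × N) : W' →L[ℝ] W' →L[ℝ] ℝ :=
  (vertical (I := I) p.1 p.2 ∘L Ψ.ρ p.2).precomp ℝ ∘L
    (h.inner p ∘L (vertical (I := I) p.1 p.2 ∘L Ψ.ρ p.2))

theorem sqrt_fibreForm (h : Metric (I.prod J) (M × N)) (p : M × N) (w : W') :
    √(fibreForm Ψ h p w w) = h.len (vertical (I := I) p.1 p.2 (Ψ.ρ p.2 w)) := rfl

theorem continuous_fibreForm [FiniteDimensional ℝ W'] (h : Metric (I.prod J) (M × N)) :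
    Continuous (fibreForm Ψ h) := by
  refine continuous_clm_apply.2 fun v => continuous_clm_apply.2 fun w => ?_
  have key : ∀ w : W', Continuous fun p : M × N => (⟨p, vertical (I := I) p.1 p.2 (Ψ.ρ p.2 w)⟩ :
      TangentBundle (I.prod J) (M × N)) := by
    intro w
    have h0 : Continuous fun p : M × N => (⟨p.1, (0 : TangentSpace I p.1)⟩ : TangentBundle I M) :=
      (Bundle.contMDiff_zeroSection (n := 0) (IB := I) ℝ (TangentSpace I : M → Type _)).continuous.comp
        continuous_fst
    have h1 := continuous_tpair.comp (h0.prodMk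
      (Ψ.cont.comp (f := fun p : M × N => (p.2, w)) (by fun_prop)))
    refine h1.congr fun p => ?_
    simp only [vertical_eq_tpair]
    rfl
  exact h.continuous_inner (b := fun p => p) (key v) (key w)

theorem closedSubspaces_fibre [T2Space N] {D : M → ∀ y : N, Submodule ℝ (TangentSpace J y)}
    (hD : IsClosed {q : M × TangentBundle J N | q.2.2 ∈ D q.1 q.2.1}) :
    ClosedSubspaces fun p : M × N => Ψ.img (D p.1) p.2 := by
  have c1 : Continuous fun q : (M × N) × W' => (⟨q.1.2, Ψ.ρ q.1.2 q.2⟩ : TangentBundle J N) :=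
    Ψ.cont.comp (f := fun q : (M × N) × W' => (q.1.2, q.2)) (by fun_prop)
  have : IsClosed ({q : (M × N) × W' | Ψ.ρ q.1.2 q.2 ∈ D q.1.1 q.1.2} ∩
      {q : (M × N) × W' | Ψ.d q.1.2 (Ψ.ρ q.1.2 q.2) = q.2}) :=
    (IsClosed.preimage ((continuous_fst.comp continuous_fst).prodMk c1) hD).inter
      (isClosed_eq (Ψ.continuous_d.comp c1) continuous_snd)
  have e : {q : (M × N) × W' | q.2 ∈ Ψ.img (D q.1.1) q.1.2} = _ :=
    Set.ext fun q => Ψ.mem_img_iff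
  exact (congrArg IsClosed e).mpr this

end Skew

end PHCocycle

namespace PHCocycle

section Algebra

variable {V : Type*} [AddCommGroup V] [Module ℝ V]

theorem components_eq {A B : Submodule ℝ V} (h : Disjoint A B) {x x' y y' : V} (hx : x ∈ A)
    (hx' : x' ∈ A) (hy : y ∈ B) (hy' : y' ∈ B) (he : x + y = x' + y') : x = x' ∧ y = y' := by
  have h1 : x - x' = y' - y := by
    rw [sub_eq_sub_iff_add_eq_add, he, add_comm]
  have h2 : x - x' = 0 := (Submodule.disjoint_def.1 h) _ (A.sub_mem hx hx')
    (h1 ▸ B.sub_mem hy' hy)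
  have h3 : x = x' := sub_eq_zero.1 h2
  exact ⟨h3, by subst h3; exact add_left_cancel he⟩

theorem components_eq₃ {A B C : Submodule ℝ V} (hBC : Disjoint B C) (hA : Disjoint A (B ⊔ C))
    {x x' y y' z z' : V} (hx : x ∈ A) (hx' : x' ∈ A) (hy : y ∈ B) (hy' : y' ∈ B) (hz : z ∈ C)
    (hz' : z' ∈ C) (he : x + y + z = x' + y' + z') : x = x' ∧ y = y' ∧ z = z' := by
  rw [add_assoc, add_assoc] at he
  obtain ⟨h1, h2⟩ := components_eq hA hx hx' (Submodule.add_mem_sup hy hz)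
    (Submodule.add_mem_sup hy' hz') he
  exact ⟨h1, components_eq hBC hy hy' hz hz' h2⟩

end Algebra

variable {E : Type*} [NormedAddCommGroup E] [NormedSpace ℝ E]
  {H : Type*} [TopologicalSpace H] {I : ModelWithCorners ℝ E H}
  {M : Type*} [TopologicalSpace M] [ChartedSpace H M] [IsManifold I 1 M]
  {F : Type*} [NormedAddCommGroup F] [NormedSpace ℝ F]
  {H' : Type*} [TopologicalSpace H'] {J : ModelWithCorners ℝ F H'}
  {N : Type*} [TopologicalSpace N] [ChartedSpace H' N] [IsManifold J 1 N]
  {W : Type*} [NormedAddCommGroup W] [NormedSpace ℝ W]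
  {W' : Type*} [NormedAddCommGroup W'] [NormedSpace ℝ W']

theorem fibreHat_mem (Φ : Framing I M W) (Ψ : Framing J N W') {ft : M × N → M × N}
    (hft : ContMDiff (I.prod J) (I.prod J) 1 ft) (p : M × N) (ξ : W × W') :
    fibreHat Φ Ψ ft p ξ ∈ Ψ.img (fun _ => ⊤) (ft p).2 := by
  refine ⟨mfderiv (I.prod J) J (fun q => (ft q).2) p ((Φ.prod Ψ).ρ p ξ), trivial, ?_⟩
  exact (congrArg (fun A : TangentSpace (I.prod J) p →L[ℝ] W' => A ((Φ.prod Ψ).ρ p ξ))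
    (mfderiv_comp p (Ψ.contMDiff.mdifferentiableAt one_ne_zero)
      ((contMDiff_snd.comp hft).mdifferentiableAt one_ne_zero))).symm

theorem Framing.img_eq_top_of_splitting (Φ : Framing I M W) {f : M ≃ₘ^1⟮I, I⟯ M}
    {S : Splitting I M} {m : Metric I M} (hf : IsPartiallyHyperbolicFor m f S) (x : M) :
    Φ.img S.s x ⊔ (Φ.img S.c x ⊔ Φ.img S.u x) = Φ.img (fun _ => ⊤) x := by
  rw [← Φ.img_sup, ← Φ.img_sup, img, (hf.compl_s x).sup_eq_top]
  rfl

theorem Framing.exists_projections [FiniteDimensional ℝ W] [CompactSpace M] [T2Space M]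
    (Φ : Framing I M W) {f : M ≃ₘ^1⟮I, I⟯ M} {S : Splitting I M} {m : Metric I M}
    (hf : IsPartiallyHyperbolicFor m f S) :
    ∃ Ps Pc Pu : M → W →L[ℝ] W, Continuous Ps ∧ Continuous Pc ∧ Continuous Pu ∧
      (∀ x w, Ps x w ∈ Φ.img S.s x ∧ Pc x w ∈ Φ.img S.c x ∧ Pu x w ∈ Φ.img S.u x) ∧
      (∀ x w, Ps x w + Pc x w + Pu x w = Φ.proj x w) ∧
      ∀ x, ∀ a ∈ Φ.img S.s x, ∀ b ∈ Φ.img S.c x, ∀ c ∈ Φ.img S.u x,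
        Ps x (a + b + c) = a ∧ Pc x (a + b + c) = b ∧ Pu x (a + b + c) = c := by
  obtain ⟨Ps, Pc, Pu, hPs, hPc, hPu, hP⟩ := (Φ.closedSubspaces_img hf.closed_s).exists_projection₃
    (Φ.closedSubspaces_img hf.closed_c) (Φ.closedSubspaces_img hf.closed_u)
    (fun p => Φ.disjoint_img (hf.disjoint_cu p))
    (fun p => by
      rw [← Φ.img_sup]
      exact Φ.disjoint_img (D' := fun x => S.c x ⊔ S.u x) (hf.compl_s p).disjoint)
    Φ.continuous_proj
    (fun p w => by rw [Φ.img_eq_top_of_splitting hf]; exact Φ.proj_mem_img_top p w)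
  refine ⟨Ps, Pc, Pu, hPs, hPc, hPu, fun p w => ⟨(hP p w).1, (hP p w).2.1, (hP p w).2.2.1⟩,
    fun p w => (hP p w).2.2.2, ?_⟩
  intro x a ha b hb c hc
  obtain ⟨h1, h2, h3, h4⟩ := hP x (a + b + c)
  rw [Φ.proj_eq (Submodule.add_mem _ (Submodule.add_mem _ (Φ.img_mono le_top ha)
    (Φ.img_mono le_top hb)) (Φ.img_mono le_top hc))] at h4
  refine components_eq₃ (Φ.disjoint_img (hf.disjoint_cu x)) ?_ h1 ha h2 hb h3 hc h4
  rw [← Φ.img_sup]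
  exact Φ.disjoint_img (D' := fun x => S.c x ⊔ S.u x) (hf.compl_s x).disjoint

variable [FiniteDimensional ℝ W] [FiniteDimensional ℝ W']
variable [CompactSpace M] [T2Space M] [CompactSpace N] [T2Space N]

theorem exists_linExt (Φ : Framing I M W) (Ψ : Framing J N W') {f : M ≃ₘ^1⟮I, I⟯ M}
    {S : Splitting I M} {m : Metric I M} (hf : IsPartiallyHyperbolicFor m f S)
    {ft : (M × N) ≃ₘ^1⟮I.prod J, I.prod J⟯ (M × N)} {g : M → N ≃ₘ^1⟮J, J⟯ N}
    (hft : ∀ x y, ft (x, y) = (f x, g x y)) {Vs Vu : M → ∀ y : N, Submodule ℝ (TangentSpace J y)}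
    {h : Metric (I.prod J) (M × N)} (hfib : IsDominatingHyperbolicFibre m h f S g Vs Vu) :
    ∃ D : LinExt (M × N) W W', D.F = ft.toHomeomorph ∧
      (∀ p, D.es p = Φ.img S.s p.1 ∧ D.ec p = Φ.img S.c p.1 ∧ D.eu p = Φ.img S.u p.1) ∧
      (∀ p, D.vs p = Ψ.img (Vs p.1) p.2 ∧ D.vu p = Ψ.img (Vu p.1) p.2) ∧
      (∀ p ξ, D.coc p ξ = (Φ.prod Ψ).lift ft p ξ) ∧
      (∀ p w, D.Qs p w + D.Qu p w = Ψ.proj p.2 w) ∧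
      (∀ p w, D.c p w = fibreHat Φ Ψ ft p (0, w)) ∧
      (∀ p w, D.c' p w = fibreHat Φ Ψ ft.symm p (0, w)) := by
  have hft1 : ∀ p, (ft p).1 = f p.1 := fun p => congrArg Prod.fst (hft p.1 p.2)
  have hft2 : ∀ p, (ft p).2 = g p.1 p.2 := fun p => congrArg Prod.snd (hft p.1 p.2)
  have hfs1 : ∀ p, (ft.symm p).1 = f.symm p.1 := fun p => by
    have := hft1 (ft.symm p)
    rw [ft.apply_symm_apply] at this
    rw [this, f.symm_apply_apply]
  -- projections
  obtain ⟨Ps, Pc, Pu, hPs, hPc, hPu, hP, -, hPeq⟩ := Φ.exists_projections hf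
  have hVtop : ∀ p : M × N, Ψ.img (Vs p.1) p.2 ⊔ Ψ.img (Vu p.1) p.2 = Ψ.img (fun _ => ⊤) p.2 := by
    intro p
    rw [← Ψ.img_sup, Framing.img, (hfib.isCompl p.1 p.2).sup_eq_top]
    rfl
  obtain ⟨Qs, hQs, hQ⟩ := (closedSubspaces_fibre Ψ hfib.closed_s).exists_projection
    (closedSubspaces_fibre Ψ hfib.closed_u)
    (fun p => Ψ.disjoint_img (D := Vs p.1) (D' := Vu p.1) (hfib.isCompl p.1 p.2).disjoint)
    (Q := fun p => Ψ.proj p.2) (Ψ.continuous_proj.comp continuous_snd)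
    (fun p w => by rw [hVtop]; exact Ψ.proj_mem_img_top p.2 w)
  have hQeq : ∀ p : M × N, ∀ a ∈ Ψ.img (Vs p.1) p.2, ∀ b ∈ Ψ.img (Vu p.1) p.2,
      Qs p (a + b) = a ∧ Ψ.proj p.2 (a + b) - Qs p (a + b) = b := by
    intro p a ha b hb
    obtain ⟨h1, h2⟩ := hQ p (a + b)
    rw [Ψ.proj_eq (Submodule.add_mem _ (Ψ.img_mono le_top ha) (Ψ.img_mono le_top hb))] at h2 ⊢
    exact components_eq (Ψ.disjoint_img (D := Vs p.1) (D' := Vu p.1)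
      (hfib.isCompl p.1 p.2).disjoint) h1 ha h2 hb (by abel)
  -- the cocycles
  have hmd : ∀ x, MDifferentiableAt I I f x := fun x => f.contMDiff.mdifferentiableAt one_ne_zero
  have hgd : ∀ x y, MDifferentiableAt J J (g x) y := fun x y =>
    (g x).contMDiff.mdifferentiableAt one_ne_zero
  let a : M × N → W →L[ℝ] W := fun p => Φ.lift f p.1
  let a' : M × N → W →L[ℝ] W := fun p => Φ.lift f.symm p.1
  let b : M × N → W →L[ℝ] W' := fun p => fibreHat Φ Ψ ft p ∘L ContinuousLinearMap.inl ℝ W W'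
  let b' : M × N → W →L[ℝ] W' := fun p => fibreHat Φ Ψ ft.symm p ∘L ContinuousLinearMap.inl ℝ W W'
  let c : M × N → W' →L[ℝ] W' := fun p => fibreHat Φ Ψ ft p ∘L ContinuousLinearMap.inr ℝ W W'
  let c' : M × N → W' →L[ℝ] W' := fun p =>
    fibreHat Φ Ψ ft.symm p ∘L ContinuousLinearMap.inr ℝ W W'
  have hlift : ∀ p w w', (Φ.prod Ψ).lift ft p (w, w') = (a p w, b p w + c p w') := by
    intro p w w'
    rw [lift_prod Φ Ψ ft.contMDiff f.contMDiff hft1]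
    refine Prod.ext rfl ?_
    change fibreHat Φ Ψ ft p (w, w') = fibreHat Φ Ψ ft p (w, 0) + fibreHat Φ Ψ ft p (0, w')
    rw [← map_add, Prod.mk_add_mk, add_zero, zero_add]
  have hlift' : ∀ p w w', (Φ.prod Ψ).lift ft.symm p (w, w') = (a' p w, b' p w + c' p w') := by
    intro p w w'
    rw [lift_prod Φ Ψ ft.symm.contMDiff f.symm.contMDiff hfs1]
    refine Prod.ext rfl ?_
    change fibreHat Φ Ψ ft.symm p (w, w') =
      fibreHat Φ Ψ ft.symm p (w, 0) + fibreHat Φ Ψ ft.symm p (0, w')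
    rw [← map_add, Prod.mk_add_mk, add_zero, zero_add]
  have htop : ∀ p : M × N, ∀ w ∈ Φ.img (fun _ => ⊤) p.1, ∀ w' ∈ Ψ.img (fun _ => ⊤) p.2,
      (w, w') ∈ (Φ.prod Ψ).img (fun _ => ⊤) p := by
    rintro p w ⟨v, -, rfl⟩ w' ⟨v', -, rfl⟩
    refine ⟨tpair p (v, v'), trivial, ?_⟩
    refine (Φ.prod_d Ψ p _).trans ?_
    rw [horizontalProj_tpair, verticalProj_tpair]
    rfl
  have hinv1 : ∀ p : M × N, ∀ w ∈ Φ.img (fun _ => ⊤) p.1, ∀ w' ∈ Ψ.img (fun _ => ⊤) p.2,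
      a' (ft p) (a p w) = w ∧ b' (ft p) (a p w) + c' (ft p) (b p w + c p w') = w' := by
    intro p w hw w' hw'
    have h1 := (Φ.prod Ψ).lift_symm_lift ft p (htop p w hw w' hw')
    rw [hlift, hlift'] at h1
    exact Prod.ext_iff.1 h1
  have hinv2 : ∀ p : M × N, ∀ w ∈ Φ.img (fun _ => ⊤) p.1, ∀ w' ∈ Ψ.img (fun _ => ⊤) p.2,
      a (ft.symm p) (a' p w) = w ∧ b (ft.symm p) (a' p w) + c (ft.symm p) (b' p w + c' p w') = w' := by
    intro p w hw w' hw'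
    have h1 := (Φ.prod Ψ).lift_symm_lift ft.symm p (htop p w hw w' hw')
    rw [hlift'] at h1
    change (Φ.prod Ψ).lift ft (ft.symm p) _ = _ at h1
    rw [hlift] at h1
    exact Prod.ext_iff.1 h1
  have ha_map : ∀ {D : ∀ x, Submodule ℝ (TangentSpace I x)},
      (∀ x, (D x).map (mfderiv I I f x).toLinearMap = D (f x)) → ∀ p : M × N,
      (Φ.img D p.1).map (a p).toLinearMap = Φ.img D (ft p).1 := fun hD p => by
    rw [hft1]; exact Φ.map_lift (hmd p.1) (hD p.1)
  have hcd : ∀ x y (w : TangentSpace J y),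
      c (x, y) (Ψ.d y w) = Ψ.d (g x y) (mfderiv J J (g x) y w) := fun x y w =>
    fibreHat_inr Φ Ψ ft.contMDiff (g x).contMDiff (fun y => hft2 (x, y)) y w
  have hc_map : ∀ {D : M → ∀ y : N, Submodule ℝ (TangentSpace J y)},
      (∀ x y, (D x y).map (mfderiv J J (g x) y).toLinearMap = D (f x) (g x y)) → ∀ p : M × N,
      (Ψ.img (D p.1) p.2).map (c p).toLinearMap = Ψ.img (D (ft p).1) (ft p).2 := by
    rintro D hD ⟨x, y⟩
    rw [hft x y]
    change (Ψ.img (D x) y).map (c (x, y)).toLinearMap = Ψ.img (D (f x)) (g x y)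
    rw [Framing.img, Framing.img, ← hD, ← Submodule.map_comp, ← Submodule.map_comp]
    congr 1
    ext w
    exact hcd x y w
  have ha_mem : ∀ {D : ∀ x, Submodule ℝ (TangentSpace I x)},
      (∀ x, (D x).map (mfderiv I I f x).toLinearMap = D (f x)) → ∀ p : M × N,
      ∀ w ∈ Φ.img D p.1, a p w ∈ Φ.img D (ft p).1 := fun hD p w hw =>
    ha_map hD p ▸ Submodule.mem_map_of_mem hw
  have hc_mem : ∀ {D : M → ∀ y : N, Submodule ℝ (TangentSpace J y)},
      (∀ x y, (D x y).map (mfderiv J J (g x) y).toLinearMap = D (f x) (g x y)) → ∀ p : M × N,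
      ∀ w ∈ Ψ.img (D p.1) p.2, c p w ∈ Ψ.img (D (ft p).1) (ft p).2 := fun hD p w hw =>
    hc_map hD p ▸ Submodule.mem_map_of_mem hw
  have ha_ex : ∀ {D : ∀ x, Submodule ℝ (TangentSpace I x)},
      (∀ x, (D x).map (mfderiv I I f x).toLinearMap = D (f x)) → ∀ p : M × N,
      ∀ w ∈ Φ.img D p.1, a' p w ∈ Φ.img D (ft.symm p).1 ∧ a (ft.symm p) (a' p w) = w := by
    intro D hD p w hw
    have h1 := ha_map hD (ft.symm p)
    rw [ft.apply_symm_apply] at h1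
    obtain ⟨w0, hw0, rfl⟩ := h1.symm ▸ hw
    have h2 := (hinv1 (ft.symm p) w0 (Φ.img_mono le_top hw0) 0 (Submodule.zero_mem _)).1
    rw [ft.apply_symm_apply] at h2
    change a' p (a (ft.symm p) w0) ∈ _ ∧ a (ft.symm p) (a' p (a (ft.symm p) w0)) = _
    rw [h2]
    exact ⟨hw0, rfl⟩
  have hc_ex : ∀ {D : M → ∀ y : N, Submodule ℝ (TangentSpace J y)},
      (∀ x y, (D x y).map (mfderiv J J (g x) y).toLinearMap = D (f x) (g x y)) → ∀ p : M × N,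
      ∀ w ∈ Ψ.img (D p.1) p.2, c' p w ∈ Ψ.img (D (ft.symm p).1) (ft.symm p).2 ∧
        c (ft.symm p) (c' p w) = w := by
    intro D hD p w hw
    have h1 := hc_map hD (ft.symm p)
    rw [ft.apply_symm_apply] at h1
    obtain ⟨w0, hw0, rfl⟩ := h1.symm ▸ hw
    have h2 := (hinv1 (ft.symm p) 0 (Submodule.zero_mem _) w0 (Ψ.img_mono le_top hw0)).2
    rw [ft.apply_symm_apply, map_zero, map_zero, map_zero, zero_add, zero_add] at h2
    change c' p (c (ft.symm p) w0) ∈ _ ∧ c (ft.symm p) (c' p (c (ft.symm p) w0)) = _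
    rw [h2]
    exact ⟨hw0, rfl⟩
  -- lengths
  have hlm : ∀ x (v : TangentSpace I x), √(Φ.form m x (Φ.d x v) (Φ.d x v)) = m.len v := by
    intro x v
    rw [Framing.sqrt_form, Framing.ρ_d]
  have hlh : ∀ x y (v : TangentSpace J y), √(fibreForm Ψ h (x, y) (Ψ.d y v) (Ψ.d y v)) =
      h.len (vertical (I := I) x y v) := by
    intro x y v
    rw [sqrt_fibreForm, Framing.ρ_d]
  have had : ∀ x (v : TangentSpace I x), Φ.lift f x (Φ.d x v) = Φ.d (f x) (mfderiv I I f x v) :=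
    fun x v => Φ.lift_d (hmd x) v
  have hne : ∀ {x} {v : TangentSpace I x}, Φ.d x v ≠ 0 → v ≠ 0 := by
    rintro x _ h1 rfl
    exact h1 (map_zero _)
  have hne' : ∀ {y} {v : TangentSpace J y}, Ψ.d y v ≠ 0 → v ≠ 0 := by
    rintro y _ h1 rfl
    exact h1 (map_zero _)
  have hane : ∀ {p : M × N} {w}, w ∈ Φ.img (fun _ => ⊤) p.1 → w ≠ 0 → a' p w ≠ 0 := by
    intro p w hw h0 h1
    have := (hinv2 p w hw 0 (Submodule.zero_mem _)).1
    rw [h1, map_zero] at this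
    exact h0 this.symm
  have hcne : ∀ {p : M × N} {w}, w ∈ Ψ.img (fun _ => ⊤) p.2 → w ≠ 0 → c' p w ≠ 0 := by
    intro p w hw h0 h1
    have := (hinv2 p 0 (Submodule.zero_mem _) w hw).2
    rw [h1, map_zero, map_zero, map_zero, zero_add, zero_add, map_zero] at this
    exact h0 this.symm
  let nm : M × N → W → ℝ := fun p w => √(Φ.form m p.1 w w)
  let nh : M × N → W' → ℝ := fun p w => √(fibreForm Ψ h p w w)
  have i1 : ∀ p : M × N, ∀ w ∈ Φ.img S.s p.1, w ≠ 0 → nm (ft p) (a p w) < nm p w := by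
    rintro ⟨x, y⟩ w ⟨v, hv, rfl⟩ hw
    simp only [nm]
    rw [hft1]
    change √(Φ.form m (f x) (Φ.lift f x (Φ.d x v)) (Φ.lift f x (Φ.d x v))) <
      √(Φ.form m x (Φ.d x v) (Φ.d x v))
    rw [had, hlm, hlm]
    exact hf.contracts x v hv (hne hw)
  have i2 : ∀ p : M × N, ∀ w ∈ Φ.img S.u p.1, w ≠ 0 → nm p w < nm (ft p) (a p w) := by
    rintro ⟨x, y⟩ w ⟨v, hv, rfl⟩ hw
    simp only [nm]
    rw [hft1]
    change √(Φ.form m x (Φ.d x v) (Φ.d x v)) <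
      √(Φ.form m (f x) (Φ.lift f x (Φ.d x v)) (Φ.lift f x (Φ.d x v)))
    rw [had, hlm, hlm]
    exact hf.expands x v hv (hne hw)
  have i3 : ∀ p : M × N, ∀ w ∈ Φ.img S.s p.1, ∀ η ∈ Φ.img S.c p.1, w ≠ 0 → η ≠ 0 →
      nm (ft p) (a p w) * nm p η < nm (ft p) (a p η) * nm p w := by
    rintro ⟨x, y⟩ w ⟨v, hv, rfl⟩ η ⟨u, hu, rfl⟩ hw hη
    simp only [nm]
    rw [hft1]
    change √(Φ.form m (f x) (Φ.lift f x (Φ.d x v)) (Φ.lift f x (Φ.d x v))) *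
      √(Φ.form m x (Φ.d x u) (Φ.d x u)) <
      √(Φ.form m (f x) (Φ.lift f x (Φ.d x u)) (Φ.lift f x (Φ.d x u))) *
      √(Φ.form m x (Φ.d x v) (Φ.d x v))
    rw [had, had, hlm, hlm, hlm, hlm]
    exact (div_lt_div_iff₀ (m.len_pos (hne hw)) (m.len_pos (hne hη))).1
      (hf.dominated_s x v hv u hu (hne hw) (hne hη))
  have i4 : ∀ p : M × N, ∀ w ∈ Φ.img S.u p.1, ∀ η ∈ Φ.img S.c p.1, w ≠ 0 → η ≠ 0 →
      nm (ft p) (a p η) * nm p w < nm (ft p) (a p w) * nm p η := by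
    rintro ⟨x, y⟩ w ⟨v, hv, rfl⟩ η ⟨u, hu, rfl⟩ hw hη
    simp only [nm]
    rw [hft1]
    change √(Φ.form m (f x) (Φ.lift f x (Φ.d x u)) (Φ.lift f x (Φ.d x u))) *
      √(Φ.form m x (Φ.d x v) (Φ.d x v)) <
      √(Φ.form m (f x) (Φ.lift f x (Φ.d x v)) (Φ.lift f x (Φ.d x v))) *
      √(Φ.form m x (Φ.d x u) (Φ.d x u))
    rw [had, had, hlm, hlm, hlm, hlm]
    exact (div_lt_div_iff₀ (m.len_pos (hne hη)) (m.len_pos (hne hw))).1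
      (hf.dominated_u x v hv u hu (hne hw) (hne hη))
  have i5 : ∀ p : M × N, ∀ w ∈ Ψ.img (Vs p.1) p.2, w ≠ 0 → nh (ft p) (c p w) < nh p w := by
    rintro ⟨x, y⟩ w ⟨v, hv, rfl⟩ hw
    simp only [nh]
    rw [hft]
    change √(fibreForm Ψ h (f x, g x y) (c (x, y) (Ψ.d y v)) (c (x, y) (Ψ.d y v))) <
      √(fibreForm Ψ h (x, y) (Ψ.d y v) (Ψ.d y v))
    rw [hcd, hlh, hlh]
    exact hfib.contracts x y v hv (hne' hw)
  have i6 : ∀ p : M × N, ∀ w ∈ Ψ.img (Vu p.1) p.2, w ≠ 0 → nh p w < nh (ft p) (c p w) := by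
    rintro ⟨x, y⟩ w ⟨v, hv, rfl⟩ hw
    simp only [nh]
    rw [hft]
    change √(fibreForm Ψ h (x, y) (Ψ.d y v) (Ψ.d y v)) <
      √(fibreForm Ψ h (f x, g x y) (c (x, y) (Ψ.d y v)) (c (x, y) (Ψ.d y v)))
    rw [hcd, hlh, hlh]
    exact hfib.expands x y v hv (hne' hw)
  have hlpos : ∀ {x y} {v : TangentSpace J y}, v ≠ 0 → 0 < h.len (vertical (I := I) x y v) := by
    intro x y v hv
    refine h.len_pos fun h0 => hv ?_
    have := congrArg (verticalProj (x, y)) h0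
    rwa [vertical_eq_tpair, verticalProj_tpair, map_zero] at this
  have i7 : ∀ p : M × N, ∀ w ∈ Ψ.img (Vs p.1) p.2, ∀ η ∈ Φ.img S.c p.1, w ≠ 0 → η ≠ 0 →
      nh (ft p) (c p w) * nm p η < nm (ft p) (a p η) * nh p w := by
    rintro ⟨x, y⟩ w ⟨v, hv, rfl⟩ η ⟨u, hu, rfl⟩ hw hη
    simp only [nh, nm]
    rw [hft]
    change √(fibreForm Ψ h (f x, g x y) (c (x, y) (Ψ.d y v)) (c (x, y) (Ψ.d y v))) *
      √(Φ.form m x (Φ.d x u) (Φ.d x u)) <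
      √(Φ.form m (f x) (Φ.lift f x (Φ.d x u)) (Φ.lift f x (Φ.d x u))) *
      √(fibreForm Ψ h (x, y) (Ψ.d y v) (Ψ.d y v))
    rw [hcd, hlh, hlh, had, hlm, hlm]
    exact (div_lt_div_iff₀ (hlpos (hne' hw)) (m.len_pos (hne hη))).1
      (hfib.dominates_s x y v hv u hu (hne' hw) (hne hη))
  have i8 : ∀ p : M × N, ∀ w ∈ Ψ.img (Vu p.1) p.2, ∀ η ∈ Φ.img S.c p.1, w ≠ 0 → η ≠ 0 →
      nm (ft p) (a p η) * nh p w < nh (ft p) (c p w) * nm p η := by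
    rintro ⟨x, y⟩ w ⟨v, hv, rfl⟩ η ⟨u, hu, rfl⟩ hw hη
    simp only [nh, nm]
    rw [hft]
    change √(Φ.form m (f x) (Φ.lift f x (Φ.d x u)) (Φ.lift f x (Φ.d x u))) *
      √(fibreForm Ψ h (x, y) (Ψ.d y v) (Ψ.d y v)) <
      √(fibreForm Ψ h (f x, g x y) (c (x, y) (Ψ.d y v)) (c (x, y) (Ψ.d y v))) *
      √(Φ.form m x (Φ.d x u) (Φ.d x u))
    rw [hcd, hlh, hlh, had, hlm, hlm]
    exact (div_lt_div_iff₀ (m.len_pos (hne hη)) (hlpos (hne' hw))).1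
      (hfib.dominates_u x y v hv u hu (hne' hw) (hne hη))
  have hz := Φ.img_eq_top_of_splitting hf
  refine ⟨{
    F := ft.toHomeomorph
    es := fun p => Φ.img S.s p.1
    ec := fun p => Φ.img S.c p.1
    eu := fun p => Φ.img S.u p.1
    vs := fun p => Ψ.img (Vs p.1) p.2
    vu := fun p => Ψ.img (Vu p.1) p.2
    a := a
    a' := a'
    b := b
    b' := b'
    c := c
    c' := c'
    Ps := fun p => Ps p.1
    Pc := fun p => Pc p.1
    Pu := fun p => Pu p.1
    Qs := Qs
    Qu := fun p => Ψ.proj p.2 - Qs p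
    mm := fun p => Φ.form m p.1
    hh := fibreForm Ψ h
    closed_es := (Φ.closedSubspaces_img hf.closed_s).preimage
      (f := fun q : (M × N) × W => (q.1.1, q.2)) (by fun_prop)
    closed_ec := (Φ.closedSubspaces_img hf.closed_c).preimage
      (f := fun q : (M × N) × W => (q.1.1, q.2)) (by fun_prop)
    closed_eu := (Φ.closedSubspaces_img hf.closed_u).preimage
      (f := fun q : (M × N) × W => (q.1.1, q.2)) (by fun_prop)
    closed_vs := closedSubspaces_fibre Ψ hfib.closed_s
    closed_vu := closedSubspaces_fibre Ψ hfib.closed_u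
    cont_a := (Φ.continuous_lift f.contMDiff).comp continuous_fst
    cont_a' := (Φ.continuous_lift f.symm.contMDiff).comp continuous_fst
    cont_b := (continuous_fibreHat Φ Ψ ft.contMDiff).clm_comp continuous_const
    cont_b' := (continuous_fibreHat Φ Ψ ft.symm.contMDiff).clm_comp continuous_const
    cont_c := (continuous_fibreHat Φ Ψ ft.contMDiff).clm_comp continuous_const
    cont_c' := (continuous_fibreHat Φ Ψ ft.symm.contMDiff).clm_comp continuous_const
    cont_Ps := hPs.comp continuous_fst
    cont_Pc := hPc.comp continuous_fst
    cont_Pu := hPu.comp continuous_fst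
    cont_Qs := hQs
    cont_Qu := (Ψ.continuous_proj.comp continuous_snd).sub hQs
    cont_mm := (Φ.continuous_form m).comp continuous_fst
    cont_hh := continuous_fibreForm Ψ h
    Ps_mem := fun p w => (hP p.1 w).1
    Pc_mem := fun p w => (hP p.1 w).2.1
    Pu_mem := fun p w => (hP p.1 w).2.2
    Qs_mem := fun p w => (hQ p w).1
    Qu_mem := fun p w => (hQ p w).2
    P_s := fun p w hw => by
      simpa using hPeq p.1 w hw 0 (Submodule.zero_mem _) 0 (Submodule.zero_mem _)
    P_c := fun p w hw => by
      simpa using hPeq p.1 0 (Submodule.zero_mem _) w hw 0 (Submodule.zero_mem _)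
    P_u := fun p w hw => by
      simpa using hPeq p.1 0 (Submodule.zero_mem _) 0 (Submodule.zero_mem _) w hw
    Q_s := fun p w hw => by simpa using hQeq p w hw 0 (Submodule.zero_mem _)
    Q_u := fun p w hw => by simpa using hQeq p 0 (Submodule.zero_mem _) w hw
    a_s := ha_mem hf.invariant_s
    a_c := ha_mem hf.invariant_c
    a_u := ha_mem hf.invariant_u
    a'_s := fun p w hw => (ha_ex hf.invariant_s p w hw).1
    a'_c := fun p w hw => (ha_ex hf.invariant_c p w hw).1
    a'_u := fun p w hw => (ha_ex hf.invariant_u p w hw).1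
    c_s := hc_mem hfib.invariant_s
    c_u := hc_mem hfib.invariant_u
    c'_s := fun p w hw => (hc_ex hfib.invariant_s p w hw).1
    c'_u := fun p w hw => (hc_ex hfib.invariant_u p w hw).1
    b_mem := fun p w hw => ?_
    b'_mem := fun p w hw => ?_
    a'_a := fun p w hw => (hinv1 p w (hz p.1 ▸ hw) 0 (Submodule.zero_mem _)).1
    a_a' := fun p w hw => (hinv2 p w (hz p.1 ▸ hw) 0 (Submodule.zero_mem _)).1
    c'_c := fun p w hw => by
      have := (hinv1 p 0 (Submodule.zero_mem _) w (hVtop p ▸ hw)).2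
      rwa [map_zero, map_zero, map_zero, zero_add, zero_add] at this
    c_c' := fun p w hw => by
      have := (hinv2 p 0 (Submodule.zero_mem _) w (hVtop p ▸ hw)).2
      rwa [map_zero, map_zero, map_zero, zero_add, zero_add] at this
    b'_a := fun p w hw => by
      have := (hinv1 p w (hz p.1 ▸ hw) 0 (Submodule.zero_mem _)).2
      rwa [map_zero, add_zero] at this
    b_a' := fun p w hw => by
      have := (hinv2 p w (hz p.1 ▸ hw) 0 (Submodule.zero_mem _)).2
      rwa [map_zero, add_zero] at this
    mm_symm := fun p v w => m.symm _ _ _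
    hh_symm := fun p v w => h.symm _ _ _
    mm_pos := fun p w hw hw0 => m.pos _ _ (Φ.ρ_ne_zero (hz p.1 ▸ hw) hw0)
    hh_pos := fun p w hw hw0 => h.pos _ _ fun h0 => by
      have h1 : vertical (I := I) p.1 p.2 (Ψ.ρ p.2 w) = 0 := h0
      have := congrArg (verticalProj (p.1, p.2)) h1
      rw [vertical_eq_tpair, verticalProj_tpair, map_zero] at this
      exact Ψ.ρ_ne_zero (hVtop p ▸ hw) hw0 this
    hh_nonneg := fun p w => h.inner_nonneg _
    hh_add := fun p v w => by
      rw [sqrt_fibreForm, sqrt_fibreForm, sqrt_fibreForm, map_add, map_add]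
      exact h.len_add_le _ _
    contr_e := i1
    contr_v := i5
    dom_e := i3
    dom_v := i7
    contr_e' := fun p w hw hw0 => ?_
    contr_v' := fun p w hw hw0 => ?_
    dom_e' := fun p w hw η hη hw0 hη0 => ?_
    dom_v' := fun p w hw η hη hw0 hη0 => ?_ }, rfl, fun p => ⟨rfl, rfl, rfl⟩, fun p => ⟨rfl, rfl⟩,
      fun p ξ => (hlift p ξ.1 ξ.2).symm, fun p w => add_sub_cancel _ _, fun p w => rfl,
      fun p w => rfl⟩
  · exact (add_sub_cancel _ _).trans (Ψ.proj_eq (fibreHat_mem Φ Ψ ft.contMDiff p (w, 0)))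
  · exact (add_sub_cancel _ _).trans (Ψ.proj_eq (fibreHat_mem Φ Ψ ft.symm.contMDiff p (w, 0)))
  · obtain ⟨h1, h2⟩ := ha_ex hf.invariant_u p w hw
    have := i2 (ft.symm p) _ h1 (hane (Φ.img_mono le_top hw) hw0)
    rwa [ft.apply_symm_apply, h2] at this
  · obtain ⟨h1, h2⟩ := hc_ex hfib.invariant_u p w hw
    have := i6 (ft.symm p) _ h1 (hcne (Ψ.img_mono le_top hw) hw0)
    rwa [ft.apply_symm_apply, h2] at this
  · obtain ⟨h1, h2⟩ := ha_ex hf.invariant_u p w hw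
    obtain ⟨h3, h4⟩ := ha_ex hf.invariant_c p η hη
    have := i4 (ft.symm p) _ h1 _ h3 (hane (Φ.img_mono le_top hw) hw0)
      (hane (Φ.img_mono le_top hη) hη0)
    rw [ft.apply_symm_apply, h2, h4] at this
    change nm (ft.symm p) _ * nm p η < nm (ft.symm p) _ * nm p w
    linarith
  · obtain ⟨h1, h2⟩ := hc_ex hfib.invariant_u p w hw
    obtain ⟨h3, h4⟩ := ha_ex hf.invariant_c p η hη
    have := i8 (ft.symm p) _ h1 _ h3 (hcne (Ψ.img_mono le_top hw) hw0)
      (hane (Φ.img_mono le_top hη) hη0)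
    rw [ft.apply_symm_apply, h2, h4] at this
    change nh (ft.symm p) _ * nm p η < nm (ft.symm p) _ * nh p w
    linarith

end PHCocycle

namespace PHCocycle

section Comap

variable {V V' : Type*} [AddCommGroup V] [Module ℝ V] [AddCommGroup V'] [Module ℝ V']

theorem disjoint_comap {e : V →ₗ[ℝ] V'} (he : Function.Injective e) {A B : Submodule ℝ V'}
    (h : Disjoint A B) : Disjoint (A.comap e) (B.comap e) :=
  Submodule.disjoint_def.2 fun x hx hy => he (by
    rw [Submodule.disjoint_def.1 h _ hx hy, map_zero])

theorem comap_sup_of_le {e : V →ₗ[ℝ] V'} (he : Function.Injective e) {A B : Submodule ℝ V'}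
    (hA : A ≤ LinearMap.range e) (hB : B ≤ LinearMap.range e) :
    (A ⊔ B).comap e = A.comap e ⊔ B.comap e := by
  refine le_antisymm (fun x hx => ?_) (sup_le (Submodule.comap_mono le_sup_left)
    (Submodule.comap_mono le_sup_right))
  obtain ⟨a, ha, b, hb, hab⟩ := Submodule.mem_sup.1 hx
  obtain ⟨a, rfl⟩ := hA ha
  obtain ⟨b, rfl⟩ := hB hb
  rw [← map_add] at hab
  exact he hab ▸ Submodule.add_mem_sup ha hb

theorem map_comap_eq {V₂ V₂' : Type*} [AddCommGroup V₂] [Module ℝ V₂] [AddCommGroup V₂']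
    [Module ℝ V₂'] {e : V →ₗ[ℝ] V'} {e₂ : V₂ →ₗ[ℝ] V₂'} (he₂ : Function.Injective e₂)
    {A : V →ₗ[ℝ] V₂} {G : Submodule ℝ V'} {G₂ : Submodule ℝ V₂'} (hle : G ≤ LinearMap.range e)
    (h1 : ∀ v, e v ∈ G → e₂ (A v) ∈ G₂)
    (h2 : ∀ w, e₂ w ∈ G₂ → ∃ x ∈ G, ∀ v, e v = x → e₂ (A v) = e₂ w) :
    (G.comap e).map A = G₂.comap e₂ := by
  refine le_antisymm ?_ fun w hw => ?_
  · rintro _ ⟨v, hv, rfl⟩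
    exact h1 v hv
  · obtain ⟨x, hx, h⟩ := h2 w hw
    obtain ⟨v, rfl⟩ := hle hx
    exact ⟨v, hx, he₂ (h v rfl)⟩

end Comap

theorem sqrt_div_lt {a b c d : ℝ} (hb : 0 < b) (hd : 0 < d) (ha : 0 ≤ a) (h : a * d < c * b) :
    √a / √b < √c / √d := by
  have hc : 0 ≤ c := by
    by_contra! hc
    have := mul_nonneg ha hd.le
    nlinarith
  rw [div_lt_div_iff₀ (Real.sqrt_pos.2 hb) (Real.sqrt_pos.2 hd), ← Real.sqrt_mul ha,
    ← Real.sqrt_mul hc]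
  exact Real.sqrt_lt_sqrt (mul_nonneg ha hd.le) h

variable {E : Type*} [NormedAddCommGroup E] [NormedSpace ℝ E] [FiniteDimensional ℝ E]
  {H : Type*} [TopologicalSpace H] {I : ModelWithCorners ℝ E H}
  {M : Type*} [TopologicalSpace M] [ChartedSpace H M] [IsManifold I 1 M]
  {F : Type*} [NormedAddCommGroup F] [NormedSpace ℝ F] [FiniteDimensional ℝ F]
  {H' : Type*} [TopologicalSpace H'] {J : ModelWithCorners ℝ F H'}
  {N : Type*} [TopologicalSpace N] [ChartedSpace H' N] [IsManifold J 1 N]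
  {W : Type*} [NormedAddCommGroup W] [NormedSpace ℝ W] [FiniteDimensional ℝ W]
  {W' : Type*} [NormedAddCommGroup W'] [NormedSpace ℝ W'] [FiniteDimensional ℝ W']
  [CompactSpace M] [T2Space M] [CompactSpace N] [T2Space N]

theorem exists_induced_splitting (Φ : Framing I M W) (Ψ : Framing J N W') {f : M ≃ₘ^1⟮I, I⟯ M}
    {S : Splitting I M} {m : Metric I M} (hf : IsPartiallyHyperbolicFor m f S)
    {ft : (M × N) ≃ₘ^1⟮I.prod J, I.prod J⟯ (M × N)} {g : M → N ≃ₘ^1⟮J, J⟯ N}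
    (hft : ∀ x y, ft (x, y) = (f x, g x y)) {Vs Vu : M → ∀ y : N, Submodule ℝ (TangentSpace J y)}
    {h : Metric (I.prod J) (M × N)} (hfib : IsDominatingHyperbolicFibre m h f S g Vs Vu) :
    ∃ T : Splitting (I.prod J) (M × N), T.IsInduced S Vs Vu ∧ IsPartiallyHyperbolic ft T := by
  obtain ⟨D, hDF, hDe, hDv, hDc, -⟩ := exists_linExt Φ Ψ hf hft hfib
  obtain ⟨L, hL⟩ := D.exists_isGraph
  let Θ := Φ.prod Ψ
  have hF : ∀ p, D.F p = ft p := fun p => by rw [hDF]; rfl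
  have hinj : ∀ p, Function.Injective (Θ.d p).toLinearMap := fun p => Θ.d_injective p
  have hcoc : ∀ p (v : TangentSpace (I.prod J) p),
      Θ.d (ft p) (mfderiv (I.prod J) (I.prod J) ft p v) = D.coc p (Θ.d p v) := fun p v =>
    (Θ.lift_d (ft.contMDiff.mdifferentiableAt one_ne_zero) v).symm.trans (hDc p _).symm
  have hΦtop := Φ.img_eq_top_of_splitting hf
  have hrange : ∀ p, D.tot p = LinearMap.range (Θ.d p).toLinearMap := by
    intro p
    obtain ⟨e1, e2, e3⟩ := hDe p
    obtain ⟨e4, e5⟩ := hDv p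
    have e6 : Ψ.img (Vs p.1) p.2 ⊔ Ψ.img (Vu p.1) p.2 = Ψ.img (fun _ => ⊤) p.2 := by
      rw [← Ψ.img_sup, Framing.img, (hfib.isCompl p.1 p.2).sup_eq_top]
      rfl
    ext ξ
    rw [LinExt.mem_tot, e1, e2, e3, e4, e5, hΦtop, e6]
    constructor
    · rintro ⟨⟨v, -, hv⟩, w, -, hw⟩
      refine ⟨tpair p (v, w), (Φ.prod_d Ψ p _).trans ?_⟩
      rw [horizontalProj_tpair, verticalProj_tpair]
      exact Prod.ext hv hw
    · rintro ⟨v, rfl⟩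
      have := Φ.prod_d Ψ p v
      exact ⟨⟨horizontalProj p v, trivial, (congrArg Prod.fst this).symm⟩,
        verticalProj p v, trivial, (congrArg Prod.snd this).symm⟩
  have hmt : ∀ p (v : TangentSpace (I.prod J) p), Θ.d p v ∈ D.tot p := fun p v => by
    rw [hrange]; exact ⟨v, rfl⟩
  let T : Splitting (I.prod J) (M × N) :=
    { s := fun p => (D.gs L p).comap (Θ.d p).toLinearMap
      c := fun p => (D.gc L p).comap (Θ.d p).toLinearMap
      u := fun p => (D.gu L p).comap (Θ.d p).toLinearMap }
  have hfst : ∀ p (v : TangentSpace (I.prod J) p), (Θ.d p v).1 = Φ.d p.1 (horizontalProj p v) :=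
    fun p v => congrArg Prod.fst (Φ.prod_d Ψ p v)
  have hvert : ∀ x y (w : TangentSpace J y), Θ.d (x, y) (vertical (I := I) x y w) = (0, Ψ.d y w) :=
    prod_d_vertical Φ Ψ
  have hvert0 : ∀ p (w : W'), LinExt.vert L p (0, w) = w := fun p w => by
    rw [LinExt.vert_apply, map_zero, sub_zero]
  have hproj : ∀ p {A : Submodule ℝ W} {B : ∀ x, Submodule ℝ (TangentSpace I x)}
      {G : Submodule ℝ (W × W')}, A = Φ.img B p.1 → (∀ ξ ∈ G, ξ.1 ∈ A) →
      (∀ w ∈ A, (w, L p w) ∈ G) → G ≤ D.tot p →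
      (G.comap (Θ.d p).toLinearMap).map (horizontalProj p).toLinearMap = B p.1 := by
    intro p A B G hA h1 h2 h3
    refine le_antisymm ?_ fun v hv => ?_
    · rintro _ ⟨v, hv, rfl⟩
      have := h1 _ hv
      rw [hA] at this
      exact Φ.d_mem_img.1 (hfst p v ▸ this)
    · have h4 := h2 (Φ.d p.1 v) (hA ▸ Φ.d_mem_img.2 hv)
      obtain ⟨ξ, hξ⟩ := hrange p ▸ h3 h4
      refine ⟨ξ, ?_, Φ.d_injective p.1 ?_⟩
      · change Θ.d p ξ ∈ G
        exact (show Θ.d p ξ = _ from hξ) ▸ h4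
      · exact (hfst p ξ).symm.trans (congrArg Prod.fst hξ)
  have hmk0 : ∀ p w, LinExt.vert L p (w, L p w) = 0 := fun p w => sub_self _
  refine ⟨T, ⟨fun p => ?_, fun p => ?_, fun p => ?_, fun x y => ?_, fun x y => ?_, fun x y => ?_⟩, ?_⟩
  · exact hproj p (hDe p).1 (fun ξ hξ => (D.mem_gs.1 hξ).1)
      (fun w hw => D.mem_gs.2 ⟨hw, by rw [hmk0]; exact Submodule.zero_mem _⟩) (hL.gs_le p)
  · exact hproj p (hDe p).2.1 (fun ξ hξ => (D.mem_gc.1 hξ).1)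
      (fun w hw => D.mem_gc.2 ⟨hw, hmk0 _ _⟩) (hL.gc_le p)
  · exact hproj p (hDe p).2.2 (fun ξ hξ => (D.mem_gu.1 hξ).1)
      (fun w hw => D.mem_gu.2 ⟨hw, by rw [hmk0]; exact Submodule.zero_mem _⟩) (hL.gu_le p)
  · ext w
    change Θ.d (x, y) (vertical (I := I) x y w) ∈ D.gs L (x, y) ↔ w ∈ Vs x y
    rw [hvert, LinExt.mem_gs, hvert0, (hDv (x, y)).1]
    exact ⟨fun h => Ψ.d_mem_img.1 h.2, fun h => ⟨Submodule.zero_mem _, Ψ.d_mem_img.2 h⟩⟩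
  · ext w
    change Θ.d (x, y) (vertical (I := I) x y w) ∈ D.gc L (x, y) ↔ w ∈ (⊥ : Submodule ℝ _)
    rw [hvert, LinExt.mem_gc, hvert0, Submodule.mem_bot]
    exact ⟨fun h => Ψ.d_injective y (h.2.trans (map_zero _).symm),
      fun h => ⟨Submodule.zero_mem _, by rw [h, map_zero]⟩⟩
  · ext w
    change Θ.d (x, y) (vertical (I := I) x y w) ∈ D.gu L (x, y) ↔ w ∈ Vu x y
    rw [hvert, LinExt.mem_gu, hvert0, (hDv (x, y)).2]
    exact ⟨fun h => Ψ.d_mem_img.1 h.2, fun h => ⟨Submodule.zero_mem _, Ψ.d_mem_img.2 h⟩⟩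
  · obtain ⟨Λ₁, hΛ1⟩ := hL.exists_gform_lt
    obtain ⟨Λ₂, hΛ2⟩ := hL.exists_gform_gt
    let Λ := max 1 (max Λ₁ Λ₂)
    have hΛ0 : 0 < Λ := lt_max_of_lt_left one_pos
    have hs := hΛ1 Λ ((le_max_left _ _).trans (le_max_right _ _))
    have hu := hΛ2 Λ ((le_max_right _ _).trans (le_max_right _ _))
    have hne : ∀ {p} {v : TangentSpace (I.prod J) p}, v ≠ 0 → Θ.d p v ≠ 0 := by
      intro p v hv h0
      exact hv (Θ.d_injective p (h0.trans (map_zero _).symm))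
    obtain ⟨G, hG⟩ := exists_metric_of_form Θ (D.continuous_gform hL.cont Λ) (D.gform_symm L Λ)
      (fun p v hv => hL.gform_pos hΛ0 (hmt p v) (hne hv))
    have hlen : ∀ p (v : TangentSpace (I.prod J) p),
        G.len v = √(D.gform L Λ p (Θ.d p v) (Θ.d p v)) := fun p v => by
      rw [Metric.len, hG]
    have hlen' : ∀ p (v : TangentSpace (I.prod J) p),
        G.len (mfderiv (I.prod J) (I.prod J) ft p v) =
          √(D.gform L Λ (D.F p) (D.coc p (Θ.d p v)) (D.coc p (Θ.d p v))) := fun p v => by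
      rw [Metric.len, hG, hF, hcoc]
    have hpos : ∀ {p} {v : TangentSpace (I.prod J) p}, v ≠ 0 →
        0 < D.gform L Λ p (Θ.d p v) (Θ.d p v) := fun hv => hL.gform_pos hΛ0 (hmt _ _) (hne hv)
    have hpos' : ∀ {p} (v : TangentSpace (I.prod J) p),
        0 ≤ D.gform L Λ (D.F p) (D.coc p (Θ.d p v)) (D.coc p (Θ.d p v)) := by
      intro p v
      rw [hF, ← hcoc, ← hG]
      exact G.inner_nonneg _
    have hle : ∀ {p} {A : Submodule ℝ (W × W')}, A ≤ D.tot p →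
        A ≤ LinearMap.range (Θ.d p).toLinearMap := fun h => h.trans (hrange _).le
    have hback' : ∀ p, ∀ ξ ∈ D.tot (ft p), D.coc p (D.symm.coc (D.F p) ξ) = ξ := by
      intro p ξ hξ
      rw [← hF, LinExt.mem_tot] at hξ
      have := LinExt.symm_coc (D := D.symm) (p := D.F p) (ξ := ξ)
        ⟨by rw [← LinExt.sup_swap] at hξ; exact hξ.1, by rw [sup_comm (D.vs _)] at hξ; exact hξ.2⟩
      change D.coc (D.F.symm (D.F p)) _ = _ at this
      rwa [D.F.symm_apply_apply] at this
    have hback : ∀ p (w : TangentSpace (I.prod J) (ft p)),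
        D.coc p (D.symm.coc (D.F p) (Θ.d (ft p) w)) = Θ.d (ft p) w :=
      fun p w => hback' p _ (hmt _ _)
    have hinvs : ∀ p, ∀ ξ ∈ D.gs L (ft p), D.symm.coc (D.F p) ξ ∈ D.gs L p := by
      intro p ξ hξ
      rw [← hF] at hξ
      have := hL.symm.coc_gu hξ
      change _ ∈ D.gs L (D.F.symm (D.F p)) at this
      rwa [D.F.symm_apply_apply] at this
    have hinvc : ∀ p, ∀ ξ ∈ D.gc L (ft p), D.symm.coc (D.F p) ξ ∈ D.gc L p := by
      intro p ξ hξ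
      rw [← hF] at hξ
      have := hL.symm.coc_gc hξ
      change _ ∈ D.gc L (D.F.symm (D.F p)) at this
      rwa [D.F.symm_apply_apply] at this
    have hinvu : ∀ p, ∀ ξ ∈ D.gu L (ft p), D.symm.coc (D.F p) ξ ∈ D.gu L p := by
      intro p ξ hξ
      rw [← hF] at hξ
      have := hL.symm.coc_gs hξ
      change _ ∈ D.gu L (D.F.symm (D.F p)) at this
      rwa [D.F.symm_apply_apply] at this
    refine ⟨G, ?_, ?_, ?_, fun p => disjoint_comap (hinj p) (D.disjoint_gc_gu p), fun p => ?_,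
      fun p => ?_, fun p => ?_, fun p => ?_, fun p v hv hv0 => ?_, fun p v hv hv0 => ?_,
      fun p v hv w hw hv0 hw0 => ?_, fun p v hv w hw hv0 hw0 => ?_⟩
    · exact (D.closed_gs hL.cont).preimage Θ.continuous_total
    · exact (D.closed_gc hL.cont).preimage Θ.continuous_total
    · exact (D.symm.closed_gs hL.cont).preimage Θ.continuous_total
    · have e : T.c p ⊔ T.u p = (D.gc L p ⊔ D.gu L p).comap (Θ.d p).toLinearMap :=
        (comap_sup_of_le (hinj p) (hle (hL.gc_le p)) (hle (hL.gu_le p))).symm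
      rw [e]
      refine ⟨disjoint_comap (hinj p) (D.disjoint_gs p), codisjoint_iff.2 ?_⟩
      have e2 := comap_sup_of_le (hinj p) (hle (hL.gs_le p))
        (hle (sup_le (hL.gc_le p) (hL.gu_le p)))
      refine e2.symm.trans ?_
      rw [hL.sup_eq, hrange]
      exact eq_top_iff.2 fun v _ => ⟨v, rfl⟩
    · refine map_comap_eq (hinj (ft p)) (hle (hL.gs_le p)) (fun v hv => ?_) fun w hw => ?_
      · have := hL.coc_gs hv
        rw [hF] at this
        exact (hcoc p v).symm ▸ this
      · exact ⟨_, hinvs p _ hw, fun v hv => (hcoc p v).trans ((congrArg _ hv).trans (hback p w))⟩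
    · refine map_comap_eq (hinj (ft p)) (hle (hL.gc_le p)) (fun v hv => ?_) fun w hw => ?_
      · have := hL.coc_gc hv
        rw [hF] at this
        exact (hcoc p v).symm ▸ this
      · exact ⟨_, hinvc p _ hw, fun v hv => (hcoc p v).trans ((congrArg _ hv).trans (hback p w))⟩
    · refine map_comap_eq (hinj (ft p)) (hle (hL.gu_le p)) (fun v hv => ?_) fun w hw => ?_
      · have := hL.coc_gu hv
        rw [hF] at this
        exact (hcoc p v).symm ▸ this
      · exact ⟨_, hinvu p _ hw, fun v hv => (hcoc p v).trans ((congrArg _ hv).trans (hback p w))⟩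
    · rw [hlen', hlen]
      exact Real.sqrt_lt_sqrt (hpos' v) (hs p _ hv (hne hv0)).1
    · rw [hlen', hlen]
      exact Real.sqrt_lt_sqrt (hpos hv0).le (hu p _ hv (hne hv0)).1
    · rw [hlen', hlen', hlen, hlen]
      exact sqrt_div_lt (hpos hv0) (hpos hw0) (hpos' v) ((hs p _ hv (hne hv0)).2 _ hw (hne hw0))
    · rw [hlen', hlen', hlen, hlen]
      exact sqrt_div_lt (hpos hw0) (hpos hv0) (hpos' w) ((hu p _ hv (hne hv0)).2 _ hw (hne hw0))

end PHCocycle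

namespace PHCocycle

variable {E : Type*} [NormedAddCommGroup E] [NormedSpace ℝ E]
  {H : Type*} [TopologicalSpace H] {I : ModelWithCorners ℝ E H}
  {X : Type*} [TopologicalSpace X] [ChartedSpace H X]

/-! ### Curves -/

section Curves

variable {D : ∀ x : X, Submodule ℝ (TangentSpace I x)}

theorem mfderiv_comp_curve {Y : Type*} [TopologicalSpace Y] {E' : Type*} [NormedAddCommGroup E']
    [NormedSpace ℝ E'] {H' : Type*} [TopologicalSpace H'] {J : ModelWithCorners ℝ E' H'}
    [ChartedSpace H' Y] {γ : ℝ → X} {f : X → Y} {t : ℝ} (hf : MDifferentiableAt I J f (γ t))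
    (hγ : MDifferentiableAt 𝓘(ℝ, ℝ) I γ t) (r : ℝ) :
    mfderiv 𝓘(ℝ, ℝ) J (f ∘ γ) t r = mfderiv I J f (γ t) (mfderiv 𝓘(ℝ, ℝ) I γ t r) :=
  congrArg (fun A : ℝ →L[ℝ] TangentSpace J (f (γ t)) => A r) (mfderiv_comp t hf hγ)

theorem mfderiv_comp_real {γ : ℝ → X} {s : ℝ → ℝ} {t s' : ℝ} (hs : HasDerivAt s s' t)
    (hγ : MDifferentiableAt 𝓘(ℝ, ℝ) I γ (s t)) :
    mfderiv 𝓘(ℝ, ℝ) I (γ ∘ s) t (1 : ℝ) = s' • mfderiv 𝓘(ℝ, ℝ) I γ (s t) (1 : ℝ) := by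
  have h1 : mfderiv 𝓘(ℝ, ℝ) 𝓘(ℝ, ℝ) s t (1 : ℝ) = s' := by
    rw [mfderiv_eq_fderiv]
    exact (fderiv_apply_one_eq_deriv (f := s)).trans hs.deriv
  refine (congrArg (fun A : ℝ →L[ℝ] TangentSpace I (γ (s t)) => A 1)
    (mfderiv_comp t hγ hs.differentiableAt.mdifferentiableAt)).trans ?_
  change mfderiv 𝓘(ℝ, ℝ) I γ (s t) (mfderiv 𝓘(ℝ, ℝ) 𝓘(ℝ, ℝ) s t (1 : ℝ)) = _
  have h2 : (s' : ℝ) = s' • (1 : ℝ) := (mul_one s').symm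
  exact (congrArg (mfderiv 𝓘(ℝ, ℝ) I γ (s t)) (h1.trans h2)).trans (map_smul _ _ _)

theorem InLeaf.symm {x y : X} (h : InLeaf D x y) : InLeaf D y x := by
  obtain ⟨γ, hγ, h0, h1, ht⟩ := h
  have hs : ∀ t : ℝ, HasDerivAt (fun t : ℝ => 1 - t) (-1) t := fun t => by
    simpa using (hasDerivAt_id t).const_sub 1
  refine ⟨γ ∘ fun t : ℝ => 1 - t, hγ.comp (contDiff_const.sub contDiff_id).contMDiff,
    by simpa using h1, by simpa using h0, fun t hts => ?_⟩
  rw [mfderiv_comp_real (hs t) (hγ.mdifferentiableAt one_ne_zero)]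
  exact Submodule.smul_mem _ _ (ht _ ⟨by linarith [hts.2], by linarith [hts.1]⟩)

theorem InLeaf.map {x y : X} (h : InLeaf D x y) {F : X → X} (hF : ContMDiff I I 1 F)
    (hD : ∀ x, ∀ v ∈ D x, mfderiv I I F x v ∈ D (F x)) : InLeaf D (F x) (F y) := by
  obtain ⟨γ, hγ, h0, h1, ht⟩ := h
  refine ⟨F ∘ γ, hF.comp hγ, congrArg F h0, congrArg F h1, fun t hts => ?_⟩
  rw [mfderiv_comp_curve (hF.mdifferentiableAt one_ne_zero) (hγ.mdifferentiableAt one_ne_zero)]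
  exact hD _ _ (ht t hts)

/-- A curve that is `C¹` near `[0, 1]` and tangent to `D` on `[0, 1]` can be reparametrized to a
curve defined on the whole line. -/
theorem exists_global_curve {γ : ℝ → X} (hγ : ∀ t ∈ Icc (0 : ℝ) 1, ContMDiffAt 𝓘(ℝ, ℝ) I 1 γ t) :
    ∃ s : ℝ → ℝ, ContDiff ℝ 1 s ∧ (∀ t, s t ∈ Icc (0 : ℝ) 1) ∧ s 0 = 0 ∧ s 1 = 1 ∧
      ContMDiff 𝓘(ℝ, ℝ) I 1 (γ ∘ s) ∧ ∀ t, mfderiv 𝓘(ℝ, ℝ) I (γ ∘ s) t (1 : ℝ) =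
        deriv s t • mfderiv 𝓘(ℝ, ℝ) I γ (s t) (1 : ℝ) := by
  have h1 : ∀ t, Real.smoothTransition t ∈ Icc (0 : ℝ) 1 := fun t =>
    ⟨Real.smoothTransition.nonneg t, Real.smoothTransition.le_one t⟩
  have h2 : ContDiff ℝ 1 Real.smoothTransition := Real.smoothTransition.contDiff
  refine ⟨Real.smoothTransition, h2, h1, Real.smoothTransition.zero, Real.smoothTransition.one,
    fun t => (hγ _ (h1 t)).comp t h2.contMDiff.contMDiffAt, fun t => ?_⟩
  exact mfderiv_comp_real (h2.differentiable one_ne_zero t).hasDerivAt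
    ((hγ _ (h1 t)).mdifferentiableAt one_ne_zero)

theorem InLeaf.of_contMDiffAt {γ : ℝ → X} (hγ : ∀ t ∈ Icc (0 : ℝ) 1, ContMDiffAt 𝓘(ℝ, ℝ) I 1 γ t)
    (ht : ∀ t ∈ Icc (0 : ℝ) 1, mfderiv 𝓘(ℝ, ℝ) I γ t (1 : ℝ) ∈ D (γ t)) :
    InLeaf D (γ 0) (γ 1) := by
  obtain ⟨s, -, hs, h0, h1, hc, hd⟩ := exists_global_curve hγ
  refine ⟨γ ∘ s, hc, congrArg γ h0, congrArg γ h1, fun t _ => ?_⟩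
  rw [hd]
  exact Submodule.smul_mem _ _ (ht _ (hs t))

variable {V : Type*} [NormedAddCommGroup V] [NormedSpace ℝ V]

theorem hasDerivAt_comp_curve {γ : ℝ → X} {ψ : X → V} {t : ℝ} (hψ : ContMDiff I 𝓘(ℝ, V) 1 ψ)
    (hγ : MDifferentiableAt 𝓘(ℝ, ℝ) I γ t) :
    HasDerivAt (ψ ∘ γ) (vderiv I ψ (γ t) (mfderiv 𝓘(ℝ, ℝ) I γ t (1 : ℝ))) t := by
  have h1 := mfderiv_comp_curve (hψ.mdifferentiableAt one_ne_zero (x := γ t)) hγ 1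
  have h2 : DifferentiableAt ℝ (ψ ∘ γ) t :=
    ((hψ.mdifferentiableAt one_ne_zero (x := γ t)).comp t hγ).differentiableAt
  have h3 : deriv (ψ ∘ γ) t = vderiv I ψ (γ t) (mfderiv 𝓘(ℝ, ℝ) I γ t (1 : ℝ)) := by
    refine Eq.trans ?_ h1
    rw [mfderiv_eq_fderiv]
    exact (fderiv_apply_one_eq_deriv (f := ψ ∘ γ)).symm
  exact h3 ▸ h2.hasDerivAt

variable [IsManifold I 1 X]

theorem exists_len_le (G : Metric I X) {γ : ℝ → X} (hγ : ContMDiff 𝓘(ℝ, ℝ) I 1 γ) :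
    ∃ ℓ, 0 ≤ ℓ ∧ ∀ t ∈ Icc (0 : ℝ) 1, G.len (mfderiv 𝓘(ℝ, ℝ) I γ t (1 : ℝ)) ≤ ℓ := by
  have h1 : Continuous fun t : ℝ => (⟨t, (1 : ℝ)⟩ : TangentBundle 𝓘(ℝ, ℝ) ℝ) :=
    (tangentBundleModelSpaceHomeomorph 𝓘(ℝ, ℝ)).symm.continuous.comp
      (by fun_prop : Continuous fun t : ℝ => (t, (1 : ℝ)))
  have h2 := G.continuous_len.comp ((hγ.continuous_tangentMap le_rfl).comp h1)
  obtain ⟨C, hC⟩ := isCompact_Icc.exists_bound_of_continuousOn (h2.continuousOn (s := Icc 0 1))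
  exact ⟨max C 0, le_max_right _ _, fun t ht => (le_abs_self _).trans ((hC t ht).trans (le_max_left _ _))⟩

theorem norm_sub_le_of_curve {G : Metric I X} {γ : ℝ → X} (hγ : ContMDiff 𝓘(ℝ, ℝ) I 1 γ) {ψ : X → V}
    (hψ : ContMDiff I 𝓘(ℝ, V) 1 ψ) {C ℓ : ℝ} (hC : 0 ≤ C)
    (hℓ : ∀ t ∈ Icc (0 : ℝ) 1, G.len (mfderiv 𝓘(ℝ, ℝ) I γ t (1 : ℝ)) ≤ ℓ)
    (hψC : ∀ t ∈ Icc (0 : ℝ) 1, ‖vderiv I ψ (γ t) (mfderiv 𝓘(ℝ, ℝ) I γ t (1 : ℝ))‖ ≤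
      C * G.len (mfderiv 𝓘(ℝ, ℝ) I γ t (1 : ℝ))) {s t : ℝ} (hs : s ∈ Icc (0 : ℝ) 1)
      (ht : t ∈ Icc (0 : ℝ) 1) :
    ‖ψ (γ t) - ψ (γ s)‖ ≤ C * ℓ * |t - s| :=
  (convex_Icc (0 : ℝ) 1).norm_image_sub_le_of_norm_hasDerivWithin_le (f := ψ ∘ γ)
    (fun _ _ => (hasDerivAt_comp_curve hψ (hγ.mdifferentiableAt one_ne_zero)).hasDerivWithinAt)
    (fun t ht => (hψC t ht).trans (mul_le_mul_of_nonneg_left (hℓ t ht) hC)) hs ht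

end Curves

/-! ### Holonomy along contracted curves -/

section Contracted

variable [IsManifold I 1 X]

/-- A family of subspaces that is invariant and uniformly contracted under `F`. -/
structure IsContracted (G : Metric I X) (F : X ≃ₘ^1⟮I, I⟯ X)
    (D : ∀ x : X, Submodule ℝ (TangentSpace I x)) (lam : ℝ) : Prop where
  pos : 0 < lam
  lt_one : lam < 1
  maps : ∀ x, ∀ v ∈ D x, mfderiv I I F x v ∈ D (F x)
  contracts : ∀ x, ∀ v ∈ D x, G.len (mfderiv I I F x v) ≤ lam * G.len v

variable {G : Metric I X} {F : X ≃ₘ^1⟮I, I⟯ X} {D : ∀ x : X, Submodule ℝ (TangentSpace I x)}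
  {lam : ℝ} {V : Type*} [NormedAddCommGroup V] [NormedSpace ℝ V]

theorem contMDiff_iterate {X : Type*} [TopologicalSpace X] [ChartedSpace H X] (F : X ≃ₘ^1⟮I, I⟯ X)
    (n : ℕ) : ContMDiff I I 1 F^[n] := by
  induction n with
  | zero => exact contMDiff_id
  | succ n ih => exact ih.comp F.contMDiff

theorem IsContracted.norm_vderiv_iterate_le (h : IsContracted G F D lam) {φ : X → V} {C : ℝ}
    (hφ : ContMDiff I 𝓘(ℝ, V) 1 φ) (hC : ∀ p, ∀ v ∈ D p, ‖vderiv I φ p v‖ ≤ C * G.len v) (n : ℕ) :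
    ∀ p, ∀ v ∈ D p, ‖vderiv I (φ ∘ F^[n]) p v‖ ≤ C * lam ^ n * G.len v := by
  have hC0 : ∀ p, ∀ v ∈ D p, 0 ≤ C * G.len v := fun p v hv => (norm_nonneg _).trans (hC p v hv)
  have key : ∀ n p, ∀ v ∈ D p, ‖vderiv I (φ ∘ F^[n]) p v‖ ≤ lam ^ n * (C * G.len v) := by
    intro n
    induction n with
    | zero => intro p v hv; simpa using hC p v hv
    | succ n ih =>
      intro p v hv
      have h1 : vderiv I (φ ∘ F^[n + 1]) p v =
          vderiv I (φ ∘ F^[n]) (F p) (mfderiv I I F p v) :=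
        congrArg (fun A : TangentSpace I p →L[ℝ] V => A v) (mfderiv_comp p
          ((hφ.comp (contMDiff_iterate F n)).mdifferentiableAt one_ne_zero)
          (F.contMDiff.mdifferentiableAt one_ne_zero))
      rw [h1]
      refine (ih _ _ (h.maps p v hv)).trans ?_
      rw [pow_succ, mul_assoc]
      refine mul_le_mul_of_nonneg_left ?_ (pow_nonneg h.pos.le _)
      rcases le_or_gt 0 C with hC' | hC'
      · rw [mul_left_comm]
        exact mul_le_mul_of_nonneg_left (h.contracts p v hv) hC'
      · have h0 : G.len v = 0 := by
          have := hC0 p v hv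
          have := G.len_nonneg v
          nlinarith
        have h2 : G.len (mfderiv I I F p v) = 0 := by
          have h3 := h.contracts p v hv
          rw [h0, mul_zero] at h3
          exact le_antisymm h3 (G.len_nonneg _)
        rw [h0, h2, mul_zero, mul_zero]
  intro p v hv
  refine (key n p v hv).trans (le_of_eq (by ring))

/-- `γ` is a `C¹` curve tangent to `D` whose speed is at most `ℓ`. -/
structure IsLeafCurve (G : Metric I X) (D : ∀ x : X, Submodule ℝ (TangentSpace I x)) (γ : ℝ → X)
    (ℓ : ℝ) : Prop where
  contMDiff : ContMDiff 𝓘(ℝ, ℝ) I 1 γ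
  mem : ∀ t ∈ Icc (0 : ℝ) 1, mfderiv 𝓘(ℝ, ℝ) I γ t (1 : ℝ) ∈ D (γ t)
  len_le : ∀ t ∈ Icc (0 : ℝ) 1, G.len (mfderiv 𝓘(ℝ, ℝ) I γ t (1 : ℝ)) ≤ ℓ

theorem InLeaf.exists_isLeafCurve (G : Metric I X) {x y : X} (h : InLeaf D x y) :
    ∃ γ ℓ, IsLeafCurve G D γ ℓ ∧ γ 0 = x ∧ γ 1 = y := by
  obtain ⟨γ, hγ, h0, h1, ht⟩ := h
  obtain ⟨ℓ, -, hℓ⟩ := exists_len_le G hγ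
  exact ⟨γ, ℓ, ⟨hγ, ht, hℓ⟩, h0, h1⟩

theorem IsLeafCurve.inLeaf {γ : ℝ → X} {ℓ : ℝ} (h : IsLeafCurve G D γ ℓ) : InLeaf D (γ 0) (γ 1) :=
  ⟨γ, h.contMDiff, rfl, rfl, h.mem⟩

theorem IsLeafCurve.nonneg {γ : ℝ → X} {ℓ : ℝ} (h : IsLeafCurve G D γ ℓ) : 0 ≤ ℓ :=
  (G.len_nonneg _).trans (h.len_le 0 (by simp))

theorem IsContracted.norm_iterate_sub_le (h : IsContracted G F D lam) {φ : X → V} {C ℓ : ℝ}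
    (hC0 : 0 ≤ C) (hφ : ContMDiff I 𝓘(ℝ, V) 1 φ)
    (hC : ∀ p, ∀ v ∈ D p, ‖vderiv I φ p v‖ ≤ C * G.len v) {γ : ℝ → X} (hγ : IsLeafCurve G D γ ℓ)
    (n : ℕ) {s t : ℝ} (hs : s ∈ Icc (0 : ℝ) 1) (ht : t ∈ Icc (0 : ℝ) 1) :
    ‖φ (F^[n] (γ t)) - φ (F^[n] (γ s))‖ ≤ C * lam ^ n * ℓ * |t - s| :=
  norm_sub_le_of_curve (ψ := φ ∘ F^[n]) hγ.contMDiff (hφ.comp (contMDiff_iterate F n))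
    (mul_nonneg hC0 (pow_nonneg h.pos.le _)) hγ.len_le
    (fun t ht => h.norm_vderiv_iterate_le hφ hC n _ _ (hγ.mem t ht)) hs ht

theorem IsContracted.norm_iterate_sub_le' (h : IsContracted G F D lam) {φ : X → V} {C ℓ : ℝ}
    (hC0 : 0 ≤ C) (hφ : ContMDiff I 𝓘(ℝ, V) 1 φ)
    (hC : ∀ p, ∀ v ∈ D p, ‖vderiv I φ p v‖ ≤ C * G.len v) {γ : ℝ → X} (hγ : IsLeafCurve G D γ ℓ)
    (n : ℕ) : ‖φ (F^[n] (γ 0)) - φ (F^[n] (γ 1))‖ ≤ C * ℓ * lam ^ n := by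
  have := h.norm_iterate_sub_le hC0 hφ hC hγ n (s := 1) (t := 0) (by simp) (by simp)
  refine this.trans (le_of_eq ?_)
  norm_num
  ring

theorem IsContracted.abs_holS_le (h : IsContracted G F D lam) {φ : X → ℝ} {C ℓ : ℝ}
    (hC0 : 0 ≤ C) (hφ : ContMDiff I 𝓘(ℝ, ℝ) 1 φ)
    (hC : ∀ p, ∀ v ∈ D p, ‖vderiv I φ p v‖ ≤ C * G.len v) {γ : ℝ → X} (hγ : IsLeafCurve G D γ ℓ) :
    (Summable fun n => φ (F^[n] (γ 0)) - φ (F^[n] (γ 1))) ∧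
      |holS F φ (γ 0) (γ 1)| ≤ C * ℓ * (1 - lam)⁻¹ := by
  have hs := (hasSum_geometric_of_lt_one h.pos.le h.lt_one).mul_left (C * ℓ)
  have hb := h.norm_iterate_sub_le' hC0 hφ hC hγ
  exact ⟨Summable.of_norm_bounded hs.summable hb, tsum_of_norm_bounded hs hb⟩

end Contracted

end PHCocycle

namespace PHCocycle

variable {E : Type*} [NormedAddCommGroup E] [NormedSpace ℝ E]
  {H : Type*} [TopologicalSpace H] {I : ModelWithCorners ℝ E H}
  {X : Type*} [TopologicalSpace X] [ChartedSpace H X] [IsManifold I 1 X]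
  {W : Type*} [NormedAddCommGroup W] [NormedSpace ℝ W] [FiniteDimensional ℝ W]
  {V : Type*} [NormedAddCommGroup V] [NormedSpace ℝ V]

/-! ### Uniform constants -/

section Uniform

variable [CompactSpace X] [T2Space X] (Θ : Framing I X W) (G : Metric I X)

theorem closedSubspaces_top : ClosedSubspaces fun _ : X => (⊤ : Submodule ℝ ℝ) := by
  simp [ClosedSubspaces]

theorem continuous_len_ρ : Continuous fun q : X × W => G.len (Θ.ρ q.1 q.2) :=
  G.continuous_len.comp Θ.cont

theorem Framing.closedSubspaces_img_top : ClosedSubspaces (Θ.img fun _ => ⊤) :=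
  Θ.closedSubspaces_img (by simp [IsClosedFamily])

theorem exists_norm_d_le : ∃ c C : ℝ, 0 < c ∧ 0 < C ∧ ∀ p (v : TangentSpace I p),
    c * ‖Θ.d p v‖ ≤ G.len v ∧ G.len v ≤ C * ‖Θ.d p v‖ := by
  have hh : ∀ (p : X) (t : ℝ) (w : W), G.len (Θ.ρ p (t • w)) = |t| * G.len (Θ.ρ p w) := by
    intro p t w
    rw [map_smul, Metric.len_smul]
  obtain ⟨C, hC, h1⟩ := exists_le_norm_of_homogeneous (n := fun p w => G.len (Θ.ρ p w))
    (continuous_len_ρ Θ G) hh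
  obtain ⟨c, hc, h2⟩ := exists_norm_le_of_homogeneous (n := fun p w => G.len (Θ.ρ p w))
    (continuous_len_ρ Θ G) hh Θ.closedSubspaces_img_top
    (fun p w hw hw0 => G.len_pos (Θ.ρ_ne_zero hw hw0))
  refine ⟨c, C, hc, hC, fun p v => ⟨?_, ?_⟩⟩
  · simpa using h2 p (Θ.d p v) ⟨v, trivial, rfl⟩
  · simpa using h1 p (Θ.d p v)

theorem exists_norm_vderiv_le (Θ : Framing I X W) (G : Metric I X) {φ : X → V} (hφ : ContMDiff I 𝓘(ℝ, V) 1 φ) :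
    ∃ C : ℝ, 0 < C ∧ ∀ p (v : TangentSpace I p), ‖vderiv I φ p v‖ ≤ C * G.len v := by
  obtain ⟨c, _, hc, _, h1⟩ := exists_norm_d_le Θ G
  obtain ⟨C, hC0, hC⟩ := exists_norm_le_of_compact (Θ.continuous_hat hφ)
  refine ⟨(C + 1) / c, by positivity, fun p v => ?_⟩
  rw [← Θ.hat_d φ p v, div_mul_eq_mul_div, le_div_iff₀ hc]
  calc _ ≤ C * ‖Θ.d p v‖ * c := by
        gcongr
        exact (Θ.hat φ p).le_of_opNorm_le (hC p) _
    _ ≤ (C + 1) * (c * ‖Θ.d p v‖) := by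
        have := norm_nonneg (Θ.d p v)
        nlinarith [mul_nonneg hc.le this]
    _ ≤ _ := mul_le_mul_of_nonneg_left (h1 p v).1 (by positivity)

variable {F : X ≃ₘ^1⟮I, I⟯ X} {D : ∀ x : X, Submodule ℝ (TangentSpace I x)}

theorem exists_isContracted (Θ : Framing I X W) (G : Metric I X) (hD : IsClosedFamily D)
    (hmaps : ∀ x, ∀ v ∈ D x, mfderiv I I F x v ∈ D (F x))
    (hc : ∀ x, ∀ v ∈ D x, v ≠ 0 → G.len (mfderiv I I F x v) < G.len v) :
    ∃ lam, IsContracted G F D lam := by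
  have hF : ∀ x, MDifferentiableAt I I F x := fun x => F.contMDiff.mdifferentiableAt one_ne_zero
  have e : ∀ p (v : TangentSpace I p), Θ.ρ (F p) (Θ.lift F p (Θ.d p v)) = mfderiv I I F p v :=
    fun p v => (congrArg (Θ.ρ (F p)) (Θ.lift_d (hF p) v)).trans (Θ.ρ_d _ _)
  obtain ⟨θ, h0, h1, h2⟩ := exists_ratio_lt_one (B := X) (V := W) (W := ℝ)
    (α := fun p w t => G.len (Θ.ρ (F p) (Θ.lift F p w)) * |t|)
    (β := fun p w t => G.len (Θ.ρ p w) * |t|)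
    (((continuous_len_ρ Θ G).comp (f := fun q : X × W × ℝ => (F q.1, Θ.lift F q.1 q.2.1))
      ((F.continuous.comp continuous_fst).prodMk (((Θ.continuous_lift F.contMDiff).comp
        continuous_fst).clm_apply (continuous_fst.comp continuous_snd)))).mul (by fun_prop))
    (((continuous_len_ρ Θ G).comp (f := fun q : X × W × ℝ => (q.1, q.2.1))
      (by fun_prop)).mul (by fun_prop))
    (fun p s t v w => by simp only [map_smul, Metric.len_smul, smul_eq_mul, abs_mul]; ring)
    (fun p s t v w => by simp only [map_smul, Metric.len_smul, smul_eq_mul, abs_mul]; ring)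
    (Θ.closedSubspaces_img hD) closedSubspaces_top
    (fun p v w => mul_nonneg (G.len_nonneg _) (abs_nonneg _))
    (fun p w hw t _ hw0 ht0 => by
      obtain ⟨v, hv, rfl⟩ := hw
      refine mul_lt_mul_of_pos_right ?_ (abs_pos.2 ht0)
      refine lt_of_eq_of_lt (congrArg G.len (e p v)) (lt_of_lt_of_eq (hc p v hv ?_)
        (congrArg G.len (Θ.ρ_d p v)).symm)
      rintro rfl
      exact hw0 (map_zero _))
  refine ⟨θ, h0, h1, hmaps, fun x v hv => ?_⟩
  have := h2 θ le_rfl x (Θ.d x v) (Θ.d_mem_img.2 hv) 1 trivial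
  rw [abs_one, mul_one, mul_one, e, Θ.ρ_d] at this
  exact this

theorem symm_maps_and_contracts (hD : ∀ x, (D x).map (mfderiv I I F x).toLinearMap = D (F x))
    (he : ∀ x, ∀ v ∈ D x, v ≠ 0 → G.len v < G.len (mfderiv I I F x v)) (x : X) :
    ∀ v ∈ D x, mfderiv I I F.symm x v ∈ D (F.symm x) ∧
      (v ≠ 0 → G.len (mfderiv I I F.symm x v) < G.len v) := by
  obtain ⟨q, hq⟩ := F.surjective x
  change F q = x at hq
  subst hq
  intro v hv
  rw [← hD] at hv
  obtain ⟨u, hu, rfl⟩ := hv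
  have key : ∀ (q' : X) (u' : TangentSpace I q'), q' = q → HEq u' u →
      u' ∈ D q' ∧ (u ≠ 0 → G.len u' < G.len (mfderiv I I F q u)) := by
    rintro q' u' rfl h
    rw [eq_of_heq h]
    exact ⟨hu, he _ u hu⟩
  refine (key _ _ (F.symm_apply_apply q) (Framing.mfderiv_symm_apply F q u)).imp_right
    fun h hv => h ?_
  rintro rfl
  exact hv (map_zero _)

end Uniform

/-! ### Legs and holonomies -/

/-- The bundle to which the legs of a given kind are tangent. -/
def Splitting.leaf (T : Splitting I X) : Leg → ∀ x : X, Submodule ℝ (TangentSpace I x)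
  | .stable => T.s
  | .unstable => T.u

/-- The holonomy functional of a leg. -/
noncomputable def holLeg (F : X ≃ₘ^1⟮I, I⟯ X) (φ : X → ℝ) (σ : Leg) (x y : X) : ℝ :=
  match σ with
  | .stable => holS F φ x y
  | .unstable => holU F φ x y

/-- The stable bundle is contracted by `F`, the unstable one by its inverse. -/
structure IsHyperbolicPair (G : Metric I X) (F : X ≃ₘ^1⟮I, I⟯ X) (T : Splitting I X) (lam : ℝ) :
    Prop where
  stable : IsContracted G F T.s lam
  unstable : IsContracted G F.symm T.u lam
  maps_u : ∀ x, ∀ v ∈ T.u x, mfderiv I I F x v ∈ T.u (F x)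

theorem IsContracted.mono {G : Metric I X} {F : X ≃ₘ^1⟮I, I⟯ X}
    {D : ∀ x : X, Submodule ℝ (TangentSpace I x)} {lam lam' : ℝ} (h : IsContracted G F D lam)
    (hle : lam ≤ lam') (h1 : lam' < 1) : IsContracted G F D lam' where
  pos := h.pos.trans_le hle
  lt_one := h1
  maps := h.maps
  contracts x v hv := (h.contracts x v hv).trans (mul_le_mul_of_nonneg_right hle (G.len_nonneg v))

theorem IsPartiallyHyperbolicFor.exists_isHyperbolicPair [CompactSpace X] [T2Space X]
    (Θ : Framing I X W) {G : Metric I X} {F : X ≃ₘ^1⟮I, I⟯ X} {T : Splitting I X}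
    (h : IsPartiallyHyperbolicFor G F T) : ∃ lam, IsHyperbolicPair G F T lam := by
  have hmaps : ∀ {D : ∀ x : X, Submodule ℝ (TangentSpace I x)},
      (∀ x, (D x).map (mfderiv I I F x).toLinearMap = D (F x)) →
      ∀ x, ∀ v ∈ D x, mfderiv I I F x v ∈ D (F x) := fun hD x v hv =>
    hD x ▸ Submodule.mem_map_of_mem hv
  obtain ⟨l₁, h1⟩ := exists_isContracted Θ G h.closed_s (hmaps h.invariant_s) h.contracts
  have hs := symm_maps_and_contracts G h.invariant_u h.expands
  obtain ⟨l₂, h2⟩ := exists_isContracted Θ G (F := F.symm) h.closed_u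
    (fun x v hv => (hs x v hv).1) (fun x v hv => (hs x v hv).2)
  exact ⟨max l₁ l₂, h1.mono (le_max_left _ _) (max_lt h1.lt_one h2.lt_one),
    h2.mono (le_max_right _ _) (max_lt h1.lt_one h2.lt_one), hmaps h.invariant_u⟩

section Hol

variable {G : Metric I X} {F : X ≃ₘ^1⟮I, I⟯ X} {T : Splitting I X} {lam : ℝ} {φ : X → ℝ}

/-- Differences along the orbits of nearby points of a leaf are summable. -/
structure HasHol (F : X ≃ₘ^1⟮I, I⟯ X) (T : Splitting I X) (φ : X → ℝ) : Prop where
  stable : ∀ x y, InLeaf T.s x y → Summable fun n => φ (F^[n] x) - φ (F^[n] y)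
  unstable : ∀ x y, InLeaf T.u x y → Summable fun n => φ (F.symm^[n] x) - φ (F.symm^[n] y)
  maps : ∀ σ x y, InLeaf (T.leaf σ) x y → InLeaf (T.leaf σ) (F x) (F y)

theorem IsHyperbolicPair.inLeaf_map (h : IsHyperbolicPair G F T lam) (σ : Leg) (x y : X)
    (hxy : InLeaf (T.leaf σ) x y) : InLeaf (T.leaf σ) (F x) (F y) := by
  cases σ
  · exact hxy.map F.contMDiff h.stable.maps
  · exact hxy.map F.contMDiff h.maps_u

theorem IsHyperbolicPair.hasHol (h : IsHyperbolicPair G F T lam) [CompactSpace X] [T2Space X]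
    (Θ : Framing I X W) (hφ : ContMDiff I 𝓘(ℝ, ℝ) 1 φ) : HasHol F T φ := by
  obtain ⟨C, hC0, hC⟩ := exists_norm_vderiv_le Θ G hφ
  refine ⟨fun x y hxy => ?_, fun x y hxy => ?_, h.inLeaf_map⟩
  · obtain ⟨γ, ℓ, hγ, rfl, rfl⟩ := hxy.exists_isLeafCurve G
    exact (h.stable.abs_holS_le hC0.le hφ (fun p v _ => hC p v) hγ).1
  · obtain ⟨γ, ℓ, hγ, rfl, rfl⟩ := hxy.exists_isLeafCurve G
    exact (h.unstable.abs_holS_le hC0.le hφ (fun p v _ => hC p v) hγ).1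

theorem holU_eq {x y : X} (h : Summable fun n => φ (F.symm^[n] x) - φ (F.symm^[n] y)) :
    holU F φ x y = φ x - φ y - holS F.symm φ x y := by
  rw [holU, holS, h.tsum_eq_zero_add]
  simp

theorem holS_map {x y : X} (h : Summable fun n => φ (F^[n] x) - φ (F^[n] y)) :
    holS F φ (F x) (F y) = holS F φ x y + φ y - φ x := by
  rw [holS, holS, h.tsum_eq_zero_add]
  simp only [Function.iterate_zero, id, Function.iterate_succ_apply]
  ring

theorem HasHol.holLeg_map (h : HasHol F T φ) {σ : Leg} {x y : X} (hxy : InLeaf (T.leaf σ) x y) :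
    holLeg F φ σ (F x) (F y) = holLeg F φ σ x y + φ y - φ x := by
  cases σ
  · exact holS_map (h.stable x y hxy)
  · have h1 := h.unstable x y hxy
    have h2 := h.unstable _ _ (h.maps _ _ _ hxy)
    have h3 := holS_map (F := F.symm) h2
    simp only [F.symm_apply_apply] at h3
    change holU F φ (F x) (F y) = holU F φ x y + φ y - φ x
    rw [holU_eq h1, holU_eq h2, h3]
    ring

theorem holLeg_symm (F : X ≃ₘ^1⟮I, I⟯ X) (φ : X → ℝ) (σ : Leg) (x y : X) :
    holLeg F φ σ y x = -holLeg F φ σ x y := by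
  cases σ
  · change holS F φ y x = -holS F φ x y
    rw [holS, holS, ← tsum_neg]
    simp
  · change holU F φ y x = -holU F φ x y
    rw [holU, holU, ← tsum_neg]
    simp

theorem IsHyperbolicPair.abs_holLeg_le (h : IsHyperbolicPair G F T lam)
    (hφ : ContMDiff I 𝓘(ℝ, ℝ) 1 φ) {C ℓ : ℝ} (hC0 : 0 ≤ C)
    (hC : ∀ p v, ‖vderiv I φ p v‖ ≤ C * G.len v) {σ : Leg} {γ : ℝ → X}
    (hγ : IsLeafCurve G (T.leaf σ) γ ℓ) :
    |holLeg F φ σ (γ 0) (γ 1)| ≤ C * ℓ * (1 + (1 - lam)⁻¹) := by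
  have hℓ : 0 ≤ ℓ := hγ.nonneg
  cases σ
  · refine (h.stable.abs_holS_le hC0 hφ (fun p v _ => hC p v) hγ).2.trans ?_
    have : 0 ≤ C * ℓ := by positivity
    linarith
  · obtain ⟨h1, h2⟩ := h.unstable.abs_holS_le hC0 hφ (fun p v _ => hC p v) hγ
    have h3 := h.unstable.norm_iterate_sub_le' hC0 hφ (fun p v _ => hC p v) hγ 0
    change |holU F φ (γ 0) (γ 1)| ≤ _
    rw [holU_eq h1]
    refine (abs_sub _ _).trans ?_
    rw [Real.norm_eq_abs, pow_zero, mul_one] at h3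
    change |φ (γ 0) - φ (γ 1)| ≤ _ at h3
    linarith

theorem HasHol.holLeg_sub {ψ : X → ℝ} (h : HasHol F T φ) (h' : HasHol F T ψ) {σ : Leg} {x y : X}
    (hxy : InLeaf (T.leaf σ) x y) :
    holLeg F (fun p => φ p - ψ p) σ x y = holLeg F φ σ x y - holLeg F ψ σ x y := by
  cases σ
  · change holS F (fun p => φ p - ψ p) x y = holS F φ x y - holS F ψ x y
    rw [holS, holS, holS, ← (h.stable x y hxy).tsum_sub (h'.stable x y hxy)]
    exact tsum_congr fun n => by ring
  · change holU F (fun p => φ p - ψ p) x y = holU F φ x y - holU F ψ x y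
    have h1 := (summable_nat_add_iff 1).2 (h.unstable x y hxy)
    have h2 := (summable_nat_add_iff 1).2 (h'.unstable x y hxy)
    rw [holU, holU, holU, ← neg_sub', ← h1.tsum_sub h2]
    exact congrArg _ (tsum_congr fun n => by ring)

end Hol

/-! ### The holonomy relation -/

section HolRel

variable {F : X ≃ₘ^1⟮I, I⟯ X} {T : Splitting I X} {φ : X → ℝ}

/-- `HolRel F T φ x y c`: some `su`-sequence from `x` to `y` has holonomy `c`. -/
inductive HolRel (F : X ≃ₘ^1⟮I, I⟯ X) (T : Splitting I X) (φ : X → ℝ) (x : X) : X → ℝ → Prop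
  | refl : HolRel F T φ x x 0
  | step {y z : X} {c : ℝ} (σ : Leg) (h : HolRel F T φ x y c) (hyz : InLeaf (T.leaf σ) y z) :
      HolRel F T φ x z (c + holLeg F φ σ y z)

theorem HolRel.cast {x y : X} {c d : ℝ} (h : HolRel F T φ x y c) (e : c = d) :
    HolRel F T φ x y d := e ▸ h

theorem HolRel.of_leg {σ : Leg} {x y : X} (h : InLeaf (T.leaf σ) x y) :
    HolRel F T φ x y (holLeg F φ σ x y) := (HolRel.refl.step σ h).cast (zero_add _)

theorem HolRel.trans {x y z : X} {c d : ℝ} (h : HolRel F T φ x y c) (h' : HolRel F T φ y z d) :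
    HolRel F T φ x z (c + d) := by
  induction h' with
  | refl => exact h.cast (add_zero c).symm
  | step σ _ hyz ih => exact (ih.step σ hyz).cast (add_assoc _ _ _)

theorem HolRel.symm {x y : X} {c : ℝ} (h : HolRel F T φ x y c) : HolRel F T φ y x (-c) := by
  induction h with
  | refl => exact HolRel.refl.cast neg_zero.symm
  | @step y z c σ _ hyz ih =>
    refine ((HolRel.of_leg hyz.symm).trans ih).cast ?_
    rw [holLeg_symm]
    ring

theorem HolRel.map (hH : HasHol F T φ) {x y : X} {c : ℝ} (h : HolRel F T φ x y c) :
    HolRel F T φ (F x) (F y) (c + φ y - φ x) := by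
  induction h with
  | refl => exact HolRel.refl.cast (by ring)
  | @step y z c σ _ hyz ih =>
    refine (ih.step σ (hH.maps σ _ _ hyz)).cast ?_
    rw [hH.holLeg_map hyz]
    ring

theorem HolRel.exists_sequence {x y : X} {c : ℝ} (h : HolRel F T φ x y c) :
    ∃ (k : ℕ) (p : ℕ → X) (σ : ℕ → Leg), IsSUSequence T k p σ ∧ p 0 = x ∧ p k = y ∧
      hol F φ k p σ = c := by
  induction h with
  | refl => exact ⟨0, fun _ => x, fun _ => .stable, fun j hj => absurd hj (Nat.not_lt_zero j),
      rfl, rfl, Finset.sum_range_zero _⟩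
  | @step y z c σ _ hyz ih =>
    obtain ⟨k, p, σs, h1, h2, h3, h4⟩ := ih
    have e1 : ∀ j ≤ k, Function.update p (k + 1) z j = p j := fun j hj =>
      Function.update_of_ne (by omega) _ _
    have e2 : ∀ j < k, Function.update σs k σ j = σs j := fun j hj =>
      Function.update_of_ne (by omega) _ _
    refine ⟨k + 1, Function.update p (k + 1) z, Function.update σs k σ, fun j hj => ?_,
      (e1 0 (Nat.zero_le k)).trans h2, Function.update_self _ _ _, ?_⟩
    · rcases Nat.lt_succ_iff_lt_or_eq.1 hj with h | rfl
      · rw [e1 j h.le, e1 (j + 1) h, e2 j h]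
        exact h1 j h
      · rw [e1 j le_rfl, Function.update_self, Function.update_self, h3]
        cases σ <;> exact hyz
    · rw [hol, Finset.sum_range_succ]
      congr 1
      · rw [← h4, hol]
        refine Finset.sum_congr rfl fun j hj => ?_
        have hj := Finset.mem_range.1 hj
        rw [e1 j hj.le, e1 (j + 1) hj, e2 j hj]
      · rw [e1 k le_rfl, Function.update_self, Function.update_self, h3]
        cases σ <;> rfl

theorem IsSUSequence.holRel {k : ℕ} {p : ℕ → X} {σ : ℕ → Leg} (h : IsSUSequence T k p σ) :
    HolRel F T φ (p 0) (p k) (hol F φ k p σ) := by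
  induction k with
  | zero => exact HolRel.refl.cast (Finset.sum_range_zero _).symm
  | succ k ih =>
    have h1 := ih fun j hj => h j (by omega)
    have h2 : InLeaf (T.leaf (σ k)) (p k) (p (k + 1)) := by
      have := h k (by omega)
      cases hσ : σ k <;> rw [hσ] at this <;> exact this
    refine (h1.step (σ k) h2).cast ?_
    rw [hol, hol, Finset.sum_range_succ]
    congr 1

theorem trivialPCF_iff : TrivialPCF F T φ ↔ ∀ x c, HolRel F T φ x x c → c = 0 := by
  refine ⟨fun h x c hc => ?_, fun h k p σ hp h0 => ?_⟩
  · obtain ⟨k, p, σ, h1, h2, h3, rfl⟩ := hc.exists_sequence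
    exact h k p σ h1 (h2.trans h3.symm)
  · have := hp.holRel (F := F) (φ := φ)
    rw [← h0] at this
    exact h _ _ this

theorem TrivialPCF.unique (h : TrivialPCF F T φ) {x y : X} {c d : ℝ} (hc : HolRel F T φ x y c)
    (hd : HolRel F T φ x y d) : c = d := by
  have := trivialPCF_iff.1 h _ _ (hc.trans hd.symm)
  linarith

end HolRel

end PHCocycle

namespace PHCocycle

variable {E : Type*} [NormedAddCommGroup E] [NormedSpace ℝ E] [FiniteDimensional ℝ E]
  {H : Type*} [TopologicalSpace H] {I : ModelWithCorners ℝ E H}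
  {X : Type*} [TopologicalSpace X] [ChartedSpace H X] [IsManifold I 1 X] [BoundarylessManifold I X]
  {W : Type*} [NormedAddCommGroup W] [NormedSpace ℝ W] [FiniteDimensional ℝ W]
  {V : Type*} [NormedAddCommGroup V] [NormedSpace ℝ V]

theorem hasStrictFDerivAt_chart {K : X → V} (hK : ContMDiff I 𝓘(ℝ, V) 1 K) (p₀ : X) :
    HasStrictFDerivAt (K ∘ (extChartAt I p₀).symm) (vderiv I K p₀ : E →L[ℝ] V)
      (extChartAt I p₀ p₀) := by
  have h1 := (contMDiffAt_iff.1 (hK p₀)).2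
  have hint : range I ∈ 𝓝 (extChartAt I p₀ p₀) :=
    mem_interior_iff_mem_nhds.1 (BoundarylessManifold.isInteriorPoint (I := I) (x := p₀))
  have h2 : ContDiffAt ℝ 1 (K ∘ (extChartAt I p₀).symm) (extChartAt I p₀ p₀) :=
    ContDiffWithinAt.contDiffAt h1 hint
  have h3 := h2.hasStrictFDerivAt one_ne_zero
  have h4 : vderiv I K p₀ = fderiv ℝ (K ∘ (extChartAt I p₀).symm) (extChartAt I p₀ p₀) := by
    rw [vderiv, (hK.mdifferentiableAt one_ne_zero).mfderiv]
    exact fderivWithin_of_mem_nhds hint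
  exact h4 ▸ h3

theorem Framing.exists_linearization_nhds (Θ : Framing I X W) {K : X → V}
    (hK : ContMDiff I 𝓘(ℝ, V) 1 K) {η : ℝ} (hη : 0 < η) (p₀ : X) :
    ∃ U, IsOpen U ∧ p₀ ∈ U ∧ ∀ p ∈ U, ∀ q ∈ U,
      ‖K p - K q - Θ.hat K q (Θ.ι p - Θ.ι q)‖ ≤ η * ‖Θ.ι p - Θ.ι q‖ := by
  let e := extChartAt I p₀
  let A : E →L[ℝ] V := vderiv I K p₀
  let B : E →L[ℝ] W := vderiv I Θ.ι p₀
  let R : W →L[ℝ] E := Θ.ρ p₀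
  let C : ℝ := ‖R‖ + 1
  let k : ℝ := ‖Θ.hat K p₀‖
  have hk : 0 ≤ k := norm_nonneg _
  have hC : 0 < C := by positivity
  have hRB : ∀ v, R (B v) = v := Θ.left_inv p₀
  have hAB : ∀ v, Θ.hat K p₀ (B v) = A v := Θ.hat_d K p₀
  let η' : ℝ := min (1 / (2 * C)) (η / (2 * C * (1 + k) + 1))
  have hη' : 0 < η' := lt_min (by positivity) (by positivity)
  have h1 := (hasStrictFDerivAt_chart hK p₀).isLittleO.def hη'
  have h2 := (hasStrictFDerivAt_chart Θ.contMDiff p₀).isLittleO.def hη'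
  have he : ContinuousAt e p₀ := continuousAt_extChartAt p₀
  have hee : Filter.Tendsto (fun q : X × X => (e q.1, e q.2)) (𝓝 (p₀, p₀)) (𝓝 (e p₀, e p₀)) := by
    rw [nhds_prod_eq, nhds_prod_eq]
    exact he.tendsto.prodMap he.tendsto
  have h3 : ∀ᶠ q : X × X in 𝓝 (p₀, p₀), ‖Θ.hat K p₀ - Θ.hat K q.2‖ < η' := by
    have : Continuous fun q : X × X => ‖Θ.hat K p₀ - Θ.hat K q.2‖ :=
      (continuous_const.sub ((Θ.continuous_hat hK).comp continuous_snd)).norm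
    exact this.continuousAt.eventually_lt continuousAt_const (by simpa using hη')
  have h4 : ∀ᶠ q : X × X in 𝓝 (p₀, p₀), q.1 ∈ e.source ∧ q.2 ∈ e.source := by
    have : ∀ᶠ y in 𝓝 p₀, y ∈ e.source := extChartAt_source_mem_nhds p₀
    exact ((continuous_fst.tendsto (p₀, p₀)).eventually this).and
      ((continuous_snd.tendsto (p₀, p₀)).eventually this)
  have key : ∀ᶠ q : X × X in 𝓝 (p₀, p₀),
      ‖K q.1 - K q.2 - Θ.hat K q.2 (Θ.ι q.1 - Θ.ι q.2)‖ ≤ η * ‖Θ.ι q.1 - Θ.ι q.2‖ := by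
    filter_upwards [hee.eventually h1, hee.eventually h2, h3, h4] with q g1 g2 g3 ⟨g4, g5⟩
    have l1 : e.symm (e q.1) = q.1 := e.left_inv g4
    have l2 : e.symm (e q.2) = q.2 := e.left_inv g5
    simp only [Function.comp_apply] at g1 g2
    change ‖K (e.symm (e q.1)) - K (e.symm (e q.2)) - A (e q.1 - e q.2)‖ ≤ _ at g1
    change ‖Θ.ι (e.symm (e q.1)) - Θ.ι (e.symm (e q.2)) - B (e q.1 - e q.2)‖ ≤ _ at g2
    rw [l1, l2] at g1 g2
    set Δ := e q.1 - e q.2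
    set δ := Θ.ι q.1 - Θ.ι q.2
    have b1 : ‖Δ‖ ≤ 2 * C * ‖δ‖ := by
      have c1 : ‖Δ‖ ≤ C * ‖B Δ‖ := by
        calc ‖Δ‖ = ‖R (B Δ)‖ := by rw [hRB]
          _ ≤ ‖R‖ * ‖B Δ‖ := R.le_opNorm _
          _ ≤ C * ‖B Δ‖ := by gcongr; exact le_add_of_nonneg_right zero_le_one
      have c2 : ‖B Δ‖ ≤ ‖δ‖ + η' * ‖Δ‖ := by
        calc ‖B Δ‖ = ‖δ - (δ - B Δ)‖ := by rw [sub_sub_cancel]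
          _ ≤ ‖δ‖ + ‖δ - B Δ‖ := norm_sub_le _ _
          _ ≤ _ := by gcongr
      have c3 : C * η' ≤ 1 / 2 := by
        calc C * η' ≤ C * (1 / (2 * C)) := by gcongr; exact min_le_left _ _
          _ = 1 / 2 := by field_simp
      nlinarith [norm_nonneg Δ]
    have b2 : K q.1 - K q.2 - Θ.hat K q.2 δ = (K q.1 - K q.2 - A Δ) - Θ.hat K p₀ (δ - B Δ) +
        (Θ.hat K p₀ - Θ.hat K q.2) δ := by
      rw [map_sub (Θ.hat K p₀) δ (B Δ), hAB, sub_apply]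
      abel
    have b3 : η' * (2 * C * (1 + k) + 1) ≤ η := by
      rw [← le_div_iff₀ (by positivity)]
      exact min_le_right _ _
    have b4 : ‖Θ.hat K p₀ (δ - B Δ)‖ ≤ k * (η' * ‖Δ‖) :=
      ((Θ.hat K p₀).le_opNorm _).trans (mul_le_mul_of_nonneg_left g2 hk)
    have b5 : ‖(Θ.hat K p₀ - Θ.hat K q.2) δ‖ ≤ η' * ‖δ‖ :=
      ((Θ.hat K p₀ - Θ.hat K q.2).le_opNorm _).trans
        (mul_le_mul_of_nonneg_right g3.le (norm_nonneg _))
    rw [b2]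
    calc _ ≤ ‖K q.1 - K q.2 - A Δ‖ + ‖Θ.hat K p₀ (δ - B Δ)‖ +
          ‖(Θ.hat K p₀ - Θ.hat K q.2) δ‖ := (norm_add_le _ _).trans (by gcongr; exact norm_sub_le _ _)
      _ ≤ η' * ‖Δ‖ + k * (η' * ‖Δ‖) + η' * ‖δ‖ := by gcongr
      _ = η' * (1 + k) * ‖Δ‖ + η' * ‖δ‖ := by ring
      _ ≤ η' * (1 + k) * (2 * C * ‖δ‖) + η' * ‖δ‖ := by gcongr
      _ = η' * (2 * C * (1 + k) + 1) * ‖δ‖ := by ring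
      _ ≤ η * ‖δ‖ := by gcongr
  rw [nhds_prod_eq] at key
  obtain ⟨t, ht, h⟩ := Filter.mem_prod_same_iff.1 key
  obtain ⟨U, hUt, hU, hpU⟩ := mem_nhds_iff.1 ht
  exact ⟨U, hU, hpU, fun p hp q hq => h (Set.mk_mem_prod (hUt hp) (hUt hq))⟩

/-- A function of class `C¹` is uniformly approximated by its differential. -/
theorem Framing.exists_linearization [CompactSpace X] [T2Space X] (Θ : Framing I X W) {K : X → V}
    (hK : ContMDiff I 𝓘(ℝ, V) 1 K) {η : ℝ} (hη : 0 < η) :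
    ∃ ε : ℝ, 0 < ε ∧ ∀ p q, ‖Θ.ι p - Θ.ι q‖ < ε →
      ‖K p - K q - Θ.hat K q (Θ.ι p - Θ.ι q)‖ ≤ η * ‖Θ.ι p - Θ.ι q‖ := by
  choose U hU hpU h using Θ.exists_linearization_nhds hK hη
  have hO : IsOpen (⋃ p, U p ×ˢ U p) := isOpen_iUnion fun p => (hU p).prod (hU p)
  have hc : Continuous Θ.ι := Θ.contMDiff.continuous
  obtain ⟨ε, hε, hle⟩ := hO.isClosed_compl.isCompact.exists_forall_le'
    (f := fun q : X × X => ‖Θ.ι q.1 - Θ.ι q.2‖) (a := 0)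
    (by fun_prop) (fun q hq => by
      rw [norm_pos_iff, sub_ne_zero]
      intro he
      refine hq (mem_iUnion.2 ⟨q.1, hpU _, ?_⟩)
      rw [← Θ.inj he]
      exact hpU _)
  refine ⟨ε, hε, fun p q hpq => ?_⟩
  have : (p, q) ∈ ⋃ p, U p ×ˢ U p := by
    by_contra hcon
    exact absurd (hle (p, q) hcon) (not_le.2 hpq)
  obtain ⟨p₀, hp, hq⟩ := mem_iUnion.1 this
  exact h p₀ p hp q hq

end PHCocycle

namespace PHCocycle

variable {E : Type*} [NormedAddCommGroup E] [NormedSpace ℝ E]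
  {H : Type*} [TopologicalSpace H] {I : ModelWithCorners ℝ E H}
  {X : Type*} [TopologicalSpace X] [ChartedSpace H X] [IsManifold I 1 X]
  {W : Type*} [NormedAddCommGroup W] [NormedSpace ℝ W] [FiniteDimensional ℝ W]
  {V : Type*} [NormedAddCommGroup V] [NormedSpace ℝ V] [CompactSpace X] [T2Space X]

/-! ### Infinitesimal holonomies -/

theorem Framing.isEmbedding (Θ : Framing I X W) : Topology.IsEmbedding Θ.ι :=
  (Θ.contMDiff.continuous.isClosedEmbedding Θ.inj).isEmbedding

theorem Framing.exists_norm_sub_lt {Z : Type*} [PseudoMetricSpace Z] (Θ : Framing I X W) {k : X → Z}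
    (p₀ : X) (hk : ContinuousAt k p₀) {ε : ℝ} (hε : 0 < ε) :
    ∃ δ : ℝ, 0 < δ ∧ ∀ p, ‖Θ.ι p - Θ.ι p₀‖ < δ → dist (k p) (k p₀) < ε := by
  have h1 := hk (Metric.ball_mem_nhds _ hε)
  rw [Filter.mem_map, Θ.isEmbedding.nhds_eq_comap, Filter.mem_comap] at h1
  obtain ⟨t, ht, hts⟩ := h1
  obtain ⟨δ, hδ, hb⟩ := Metric.mem_nhds_iff.1 ht
  exact ⟨δ, hδ, fun p hp => hts (hb (by rwa [Metric.mem_ball, dist_eq_norm]))⟩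

theorem vderiv_sub {a b : X → V} (ha : ContMDiff I 𝓘(ℝ, V) 1 a) (hb : ContMDiff I 𝓘(ℝ, V) 1 b)
    (p : X) (v : TangentSpace I p) :
    vderiv I (fun x => a x - b x) p v = vderiv I a p v - vderiv I b p v :=
  congrArg (fun A : TangentSpace I p →L[ℝ] V => A v) (mfderiv_sub
    (ha.mdifferentiableAt one_ne_zero) (hb.mdifferentiableAt one_ne_zero))

theorem vderiv_sum {a : ℕ → X → V} (ha : ∀ n, ContMDiff I 𝓘(ℝ, V) 1 (a n)) (N : ℕ)
    (p : X) (v : TangentSpace I p) :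
    vderiv I (fun x => ∑ n ∈ Finset.range N, a n x) p v =
      ∑ n ∈ Finset.range N, vderiv I (a n) p v := by
  induction N with
  | zero =>
    simp only [Finset.range_zero, Finset.sum_empty]
    exact congrArg (fun A : TangentSpace I p →L[ℝ] V => A v) (mfderiv_const)
  | succ N ih =>
    simp only [Finset.sum_range_succ]
    rw [← ih]
    exact congrArg (fun A : TangentSpace I p →L[ℝ] V => A v) (mfderiv_add
      ((contMDiff_finsetSum fun n _ => ha n).mdifferentiableAt one_ne_zero)
      ((ha N).mdifferentiableAt one_ne_zero))

/-- The sum of the differentials of `φ ∘ Fⁿ` along a contracted bundle. -/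
theorem IsContracted.exists_sum_form {G : Metric I X} {F : X ≃ₘ^1⟮I, I⟯ X}
    {D : ∀ x : X, Submodule ℝ (TangentSpace I x)} {lam : ℝ} (h : IsContracted G F D lam)
    (Θ : Framing I X W) {P : X → W →L[ℝ] W} (hP : Continuous P)
    (hPm : ∀ p w, P p w ∈ Θ.img D p) (hPe : ∀ p, ∀ w ∈ Θ.img D p, P p w = w)
    {φ : X → ℝ} (hφ : ContMDiff I 𝓘(ℝ, ℝ) 1 φ) :
    ∃ a : X → W →L[ℝ] ℝ, Continuous a ∧ (∀ p w, P p w = 0 → a p w = 0) ∧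
      ∀ ε > 0, ∀ᶠ N in Filter.atTop, ∀ p, ∀ v ∈ D p,
        ‖vderiv I (fun x => ∑ n ∈ Finset.range N, φ (F^[n] x)) p v - a p (Θ.d p v)‖ ≤
          ε * ‖Θ.d p v‖ := by
  obtain ⟨c, C₁, _, hC₁, h1⟩ := exists_norm_d_le Θ G
  obtain ⟨C₂, hC₂, h2⟩ := exists_norm_vderiv_le Θ G hφ
  obtain ⟨K, hK, h3⟩ := exists_norm_le_of_compact hP
  have hφn : ∀ n, ContMDiff I 𝓘(ℝ, ℝ) 1 (fun x => φ (F^[n] x)) := fun n =>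
    hφ.comp (contMDiff_iterate F n)
  let f : ℕ → X → W →L[ℝ] ℝ := fun n p => Θ.hat (fun x => φ (F^[n] x)) p ∘L P p
  have hf : ∀ n, Continuous (f n) := fun n => (Θ.continuous_hat (hφn n)).clm_comp hP
  have hfa : ∀ n p, ∀ v ∈ D p, f n p (Θ.d p v) = vderiv I (fun x => φ (F^[n] x)) p v := by
    intro n p v hv
    change Θ.hat _ p (P p (Θ.d p v)) = _
    rw [hPe p _ (Θ.d_mem_img.2 hv), Θ.hat_d]
  let u : ℕ → ℝ := fun n => C₂ * C₁ * K * lam ^ n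
  have hu : Summable u := (summable_geometric_of_lt_one h.pos.le h.lt_one).mul_left _
  have hfu : ∀ n p, ‖f n p‖ ≤ u n := by
    intro n p
    have hu0 : 0 ≤ u n := mul_nonneg (by positivity) (pow_nonneg h.pos.le n)
    refine (f n p).opNorm_le_bound hu0 fun w => ?_
    obtain ⟨v, hv, hvw⟩ := hPm p w
    have e : f n p w = vderiv I (φ ∘ F^[n]) p v := by
      change Θ.hat _ p (P p w) = _
      rw [← hvw]
      exact Θ.hat_d _ p v
    rw [e]
    calc _ ≤ C₂ * lam ^ n * G.len v := h.norm_vderiv_iterate_le hφ (fun p v _ => h2 p v) n p v hv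
      _ ≤ C₂ * lam ^ n * (C₁ * (K * ‖w‖)) := by
        have := h.pos
        gcongr
        refine (h1 p v).2.trans ?_
        gcongr
        refine (congrArg norm hvw).trans_le ?_
        exact (P p).le_of_opNorm_le (h3 p) w
      _ = _ := by simp only [u]; ring
  refine ⟨fun p => ∑' n, f n p, continuous_tsum hf hu hfu, fun p w hw => ?_, fun ε hε => ?_⟩
  · have hs : Summable fun n => f n p := Summable.of_norm_bounded hu fun n => hfu n p
    have := (ContinuousLinearMap.apply ℝ ℝ w).map_tsum hs
    refine this.trans ?_
    have : ∀ n, f n p w = 0 := fun n => by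
      change Θ.hat _ p (P p w) = 0
      rw [hw, map_zero]
    simp [this]
  · have := Metric.tendstoUniformly_iff.1 (tendstoUniformly_tsum_nat hu hfu) ε hε
    filter_upwards [this] with N hN p v hv
    have e : vderiv I (fun x => ∑ n ∈ Finset.range N, φ (F^[n] x)) p v =
        (∑ n ∈ Finset.range N, f n p) (Θ.d p v) := by
      rw [vderiv_sum hφn, sum_apply]
      exact Finset.sum_congr rfl fun n _ => (hfa n p v hv).symm
    rw [e, ← sub_apply]
    refine ContinuousLinearMap.le_of_opNorm_le _ ?_ _
    rw [norm_sub_rev]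
    exact (dist_eq_norm (∑' n, f n p) _ ▸ hN p).le

/-- Mean value inequality for a limit of `C¹` functions. -/
theorem exists_abs_sub_form_le (Θ : Framing I X W) (G : Metric I X)
    {D : ∀ x : X, Submodule ℝ (TangentSpace I x)} {a : X → W →L[ℝ] ℝ} (ha : Continuous a)
    {ψ : ℕ → X → ℝ} (hψ : ∀ N, ContMDiff I 𝓘(ℝ, ℝ) 1 (ψ N))
    (hψa : ∀ ε > 0, ∀ᶠ N in Filter.atTop, ∀ p, ∀ v ∈ D p,
        ‖vderiv I (ψ N) p v - a p (Θ.d p v)‖ ≤ ε * ‖Θ.d p v‖)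
    {k : X → X → ℝ} (hk : ∀ x y, InLeaf D x y →
      Filter.Tendsto (fun N => ψ N x - ψ N y) Filter.atTop (𝓝 (k x y))) (p₀ : X) {ε : ℝ}
    (hε : 0 < ε) :
    ∃ δ : ℝ, 0 < δ ∧ ∀ γ ℓ, IsLeafCurve G D γ ℓ →
      (∀ t ∈ Icc (0 : ℝ) 1, ‖Θ.ι (γ t) - Θ.ι p₀‖ < δ) →
      |k (γ 0) (γ 1) - a p₀ (Θ.ι (γ 0) - Θ.ι (γ 1))| ≤ ε * ℓ := by
  obtain ⟨c, _, hc, _, h1⟩ := exists_norm_d_le Θ G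
  obtain ⟨δ, hδ, h2⟩ := Θ.exists_norm_sub_lt p₀ ha.continuousAt (ε := ε * c / 2) (by positivity)
  refine ⟨δ, hδ, fun γ ℓ hγ hclose => ?_⟩
  have hlim := ((hk _ _ hγ.inLeaf).sub_const (a p₀ (Θ.ι (γ 0) - Θ.ι (γ 1)))).abs
  refine le_of_tendsto hlim ?_
  filter_upwards [hψa (ε * c / 2) (by positivity)] with N hN
  have ha₀ : ContMDiff I 𝓘(ℝ, ℝ) 1 fun x => a p₀ (Θ.ι x) :=
    (a p₀).contDiff.contMDiff.comp Θ.contMDiff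
  have hd : ∀ p (v : TangentSpace I p), vderiv I (fun x => a p₀ (Θ.ι x)) p v = a p₀ (Θ.d p v) :=
    fun p v => vderiv_clm_comp (a p₀) (Θ.contMDiff.mdifferentiableAt one_ne_zero) v
  have := norm_sub_le_of_curve hγ.contMDiff ((hψ N).sub ha₀) hε.le hγ.len_le (fun t ht => ?_)
    (s := 1) (t := 0) (by simp) (by simp)
  · simp only [zero_sub, abs_neg, abs_one, mul_one, Real.norm_eq_abs] at this
    refine le_trans (le_of_eq (congrArg _ ?_)) this
    simp only [map_sub]
    ring
  · set v := mfderiv 𝓘(ℝ, ℝ) I γ t (1 : ℝ)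
    have e : vderiv I (fun x => ψ N x - a p₀ (Θ.ι x)) (γ t) v =
        (vderiv I (ψ N) (γ t) v - a (γ t) (Θ.d _ v)) + (a (γ t) - a p₀) (Θ.d _ v) := by
      refine (vderiv_sub (hψ N) ha₀ _ _).trans ?_
      rw [hd, sub_apply]
      ring
    rw [e]
    calc _ ≤ ε * c / 2 * ‖Θ.d _ v‖ + ε * c / 2 * ‖Θ.d _ v‖ := by
          refine (norm_add_le _ _).trans (add_le_add (hN _ _ (hγ.mem t ht)) ?_)
          refine ContinuousLinearMap.le_of_opNorm_le _ ?_ _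
          rw [← dist_eq_norm]
          exact (h2 _ (hclose t ht)).le
      _ = ε * (c * ‖Θ.d _ v‖) := by ring
      _ ≤ _ := mul_le_mul_of_nonneg_left (h1 _ _).1 hε.le

/-- The holonomies of short legs are approximated by a continuous form. -/
theorem IsHyperbolicPair.exists_form {G : Metric I X} {F : X ≃ₘ^1⟮I, I⟯ X} {T : Splitting I X}
    {lam : ℝ} (h : IsHyperbolicPair G F T lam) (Θ : Framing I X W) {Ps Pu : X → W →L[ℝ] W}
    (hPs : Continuous Ps) (hPu : Continuous Pu)
    (hs : ∀ p w, Ps p w ∈ Θ.img T.s p) (hs' : ∀ p, ∀ w ∈ Θ.img T.s p, Ps p w = w ∧ Pu p w = 0)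
    (hu : ∀ p w, Pu p w ∈ Θ.img T.u p) (hu' : ∀ p, ∀ w ∈ Θ.img T.u p, Pu p w = w ∧ Ps p w = 0)
    {φ : X → ℝ} (hφ : ContMDiff I 𝓘(ℝ, ℝ) 1 φ) :
    ∃ a : X → W →L[ℝ] ℝ, Continuous a ∧ ∀ p₀, ∀ ε > 0, ∃ δ : ℝ, 0 < δ ∧
      ∀ σ γ ℓ, IsLeafCurve G (T.leaf σ) γ ℓ →
        (∀ t ∈ Icc (0 : ℝ) 1, ‖Θ.ι (γ t) - Θ.ι p₀‖ < δ) →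
        |holLeg F φ σ (γ 0) (γ 1) - a p₀ (Θ.ι (γ 0) - Θ.ι (γ 1))| ≤ ε * ℓ := by
  have hH := h.hasHol Θ hφ
  obtain ⟨a₁, c1, z1, l1⟩ := h.stable.exists_sum_form Θ hPs hs (fun p w hw => (hs' p w hw).1) hφ
  obtain ⟨a₂, c2, z2, l2⟩ := h.unstable.exists_sum_form Θ hPu hu (fun p w hw => (hu' p w hw).1) hφ
  let a : X → W →L[ℝ] ℝ := fun p => a₁ p + (Θ.hat φ p ∘L Pu p - a₂ p)
  have ha : Continuous a := c1.add (((Θ.continuous_hat hφ).clm_comp hPu).sub c2)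
  have hφn : ∀ (F : X ≃ₘ^1⟮I, I⟯ X) N,
      ContMDiff I 𝓘(ℝ, ℝ) 1 (fun x => ∑ n ∈ Finset.range N, φ (F^[n] x)) := fun F N =>
    contMDiff_finsetSum fun n _ => hφ.comp (contMDiff_iterate F n)
  refine ⟨a, ha, fun p₀ ε hε => ?_⟩
  obtain ⟨δ₁, hδ₁, m1⟩ := exists_abs_sub_form_le Θ G (D := T.s) ha
    (ψ := fun N x => ∑ n ∈ Finset.range N, φ (F^[n] x)) (hφn F) (fun ε hε => by
      filter_upwards [l1 ε hε] with N hN p v hv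
      have hd := hs' p _ (Θ.d_mem_img.2 hv)
      have e : a p (Θ.d p v) = a₁ p (Θ.d p v) := by
        simp only [a, add_apply, sub_apply, ContinuousLinearMap.comp_apply, hd.2, map_zero,
          z2 p _ hd.2, sub_zero, add_zero]
      rw [e]
      exact hN p v hv) (k := holS F φ) (fun x y hxy => by
      have := (hH.stable x y hxy).hasSum.tendsto_sum_nat
      simp only [Finset.sum_sub_distrib] at this
      exact this) p₀ hε
  obtain ⟨δ₂, hδ₂, m2⟩ := exists_abs_sub_form_le Θ G (D := T.u) ha
    (ψ := fun N x => φ x - ∑ n ∈ Finset.range N, φ (F.symm^[n] x))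
    (fun N => hφ.sub (hφn F.symm N)) (fun ε hε => by
      filter_upwards [l2 ε hε] with N hN p v hv
      have hd := hu' p _ (Θ.d_mem_img.2 hv)
      have e : a p (Θ.d p v) = vderiv I φ p v - a₂ p (Θ.d p v) := by
        simp only [a, add_apply, sub_apply, ContinuousLinearMap.comp_apply, hd.1, Θ.hat_d,
          z1 p _ hd.2, zero_add]
      rw [e, vderiv_sub hφ (hφn F.symm N), sub_sub_sub_cancel_left, norm_sub_rev]
      exact hN p v hv) (k := holU F φ) (fun x y hxy => by
      have h1 := hH.unstable x y hxy
      have := h1.hasSum.tendsto_sum_nat.const_sub (φ x - φ y)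
      rw [holU_eq h1]
      refine this.congr fun N => ?_
      rw [Finset.sum_sub_distrib]
      ring) p₀ hε
  refine ⟨min δ₁ δ₂, lt_min hδ₁ hδ₂, fun σ γ ℓ hγ hc => ?_⟩
  cases σ
  · exact m1 γ ℓ hγ fun t ht => (hc t ht).trans_le (min_le_left _ _)
  · exact m2 γ ℓ hγ fun t ht => (hc t ht).trans_le (min_le_right _ _)

end PHCocycle

namespace PHCocycle

variable {E : Type*} [NormedAddCommGroup E] [NormedSpace ℝ E] [FiniteDimensional ℝ E]
  {H : Type*} [TopologicalSpace H] {I : ModelWithCorners ℝ E H}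
  {X : Type*} [TopologicalSpace X] [ChartedSpace H X] [IsManifold I 1 X] [BoundarylessManifold I X]
  {W : Type*} [NormedAddCommGroup W] [NormedSpace ℝ W] [FiniteDimensional ℝ W]

/-! ### Integral curves of continuous vector fields -/

theorem extChartAt_target_mem_nhds_of_boundaryless (x : X) :
    (extChartAt I x).target ∈ 𝓝 (extChartAt I x x) := by
  have h := extChartAt_target_mem_nhdsWithin (I := I) x
  rwa [nhdsWithin_eq_nhds.2 (mem_interior_iff_mem_nhds.1
    (BoundarylessManifold.isInteriorPoint (I := I) (x := x)))] at h

/-- The radial retraction on a ball. -/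
noncomputable def ballRetract (c : E) (R : ℝ) (z : E) : E := c + (R / max R ‖z - c‖) • (z - c)

theorem continuous_ballRetract (c : E) {R : ℝ} (hR : 0 < R) : Continuous (ballRetract c R) := by
  unfold ballRetract
  refine continuous_const.add (((continuous_const.div (by fun_prop) fun z => ?_)).smul (by fun_prop))
  exact (lt_max_of_lt_left hR).ne'

theorem ballRetract_mem (c : E) {R : ℝ} (hR : 0 < R) (z : E) :
    ballRetract c R z ∈ Metric.closedBall c R := by
  have h : 0 < max R ‖z - c‖ := lt_max_of_lt_left hR
  rw [Metric.mem_closedBall, dist_eq_norm, ballRetract, add_sub_cancel_left, norm_smul,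
    Real.norm_of_nonneg (by positivity), div_mul_eq_mul_div, div_le_iff₀ h]
  exact mul_le_mul_of_nonneg_left (le_max_right _ _) hR.le

theorem ballRetract_of_mem (c : E) {R : ℝ} (hR : 0 < R) {z : E} (hz : z ∈ Metric.closedBall c R) :
    ballRetract c R z = z := by
  rw [Metric.mem_closedBall, dist_eq_norm] at hz
  rw [ballRetract, max_eq_left hz, div_self hR.ne', one_smul, add_sub_cancel]

/-- **Peano's existence theorem** for small continuous time-dependent vector fields. -/
theorem Framing.exists_integral_curve [CompactSpace X] [T2Space X] (Ψ : Framing I X W) (y₀ : X)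
    {U : Set X} (hU : U ∈ 𝓝 y₀) :
    ∃ r : ℝ, 0 < r ∧ ∀ y₁, ‖Ψ.ι y₁ - Ψ.ι y₀‖ < r → ∀ b : ℝ → X → W,
      ContinuousOn (fun q : ℝ × X => b q.1 q.2) (univ ×ˢ U) → (∀ t, ∀ y ∈ U, ‖b t y‖ ≤ r) →
      ∃ γ : ℝ → X, γ 0 = y₁ ∧ ∀ t ∈ Icc (0 : ℝ) 1, γ t ∈ U ∧ ContMDiffAt 𝓘(ℝ, ℝ) I 1 γ t ∧
        mfderiv 𝓘(ℝ, ℝ) I γ t (1 : ℝ) = Ψ.ρ (γ t) (b t (γ t)) := by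
  obtain ⟨U₀, hU₀, hUT, D, hD, hDd⟩ := exists_local_left_inverse Ψ.contMDiff Ψ.d_injective y₀
  set T := trivializationAt E (TangentSpace I : X → Type _) y₀ with hT
  set e := extChartAt I y₀ with he
  have hTs : T.baseSet = (chartAt H y₀).source := rfl
  have hsymm : ContMDiffOn 𝓘(ℝ, E) I 1 e.symm e.target := contMDiffOn_extChartAt_symm y₀
  have hnhds : e.target ∩ e.symm ⁻¹' (U ∩ U₀) ∈ 𝓝 (e y₀) :=
    Filter.inter_mem (extChartAt_target_mem_nhds_of_boundaryless y₀)
      ((continuousAt_extChartAt_symm (I := I) y₀).preimage_mem_nhds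
        (by rw [extChartAt_to_inv]; exact Filter.inter_mem hU hU₀))
  obtain ⟨R, hR, hball⟩ := Metric.nhds_basis_closedBall.mem_iff.1 hnhds
  have hproper : ProperSpace E := FiniteDimensional.proper ℝ E
  let L : E → W →L[ℝ] E := fun z => D (e.symm z) ∘L Ψ.proj (e.symm z)
  have hsc : ContinuousOn e.symm (Metric.closedBall (e y₀) R) :=
    hsymm.continuousOn.mono fun z hz => (hball hz).1
  have hL : ContinuousOn L (Metric.closedBall (e y₀) R) :=
    (hD.comp hsc fun z hz => (hball hz).2.2).clm_comp
      (Ψ.continuous_proj.comp_continuousOn hsc)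
  obtain ⟨C, hC⟩ := (isCompact_closedBall (e y₀) R).exists_bound_of_continuousOn hL
  obtain ⟨δ, hδ, hclose⟩ := Ψ.exists_norm_sub_lt y₀ (continuousAt_extChartAt (I := I) y₀)
    (half_pos hR)
  obtain ⟨δ', hδ', hclose'⟩ : ∃ δ : ℝ, 0 < δ ∧ ∀ p, ‖Ψ.ι p - Ψ.ι y₀‖ < δ → p ∈ e.source := by
    have h1 : e.source ∈ 𝓝 y₀ := extChartAt_source_mem_nhds y₀
    rw [Ψ.isEmbedding.nhds_eq_comap, Filter.mem_comap] at h1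
    obtain ⟨t, ht, hts⟩ := h1
    obtain ⟨δ, hδ, hb⟩ := Metric.mem_nhds_iff.1 ht
    exact ⟨δ, hδ, fun p hp => hts (hb (by rwa [Metric.mem_ball, dist_eq_norm]))⟩
  have hC0 : 0 ≤ C := (norm_nonneg _).trans (hC (e y₀) (Metric.mem_closedBall_self hR.le))
  refine ⟨min (min δ δ') (R / (4 * (C + 1))), by positivity, fun y₁ hy₁ b hb hbr => ?_⟩
  set r := min (min δ δ') (R / (4 * (C + 1)))
  have hr : 0 < r := by positivity
  have hCr : C * r ≤ R / 4 := by
    calc C * r ≤ (C + 1) * (R / (4 * (C + 1))) := by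
          gcongr
          · linarith
          · exact min_le_right _ _
      _ = R / 4 := by field_simp
  have hy₁s : y₁ ∈ e.source :=
    hclose' _ (hy₁.trans_le ((min_le_left _ _).trans (min_le_right _ _)))
  have hy₁d : dist (e y₁) (e y₀) < R / 2 :=
    hclose _ (hy₁.trans_le ((min_le_left _ _).trans (min_le_left _ _)))
  let v : ℝ → E → E := fun t z => L z (b t (e.symm z))
  have hv : ContinuousOn (fun q : ℝ × E => v q.1 q.2) (univ ×ˢ Metric.closedBall (e y₀) R) := by
    refine (hL.comp continuousOn_snd fun q hq => hq.2).clm_apply ?_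
    exact hb.comp (f := fun q : ℝ × E => (q.1, e.symm q.2))
      (continuousOn_fst.prodMk (hsc.comp continuousOn_snd fun q hq => hq.2))
      fun q hq => ⟨trivial, (hball hq.2).2.1⟩
  have hG : Continuous fun q : ℝ × E => v q.1 (ballRetract (e y₀) R q.2) :=
    hv.comp_continuous (f := fun q : ℝ × E => (q.1, ballRetract (e y₀) R q.2))
      (continuous_fst.prodMk ((continuous_ballRetract _ hR).comp continuous_snd))
      fun q => ⟨trivial, ballRetract_mem _ hR _⟩
  obtain ⟨y, hy0, hy1, hy2, hy3⟩ := exists_solution_of_continuous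
    (G := fun t z => v t (ballRetract (e y₀) R z)) hG (K := C * r) (fun t z => by
      have hz := ballRetract_mem (e y₀) hR z
      refine ((L _).le_of_opNorm_le (hC _ hz) _).trans ?_
      gcongr
      exact hbr _ _ (hball hz).2.1) (e y₁)
  have hyb : ∀ t ∈ Icc (0 : ℝ) 1, y t ∈ Metric.ball (e y₀) R := by
    intro t ht
    have h1 := hy3 t
    rw [abs_of_nonneg ht.1, ← dist_eq_norm] at h1
    have h2 : C * r * t ≤ R / 4 :=
      (mul_le_of_le_one_right (by positivity) ht.2).trans hCr
    rw [Metric.mem_ball]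
    linarith [dist_triangle (y t) (e y₁) (e y₀)]
  refine ⟨e.symm ∘ y, by simp [hy0, e.left_inv hy₁s], fun t ht => ?_⟩
  have hyt := hyb t ht
  have hyt' := Metric.ball_subset_closedBall hyt
  have htarget : e.target ∈ 𝓝 (y t) :=
    Filter.mem_of_superset (Metric.isOpen_ball.mem_nhds hyt)
      fun z hz => (hball (Metric.ball_subset_closedBall hz)).1
  have hγ : ContMDiffAt 𝓘(ℝ, ℝ) I 1 (e.symm ∘ y) t :=
    ((hsymm _ (hball hyt').1).contMDiffAt htarget).comp t hy1.contMDiff.contMDiffAt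
  refine ⟨(hball hyt').2.1, hγ, ?_⟩
  set p := (e.symm ∘ y) t with hp
  have hpU : p ∈ U₀ := (hball hyt').2.2
  have hpc : p ∈ (chartAt H y₀).source := hUT hpU
  have hpT : p ∈ T.baseSet := hpc
  have hde : HasDerivAt (e ∘ (e.symm ∘ y)) (L (y t) (b t p)) t := by
    have h1 := hy2 t ht.1
    simp only [ballRetract_of_mem _ hR hyt'] at h1
    refine h1.congr_of_eventuallyEq ?_
    filter_upwards [hy1.continuous.continuousAt.preimage_mem_nhds htarget] with s hs
    exact e.right_inv hs
  have h1 : mfderiv I 𝓘(ℝ, E) e p (mfderiv 𝓘(ℝ, ℝ) I (e.symm ∘ y) t (1 : ℝ)) = L (y t) (b t p) := by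
    refine (mfderiv_comp_curve ((contMDiffAt_extChartAt' (n := 1) hpc).mdifferentiableAt
      one_ne_zero) (hγ.mdifferentiableAt one_ne_zero) 1).symm.trans ?_
    rw [mfderiv_eq_fderiv]
    exact (fderiv_apply_one_eq_deriv (f := e ∘ (e.symm ∘ y))).trans hde.deriv
  have h2 : T.continuousLinearMapAt ℝ p = mfderiv I 𝓘(ℝ, E) e p :=
    TangentBundle.continuousLinearMapAt_trivializationAt hpc
  have h3 : L (y t) (b t p) = T.continuousLinearMapAt ℝ p (Ψ.ρ p (b t p)) :=
    hDd p hpU (Ψ.ρ p (b t p))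
  have h4 : T.continuousLinearMapAt ℝ p (mfderiv 𝓘(ℝ, ℝ) I (e.symm ∘ y) t (1 : ℝ)) =
      T.continuousLinearMapAt ℝ p (Ψ.ρ p (b t p)) :=
    (congrArg (fun A : TangentSpace I p →L[ℝ] E =>
      A (mfderiv 𝓘(ℝ, ℝ) I (e.symm ∘ y) t (1 : ℝ))) h2).trans (h1.trans h3)
  have h5 := congrArg (T.symmL ℝ p) h4
  rwa [T.symmL_continuousLinearMapAt hpT, T.symmL_continuousLinearMapAt hpT] at h5

end PHCocycle

namespace PHCocycle

/-! ### Invariant cones -/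

theorem le_of_hyperbolic_sequence {s u : ℕ → ℝ} {θ κ η K : ℝ} (hs : ∀ n, 0 ≤ s n)
    (hθ0 : 0 < θ) (hκ : 0 < κ) (hη : 0 ≤ η)
    (hsmall : η * (κ⁻¹ + 1) * (2 * (1 + κ)) ≤ 1 - θ) (hθ1 : θ < 1)
    (h1 : ∀ n, s (n + 1) ≤ θ * s n + η * (s n + u n))
    (h2 : ∀ n, u n ≤ θ * u (n + 1) + η * (s n + u n)) (hK : ∀ n, u n ≤ K) : u 0 ≤ κ * s 0 := by
  by_contra! hcon
  set τ := η * (κ⁻¹ + 1) with hτ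
  have hτ0 : 0 ≤ τ := by positivity
  have hτ1 : τ * (1 + κ) ≤ 1 - θ := by nlinarith
  have hτ2 : 2 * τ ≤ 1 - θ := by nlinarith
  have hu0 : 0 < u 0 := (mul_nonneg hκ.le (hs 0)).trans_lt hcon
  have hρ : 1 < (1 - τ) / θ := by
    rw [one_lt_div hθ0]
    linarith
  have key : ∀ n, κ * s n ≤ u n ∧ ((1 - τ) / θ) ^ n * u 0 ≤ u n := by
    intro n
    induction n with
    | zero => simpa using hcon.le
    | succ n ih =>
      obtain ⟨i1, i2⟩ := ih
      have hun : 0 ≤ u n := (mul_nonneg hκ.le (hs n)).trans i1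
      have i3 : s n ≤ κ⁻¹ * u n := by rwa [inv_mul_eq_div, le_div_iff₀' hκ]
      have i4 : η * (s n + u n) ≤ τ * u n := by
        rw [hτ, mul_assoc]
        gcongr
        linarith
      have i5 : (1 - τ) * u n ≤ θ * u (n + 1) := by linarith [h2 n]
      have i6 : (1 - τ) / θ * u n ≤ u (n + 1) := by
        rw [div_mul_eq_mul_div, div_le_iff₀ hθ0]
        linarith
      have i7 : u n ≤ u (n + 1) := by nlinarith
      refine ⟨?_, ?_⟩
      · have := mul_le_mul_of_nonneg_left ((h1 n).trans (add_le_add_right i4 _)) hκ.le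
        nlinarith
      · rw [pow_succ', mul_assoc]
        exact (mul_le_mul_of_nonneg_left i2 (by linarith)).trans i6
  have hlim : Filter.Tendsto (fun n => ((1 - τ) / θ) ^ n * u 0) Filter.atTop Filter.atTop :=
    (tendsto_pow_atTop_atTop_of_one_lt hρ).atTop_mul_const hu0
  obtain ⟨n, hn⟩ := (hlim.eventually_gt_atTop K).exists
  linarith [(key n).2, hK n]

variable {B : Type*} [TopologicalSpace B]
  {F : Type*} [NormedAddCommGroup F] [NormedSpace ℝ F]
  {H' : Type*} [TopologicalSpace H'] {J : ModelWithCorners ℝ F H'}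
  {N : Type*} [TopologicalSpace N] [ChartedSpace H' N] [IsManifold J 1 N]
  {W : Type*} [NormedAddCommGroup W] [NormedSpace ℝ W]
  {W' : Type*} [NormedAddCommGroup W'] [NormedSpace ℝ W']

/-- The vertical cocycle of `D` is the differential, along the fibres, of the homeomorphism
`D.F`. -/
structure IsFibred (D : LinExt (B × N) W W') (Ψ : Framing J N W') : Prop where
  sum : ∀ p w, D.Qs p w + D.Qu p w = Ψ.proj p.2 w
  lin : ∀ η : ℝ, 0 < η → ∃ ε : ℝ, 0 < ε ∧ ∀ x y y', ‖Ψ.ι y' - Ψ.ι y‖ < ε →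
    ‖Ψ.ι (D.F (x, y')).2 - Ψ.ι (D.F (x, y)).2 - D.c (x, y) (Ψ.ι y' - Ψ.ι y)‖ ≤
      η * ‖Ψ.ι y' - Ψ.ι y‖
  lin_symm : ∀ η : ℝ, 0 < η → ∃ ε : ℝ, 0 < ε ∧ ∀ x y y', ‖Ψ.ι y' - Ψ.ι y‖ < ε →
    ‖Ψ.ι (D.F.symm (x, y')).2 - Ψ.ι (D.F.symm (x, y)).2 - D.c' (x, y) (Ψ.ι y' - Ψ.ι y)‖ ≤
      η * ‖Ψ.ι y' - Ψ.ι y‖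
  fst : ∀ p q, p.1 = q.1 → (D.F p).1 = (D.F q).1
  fst_symm : ∀ p q, p.1 = q.1 → (D.F.symm p).1 = (D.F.symm q).1

namespace IsFibred

variable {D : LinExt (B × N) W W'} {Ψ : Framing J N W'}

theorem symm (h : IsFibred D Ψ) : IsFibred D.symm Ψ where
  sum p w := (add_comm _ _).trans (h.sum p w)
  lin := h.lin_symm
  lin_symm := h.lin
  fst := h.fst_symm
  fst_symm := h.fst

variable [FiniteDimensional ℝ F] [BoundarylessManifold J N] [FiniteDimensional ℝ W]
  [FiniteDimensional ℝ W'] [CompactSpace B] [CompactSpace N] [T2Space N]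

/-- One step of the nonlinear dynamics along the fibres. -/
theorem exists_step (h : IsFibred D Ψ) : ∃ θ c C : ℝ, 0 < θ ∧ θ < 1 ∧ 0 < c ∧ 0 < C ∧
    (∀ p w, c * ‖D.Qs p w‖ ≤ D.nh p (D.Qs p w)) ∧ (∀ p w, c * ‖D.Qu p w‖ ≤ D.nh p (D.Qu p w)) ∧
    (∀ p w, D.nh p w ≤ C * ‖w‖) ∧ ∀ η : ℝ, 0 < η → ∃ ε : ℝ, 0 < ε ∧ ∀ x y y',
      ‖Ψ.ι y' - Ψ.ι y‖ < ε →
      D.nh (D.F (x, y)) (D.Qs (D.F (x, y)) (Ψ.ι (D.F (x, y')).2 - Ψ.ι (D.F (x, y)).2)) ≤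
        θ * D.nh (x, y) (D.Qs (x, y) (Ψ.ι y' - Ψ.ι y)) +
          η * (D.nh (x, y) (D.Qs (x, y) (Ψ.ι y' - Ψ.ι y)) +
            D.nh (x, y) (D.Qu (x, y) (Ψ.ι y' - Ψ.ι y))) ∧
      D.nh (x, y) (D.Qu (x, y) (Ψ.ι y' - Ψ.ι y)) ≤
        θ * D.nh (D.F (x, y)) (D.Qu (D.F (x, y)) (Ψ.ι (D.F (x, y')).2 - Ψ.ι (D.F (x, y)).2)) +
          η * (D.nh (x, y) (D.Qs (x, y) (Ψ.ι y' - Ψ.ι y)) +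
            D.nh (x, y) (D.Qu (x, y) (Ψ.ι y' - Ψ.ι y))) := by
  have hn : Continuous fun q : (B × N) × W' => D.nh q.1 q.2 :=
    D.continuous_nh continuous_fst continuous_snd
  obtain ⟨θ₁, h10, h11, _, h1, _⟩ := D.exists_uniform
  obtain ⟨θ₂, h20, h21, _, h2, _⟩ := D.symm.exists_uniform
  obtain ⟨c₁, hc₁, k1⟩ := exists_norm_le_of_homogeneous hn D.nh_smul D.closed_vs
    fun p w hw => D.nh_pos (D.mem_of_vs hw)
  obtain ⟨c₂, hc₂, k2⟩ := exists_norm_le_of_homogeneous hn D.nh_smul D.closed_vu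
    fun p w hw => D.nh_pos (D.mem_of_vu hw)
  obtain ⟨C, hC, k3⟩ := exists_le_norm_of_homogeneous hn D.nh_smul
  obtain ⟨Ks, hKs, b1⟩ := exists_norm_le_of_compact D.cont_Qs
  obtain ⟨Ku, hKu, b2⟩ := exists_norm_le_of_compact D.cont_Qu
  obtain ⟨Kc, hKc, b3⟩ := exists_norm_le_of_compact D.cont_c
  set θ := max θ₁ θ₂
  set c := min c₁ c₂
  have hc : 0 < c := lt_min hc₁ hc₂
  have e1 : ∀ p w, c * ‖D.Qs p w‖ ≤ D.nh p (D.Qs p w) := fun p w =>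
    (mul_le_mul_of_nonneg_right (min_le_left _ _) (norm_nonneg _)).trans (k1 p _ (D.Qs_mem p w))
  have e2 : ∀ p w, c * ‖D.Qu p w‖ ≤ D.nh p (D.Qu p w) := fun p w =>
    (mul_le_mul_of_nonneg_right (min_le_right _ _) (norm_nonneg _)).trans (k2 p _ (D.Qu_mem p w))
  have hθ : 0 < θ := lt_max_of_lt_left h10
  have hθ1 : θ < 1 := max_lt h11 h21
  refine ⟨θ, c, C, hθ, hθ1, hc, hC, e1, e2, k3, fun η hη => ?_⟩
  let K := Ks + Ku
  let m : ℝ := C * (K + 1) * (Kc + 1) * (2 * c⁻¹)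
  have hm : 0 < m := by positivity
  let η' := min (1 / 2) (η / m)
  have hη' : 0 < η' := by positivity
  obtain ⟨ε₁, hε₁, l1⟩ := h.lin η' hη'
  obtain ⟨ε₂, hε₂, l2⟩ := Ψ.exists_linearization Ψ.contMDiff hη'
  refine ⟨min ε₁ ε₂, lt_min hε₁ hε₂, fun x y y' hyy => ?_⟩
  have m1 := l1 x y y' (hyy.trans_le (min_le_left _ _))
  have m2 := l2 y' y (hyy.trans_le (min_le_right _ _))
  set p : B × N := (x, y)
  set Δ := Ψ.ι y' - Ψ.ι y
  set Δ' := Ψ.ι (D.F (x, y')).2 - Ψ.ι (D.F p).2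
  set S := D.nh p (D.Qs p Δ)
  set U := D.nh p (D.Qu p Δ)
  have hproj : Ψ.hat Ψ.ι y Δ = D.Qs p Δ + D.Qu p Δ := (h.sum p Δ).symm
  rw [hproj] at m2
  set r := Δ - (D.Qs p Δ + D.Qu p Δ) with hr
  have n1 : ‖Δ‖ ≤ 2 * c⁻¹ * (S + U) := by
    have i1 : ‖Δ‖ ≤ ‖r‖ + (‖D.Qs p Δ‖ + ‖D.Qu p Δ‖) := by
      calc ‖Δ‖ = ‖r + (D.Qs p Δ + D.Qu p Δ)‖ := by rw [hr, sub_add_cancel]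
        _ ≤ _ := (norm_add_le _ _).trans (by gcongr; exact norm_add_le _ _)
    have i2 : ‖r‖ ≤ 1 / 2 * ‖Δ‖ := m2.trans (by gcongr; exact min_le_left _ _)
    have i3 : ‖D.Qs p Δ‖ ≤ c⁻¹ * S := by rw [inv_mul_eq_div, le_div_iff₀' hc]; exact e1 p Δ
    have i4 : ‖D.Qu p Δ‖ ≤ c⁻¹ * U := by rw [inv_mul_eq_div, le_div_iff₀' hc]; exact e2 p Δ
    linarith
  have hSU : 0 ≤ S + U := add_nonneg (D.nh_nonneg _ _) (D.nh_nonneg _ _)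
  set E₀ := (Δ' - D.c p Δ) + D.c p r with hE₀
  have n2 : ‖E₀‖ ≤ η' * (Kc + 1) * ‖Δ‖ := by
    calc ‖E₀‖ ≤ η' * ‖Δ‖ + Kc * (η' * ‖Δ‖) :=
          (norm_add_le _ _).trans (add_le_add m1 (((D.c p).le_of_opNorm_le (b3 p) _).trans
            (mul_le_mul_of_nonneg_left m2 hKc)))
      _ = _ := by ring
  have n3 : ∀ (Q : W' →L[ℝ] W') (q : B × N), ‖Q‖ ≤ K → D.nh q (Q E₀) ≤ η * (S + U) := by
    intro Q q hQ
    calc D.nh q (Q E₀) ≤ C * (K * ‖E₀‖) := (k3 q _).trans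
          (mul_le_mul_of_nonneg_left (Q.le_of_opNorm_le hQ _) hC.le)
      _ ≤ C * ((K + 1) * (η' * (Kc + 1) * (2 * c⁻¹ * (S + U)))) := by
          gcongr
          · linarith
          · exact n2.trans (by gcongr)
      _ = (η' * m) * (S + U) := by simp only [m]; ring
      _ ≤ η * (S + U) := by
          gcongr
          rw [← le_div_iff₀ hm]
          exact min_le_right _ _
  have hΔ' : Δ' = D.c p (D.Qs p Δ) + D.c p (D.Qu p Δ) + E₀ := by
    rw [hE₀, hr, map_sub (D.c p) Δ, map_add (D.c p) (D.Qs p Δ)]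
    abel
  have q1 := D.Q_s (D.F p) _ (D.c_s p _ (D.Qs_mem p Δ))
  have q2 := D.Q_u (D.F p) _ (D.c_u p _ (D.Qu_mem p Δ))
  refine ⟨?_, ?_⟩
  · have i1 : D.Qs (D.F p) Δ' = D.c p (D.Qs p Δ) + D.Qs (D.F p) E₀ := by
      rw [hΔ', map_add, map_add, q1.1, q2.1, add_zero]
    rw [i1]
    refine (D.hh_add _ _ _).trans (add_le_add ?_ (n3 _ _ ((b1 _).trans (by simp only [K]; linarith))))
    exact (h1 p _ (D.Qs_mem p Δ)).trans
      (mul_le_mul_of_nonneg_right (le_max_left _ _) (D.nh_nonneg _ _))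
  · have i1 : D.c p (D.Qu p Δ) = D.Qu (D.F p) Δ' + (-1 : ℝ) • D.Qu (D.F p) E₀ := by
      rw [hΔ', map_add, map_add, q1.2, q2.2]
      module
    have i2 := h2 (D.F p) _ (D.c_u p _ (D.Qu_mem p Δ))
    change D.nh (D.F.symm (D.F p)) (D.c' (D.F p) _) ≤ θ₂ * D.nh (D.F p) _ at i2
    rw [D.c'_c p _ (D.mem_of_vu (D.Qu_mem p Δ)), D.F.symm_apply_apply] at i2
    have i3 : D.nh (D.F p) (D.c p (D.Qu p Δ)) ≤ D.nh (D.F p) (D.Qu (D.F p) Δ') + η * (S + U) := by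
      rw [i1]
      refine (D.hh_add _ _ _).trans (add_le_add le_rfl ?_)
      change D.nh _ _ ≤ _
      rw [D.nh_smul, abs_neg, abs_one, one_mul]
      exact n3 _ _ ((b2 _).trans (by simp only [K]; linarith))
    calc U ≤ θ₂ * D.nh (D.F p) (D.c p (D.Qu p Δ)) := i2
      _ ≤ θ * (D.nh (D.F p) (D.Qu (D.F p) Δ') + η * (S + U)) := by
          gcongr
          · exact D.nh_nonneg _ _
          · exact le_max_right _ _
      _ ≤ _ := by
          rw [mul_add]
          exact add_le_add le_rfl (mul_le_of_le_one_left (by positivity) hθ1.le)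

/-- Two points of a fibre whose forward orbits stay close differ in a nearly stable direction. -/
theorem cone (h : IsFibred D Ψ) {κ : ℝ} (hκ : 0 < κ) : ∃ ε : ℝ, 0 < ε ∧ ∀ x y y',
    (∀ n, ‖Ψ.ι (D.F^[n] (x, y')).2 - Ψ.ι (D.F^[n] (x, y)).2‖ ≤ ε) →
    ‖D.Qu (x, y) (Ψ.ι y' - Ψ.ι y)‖ ≤ κ * ‖D.Qs (x, y) (Ψ.ι y' - Ψ.ι y)‖ := by
  obtain ⟨θ, c, C, hθ, hθ1, hc, hC, _, e2, k3, hstep⟩ := h.exists_step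
  obtain ⟨Ku, hKu, b2⟩ := exists_norm_le_of_compact D.cont_Qu
  set κ' := κ * c / C with hκ'
  have hκ'0 : 0 < κ' := by positivity
  set η := (1 - θ) / ((κ'⁻¹ + 1) * (2 * (1 + κ'))) with hη
  have h1θ : 0 < 1 - θ := by linarith
  have hη0 : 0 < η := by positivity
  obtain ⟨ε, hε, hst⟩ := hstep η hη0
  refine ⟨ε / 2, by positivity, fun x y y' hclose => ?_⟩
  let a : ℕ → B × N := fun n => D.F^[n] (x, y)
  let a' : ℕ → B × N := fun n => D.F^[n] (x, y')
  have ha : ∀ n, a (n + 1) = D.F (a n) := fun n => Function.iterate_succ_apply' _ _ _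
  have ha' : ∀ n, a' (n + 1) = D.F (a' n) := fun n => Function.iterate_succ_apply' _ _ _
  have hfst : ∀ n, (a n).1 = (a' n).1 := by
    intro n
    induction n with
    | zero => rfl
    | succ n ih => rw [ha, ha', h.fst _ _ ih]
  let Δ : ℕ → W' := fun n => Ψ.ι (a' n).2 - Ψ.ι (a n).2
  have hs : ∀ n, _ := fun n => hst (a n).1 (a n).2 (a' n).2 ((hclose n).trans_lt (by linarith))
  have e' : ∀ n, ((a n).1, (a' n).2) = a' n := fun n => Prod.ext (hfst n) rfl
  have e : ∀ n, ((a n).1, (a n).2) = a n := fun n => rfl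
  simp only [e', e, ← ha, ← ha'] at hs
  have key := le_of_hyperbolic_sequence (s := fun n => D.nh (a n) (D.Qs (a n) (Δ n)))
    (u := fun n => D.nh (a n) (D.Qu (a n) (Δ n))) (θ := θ) (κ := κ') (η := η)
    (K := C * (Ku * (ε / 2))) (fun n => D.nh_nonneg _ _) hθ hκ'0 hη0.le
    (le_of_eq (by rw [hη]; field_simp)) hθ1 (fun n => (hs n).1) (fun n => (hs n).2)
    fun n => (k3 _ _).trans (mul_le_mul_of_nonneg_left (((D.Qu _).le_of_opNorm_le (b2 _) _).trans
      (mul_le_mul_of_nonneg_left (hclose n) hKu)) hC.le)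
  have h1 : c * ‖D.Qu (x, y) (Δ 0)‖ ≤ κ' * (C * ‖D.Qs (x, y) (Δ 0)‖) :=
    (e2 (x, y) _).trans (key.trans (mul_le_mul_of_nonneg_left (k3 _ _) hκ'0.le))
  have h2 : κ' * (C * ‖D.Qs (x, y) (Δ 0)‖) = c * (κ * ‖D.Qs (x, y) (Δ 0)‖) := by
    rw [hκ']; field_simp
  rw [h2] at h1
  exact le_of_mul_le_mul_left h1 hc

end IsFibred

end PHCocycle

namespace PHCocycle

variable {F : Type*} [NormedAddCommGroup F] [NormedSpace ℝ F] [FiniteDimensional ℝ F]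
  {H' : Type*} [TopologicalSpace H'] {J : ModelWithCorners ℝ F H'}
  {N : Type*} [TopologicalSpace N] [ChartedSpace H' N] [IsManifold J 1 N] [BoundarylessManifold J N]
  [CompactSpace N] [T2Space N]
  {W' : Type*} [NormedAddCommGroup W'] [NormedSpace ℝ W'] [FiniteDimensional ℝ W']

/-! ### Local product structure along the fibres -/

/-- A subbundle has curves that are tangent to it and have a prescribed displacement. -/
theorem Framing.exists_curve_of_displacement (Ψ : Framing J N W')
    {V : ∀ y : N, Submodule ℝ (TangentSpace J y)} {Q : N → W' →L[ℝ] W'} (hQ : Continuous Q)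
    (hQm : ∀ y w, Q y w ∈ Ψ.img V y) (hQe : ∀ y, ∀ w ∈ Ψ.img V y, Q y w = w) (y₀ : N) :
    ∃ C : ℝ, 0 < C ∧ ∀ U ∈ 𝓝 y₀, ∃ r : ℝ, 0 < r ∧ ∀ z, ‖Ψ.ι z - Ψ.ι y₀‖ < r →
      ∀ ξ ∈ Ψ.img V y₀, ‖ξ‖ < r → ∃ γ : ℝ → N, ContMDiff 𝓘(ℝ, ℝ) J 1 γ ∧ γ 0 = z ∧
        (∀ t, γ t ∈ U ∧ mfderiv 𝓘(ℝ, ℝ) J γ t (1 : ℝ) ∈ V (γ t)) ∧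
        (∀ t ∈ Icc (0 : ℝ) 1, ‖Ψ.d (γ t) (mfderiv 𝓘(ℝ, ℝ) J γ t (1 : ℝ))‖ ≤ C * ‖ξ‖ ∧
          ‖Ψ.ι (γ t) - Ψ.ι z‖ ≤ C * ‖ξ‖) ∧
        Q y₀ (Ψ.ι (γ 1) - Ψ.ι z) = ξ := by
  obtain ⟨K, hK, hQK⟩ := exists_norm_le_of_compact hQ
  have hs2 : ContDiff ℝ 1 Real.smoothTransition := Real.smoothTransition.contDiff
  have hs1 : ∀ t, Real.smoothTransition t ∈ Icc (0 : ℝ) 1 := fun t =>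
    ⟨Real.smoothTransition.nonneg t, Real.smoothTransition.le_one t⟩
  obtain ⟨S, hS⟩ := isCompact_Icc.exists_bound_of_continuousOn (s := Icc (0 : ℝ) 1)
    (hs2.continuous_deriv le_rfl).continuousOn
  have hS0 : 0 ≤ S := (norm_nonneg _).trans (hS 0 (by simp))
  set P := Q y₀ with hP
  have hPP : ∀ w, P (P w) = P w := fun w => hQe y₀ _ (hQm y₀ w)
  let A : N → W' →L[ℝ] W' := fun y => P * Q y * P + (1 - P)
  have hA : Continuous A := ((continuous_const.mul hQ).mul continuous_const).add continuous_const
  have hA0 : A y₀ = 1 := by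
    ext w
    change P (P (P w)) + (w - P w) = w
    rw [hPP, hPP, add_sub_cancel]
  have hinv : ContinuousAt (fun y => Ring.inverse (A y)) y₀ := by
    have : ContinuousAt Ring.inverse (A y₀) := by
      rw [hA0]
      exact NormedRing.inverse_continuousAt (1 : (W' →L[ℝ] W')ˣ)
    exact this.comp hA.continuousAt
  have hU₁ : ∀ᶠ y in 𝓝 y₀, IsUnit (A y) := by
    refine hA.continuousAt.eventually ?_
    rw [hA0]
    exact (Units.isOpen (R := W' →L[ℝ] W')).mem_nhds isUnit_one
  have hU₂ : ∀ᶠ y in 𝓝 y₀, ‖Ring.inverse (A y)‖ < 2 := by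
    refine hinv.norm.eventually_lt continuousAt_const ?_
    rw [hA0, Ring.inverse_one]
    exact (ContinuousLinearMap.norm_id_le).trans_lt one_lt_two
  set C : ℝ := S * (2 * K) + 1 with hC
  refine ⟨C, by positivity, fun U hU => ?_⟩
  obtain ⟨r, hr, hpeano⟩ := Ψ.exists_integral_curve y₀ (Filter.inter_mem hU (hU₁.and hU₂))
  refine ⟨min r (r / (2 * K + 1)), by positivity, fun z hz ξ hξ hξr => ?_⟩
  let η : N → W' := fun y => Ring.inverse (A y) ξ
  have hPξ : P ξ = ξ := hQe y₀ _ hξ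
  have hη : ∀ y, IsUnit (A y) → P (Q y (η y)) = ξ := by
    intro y hy
    have i1 : A y (η y) = ξ :=
      congrArg (fun B : W' →L[ℝ] W' => B ξ) (Ring.mul_inverse_cancel _ hy)
    have i2 : P (A y (η y)) = P (Q y (P (η y))) := by
      change P (P (Q y (P (η y))) + (η y - P (η y))) = _
      rw [map_add, map_sub, hPP, hPP, sub_self, add_zero]
    have i3 : A y (η y) = P (Q y (P (η y))) + (η y - P (η y)) := rfl
    rw [i1, hPξ] at i2
    rw [i1, ← i2] at i3
    have i4 : η y = P (η y) := by
      have := (left_eq_add.1 i3)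
      exact sub_eq_zero.1 this
    rw [i4, ← i2]
  have hηn : ∀ y, ‖Ring.inverse (A y)‖ < 2 → ‖Q y (η y)‖ ≤ 2 * K * ‖ξ‖ := by
    intro y hy
    calc _ ≤ K * (2 * ‖ξ‖) := ((Q y).le_of_opNorm_le (hQK y) _).trans
          (mul_le_mul_of_nonneg_left (ContinuousLinearMap.le_of_opNorm_le _ hy.le _) hK)
      _ = _ := by ring
  obtain ⟨γ, hγ0, hγ⟩ := hpeano z (hz.trans_le (min_le_left _ _)) (fun _ y => Q y (η y)) (by
      have h1 : ContinuousOn (fun y => Ring.inverse (A y)) {y | IsUnit (A y)} := by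
        intro y hy
        obtain ⟨u, hu⟩ := hy
        have h2 : ContinuousAt Ring.inverse (A y) := hu ▸ NormedRing.inverse_continuousAt u
        exact (h2.comp hA.continuousAt).continuousWithinAt
      refine ((hQ.comp continuous_snd).continuousOn).clm_apply
        (ContinuousOn.clm_apply (h1.comp continuousOn_snd fun q hq => ?_) continuousOn_const)
      exact hq.2.2.1)
    (fun _ y hy => (hηn y hy.2.2).trans (by
      have h1 : ‖ξ‖ ≤ r / (2 * K + 1) := hξr.le.trans (min_le_right _ _)
      rw [le_div_iff₀ (by positivity)] at h1
      nlinarith [norm_nonneg ξ]))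
  have hmem : ∀ t ∈ Icc (0 : ℝ) 1, mfderiv 𝓘(ℝ, ℝ) J γ t (1 : ℝ) ∈ V (γ t) ∧
      Ψ.d (γ t) (mfderiv 𝓘(ℝ, ℝ) J γ t (1 : ℝ)) = Q (γ t) (η (γ t)) := by
    intro t ht
    rw [(hγ t ht).2.2]
    exact Ψ.mem_img_iff.1 (hQm _ _)
  have hder : ∀ t ∈ Icc (0 : ℝ) 1, HasDerivAt (Ψ.ι ∘ γ) (Q (γ t) (η (γ t))) t := fun t ht =>
    (hmem t ht).2 ▸ hasDerivAt_comp_curve Ψ.contMDiff ((hγ t ht).2.1.mdifferentiableAt one_ne_zero)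
  have hdisp : P (Ψ.ι (γ 1) - Ψ.ι z) = ξ := by
    have h1 : ∀ t ∈ Icc (0 : ℝ) 1,
        HasDerivWithinAt (fun t => P (Ψ.ι (γ t)) - t • ξ) 0 (Icc (0 : ℝ) 1) t := by
      intro t ht
      have := (P.hasFDerivAt.comp_hasDerivAt t (hder t ht)).sub ((hasDerivAt_id t).smul_const ξ)
      rw [one_smul, hη _ (hγ t ht).1.2.1, sub_self] at this
      exact this.hasDerivWithinAt
    have h2 := (convex_Icc (0 : ℝ) 1).norm_image_sub_le_of_norm_hasDerivWithin_le
      (C := 0) h1 (fun t _ => by simp) (x := 0) (y := 1) (by simp) (by simp)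
    rw [zero_mul, norm_le_zero_iff, one_smul, zero_smul, sub_zero, sub_sub, sub_eq_zero] at h2
    rw [map_sub, h2, hγ0, add_sub_cancel_right]
  have hglob : ∀ t, mfderiv 𝓘(ℝ, ℝ) J (γ ∘ Real.smoothTransition) t (1 : ℝ) =
      deriv Real.smoothTransition t •
        mfderiv 𝓘(ℝ, ℝ) J γ (Real.smoothTransition t) (1 : ℝ) := fun t =>
    mfderiv_comp_real (hs2.differentiable one_ne_zero t).hasDerivAt
      ((hγ _ (hs1 t)).2.1.mdifferentiableAt one_ne_zero)
  have hcont : ContMDiff 𝓘(ℝ, ℝ) J 1 (γ ∘ Real.smoothTransition) := fun t =>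
    (hγ _ (hs1 t)).2.1.comp t hs2.contMDiff.contMDiffAt
  have hspeed : ∀ t ∈ Icc (0 : ℝ) 1, ‖Ψ.d ((γ ∘ Real.smoothTransition) t)
      (mfderiv 𝓘(ℝ, ℝ) J (γ ∘ Real.smoothTransition) t (1 : ℝ))‖ ≤ C * ‖ξ‖ := by
    intro t ht
    rw [hglob, map_smul, norm_smul]
    change ‖deriv Real.smoothTransition t‖ * ‖Ψ.d (γ (Real.smoothTransition t)) _‖ ≤ _
    rw [(hmem _ (hs1 t)).2]
    calc _ ≤ S * (2 * K * ‖ξ‖) := mul_le_mul (hS t ht) (hηn _ (hγ _ (hs1 t)).1.2.2)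
          (norm_nonneg _) hS0
      _ ≤ C * ‖ξ‖ := by
        rw [hC, ← mul_assoc]
        gcongr
        linarith
  refine ⟨γ ∘ Real.smoothTransition, hcont, by simp [hγ0], fun t => ⟨(hγ _ (hs1 t)).1.1, ?_⟩,
    fun t ht => ⟨hspeed t ht, ?_⟩, by simpa using hdisp⟩
  · rw [hglob]
    exact Submodule.smul_mem _ _ (hmem _ (hs1 t)).1
  · have := (convex_Icc (0 : ℝ) 1).norm_image_sub_le_of_norm_hasDerivWithin_le
      (f := Ψ.ι ∘ (γ ∘ Real.smoothTransition)) (C := C * ‖ξ‖)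
      (fun t _ => (hasDerivAt_comp_curve Ψ.contMDiff
        (hcont.mdifferentiableAt one_ne_zero)).hasDerivWithinAt)
      (fun t ht => hspeed t ht) (x := 0) (y := t) (by simp) ht
    simp only [Function.comp_apply, Real.smoothTransition.zero, hγ0] at this
    refine this.trans (mul_le_of_le_one_right (by positivity) ?_)
    rw [sub_zero, Real.norm_eq_abs, abs_of_nonneg ht.1]
    exact ht.2

theorem Framing.exists_norm_sub_le_proj (Ψ : Framing J N W') (y₀ : N) : ∃ U ∈ 𝓝 y₀,
    ∀ p ∈ U, ∀ q ∈ U, ‖Ψ.ι p - Ψ.ι q‖ ≤ 2 * ‖Ψ.proj y₀ (Ψ.ι p - Ψ.ι q)‖ := by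
  obtain ⟨U, hU, hyU, h⟩ := Ψ.exists_linearization_nhds Ψ.contMDiff (η := 1 / 4) (by norm_num) y₀
  have h2 : ∀ᶠ y in 𝓝 y₀, ‖Ψ.proj y - Ψ.proj y₀‖ < 1 / 4 :=
    (Ψ.continuous_proj.continuousAt.sub continuousAt_const).norm.eventually_lt continuousAt_const
      (by simp)
  refine ⟨U ∩ {y | ‖Ψ.proj y - Ψ.proj y₀‖ < 1 / 4}, Filter.inter_mem (hU.mem_nhds hyU) h2,
    fun p hp q hq => ?_⟩
  have i1 := h p hp.1 q hq.1
  set Δ := Ψ.ι p - Ψ.ι q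
  have i2 : ‖(Ψ.proj q - Ψ.proj y₀) Δ‖ ≤ 1 / 4 * ‖Δ‖ :=
    ContinuousLinearMap.le_of_opNorm_le _ (le_of_lt hq.2) _
  have i3 : Δ = (Δ - Ψ.hat Ψ.ι q Δ) + (Ψ.proj q - Ψ.proj y₀) Δ + Ψ.proj y₀ Δ := by
    rw [sub_apply]
    change Δ = Δ - Ψ.proj q Δ + _ + _
    abel
  have i4 : ‖Δ‖ ≤ 1 / 4 * ‖Δ‖ + 1 / 4 * ‖Δ‖ + ‖Ψ.proj y₀ Δ‖ := by
    nth_rewrite 1 [i3]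
    exact (norm_add_le _ _).trans (add_le_add ((norm_add_le _ _).trans (add_le_add i1 i2)) le_rfl)
  linarith

variable {E : Type*} [NormedAddCommGroup E] [NormedSpace ℝ E]
  {H : Type*} [TopologicalSpace H] {I : ModelWithCorners ℝ E H}
  {M : Type*} [TopologicalSpace M] [ChartedSpace H M] [IsManifold I 1 M] [CompactSpace M] [T2Space M]
  {W : Type*} [NormedAddCommGroup W] [NormedSpace ℝ W] [FiniteDimensional ℝ W]

theorem contMDiff_vertical_curve (x : M) {γ : ℝ → N} (hγ : ContMDiff 𝓘(ℝ, ℝ) J 1 γ) :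
    ContMDiff 𝓘(ℝ, ℝ) (I.prod J) 1 fun t => (x, γ t) := contMDiff_const.prodMk hγ

theorem mfderiv_vertical_curve (x : M) {γ : ℝ → N} (hγ : ContMDiff 𝓘(ℝ, ℝ) J 1 γ) (t : ℝ) :
    mfderiv 𝓘(ℝ, ℝ) (I.prod J) (fun t => (x, γ t)) t (1 : ℝ) =
      vertical (I := I) x (γ t) (mfderiv 𝓘(ℝ, ℝ) J γ t (1 : ℝ)) :=
  mfderiv_comp_curve (f := fun y : N => (x, y))
    ((contMDiff_const.prodMk contMDiff_id).mdifferentiableAt one_ne_zero)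
    (hγ.mdifferentiableAt one_ne_zero) 1

/-- Stable pieces of a fibre are graphs of contractions. -/
theorem IsFibred.exists_graph {D : LinExt (M × N) W W'} {Φ : Framing I M W} {Ψ : Framing J N W'}
    (h : IsFibred D Ψ) {V : M → ∀ y : N, Submodule ℝ (TangentSpace J y)}
    (hV : ∀ p, D.vs p = Ψ.img (V p.1) p.2) {Fd : (M × N) ≃ₘ^1⟮I.prod J, I.prod J⟯ (M × N)}
    (hF : D.F = Fd.toHomeomorph) {Lf : ∀ p : M × N, Submodule ℝ (TangentSpace (I.prod J) p)}
    (hLf : ∀ x y, ∀ v ∈ V x y, vertical (I := I) x y v ∈ Lf (x, y)) {G : Metric (I.prod J) (M × N)}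
    {lam : ℝ} (hc : IsContracted G Fd Lf lam) (x : M) (y₀ : N) {U : Set N} (hU : U ∈ 𝓝 y₀) :
    ∃ C r : ℝ, 0 < C ∧ 0 < r ∧ ∀ z, ‖Ψ.ι z - Ψ.ι y₀‖ < r → ∃ α : W' → N,
      (∀ ξ ∈ D.vs (x, y₀), ‖ξ‖ < r → ∃ γ : ℝ → N,
        IsLeafCurve G Lf (fun t => (x, γ t)) (C * ‖ξ‖) ∧ γ 0 = z ∧ γ 1 = α ξ ∧ α ξ ∈ U ∧
        (∀ t ∈ Icc (0 : ℝ) 1, ‖Ψ.ι (γ t) - Ψ.ι z‖ ≤ C * ‖ξ‖) ∧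
        D.Qs (x, y₀) (Ψ.ι (α ξ) - Ψ.ι z) = ξ) ∧
      ∀ ξ ∈ D.vs (x, y₀), ‖ξ‖ < r → ∀ ξ' ∈ D.vs (x, y₀), ‖ξ'‖ < r →
        ‖D.Qu (x, y₀) (Ψ.ι (α ξ) - Ψ.ι (α ξ'))‖ ≤ 1 / 2 * ‖ξ - ξ'‖ := by
  obtain ⟨_, C₁, _, hC₁, hG⟩ := exists_norm_d_le (Φ.prod Ψ) G
  have hφ : ContMDiff (I.prod J) 𝓘(ℝ, W') 1 (fun p : M × N => Ψ.ι p.2) :=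
    Ψ.contMDiff.comp contMDiff_snd
  obtain ⟨C₂, hC₂, hφG⟩ := exists_norm_vderiv_le (Φ.prod Ψ) G hφ
  obtain ⟨C₃, hC₃, hcurve⟩ := Ψ.exists_curve_of_displacement (V := V x) (Q := fun y => D.Qs (x, y))
    (D.cont_Qs.comp (by fun_prop)) (fun y w => hV (x, y) ▸ D.Qs_mem (x, y) w)
    (fun y w hw => (D.Q_s (x, y) w (by rw [hV]; exact hw)).1) y₀
  obtain ⟨U₁, hU₁, hinj⟩ := Ψ.exists_norm_sub_le_proj y₀
  obtain ⟨ε, hε, hcone⟩ := h.cone (κ := 1 / 14) (by norm_num)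
  have hQ : ∀ Q : M × N → W' →L[ℝ] W', Continuous Q →
      ∀ᶠ y in 𝓝 y₀, ‖Q (x, y) - Q (x, y₀)‖ < 1 / 14 := fun Q hQ =>
    ((hQ.comp (f := fun y : N => (x, y)) (by fun_prop)).continuousAt.sub
      continuousAt_const).norm.eventually_lt continuousAt_const (by simp)
  obtain ⟨r, hr, hcu⟩ := hcurve _ (Filter.inter_mem (Filter.inter_mem hU hU₁)
    ((hQ _ D.cont_Qs).and (hQ _ D.cont_Qu)))
  set C := (C₁ + 1) * C₃ with hC
  have hC0 : 0 < C := by positivity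
  refine ⟨C, min r (ε / (2 * C₂ * C)), hC0, by positivity, fun z hz => ?_⟩
  set r' := min r (ε / (2 * C₂ * C))
  have hr' : C₂ * C * r' ≤ ε / 2 := by
    calc _ ≤ C₂ * C * (ε / (2 * C₂ * C)) := by gcongr; exact min_le_right _ _
      _ = ε / 2 := by field_simp
  have hex : ∀ ξ, ∃ γ : ℝ → N, ξ ∈ D.vs (x, y₀) → ‖ξ‖ < r' →
      IsLeafCurve G Lf (fun t => (x, γ t)) (C * ‖ξ‖) ∧ γ 0 = z ∧
        γ 1 ∈ (U ∩ U₁) ∩ {y | ‖D.Qs (x, y) - D.Qs (x, y₀)‖ < 1 / 14 ∧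
          ‖D.Qu (x, y) - D.Qu (x, y₀)‖ < 1 / 14} ∧
        (∀ t ∈ Icc (0 : ℝ) 1, ‖Ψ.ι (γ t) - Ψ.ι z‖ ≤ C * ‖ξ‖) ∧
        D.Qs (x, y₀) (Ψ.ι (γ 1) - Ψ.ι z) = ξ := by
    intro ξ
    by_cases hξ : ξ ∈ D.vs (x, y₀) ∧ ‖ξ‖ < r'
    · obtain ⟨γ, h1, h2, h3, h4, h5⟩ := hcu z (hz.trans_le (min_le_left _ _)) ξ ((hV (x, y₀)).le hξ.1)
        (hξ.2.trans_le (min_le_left _ _))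
      refine ⟨γ, fun _ _ => ⟨⟨contMDiff_vertical_curve x h1, fun t _ => ?_, fun t ht => ?_⟩, h2,
        (h3 1).1, fun t ht => (h4 t ht).2.trans ?_, h5⟩⟩
      · rw [mfderiv_vertical_curve x h1]
        exact hLf _ _ _ (h3 t).2
      · rw [mfderiv_vertical_curve x h1]
        refine (hG _ _).2.trans ?_
        rw [prod_d_vertical, Prod.norm_def, norm_zero, max_eq_right (norm_nonneg _)]
        calc _ ≤ C₁ * (C₃ * ‖ξ‖) := mul_le_mul_of_nonneg_left (h4 t ht).1 hC₁.le
          _ ≤ C * ‖ξ‖ := by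
            rw [hC, ← mul_assoc]
            gcongr
            linarith
      · rw [hC]
        gcongr
        nlinarith
    · exact ⟨fun _ => z, fun h1 h2 => absurd ⟨h1, h2⟩ hξ⟩
  choose γ hγ using hex
  refine ⟨fun ξ => γ ξ 1, fun ξ hξ hξr => ?_, fun ξ hξ hξr ξ' hξ' hξr' => ?_⟩
  · obtain ⟨h1, h2, h3, h4, h5⟩ := hγ ξ hξ hξr
    exact ⟨γ ξ, h1, h2, rfl, h3.1.1, h4, h5⟩
  · obtain ⟨h1, h2, h3, h4, h5⟩ := hγ ξ hξ hξr
    obtain ⟨h1', h2', h3', h4', h5'⟩ := hγ ξ' hξ' hξr'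
    have hit : ∀ ξ ∈ D.vs (x, y₀), ‖ξ‖ < r' → ∀ n,
        ‖Ψ.ι (D.F^[n] (x, z)).2 - Ψ.ι (D.F^[n] (x, γ ξ 1)).2‖ ≤ ε / 2 := by
      intro ξ hξ hξr n
      obtain ⟨h1, h2, -⟩ := hγ ξ hξ hξr
      have i1 := hc.norm_iterate_sub_le' hC₂.le hφ (fun p v _ => hφG p v) h1 n
      rw [hF]
      simp only [h2] at i1
      refine i1.trans ?_
      calc C₂ * (C * ‖ξ‖) * lam ^ n ≤ C₂ * (C * r') * 1 := by
            have := pow_nonneg hc.pos.le n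
            gcongr
            exact pow_le_one₀ hc.pos.le hc.lt_one.le
        _ ≤ _ := by linarith
    have i1 := hcone x (γ ξ' 1) (γ ξ 1) fun n => by
      have j1 := hit ξ hξ hξr n
      have j2 := hit ξ' hξ' hξr' n
      rw [← sub_sub_sub_cancel_left _ _ (Ψ.ι (D.F^[n] (x, z)).2)]
      refine (norm_sub_le _ _).trans ?_
      linarith
    have i2 := hinj _ h3.1.2 _ h3'.1.2
    set Δ := Ψ.ι (γ ξ 1) - Ψ.ι (γ ξ' 1) with hΔ
    have i3 : D.Qs (x, y₀) Δ = ξ - ξ' := by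
      rw [← h5, ← h5', ← map_sub, sub_sub_sub_cancel_right]
    rw [← h.sum (x, y₀) Δ, i3] at i2
    have i4 : ‖(D.Qu (x, γ ξ' 1) - D.Qu (x, y₀)) Δ‖ ≤ 1 / 14 * ‖Δ‖ :=
      ContinuousLinearMap.le_of_opNorm_le _ (le_of_lt h3'.2.2) _
    have i5 : ‖(D.Qs (x, γ ξ' 1) - D.Qs (x, y₀)) Δ‖ ≤ 1 / 14 * ‖Δ‖ :=
      ContinuousLinearMap.le_of_opNorm_le _ (le_of_lt h3'.2.1) _
    rw [sub_apply] at i4 i5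
    rw [i3] at i5
    have i6 := norm_sub_norm_le (D.Qs (x, γ ξ' 1) Δ) (ξ - ξ')
    have i7 := norm_sub_norm_le (D.Qu (x, y₀) Δ) (D.Qu (x, γ ξ' 1) Δ)
    rw [norm_sub_rev] at i7
    have i8 := norm_add_le (ξ - ξ') (D.Qu (x, y₀) Δ)
    linarith [norm_nonneg Δ]

end PHCocycle

namespace PHCocycle

variable {E : Type*} [NormedAddCommGroup E] [NormedSpace ℝ E] [FiniteDimensional ℝ E]
  {H : Type*} [TopologicalSpace H] {I : ModelWithCorners ℝ E H}
  {M : Type*} [TopologicalSpace M] [ChartedSpace H M] [IsManifold I 1 M] [BoundarylessManifold I M]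
  [CompactSpace M] [T2Space M]
  {F : Type*} [NormedAddCommGroup F] [NormedSpace ℝ F] [FiniteDimensional ℝ F]
  {H' : Type*} [TopologicalSpace H'] {J : ModelWithCorners ℝ F H'}
  {N : Type*} [TopologicalSpace N] [ChartedSpace H' N] [IsManifold J 1 N] [BoundarylessManifold J N]
  [CompactSpace N] [T2Space N]
  {W : Type*} [NormedAddCommGroup W] [NormedSpace ℝ W] [FiniteDimensional ℝ W]
  {W' : Type*} [NormedAddCommGroup W'] [NormedSpace ℝ W'] [FiniteDimensional ℝ W']
  {f : M ≃ₘ^1⟮I, I⟯ M} {S : Splitting I M} {m : Metric I M}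
  {ft : (M × N) ≃ₘ^1⟮I.prod J, I.prod J⟯ (M × N)} {g : M → N ≃ₘ^1⟮J, J⟯ N}
  {Vs Vu : M → ∀ y : N, Submodule ℝ (TangentSpace J y)} {h : Metric (I.prod J) (M × N)}

theorem exists_fibre_linearization (Φ : Framing I M W) (Ψ : Framing J N W') {k : M × N → M × N}
    (hk : ContMDiff (I.prod J) (I.prod J) 1 k) {η : ℝ} (hη : 0 < η) :
    ∃ ε : ℝ, 0 < ε ∧ ∀ x y y', ‖Ψ.ι y' - Ψ.ι y‖ < ε →
    ‖Ψ.ι (k (x, y')).2 - Ψ.ι (k (x, y)).2 - fibreHat Φ Ψ k (x, y) (0, Ψ.ι y' - Ψ.ι y)‖ ≤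
      η * ‖Ψ.ι y' - Ψ.ι y‖ := by
  obtain ⟨ε, hε, hl⟩ := (Φ.prod Ψ).exists_linearization
    (Ψ.contMDiff.comp (contMDiff_snd.comp hk)) hη
  refine ⟨ε, hε, fun x y y' hy => ?_⟩
  have e : (Φ.prod Ψ).ι (x, y') - (Φ.prod Ψ).ι (x, y) = (0, Ψ.ι y' - Ψ.ι y) :=
    Prod.ext (sub_self _) rfl
  have e' : ‖((0 : W), Ψ.ι y' - Ψ.ι y)‖ = ‖Ψ.ι y' - Ψ.ι y‖ := by
    rw [Prod.norm_def, norm_zero, max_eq_right (norm_nonneg _)]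
  have := hl (x, y') (x, y) (by rw [e, e']; exact hy)
  rw [e, e'] at this
  exact this

theorem exists_isFibred (Φ : Framing I M W) (Ψ : Framing J N W')
    (hf : IsPartiallyHyperbolicFor m f S) (hft : ∀ x y, ft (x, y) = (f x, g x y))
    (hfib : IsDominatingHyperbolicFibre m h f S g Vs Vu) :
    ∃ D : LinExt (M × N) W W', D.F = ft.toHomeomorph ∧
      (∀ p, D.vs p = Ψ.img (Vs p.1) p.2) ∧ (∀ p, D.vu p = Ψ.img (Vu p.1) p.2) ∧
      IsFibred D Ψ := by
  obtain ⟨D, hF, -, hv, -, hsum, hc, hc'⟩ := exists_linExt Φ Ψ hf hft hfib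
  have hFs : D.F.symm = ft.symm.toHomeomorph := by rw [hF]; rfl
  have hfst : ∀ p, (ft p).1 = f p.1 := fun p => congrArg Prod.fst (hft p.1 p.2)
  have hfst' : ∀ p, (ft.symm p).1 = f.symm p.1 := fun p => by
    have := hfst (ft.symm p)
    rw [ft.apply_symm_apply] at this
    rw [this, f.symm_apply_apply]
  refine ⟨D, hF, fun p => (hv p).1, fun p => (hv p).2, hsum, fun η hη => ?_, fun η hη => ?_,
    fun p q hpq => ?_, fun p q hpq => ?_⟩
  · obtain ⟨ε, hε, hl⟩ := exists_fibre_linearization Φ Ψ ft.contMDiff hη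
    refine ⟨ε, hε, fun x y y' hy => ?_⟩
    rw [hF, hc]
    exact hl x y y' hy
  · obtain ⟨ε, hε, hl⟩ := exists_fibre_linearization Φ Ψ ft.symm.contMDiff hη
    refine ⟨ε, hε, fun x y y' hy => ?_⟩
    rw [hFs, hc']
    exact hl x y y' hy
  · rw [hF]
    exact (hfst p).trans ((congrArg f hpq).trans (hfst q).symm)
  · rw [hFs]
    exact (hfst' p).trans ((congrArg f.symm hpq).trans (hfst' q).symm)

/-- Nearby points of a fibre are joined by a stable leg followed by an unstable one. -/
theorem exists_fibre_access (Φ : Framing I M W) (Ψ : Framing J N W')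
    (hf : IsPartiallyHyperbolicFor m f S) (hft : ∀ x y, ft (x, y) = (f x, g x y))
    (hfib : IsDominatingHyperbolicFibre m h f S g Vs Vu) {T : Splitting (I.prod J) (M × N)}
    (hT : T.IsInduced S Vs Vu) {G : Metric (I.prod J) (M × N)} {lam : ℝ}
    (hG : IsHyperbolicPair G ft T lam) (x : M) (y₀ : N) :
    ∃ C r : ℝ, 0 < C ∧ 0 < r ∧ ∀ z, ‖Ψ.ι z - Ψ.ι y₀‖ < r → ∃ γ₁ γ₂ : ℝ → N,
      IsLeafCurve G T.s (fun t => (x, γ₁ t)) (C * ‖Ψ.ι z - Ψ.ι y₀‖) ∧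
      IsLeafCurve G T.u (fun t => (x, γ₂ t)) (C * ‖Ψ.ι z - Ψ.ι y₀‖) ∧
      γ₁ 0 = y₀ ∧ γ₂ 0 = z ∧ γ₁ 1 = γ₂ 1 ∧ ∀ t ∈ Icc (0 : ℝ) 1,
        ‖Ψ.ι (γ₁ t) - Ψ.ι y₀‖ ≤ C * ‖Ψ.ι z - Ψ.ι y₀‖ ∧
        ‖Ψ.ι (γ₂ t) - Ψ.ι y₀‖ ≤ C * ‖Ψ.ι z - Ψ.ι y₀‖ := by
  obtain ⟨D, hF, hvs, hvu, hD⟩ := exists_isFibred Φ Ψ hf hft hfib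
  have hFs : D.symm.F = ft.symm.toHomeomorph := by
    change D.F.symm = _
    rw [hF]
    rfl
  obtain ⟨U, hU, hinj⟩ := Ψ.exists_norm_sub_le_proj y₀
  obtain ⟨C₁, r₁, hC₁, hr₁, g1⟩ := hD.exists_graph (Φ := Φ) hvs hF (Lf := T.s)
    (fun x y v hv => by rw [← hT.vert_s x y] at hv; exact hv) hG.stable x y₀ hU
  obtain ⟨C₂, r₂, hC₂, hr₂, g2⟩ := hD.symm.exists_graph (Φ := Φ) hvu hFs (Lf := T.u)
    (fun x y v hv => by rw [← hT.vert_u x y] at hv; exact hv) hG.unstable x y₀ hU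
  set Qs := D.Qs (x, y₀)
  set Qu := D.Qu (x, y₀)
  set C₀ : ℝ := max ‖Qs‖ ‖Qu‖ + 1 with hC₀
  have hC₀0 : 0 < C₀ := by positivity
  have hQs : ∀ w, ‖Qs w‖ ≤ C₀ * ‖w‖ := fun w =>
    Qs.le_of_opNorm_le (by rw [hC₀]; linarith [le_max_left ‖Qs‖ ‖Qu‖]) w
  have hQu : ∀ w, ‖Qu w‖ ≤ C₀ * ‖w‖ := fun w =>
    Qu.le_of_opNorm_le (by rw [hC₀]; linarith [le_max_right ‖Qs‖ ‖Qu‖]) w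
  set C : ℝ := (C₁ + C₂) * (2 * C₀) + 1 with hC
  refine ⟨C, min r₁ (min r₂ (min r₁ r₂ / (2 * C₀))), by positivity, by positivity, fun z hz => ?_⟩
  set d := ‖Ψ.ι z - Ψ.ι y₀‖
  have hd : 0 ≤ d := norm_nonneg _
  have hz1 : d < r₁ := hz.trans_le (min_le_left _ _)
  have hz2 : d < r₂ := hz.trans_le ((min_le_right _ _).trans (min_le_left _ _))
  have hz3 : 2 * C₀ * d < min r₁ r₂ := by
    have := hz.trans_le ((min_le_right _ _).trans (min_le_right _ _))
    rwa [lt_div_iff₀' (by positivity)] at this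
  obtain ⟨α, a1, a2⟩ := g1 y₀ (by simpa using hr₁)
  obtain ⟨β, b1, b2⟩ := g2 z hz2
  change ∀ ξ ∈ D.vu (x, y₀), ‖ξ‖ < r₂ → ∃ γ : ℝ → N, _ ∧ _ ∧ _ ∧ _ ∧ _ ∧ Qu _ = _ at b1
  change ∀ ξ ∈ D.vu (x, y₀), ‖ξ‖ < r₂ → ∀ ξ' ∈ D.vu (x, y₀), ‖ξ'‖ < r₂ → ‖Qs _‖ ≤ _ at b2
  let s : Set W' := {ξ | ξ ∈ D.vs (x, y₀) ∧ ‖ξ‖ ≤ 2 * C₀ * d}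
  have hs : IsComplete s := by
    refine IsClosed.isComplete (IsClosed.inter ?_ (isClosed_le continuous_norm continuous_const))
    exact Submodule.closed_of_finiteDimensional (D.vs (x, y₀))
  have hsr : ∀ ξ ∈ s, ‖ξ‖ < r₁ := fun ξ hξ => hξ.2.trans_lt (hz3.trans_le (min_le_left _ _))
  have hα0 : Ψ.ι (α 0) = Ψ.ι y₀ := by
    obtain ⟨γ, -, -, h2, -, h3, -⟩ := a1 0 (Submodule.zero_mem _) (by simpa using hr₁)
    have := h3 1 (by simp)
    rwa [norm_zero, mul_zero, norm_le_zero_iff, sub_eq_zero, h2] at this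
  let ζ : W' → W' := fun ξ => Qu (Ψ.ι (α ξ) - Ψ.ι y₀) - Qu (Ψ.ι z - Ψ.ι y₀)
  have hζm : ∀ ξ, ζ ξ ∈ D.vu (x, y₀) := fun ξ =>
    Submodule.sub_mem _ (D.Qu_mem _ _) (D.Qu_mem _ _)
  have hζn : ∀ ξ ∈ s, ‖ζ ξ‖ ≤ 2 * C₀ * d := by
    intro ξ hξ
    have h1 := a2 ξ hξ.1 (hsr ξ hξ) 0 (Submodule.zero_mem _) (by simpa using hr₁)
    rw [hα0, sub_zero] at h1
    have h2 := hQu (Ψ.ι z - Ψ.ι y₀)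
    have h3 := norm_sub_le (Qu (Ψ.ι (α ξ) - Ψ.ι y₀)) (Qu (Ψ.ι z - Ψ.ι y₀))
    have h4 := hξ.2
    change ‖ζ ξ‖ ≤ _ at h3
    change _ ≤ C₀ * d at h2
    change ‖Qu _‖ ≤ _ at h1
    linarith
  have hζr : ∀ ξ ∈ s, ‖ζ ξ‖ < r₂ := fun ξ hξ =>
    (hζn ξ hξ).trans_lt (hz3.trans_le (min_le_right _ _))
  have hβz : ∀ ξ ∈ s, ‖Qs (Ψ.ι (β (ζ ξ)) - Ψ.ι z)‖ ≤ 1 / 2 * ‖ζ ξ‖ := by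
    intro ξ hξ
    obtain ⟨γ, -, -, h2, -, h3, -⟩ := b1 0 (Submodule.zero_mem _) (by simpa using hr₂)
    have h4 := h3 1 (by simp)
    rw [norm_zero, mul_zero, norm_le_zero_iff, sub_eq_zero, h2] at h4
    have := b2 _ (hζm ξ) (hζr ξ hξ) 0 (Submodule.zero_mem _) (by simpa using hr₂)
    rwa [h4, sub_zero] at this
  let k : W' → W' := fun ξ => Qs (Ψ.ι z - Ψ.ι y₀) + Qs (Ψ.ι (β (ζ ξ)) - Ψ.ι z)
  have hk : MapsTo k s s := by
    intro ξ hξ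
    refine ⟨Submodule.add_mem _ (D.Qs_mem _ _) (D.Qs_mem _ _), ?_⟩
    have h1 := norm_add_le (Qs (Ψ.ι z - Ψ.ι y₀)) (Qs (Ψ.ι (β (ζ ξ)) - Ψ.ι z))
    have h2 := hQs (Ψ.ι z - Ψ.ι y₀)
    change _ ≤ C₀ * d at h2
    have h3 := hβz ξ hξ
    have h4 := hζn ξ hξ
    change ‖k ξ‖ ≤ _ at h1
    linarith
  have hcontr : ContractingWith (1 / 2) (hk.restrict k s s) := by
    refine ⟨by rw [← NNReal.coe_lt_coe]; norm_num, LipschitzWith.of_dist_le_mul ?_⟩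
    rintro ⟨ξ, hξ⟩ ⟨ξ', hξ'⟩
    rw [Subtype.dist_eq, Subtype.dist_eq, dist_eq_norm, dist_eq_norm]
    have e1 : k ξ - k ξ' = Qs (Ψ.ι (β (ζ ξ)) - Ψ.ι (β (ζ ξ'))) := by
      simp only [k]
      rw [add_sub_add_left_eq_sub, ← map_sub, sub_sub_sub_cancel_right]
    have e2 : ζ ξ - ζ ξ' = Qu (Ψ.ι (α ξ) - Ψ.ι (α ξ')) := by
      simp only [ζ]
      rw [sub_sub_sub_cancel_right, ← map_sub, sub_sub_sub_cancel_right]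
    have h1 := b2 _ (hζm ξ) (hζr ξ hξ) _ (hζm ξ') (hζr ξ' hξ')
    have h2 := a2 ξ hξ.1 (hsr ξ hξ) ξ' hξ'.1 (hsr ξ' hξ')
    rw [← e1] at h1
    change ‖Qu _‖ ≤ _ at h2
    rw [← e2] at h2
    change ‖k ξ - k ξ'‖ ≤ ((1 / 2 : NNReal) : ℝ) * ‖ξ - ξ'‖
    push_cast
    linarith [norm_nonneg (ξ - ξ')]
  have h0s : (0 : W') ∈ s := ⟨Submodule.zero_mem _, by rw [norm_zero]; positivity⟩
  obtain ⟨ξ, hξ, hfix, -⟩ := hcontr.exists_fixedPoint' hs hk h0s (edist_ne_top _ _)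
  obtain ⟨γ₁, p1, p2, p3, p4, p5, p6⟩ := a1 ξ hξ.1 (hsr ξ hξ)
  obtain ⟨γ₂, q1, q2, q3, q4, q5, q6⟩ := b1 _ (hζm ξ) (hζr ξ hξ)
  have heq : Ψ.proj y₀ (Ψ.ι (α ξ) - Ψ.ι (β (ζ ξ))) = 0 := by
    have e1 : Qs (Ψ.ι (α ξ) - Ψ.ι y₀) = Qs (Ψ.ι (β (ζ ξ)) - Ψ.ι y₀) := by
      refine p6.trans (hfix.symm.trans ?_)
      simp only [k]
      rw [← map_add, add_comm, sub_add_sub_cancel]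
    have e2 : Qu (Ψ.ι (α ξ) - Ψ.ι y₀) = Qu (Ψ.ι (β (ζ ξ)) - Ψ.ι y₀) := by
      have : Qu (Ψ.ι (β (ζ ξ)) - Ψ.ι z) + Qu (Ψ.ι z - Ψ.ι y₀) = Qu (Ψ.ι (α ξ) - Ψ.ι y₀) := by
        rw [q6]
        exact sub_add_cancel _ _
      rw [← this, ← map_add, sub_add_sub_cancel]
    have e3 : Ψ.ι (α ξ) - Ψ.ι (β (ζ ξ)) =
        (Ψ.ι (α ξ) - Ψ.ι y₀) - (Ψ.ι (β (ζ ξ)) - Ψ.ι y₀) := (sub_sub_sub_cancel_right _ _ _).symm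
    rw [← hD.sum (x, y₀), e3, map_sub (D.Qs (x, y₀)), map_sub (D.Qu (x, y₀))]
    change Qs _ - Qs _ + (Qu _ - Qu _) = 0
    rw [e1, e2, sub_self, sub_self, add_zero]
  have hw : α ξ = β (ζ ξ) := by
    have := hinj _ p4 _ q4
    rw [heq, norm_zero, mul_zero, norm_le_zero_iff, sub_eq_zero] at this
    exact Ψ.inj this
  have hb1 : C₁ * ‖ξ‖ ≤ C * d := by
    calc C₁ * ‖ξ‖ ≤ C₁ * (2 * C₀ * d) := by gcongr; exact hξ.2
      _ ≤ C * d := by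
        rw [hC, ← mul_assoc]
        gcongr
        nlinarith [mul_pos hC₂ hC₀0]
  have hb2 : C₂ * ‖ζ ξ‖ + d ≤ C * d := by
    calc C₂ * ‖ζ ξ‖ + d ≤ C₂ * (2 * C₀ * d) + d := by gcongr; exact hζn ξ hξ
      _ = (C₂ * (2 * C₀) + 1) * d := by ring
      _ ≤ C * d := by
        rw [hC]
        gcongr
        linarith
  refine ⟨γ₁, γ₂, ⟨p1.contMDiff, p1.mem, fun t ht => (p1.len_le t ht).trans hb1⟩,
    ⟨q1.contMDiff, q1.mem, fun t ht => (q1.len_le t ht).trans (by linarith)⟩, p2, q2,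
    (p3.trans hw).trans q3.symm, fun t ht => ⟨(p5 t ht).trans hb1, ?_⟩⟩
  rw [← sub_add_sub_cancel _ (Ψ.ι z)]
  exact (norm_add_le _ _).trans ((add_le_add (q5 t ht) le_rfl).trans hb2)

/-- The holonomy between nearby points of a fibre is approximated by a continuous form. -/
theorem exists_fibre_form (Φ : Framing I M W) (Ψ : Framing J N W')
    (hf : IsPartiallyHyperbolicFor m f S) (hft : ∀ x y, ft (x, y) = (f x, g x y))
    (hfib : IsDominatingHyperbolicFibre m h f S g Vs Vu) {T : Splitting (I.prod J) (M × N)}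
    (hT : T.IsInduced S Vs Vu) {G : Metric (I.prod J) (M × N)}
    (hTG : IsPartiallyHyperbolicFor G ft T) {φ : M × N → ℝ}
    (hφ : ContMDiff (I.prod J) 𝓘(ℝ, ℝ) 1 φ) :
    ∃ a : M × N → W' →L[ℝ] ℝ, Continuous a ∧ ∀ x y₀, ∀ ε > 0, ∃ δ : ℝ, 0 < δ ∧
      ∀ z, ‖Ψ.ι z - Ψ.ι y₀‖ < δ → ∃ c, HolRel ft T φ (x, y₀) (x, z) c ∧
        |c - a (x, y₀) (Ψ.ι z - Ψ.ι y₀)| ≤ ε * ‖Ψ.ι z - Ψ.ι y₀‖ := by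
  obtain ⟨lam, hG⟩ := hTG.exists_isHyperbolicPair (Φ.prod Ψ)
  obtain ⟨Ps, Pc, Pu, hPs, _, hPu, hm, _, he⟩ := (Φ.prod Ψ).exists_projections hTG
  obtain ⟨a, ha, happ⟩ := hG.exists_form (Φ.prod Ψ) hPs hPu (fun p w => (hm p w).1)
    (fun p w hw => by
      have := he p w hw 0 (Submodule.zero_mem _) 0 (Submodule.zero_mem _)
      rw [add_zero, add_zero] at this
      exact ⟨this.1, this.2.2⟩) (fun p w => (hm p w).2.2)
    (fun p w hw => by
      have := he p 0 (Submodule.zero_mem _) 0 (Submodule.zero_mem _) w hw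
      rw [zero_add, zero_add] at this
      exact ⟨this.2.2, this.1⟩) hφ
  refine ⟨fun p => -(a p ∘L ContinuousLinearMap.inr ℝ W W'), (ha.clm_comp continuous_const).neg,
    fun x y₀ ε hε => ?_⟩
  obtain ⟨C, r, hC, hr, hacc⟩ := exists_fibre_access Φ Ψ hf hft hfib hT hG x y₀
  obtain ⟨δ, hδ, hap⟩ := happ (x, y₀) (ε / (2 * C)) (by positivity)
  refine ⟨min r (δ / C), by positivity, fun z hz => ?_⟩
  obtain ⟨γ₁, γ₂, h1, h2, h3, h4, h5, h6⟩ := hacc z (hz.trans_le (min_le_left _ _))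
  set d := ‖Ψ.ι z - Ψ.ι y₀‖
  have hd : C * d < δ := by
    have := hz.trans_le (min_le_right _ _)
    rwa [lt_div_iff₀' hC] at this
  have e : ∀ y y', (Φ.prod Ψ).ι (x, y) - (Φ.prod Ψ).ι (x, y') = (0, Ψ.ι y - Ψ.ι y') :=
    fun y y' => Prod.ext (sub_self _) rfl
  have e' : ∀ v : W', ‖((0 : W), v)‖ = ‖v‖ := fun v => by
    rw [Prod.norm_def, norm_zero, max_eq_right (norm_nonneg _)]
  have i1 := hap .stable _ _ h1 (fun t ht => by
    rw [e, e']; exact ((h6 t ht).1).trans_lt hd)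
  have i2 := hap .unstable _ _ h2 (fun t ht => by
    rw [e, e']; exact ((h6 t ht).2).trans_lt hd)
  rw [e] at i1 i2
  rw [h3] at i1
  rw [h4] at i2
  have r1 : HolRel ft T φ (x, y₀) (x, γ₁ 1) _ :=
    HolRel.of_leg (σ := .stable) (by have := h1.inLeaf; rwa [h3] at this)
  have r2 : HolRel ft T φ (x, z) (x, γ₁ 1) _ :=
    HolRel.of_leg (σ := .unstable) (by have := h2.inLeaf; rwa [h4, ← h5] at this)
  refine ⟨_, r1.trans r2.symm, ?_⟩
  rw [← h5] at i2
  set A := a (x, y₀)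
  have e3 : (-(A ∘L ContinuousLinearMap.inr ℝ W W')) (Ψ.ι z - Ψ.ι y₀) =
      A (0, Ψ.ι y₀ - Ψ.ι (γ₁ 1)) - A (0, Ψ.ι z - Ψ.ι (γ₁ 1)) := by
    rw [← map_sub]
    change -A (0, _) = _
    rw [← map_neg]
    congr 1
    exact Prod.ext (by simp) (by simp)
  change |_ - (-(A ∘L ContinuousLinearMap.inr ℝ W W')) (Ψ.ι z - Ψ.ι y₀)| ≤ _
  rw [e3]
  set c₁ := holLeg ft φ .stable (x, y₀) (x, γ₁ 1)
  set c₂ := holLeg ft φ .unstable (x, z) (x, γ₁ 1)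
  have e4 : ε / (2 * C) * (C * d) = ε * d / 2 := by field_simp
  rw [e4] at i1 i2
  have := abs_sub (c₁ - A (0, Ψ.ι y₀ - Ψ.ι (γ₁ 1))) (c₂ - A (0, Ψ.ι z - Ψ.ι (γ₁ 1)))
  calc _ = |(c₁ - A (0, Ψ.ι y₀ - Ψ.ι (γ₁ 1))) - (c₂ - A (0, Ψ.ι z - Ψ.ι (γ₁ 1)))| := by
        congr 1; ring
    _ ≤ _ := by linarith

end PHCocycle

namespace PHCocycle

variable {F : Type*} [NormedAddCommGroup F] [NormedSpace ℝ F] [FiniteDimensional ℝ F]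
  {H' : Type*} [TopologicalSpace H'] {J : ModelWithCorners ℝ F H'}
  {N : Type*} [TopologicalSpace N] [ChartedSpace H' N] [IsManifold J 1 N] [BoundarylessManifold J N]
  [CompactSpace N] [T2Space N]
  {W' : Type*} [NormedAddCommGroup W'] [NormedSpace ℝ W'] [FiniteDimensional ℝ W']

/-! ### Continuity of the holonomy along the fibres -/

theorem abs_sub_le_of_local {k : ℝ → ℝ} {C : ℝ}
    (h : ∀ t ∈ Icc (0 : ℝ) 1, ∀ᶠ s in 𝓝[Icc 0 1] t, |k s - k t| ≤ C * |s - t|) :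
    |k 1 - k 0| ≤ C := by
  have hcont : ContinuousOn k (Icc 0 1) := by
    intro t ht
    rw [ContinuousWithinAt, tendsto_iff_dist_tendsto_zero]
    have h1 : Filter.Tendsto (fun s => C * |s - t|) (𝓝[Icc 0 1] t) (𝓝 0) := by
      have : Filter.Tendsto (fun s => C * |s - t|) (𝓝 t) (𝓝 (C * |t - t|)) :=
        (by fun_prop : Continuous fun s => C * |s - t|).tendsto t
      rw [sub_self, abs_zero, mul_zero] at this
      exact this.mono_left nhdsWithin_le_nhds
    exact squeeze_zero' (Filter.Eventually.of_forall fun _ => dist_nonneg)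
      ((h t ht).mono fun s hs => hs) h1
  have key : ∀ k : ℝ → ℝ, ContinuousOn k (Icc 0 1) →
      (∀ t ∈ Icc (0 : ℝ) 1, ∀ᶠ s in 𝓝[Icc 0 1] t, |k s - k t| ≤ C * |s - t|) →
      k 1 ≤ k 0 + C * 1 := by
    intro k hk h
    refine image_le_of_liminf_slope_right_le_deriv_boundary (f := k) (a := 0) (b := 1)
      (B := fun t => k 0 + C * t) (B' := fun _ => C) hk (by simp) (by fun_prop)
      (fun t _ => ?_) (fun t ht r hr => ?_) (by simp)
    · simpa using (((hasDerivAt_id t).const_mul C).const_add (k 0)).hasDerivWithinAt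
    · refine Filter.Eventually.frequently ?_
      have h1 : ∀ᶠ s in 𝓝[>] t, s ∈ Icc (0 : ℝ) 1 := by
        filter_upwards [Ioo_mem_nhdsGT ht.2] with s hs
        exact ⟨ht.1.trans hs.1.le, hs.2.le⟩
      have h2 : ∀ᶠ s in 𝓝[>] t, |k s - k t| ≤ C * |s - t| := by
        have := h t ⟨ht.1, ht.2.le⟩
        rw [eventually_nhdsWithin_iff] at this
        filter_upwards [this.filter_mono nhdsWithin_le_nhds, h1] with s hs hs1
        exact hs hs1
      filter_upwards [h2, self_mem_nhdsWithin] with s hs hst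
      have hst : 0 < s - t := sub_pos.2 hst
      rw [slope_def_field, div_lt_iff₀ hst]
      rw [abs_of_pos hst] at hs
      calc k s - k t ≤ C * (s - t) := (le_abs_self _).trans hs
        _ < r * (s - t) := by gcongr
  rw [mul_one] at key
  refine abs_sub_le_iff.2 ⟨by linarith [key k hcont h], ?_⟩
  have := key (fun t => -k t) hcont.neg fun t ht => by
    filter_upwards [h t ht] with s hs
    rwa [neg_sub_neg, abs_sub_comm]
  linarith

/-- A function whose increments are infinitesimally small is locally small. -/
theorem Framing.exists_local_bound (Ψ : Framing J N W') (y₀ : N) : ∃ U ∈ 𝓝 y₀, ∃ L : ℝ, 0 < L ∧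
    ∀ (κ : N → ℝ) (ε : ℝ), (∀ y, ∃ δ : ℝ, 0 < δ ∧ ∀ z, ‖Ψ.ι z - Ψ.ι y‖ < δ →
      |κ z - κ y| ≤ ε * ‖Ψ.ι z - Ψ.ι y‖) → 0 ≤ ε → ∀ z ∈ U, |κ z - κ y₀| ≤ L * ε := by
  obtain ⟨K, t, ht, hK⟩ := (hasStrictFDerivAt_chart Ψ.contMDiff y₀).exists_lipschitzOnWith
  set e := extChartAt J y₀
  obtain ⟨R, hR, hball⟩ := Metric.nhds_basis_ball.mem_iff.1
    (Filter.inter_mem (extChartAt_target_mem_nhds_of_boundaryless (I := J) y₀) ht)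
  refine ⟨e.source ∩ e ⁻¹' Metric.ball (e y₀) R, Filter.inter_mem (extChartAt_source_mem_nhds y₀)
    ((continuousAt_extChartAt y₀).preimage_mem_nhds (Metric.ball_mem_nhds _ hR)), K * R + 1,
    by positivity, fun κ ε hκ hε z hz => ?_⟩
  set v := e z - e y₀
  have hv : ‖v‖ < R := by
    rw [← dist_eq_norm]
    exact hz.2
  have hin : ∀ s ∈ Icc (0 : ℝ) 1, e y₀ + s • v ∈ Metric.ball (e y₀) R := by
    intro s hs
    rw [Metric.mem_ball, dist_eq_norm, add_sub_cancel_left, norm_smul, Real.norm_of_nonneg hs.1]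
    exact (mul_le_of_le_one_left (norm_nonneg _) hs.2).trans_lt hv
  have hlip : ∀ s ∈ Icc (0 : ℝ) 1, ∀ t ∈ Icc (0 : ℝ) 1,
      ‖Ψ.ι (e.symm (e y₀ + s • v)) - Ψ.ι (e.symm (e y₀ + t • v))‖ ≤ K * R * |s - t| := by
    intro s hs t ht
    have := hK.dist_le_mul _ (hball (hin s hs)).2 _ (hball (hin t ht)).2
    rw [dist_eq_norm, dist_eq_norm, add_sub_add_left_eq_sub, ← sub_smul, norm_smul,
      Real.norm_eq_abs] at this
    refine this.trans ?_
    rw [mul_comm |s - t|, mul_assoc]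
    gcongr
  have h1 := abs_sub_le_of_local (k := fun s => κ (e.symm (e y₀ + s • v))) (C := (K * R) * ε)
    fun t ht => by
      obtain ⟨δ, hδ, hd⟩ := hκ (e.symm (e y₀ + t • v))
      have hcl : ∀ᶠ s in 𝓝[Icc 0 1] t, K * R * |s - t| < δ := by
        have : Filter.Tendsto (fun s => K * R * |s - t|) (𝓝 t) (𝓝 (K * R * |t - t|)) :=
          (by fun_prop : Continuous fun s => K * R * |s - t|).tendsto t
        rw [sub_self, abs_zero, mul_zero] at this
        exact (this.mono_left nhdsWithin_le_nhds).eventually_lt_const hδ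
      filter_upwards [hcl, self_mem_nhdsWithin] with s hs hs1
      have hst := hlip s hs1 t ht
      calc _ ≤ ε * ‖Ψ.ι (e.symm (e y₀ + s • v)) - Ψ.ι (e.symm (e y₀ + t • v))‖ :=
            hd _ (hst.trans_lt hs)
        _ ≤ ε * (K * R * |s - t|) := by gcongr
        _ = _ := by ring
  simp only [one_smul, zero_smul, add_zero, v, add_sub_cancel] at h1
  rw [e.left_inv hz.1, extChartAt_to_inv] at h1
  refine h1.trans ?_
  gcongr
  linarith

variable {M : Type*} [TopologicalSpace M] [CompactSpace M] [ConnectedSpace N]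

theorem Framing.continuous_of_form (Ψ : Framing J N W') {k : M × N → ℝ} {a : M × N → W' →L[ℝ] ℝ}
    (ha : Continuous a) (y₀ : N) (hk0 : ∀ x, k (x, y₀) = 0)
    (hk : ∀ x y, ∀ ε > 0, ∃ δ : ℝ, 0 < δ ∧ ∀ z, ‖Ψ.ι z - Ψ.ι y‖ < δ →
      |k (x, z) - k (x, y) - a (x, y) (Ψ.ι z - Ψ.ι y)| ≤ ε * ‖Ψ.ι z - Ψ.ι y‖) :
    Continuous k := by
  rw [continuous_iff_continuousAt]
  rintro ⟨x₀, y₁⟩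
  choose U hU L hL hb using Ψ.exists_local_bound
  have hunif : ∀ ε > 0, ∀ᶠ x in 𝓝 x₀, ∀ y, ‖a (x, y) - a (x₀, y)‖ < ε := by
    intro ε hε
    have : Continuous fun q : M × N => ‖a q - a (x₀, q.2)‖ := by fun_prop
    have h1 : ∀ y ∈ (univ : Set N), ∀ᶠ q : M × N in 𝓝 x₀ ×ˢ 𝓝 y, ‖a q - a (x₀, q.2)‖ < ε := by
      intro y _
      rw [← nhds_prod_eq]
      exact this.continuousAt.eventually_lt continuousAt_const (by simpa using hε)
    have h2 := isCompact_univ.eventually_forall_of_forall_eventually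
      (P := fun x y => ‖a (x, y) - a (x₀, y)‖ < ε) (fun y hy => by
        rw [nhds_prod_eq]; exact h1 y hy)
    filter_upwards [h2] with x hx y
    exact hx y trivial
  have hloc : ∀ y, ∀ ε > 0, ∀ᶠ x in 𝓝 x₀, ∀ z ∈ U y,
      |k (x, z) - k (x₀, z) - (k (x, y) - k (x₀, y))| ≤ ε := by
    intro y ε hε
    have hε' : 0 < ε / (3 * L y) := by have := hL y; positivity
    filter_upwards [hunif _ hε'] with x hx z hz
    have := hb y (fun z => k (x, z) - k (x₀, z)) (3 * (ε / (3 * L y))) (fun y' => ?_)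
      (by positivity) z hz
    · refine this.trans (le_of_eq ?_)
      have := hL y
      field_simp
    · obtain ⟨δ₁, hδ₁, d1⟩ := hk x y' _ hε'
      obtain ⟨δ₂, hδ₂, d2⟩ := hk x₀ y' _ hε'
      refine ⟨min δ₁ δ₂, lt_min hδ₁ hδ₂, fun z hz => ?_⟩
      have i1 := d1 z (hz.trans_le (min_le_left _ _))
      have i2 := d2 z (hz.trans_le (min_le_right _ _))
      have i3 : |(a (x, y') - a (x₀, y')) (Ψ.ι z - Ψ.ι y')| ≤ ε / (3 * L y) * ‖Ψ.ι z - Ψ.ι y'‖ :=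
        ContinuousLinearMap.le_of_opNorm_le _ (hx y').le _
      rw [sub_apply] at i3
      rw [abs_le] at i1 i2 i3 ⊢
      constructor <;> linarith [i1.1, i1.2, i2.1, i2.2, i3.1, i3.2]
  let Z : Set N := {z | ∀ ε > 0, ∀ᶠ x in 𝓝 x₀, |k (x, z) - k (x₀, z)| ≤ ε}
  have hZ : ∀ y, (y ∈ Z → ∀ z ∈ U y, z ∈ Z) ∧ (∀ z ∈ U y, z ∈ Z → y ∈ Z) := by
    refine fun y => ⟨fun hy z hz ε hε => ?_, fun z hz hzZ ε hε => ?_⟩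
    · filter_upwards [hy (ε / 2) (by positivity), hloc y (ε / 2) (by positivity)] with x h1 h2
      have h2 := h2 z hz
      rw [abs_le] at *
      constructor <;> linarith [h1.1, h1.2, h2.1, h2.2]
    · filter_upwards [hzZ (ε / 2) (by positivity), hloc y (ε / 2) (by positivity)] with x h1 h2
      have h2 := h2 z hz
      rw [abs_le] at *
      constructor <;> linarith [h1.1, h1.2, h2.1, h2.2]
  have hclopen : IsClopen Z := by
    refine ⟨⟨isOpen_iff_mem_nhds.2 fun y hy => ?_⟩, isOpen_iff_mem_nhds.2 fun y hy => ?_⟩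
    · exact Filter.mem_of_superset (hU y) fun z hz hzZ => hy ((hZ y).2 z hz hzZ)
    · exact Filter.mem_of_superset (hU y) fun z hz => (hZ y).1 hy z hz
  have hZuniv : Z = univ := hclopen.eq_univ ⟨y₀, fun ε hε => by simp [hk0, hε.le]⟩
  have hy₁ : y₁ ∈ Z := hZuniv ▸ mem_univ y₁
  have hc : ContinuousAt (fun z => k (x₀, z)) y₁ := by
    rw [ContinuousAt, tendsto_iff_dist_tendsto_zero]
    obtain ⟨δ, hδ, hd⟩ := hk x₀ y₁ 1 one_pos
    have hι : Continuous fun z => Ψ.ι z - Ψ.ι y₁ := Ψ.contMDiff.continuous.sub continuous_const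
    have h1 : ∀ᶠ z in 𝓝 y₁, ‖Ψ.ι z - Ψ.ι y₁‖ < δ :=
      hι.norm.continuousAt.eventually_lt continuousAt_const (by simpa using hδ)
    have h2 : Filter.Tendsto (fun z => (‖a (x₀, y₁)‖ + 1) * ‖Ψ.ι z - Ψ.ι y₁‖) (𝓝 y₁) (𝓝 0) := by
      have := (hι.norm.const_mul (‖a (x₀, y₁)‖ + 1)).tendsto y₁
      simpa using this
    refine squeeze_zero' (Filter.Eventually.of_forall fun _ => dist_nonneg) ?_ h2
    filter_upwards [h1] with z hz
    have i1 := hd z hz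
    have i2 : |a (x₀, y₁) (Ψ.ι z - Ψ.ι y₁)| ≤ _ := (a (x₀, y₁)).le_opNorm _
    rw [Real.dist_eq]
    have i3 := abs_add_le (k (x₀, z) - k (x₀, y₁) - a (x₀, y₁) (Ψ.ι z - Ψ.ι y₁))
      (a (x₀, y₁) (Ψ.ι z - Ψ.ι y₁))
    rw [sub_add_cancel] at i3
    linarith
  rw [Metric.continuousAt_iff'] 
  intro ε hε
  rw [nhds_prod_eq]
  have e1 := (hy₁ (ε / 4) (by positivity)).and (hloc y₁ (ε / 4) (by positivity))
  have e2 := ((Metric.continuousAt_iff'.1 hc) (ε / 4) (by positivity)).and (hU y₁)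
  filter_upwards [e1.prod_mk e2] with ⟨x, z⟩ ⟨⟨h1, h2⟩, h3, h4⟩
  have h2 := h2 z h4
  simp only [Real.dist_eq] at h1 h2 h3 ⊢
  rw [abs_le] at h1 h2
  rw [abs_lt] at h3 ⊢
  constructor <;> linarith [h1.1, h1.2, h2.1, h2.2, h3.1, h3.2]

end PHCocycle

namespace PHCocycle

variable {E : Type*} [NormedAddCommGroup E] [NormedSpace ℝ E] [FiniteDimensional ℝ E]
  {H : Type*} [TopologicalSpace H] {I : ModelWithCorners ℝ E H}
  {M : Type*} [TopologicalSpace M] [ChartedSpace H M] [IsManifold I 1 M] [BoundarylessManifold I M]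
  [CompactSpace M] [T2Space M]
  {F : Type*} [NormedAddCommGroup F] [NormedSpace ℝ F] [FiniteDimensional ℝ F]
  {H' : Type*} [TopologicalSpace H'] {J : ModelWithCorners ℝ F H'}
  {N : Type*} [TopologicalSpace N] [ChartedSpace H' N] [IsManifold J 1 N] [BoundarylessManifold J N]
  [CompactSpace N] [T2Space N] [ConnectedSpace N]
  {W : Type*} [NormedAddCommGroup W] [NormedSpace ℝ W] [FiniteDimensional ℝ W]
  {W' : Type*} [NormedAddCommGroup W'] [NormedSpace ℝ W'] [FiniteDimensional ℝ W']
  {f : M ≃ₘ^1⟮I, I⟯ M} {S : Splitting I M} {m : Metric I M}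
  {ft : (M × N) ≃ₘ^1⟮I.prod J, I.prod J⟯ (M × N)} {g : M → N ≃ₘ^1⟮J, J⟯ N}
  {Vs Vu : M → ∀ y : N, Submodule ℝ (TangentSpace J y)} {h : Metric (I.prod J) (M × N)}

/-- The holonomies along the fibres are the differences of a continuous function. -/
theorem exists_fibre_potential (Φ : Framing I M W) (Ψ : Framing J N W')
    (hf : IsPartiallyHyperbolicFor m f S) (hft : ∀ x y, ft (x, y) = (f x, g x y))
    (hfib : IsDominatingHyperbolicFibre m h f S g Vs Vu) {T : Splitting (I.prod J) (M × N)}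
    (hT : T.IsInduced S Vs Vu) {G : Metric (I.prod J) (M × N)}
    (hTG : IsPartiallyHyperbolicFor G ft T) {φ : M × N → ℝ}
    (hφ : ContMDiff (I.prod J) 𝓘(ℝ, ℝ) 1 φ) (hpcf : TrivialPCF ft T φ) :
    ∃ k : M × N → ℝ, Continuous k ∧
      ∀ x y z, HolRel ft T φ (x, y) (x, z) (k (x, z) - k (x, y)) := by
  obtain ⟨a, ha, hform⟩ := exists_fibre_form Φ Ψ hf hft hfib hT hTG hφ
  have hnear : ∀ x y, ∀ᶠ z in 𝓝 y, ∃ c, HolRel ft T φ (x, y) (x, z) c := by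
    intro x y
    obtain ⟨δ, hδ, hd⟩ := hform x y 1 one_pos
    have hι : Continuous fun z => ‖Ψ.ι z - Ψ.ι y‖ :=
      (Ψ.contMDiff.continuous.sub continuous_const).norm
    filter_upwards [hι.continuousAt.eventually_lt continuousAt_const (by simpa using hδ)] with z hz
    obtain ⟨c, hc, -⟩ := hd z hz
    exact ⟨c, hc⟩
  have hex : ∀ x y z, ∃ c, HolRel ft T φ (x, y) (x, z) c := by
    intro x y z
    let Z : Set N := {z | ∃ c, HolRel ft T φ (x, y) (x, z) c}
    have hclopen : IsClopen Z := by
      refine ⟨⟨isOpen_iff_mem_nhds.2 fun z hz => ?_⟩, isOpen_iff_mem_nhds.2 ?_⟩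
      · filter_upwards [hnear x z] with w ⟨c, hc⟩ ⟨d, hd⟩
        exact hz ⟨_, hd.trans hc.symm⟩
      · rintro z ⟨d, hd⟩
        filter_upwards [hnear x z] with w ⟨c, hc⟩
        exact ⟨_, hd.trans hc⟩
    have hZ : Z = univ := hclopen.eq_univ ⟨y, 0, HolRel.refl⟩
    exact hZ.symm.subset (mem_univ z)
  obtain ⟨y₀⟩ : Nonempty N := inferInstance
  choose k hk using fun p : M × N => hex p.1 y₀ p.2
  have hdiff : ∀ x y z, HolRel ft T φ (x, y) (x, z) (k (x, z) - k (x, y)) := fun x y z =>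
    ((hk (x, y)).symm.trans (hk (x, z))).cast (by ring)
  refine ⟨k, Ψ.continuous_of_form ha y₀ (fun x => hpcf.unique (hk (x, y₀)) HolRel.refl)
    fun x y ε hε => ?_, hdiff⟩
  obtain ⟨δ, hδ, hd⟩ := hform x y ε hε
  refine ⟨δ, hδ, fun z hz => ?_⟩
  obtain ⟨c, hc, hle⟩ := hd z hz
  rwa [hpcf.unique (hdiff x y z) hc]

variable [MeasurableSpace N] [BorelSpace N]

theorem continuous_fibre_integral (Φ : Framing I M W) (μ : Measure N) [IsProbabilityMeasure μ] {k : M × N → ℝ}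
    (hk : Continuous k) : Continuous fun x => ∫ y, k (x, y) ∂μ := by
  have := Φ.isEmbedding.isInducing.firstCountableTopology
  have := continuous_parametric_integral_of_continuous (μ := μ) (s := univ)
    (f := fun x y => k (x, y)) (by exact hk) isCompact_univ
  simpa using this

theorem exists_fibre_transfer (Φ : Framing I M W) (Ψ : Framing J N W')
    (hf : IsPartiallyHyperbolicFor m f S) (hft : ∀ x y, ft (x, y) = (f x, g x y))
    (hfib : IsDominatingHyperbolicFibre m h f S g Vs Vu) {T : Splitting (I.prod J) (M × N)}
    (hT : T.IsInduced S Vs Vu) {G : Metric (I.prod J) (M × N)}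
    (hTG : IsPartiallyHyperbolicFor G ft T) (μ : Measure N) [IsProbabilityMeasure μ]
    (hμ : ∀ x, MeasurePreserving (g x) μ μ) {φ : M × N → ℝ}
    (hφ : ContMDiff (I.prod J) 𝓘(ℝ, ℝ) 1 φ) (hpcf : TrivialPCF ft T φ) :
    ∃ k : M × N → ℝ, Continuous k ∧
      (∀ x y z, HolRel ft T φ (x, y) (x, z) (k (x, z) - k (x, y))) ∧
      ∀ p, φ p = k (ft p) - k p + ∫ y, φ (p.1, y) ∂μ := by
  obtain ⟨k, hk, hkr⟩ := exists_fibre_potential Φ Ψ hf hft hfib hT hTG hφ hpcf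
  obtain ⟨lam, hG⟩ := hTG.exists_isHyperbolicPair (Φ.prod Ψ)
  have hH := hG.hasHol (Φ.prod Ψ) hφ
  have hint : ∀ k : M × N → ℝ, Continuous k → ∀ x, Integrable (fun y => k (x, y)) μ :=
    fun k hk x => (hk.comp (f := fun y : N => (x, y)) (by fun_prop)).integrable_of_hasCompactSupport
      (HasCompactSupport.of_compactSpace _)
  refine ⟨fun p => k p - ∫ y, k (p.1, y) ∂μ,
    hk.sub ((continuous_fibre_integral Φ μ hk).comp continuous_fst),
    fun x y z => (hkr x y z).cast (by ring), ?_⟩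
  rintro ⟨x, z⟩
  have h1 : ∀ y, k (f x, g x z) - k (f x, g x y) =
      (k (x, z) + φ (x, z)) - (k (x, y) + φ (x, y)) := by
    intro y
    have := (hkr x y z).map hH
    rw [hft, hft] at this
    exact (hpcf.unique (hkr _ _ _) this).trans (by ring)
  have h2 : ∫ y, k (f x, g x y) ∂μ = ∫ y, k (f x, y) ∂μ :=
    (hμ x).integral_comp (g x).toHomeomorph.measurableEmbedding (fun y => k (f x, y))
  have h3 : ∫ y, (k (f x, g x z) - k (f x, g x y)) ∂μ =
      ∫ y, ((k (x, z) + φ (x, z)) - (k (x, y) + φ (x, y))) ∂μ := by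
    congr 1
    exact funext h1
  have i1 : Integrable (fun y => k (f x, g x y)) μ :=
    (hμ x).integrable_comp_of_integrable (hint k hk (f x))
  rw [integral_sub (integrable_const _) i1, integral_sub (integrable_const _)
    (show Integrable (fun y => k (x, y) + φ (x, y)) μ from
      (hint k hk x).add (hint φ hφ.continuous x)),
    integral_add (hint k hk x) (hint φ hφ.continuous x), h2] at h3
  simp only [integral_const, probReal_univ, one_smul] at h3
  rw [hft]
  simp only
  linarith

end PHCocycle

namespace PHCocycle

/-! ### Smoothness of integrals depending on a parameter -/

section Parametric

variable {E : Type*} [NormedAddCommGroup E] [NormedSpace ℝ E] [FiniteDimensional ℝ E]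
  {H : Type*} [TopologicalSpace H] {I : ModelWithCorners ℝ E H}
  {M : Type*} [TopologicalSpace M] [ChartedSpace H M] [IsManifold I ∞ M] [BoundarylessManifold I M]
  {F : Type*} [NormedAddCommGroup F] [NormedSpace ℝ F]
  {H' : Type*} [TopologicalSpace H'] {J : ModelWithCorners ℝ F H'}
  {N : Type*} [TopologicalSpace N] [ChartedSpace H' N] [IsManifold J ∞ N]
  [CompactSpace N] [MeasurableSpace N] [BorelSpace N]

theorem contMDiffAt_fderiv_param {n : ℕ} {G : E × N → ℝ} {O : Set E}
    (hO : IsOpen O) (hG : ContMDiffOn (𝓘(ℝ, E).prod J) 𝓘(ℝ, ℝ) (n + 1 : ℕ) G (O ×ˢ univ)) {q : E × N}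
    (hq : q.1 ∈ O) :
    ContMDiffAt (𝓘(ℝ, E).prod J) 𝓘(ℝ, E →L[ℝ] ℝ) n
      (fun q : E × N => fderiv ℝ (fun u => G (u, q.2)) q.1) q := by
  have : IsManifold J 1 N := IsManifold.of_le (n := ∞) (by norm_cast)
  have hGq := hG.contMDiffAt ((hO.prod isOpen_univ).mem_nhds (show q ∈ O ×ˢ univ from ⟨hq, trivial⟩))
  have h1 : ContMDiffAt ((𝓘(ℝ, E).prod J).prod 𝓘(ℝ, E)) 𝓘(ℝ, ℝ) (n + 1 : ℕ)
      (Function.uncurry fun (p : E × N) (u : E) => G (u, p.2)) (q, q.1) := by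
    refine ContMDiffAt.comp (I' := 𝓘(ℝ, E).prod J) (x := (q, q.1)) (g := G) (f := fun r : (E × N) × E => (r.2, r.1.2))
      (by exact hGq) ?_
    exact contMDiffAt_snd.prodMk (contMDiffAt_snd.comp _ contMDiffAt_fst)
  have h2 := ContMDiffAt.mfderiv (m := n) (fun (p : E × N) (u : E) => G (u, p.2)) (fun p => p.1) h1
    contMDiffAt_fst (by norm_cast)
  refine h2.congr_of_eventuallyEq (.of_forall fun p => ?_)
  have h3 := inTangentCoordinates_model_space (I := 𝓘(ℝ, E)) (I' := 𝓘(ℝ, ℝ)) (fun p : E × N => p.1)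
    (fun p => G (p.1, p.2)) (fun p => fderiv ℝ (fun u => G (u, p.2)) p.1) q
  exact (congrFun h3 p).symm.trans (by simp only [mfderiv_eq_fderiv])

theorem hasFDerivAt_integral_param (μ : Measure N) [IsProbabilityMeasure μ] {G : E × N → ℝ}
    {O : Set E} (hO : IsOpen O) {n : ℕ} (hG : ContMDiffOn (𝓘(ℝ, E).prod J) 𝓘(ℝ, ℝ) (n + 1 : ℕ) G (O ×ˢ univ))
    {u : E} (hu : u ∈ O) :
    HasFDerivAt (fun u => ∫ y, G (u, y) ∂μ) (∫ y, fderiv ℝ (fun u => G (u, y)) u ∂μ) u ∧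
      Integrable (fun y => fderiv ℝ (fun u => G (u, y)) u) μ := by
  have hD : ContinuousOn (fun q : E × N => fderiv ℝ (fun u => G (u, q.2)) q.1) (O ×ˢ univ) :=
    fun q hq => (contMDiffAt_fderiv_param hO hG hq.1).continuousAt.continuousWithinAt
  obtain ⟨K, hK, huK, hKO⟩ := exists_compact_subset hO hu
  obtain ⟨C, hC⟩ := (hK.prod isCompact_univ).exists_bound_of_continuousOn
    (hD.mono (prod_mono hKO subset_rfl))
  have hDi : Integrable (fun y => fderiv ℝ (fun u => G (u, y)) u) μ :=
    (hD.comp_continuous (f := fun y : N => (u, y)) (by fun_prop)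
      fun y => ⟨hu, trivial⟩).integrable_of_hasCompactSupport (HasCompactSupport.of_compactSpace _)
  have hGi : ∀ v ∈ O, Integrable (fun y => G (v, y)) μ := fun v hv =>
    (hG.continuousOn.comp_continuous (f := fun y : N => (v, y)) (by fun_prop)
      fun y => ⟨hv, trivial⟩).integrable_of_hasCompactSupport
      (HasCompactSupport.of_compactSpace _)
  refine ⟨hasFDerivAt_integral_of_dominated_of_fderiv_le (s := K) (bound := fun _ => C)
    (F := fun v y => G (v, y)) (F' := fun v y => fderiv ℝ (fun u => G (u, y)) v)
    (mem_interior_iff_mem_nhds.1 huK) ?_ (hGi u hu) hDi.aestronglyMeasurable ?_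
    (integrable_const _) ?_, hDi⟩
  · filter_upwards [hO.mem_nhds hu] with v hv using (hGi v hv).aestronglyMeasurable
  · exact .of_forall fun y v hv => hC (v, y) ⟨hv, trivial⟩
  · refine .of_forall fun y v hv => DifferentiableAt.hasFDerivAt ?_
    have h1 := hG.contMDiffAt ((hO.prod isOpen_univ).mem_nhds
      (show (v, y) ∈ O ×ˢ univ from ⟨hKO hv, trivial⟩))
    have h2 : ContMDiffAt 𝓘(ℝ, E) 𝓘(ℝ, ℝ) (n + 1 : ℕ) (fun u => G (u, y)) v :=
      h1.comp (f := fun u : E => (u, y)) v (contMDiffAt_id.prodMk contMDiffAt_const)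
    exact h2.contDiffAt.differentiableAt (by norm_cast)

theorem contDiffOn_integral_param (μ : Measure N) [IsProbabilityMeasure μ] (n : ℕ) {G : E × N → ℝ}
    {O : Set E} (hO : IsOpen O) (hG : ContMDiffOn (𝓘(ℝ, E).prod J) 𝓘(ℝ, ℝ) n G (O ×ˢ univ)) :
    ContDiffOn ℝ n (fun u => ∫ y, G (u, y) ∂μ) O := by
  induction n generalizing G with
  | zero =>
    refine contDiffOn_zero.2 fun u hu => ContinuousAt.continuousWithinAt ?_
    obtain ⟨K, hK, huK, hKO⟩ := exists_compact_subset hO hu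
    obtain ⟨C, hC⟩ := (hK.prod isCompact_univ).exists_bound_of_continuousOn
      (hG.continuousOn.mono (prod_mono hKO subset_rfl))
    have hs : ∀ v ∈ O, Continuous fun y : N => G (v, y) := fun v hv =>
      hG.continuousOn.comp_continuous (by fun_prop) fun y => ⟨hv, trivial⟩
    refine continuousAt_of_dominated (bound := fun _ => C) ?_ ?_ (integrable_const _) ?_
    · filter_upwards [hO.mem_nhds hu] with v hv
      exact ((hs v hv).integrable_of_hasCompactSupport
        (HasCompactSupport.of_compactSpace _)).aestronglyMeasurable
    · filter_upwards [mem_interior_iff_mem_nhds.1 huK] with v hv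
      exact .of_forall fun y => hC (v, y) ⟨hv, trivial⟩
    · refine .of_forall fun y => ContinuousAt.comp (f := fun v : E => (v, y)) (g := G) ?_ (by fun_prop)
      exact hG.continuousOn.continuousAt ((hO.prod isOpen_univ).mem_nhds ⟨hu, trivial⟩)
  | succ n ih =>
    rw [Nat.cast_add, Nat.cast_one]
    refine contDiffOn_succ_of_fderiv_apply
      (fun u hu => (hasFDerivAt_integral_param μ hO hG hu).1.differentiableAt.differentiableWithinAt)
      (by simp) fun e => ?_
    refine (ih (G := fun q => fderiv ℝ (fun u => G (u, q.2)) q.1 e) fun q hq => ?_).congr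
      fun u hu => ?_
    · exact ((contMDiffAt_fderiv_param hO hG hq.1).clm_apply contMDiffAt_const).contMDiffWithinAt
    · obtain ⟨h1, h2⟩ := hasFDerivAt_integral_param μ hO hG hu
      rw [fderivWithin_of_isOpen hO hu, h1.fderiv, ContinuousLinearMap.integral_apply h2]

theorem contMDiff_integral_param (μ : Measure N) [IsProbabilityMeasure μ] {R : ℕ∞}
    {φ : M × N → ℝ} (hφ : ContMDiff (I.prod J) 𝓘(ℝ, ℝ) R φ) :
    ContMDiff I 𝓘(ℝ, ℝ) R fun x => ∫ y, φ (x, y) ∂μ := by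
  have key : ∀ n : ℕ, ContMDiff (I.prod J) 𝓘(ℝ, ℝ) n φ →
      ContMDiff I 𝓘(ℝ, ℝ) n fun x => ∫ y, φ (x, y) ∂μ := by
    intro n hφ x
    have : IsManifold I n M := IsManifold.of_le (n := ∞) (by norm_cast; exact le_top)
    let e := extChartAt I x
    have hs : ContMDiffOn (𝓘(ℝ, E).prod J) 𝓘(ℝ, ℝ) n (fun q : E × N => φ (e.symm q.1, q.2))
        (interior e.target ×ˢ univ) := by
      refine hφ.comp_contMDiffOn ?_
      refine ContMDiffOn.prodMk ?_ contMDiff_snd.contMDiffOn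
      exact (contMDiffOn_extChartAt_symm x).comp contMDiff_fst.contMDiffOn
        fun q hq => (interior_subset hq.1 : q.1 ∈ e.target)
    have h1 := (contDiffOn_integral_param μ n isOpen_interior hs).contDiffAt
      (isOpen_interior.mem_nhds (mem_interior_iff_mem_nhds.2
        (extChartAt_target_mem_nhds_of_boundaryless (I := I) x)))
    have h2 : ContMDiffAt I 𝓘(ℝ, ℝ) n ((fun u => ∫ y, φ (e.symm u, y) ∂μ) ∘ e) x :=
      h1.contMDiffAt.comp x contMDiffAt_extChartAt
    refine h2.congr_of_eventuallyEq ?_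
    filter_upwards [extChartAt_source_mem_nhds (I := I) x] with z hz
    simp only [Function.comp, e, (extChartAt I x).left_inv hz]
  induction R using ENat.recTopCoe with
  | top => exact contMDiff_infty.2 fun n => key n (contMDiff_infty.1 hφ n)
  | coe n => exact key n hφ

end Parametric

end PHCocycle

namespace PHCocycle

/-! ### Holonomies of cohomologous functions -/

section Cohomologous

variable {E : Type*} [NormedAddCommGroup E] [NormedSpace ℝ E]
  {H : Type*} [TopologicalSpace H] {I : ModelWithCorners ℝ E H}
  {X : Type*} [TopologicalSpace X] [ChartedSpace H X] [IsManifold I 1 X]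
  [CompactSpace X] [T2Space X]
  {W : Type*} [NormedAddCommGroup W] [NormedSpace ℝ W] [FiniteDimensional ℝ W]
  {G : Metric I X} {F : X ≃ₘ^1⟮I, I⟯ X} {T : Splitting I X} {lam : ℝ} {φ χ k : X → ℝ}
  {D : ∀ x : X, Submodule ℝ (TangentSpace I x)}

/-- The orbits of two points of a contracted leaf are asymptotic. -/
theorem IsContracted.tendsto_iterate_sub (h : IsContracted G F D lam) (Θ : Framing I X W)
    (hk : Continuous k) {x y : X} (hxy : InLeaf D x y) :
    Filter.Tendsto (fun n => k (F^[n] x) - k (F^[n] y)) Filter.atTop (𝓝 0) := by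
  obtain ⟨C, hC0, hC⟩ := exists_norm_vderiv_le Θ G Θ.contMDiff
  obtain ⟨γ, ℓ, hγ, rfl, rfl⟩ := hxy.exists_isLeafCurve G
  have h1 : Filter.Tendsto (fun n => Θ.ι (F^[n] (γ 0)) - Θ.ι (F^[n] (γ 1))) Filter.atTop (𝓝 0) :=
    squeeze_zero_norm (h.norm_iterate_sub_le' hC0.le Θ.contMDiff (fun p v _ => hC p v) hγ)
      (by simpa using (tendsto_pow_atTop_nhds_zero_of_lt_one h.pos.le h.lt_one).const_mul (C * ℓ))
  have hlim : ∀ (g : Ultrafilter ℕ) (z : X), ∃ p, Filter.Tendsto (fun n => F^[n] z) g (𝓝 p) :=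
    fun g z => ⟨_, (g.map fun n => F^[n] z).le_nhds_lim⟩
  rw [Filter.tendsto_iff_ultrafilter]
  intro g hg
  obtain ⟨p, hp⟩ := hlim g (γ 0)
  obtain ⟨q, hq⟩ := hlim g (γ 1)
  have h2 : Θ.ι p - Θ.ι q = 0 := tendsto_nhds_unique
    (((Θ.contMDiff.continuous.tendsto p).comp hp).sub ((Θ.contMDiff.continuous.tendsto q).comp hq))
    (h1.mono_left hg)
  obtain rfl := Θ.inj (sub_eq_zero.1 h2)
  simpa using ((hk.tendsto p).comp hp).sub ((hk.tendsto p).comp hq)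

theorem tsum_of_telescope {a b c : ℕ → ℝ} (hb : Summable b) (hc : Summable c)
    (e : ∀ n, b n = a (n + 1) - a n + c n) (ha : Filter.Tendsto a Filter.atTop (𝓝 0)) :
    ∑' n, b n = ∑' n, c n - a 0 := by
  have h1 := (hb.hasSum.sub hc.hasSum).tendsto_sum_nat
  have h2 : ∀ n, ∑ i ∈ Finset.range n, (b i - c i) = a n - a 0 := fun n => by
    rw [← Finset.sum_range_sub]
    exact Finset.sum_congr rfl fun i _ => by rw [e]; ring
  simp only [h2] at h1
  have := tendsto_nhds_unique h1 (ha.sub_const (a 0))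
  linarith

theorem IsHyperbolicPair.holLeg_of_cohomologous (h : IsHyperbolicPair G F T lam)
    (Θ : Framing I X W) (hφ : HasHol F T φ) (hχ : HasHol F T χ) (hk : Continuous k)
    (e : ∀ p, φ p = k (F p) - k p + χ p) {σ : Leg} {x y : X} (hxy : InLeaf (T.leaf σ) x y) :
    holLeg F φ σ x y = holLeg F χ σ x y + (k y - k x) := by
  cases σ
  · have := tsum_of_telescope (hφ.stable x y hxy) (hχ.stable x y hxy)
      (a := fun n => k (F^[n] x) - k (F^[n] y))
      (fun n => by simp only [e, Function.iterate_succ_apply']; ring)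
      (h.stable.tendsto_iterate_sub Θ hk hxy)
    change holS F φ x y = holS F χ x y + _
    rw [holS, this, holS]
    simp only [Function.iterate_zero, id]
    ring
  · have := tsum_of_telescope ((summable_nat_add_iff 1).2 (hφ.unstable x y hxy)).neg
      ((summable_nat_add_iff 1).2 (hχ.unstable x y hxy)).neg
      (a := fun n => k (F.symm^[n] x) - k (F.symm^[n] y))
      (fun n => by
        simp only [e, Function.iterate_succ_apply', F.apply_symm_apply]; ring)
      (h.unstable.tendsto_iterate_sub Θ hk hxy)
    change holU F φ x y = holU F χ x y + _
    rw [tsum_neg, tsum_neg] at this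
    rw [holU, this, holU]
    simp only [Function.iterate_zero, id]
    ring

theorem HasHol.holLeg_add (h : HasHol F T φ) {σ : Leg} {x y z : X}
    (hxy : InLeaf (T.leaf σ) x y) (hyz : InLeaf (T.leaf σ) y z) :
    holLeg F φ σ x z = holLeg F φ σ x y + holLeg F φ σ y z := by
  cases σ
  · change holS F φ x z = holS F φ x y + holS F φ y z
    rw [holS, holS, holS, ← (h.stable x y hxy).tsum_add (h.stable y z hyz)]
    exact tsum_congr fun n => by ring
  · change holU F φ x z = holU F φ x y + holU F φ y z
    rw [holU, holU, holU, ← neg_add, ← ((summable_nat_add_iff 1).2 (h.unstable x y hxy)).tsum_add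
      ((summable_nat_add_iff 1).2 (h.unstable y z hyz))]
    exact congrArg _ (tsum_congr fun n => by ring)

theorem InLeaf.of_curve {γ : ℝ → X} (hγ : ContMDiff 𝓘(ℝ, ℝ) I 1 γ)
    (ht : ∀ t ∈ Icc (0 : ℝ) 1, mfderiv 𝓘(ℝ, ℝ) I γ t (1 : ℝ) ∈ D (γ t)) {s t : ℝ}
    (hs : s ∈ Icc (0 : ℝ) 1) (ht' : t ∈ Icc (0 : ℝ) 1) : InLeaf D (γ s) (γ t) := by
  have hd : ∀ r : ℝ, HasDerivAt (fun r : ℝ => s + r * (t - s)) (t - s) r := fun r => by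
    simpa using ((hasDerivAt_id r).mul_const (t - s)).const_add s
  refine ⟨γ ∘ fun r : ℝ => s + r * (t - s), hγ.comp (ContDiff.contMDiff (by fun_prop)),
    by simp, by simp, fun r hr => ?_⟩
  rw [mfderiv_comp_real (hd r) (hγ.mdifferentiableAt one_ne_zero)]
  refine Submodule.smul_mem _ _ (ht _ ((convex_Icc (0 : ℝ) 1).add_smul_sub_mem hs ht' hr))

end Cohomologous

end PHCocycle

namespace PHCocycle

/-! ### Lifting legs of the base -/

section Lifting

variable {E : Type*} [NormedAddCommGroup E] [NormedSpace ℝ E] [FiniteDimensional ℝ E]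
  {H : Type*} [TopologicalSpace H] {I : ModelWithCorners ℝ E H}
  {M : Type*} [TopologicalSpace M] [ChartedSpace H M] [IsManifold I 1 M] [BoundarylessManifold I M]
  [CompactSpace M] [T2Space M]
  {F : Type*} [NormedAddCommGroup F] [NormedSpace ℝ F] [FiniteDimensional ℝ F]
  {H' : Type*} [TopologicalSpace H'] {J : ModelWithCorners ℝ F H'}
  {N : Type*} [TopologicalSpace N] [ChartedSpace H' N] [IsManifold J 1 N] [BoundarylessManifold J N]
  [CompactSpace N] [T2Space N]
  {W : Type*} [NormedAddCommGroup W] [NormedSpace ℝ W] [FiniteDimensional ℝ W]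
  {W' : Type*} [NormedAddCommGroup W'] [NormedSpace ℝ W'] [FiniteDimensional ℝ W']
  {f : M ≃ₘ^1⟮I, I⟯ M} {S : Splitting I M} {m : Metric I M}
  {ft : (M × N) ≃ₘ^1⟮I.prod J, I.prod J⟯ (M × N)} {g : M → N ≃ₘ^1⟮J, J⟯ N}
  {Vs Vu : M → ∀ y : N, Submodule ℝ (TangentSpace J y)}

/-- Vectors tangent to a leaf of the base lift continuously to vectors tangent to the leaf
upstairs. -/
theorem Splitting.IsInduced.exists_lift (Φ : Framing I M W) (Ψ : Framing J N W')
    (hf : IsPartiallyHyperbolicFor m f S) {T : Splitting (I.prod J) (M × N)}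
    (hT : T.IsInduced S Vs Vu) {G : Metric (I.prod J) (M × N)}
    (hTG : IsPartiallyHyperbolicFor G ft T) (σ : Leg) :
    ∃ B : M × N → W →L[ℝ] W', Continuous B ∧ ∀ p, ∀ v ∈ S.leaf σ p.1,
      tpair p (v, Ψ.ρ p.2 (B p (Φ.d p.1 v))) ∈ T.leaf σ p := by
  obtain ⟨Ps, Pc, Pu, hPs, hPc, hPu, hmem, hsum, -⟩ := (Φ.prod Ψ).exists_projections hTG
  have key : ∀ (p : M × N) (v : TangentSpace I p.1), ∃ a ∈ T.s p, ∃ b ∈ T.c p, ∃ c ∈ T.u p,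
      (Φ.prod Ψ).d p a = Ps p (Φ.d p.1 v, 0) ∧ (Φ.prod Ψ).d p c = Pu p (Φ.d p.1 v, 0) ∧
      horizontalProj p a + horizontalProj p b + horizontalProj p c = v ∧
      horizontalProj p a ∈ S.s p.1 ∧ horizontalProj p b ∈ S.c p.1 ∧
      horizontalProj p c ∈ S.u p.1 := by
    intro p v
    have hd : (Φ.prod Ψ).d p (tpair p (v, 0)) = (Φ.d p.1 v, 0) := by
      rw [Framing.prod_d, horizontalProj_tpair, verticalProj_tpair, map_zero]
    obtain ⟨⟨a, ha, ea⟩, ⟨b, hb, eb⟩, ⟨c, hc, ec⟩⟩ := hmem p (Φ.d p.1 v, 0)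
    have hs := hsum p (Φ.d p.1 v, 0)
    rw [← ea, ← eb, ← ec, ← hd, Framing.proj_d] at hs
    have habc : a + b + c = tpair p (v, 0) := (Φ.prod Ψ).d_injective p (by
      rw [map_add, map_add]; exact hs)
    refine ⟨a, ha, b, hb, c, hc, ea, ec, ?_, hT.proj_s p ▸ Submodule.mem_map_of_mem ha,
      hT.proj_c p ▸ Submodule.mem_map_of_mem hb, hT.proj_u p ▸ Submodule.mem_map_of_mem hc⟩
    rw [← map_add, ← map_add, habc, horizontalProj_tpair]
  have hS := fun x => (hf.compl_s x).disjoint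
  have hrep : ∀ (p : M × N) (a : TangentSpace (I.prod J) p) (w : W × W'),
      (Φ.prod Ψ).d p a = w → tpair p (horizontalProj p a, Ψ.ρ p.2 w.2) = a := by
    rintro p a _ rfl
    rw [Framing.prod_d, Framing.ρ_d, tpair_proj]
  cases σ
  · refine ⟨fun p => (ContinuousLinearMap.snd ℝ W W' ∘L Ps p) ∘L ContinuousLinearMap.inl ℝ W W',
      (continuous_const.clm_comp hPs).clm_comp continuous_const, fun p v hv => ?_⟩
    obtain ⟨a, ha, b, hb, c, hc, ea, -, hv', h1, h2, h3⟩ := key p v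
    have : horizontalProj p a = v := (components_eq₃ (hf.disjoint_cu p.1) (hS p.1) h1 hv h2
      (Submodule.zero_mem _) h3 (Submodule.zero_mem _) (hv'.trans ((add_zero _).trans (add_zero v)).symm)).1
    have h4 := hrep p a _ ea
    rw [this] at h4
    change tpair p (v, Ψ.ρ p.2 (Ps p (Φ.d p.1 v, 0)).2) ∈ T.s p
    rwa [h4]
  · refine ⟨fun p => (ContinuousLinearMap.snd ℝ W W' ∘L Pu p) ∘L ContinuousLinearMap.inl ℝ W W',
      (continuous_const.clm_comp hPu).clm_comp continuous_const, fun p v hv => ?_⟩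
    obtain ⟨a, ha, b, hb, c, hc, -, ec, hv', h1, h2, h3⟩ := key p v
    have : horizontalProj p c = v := (components_eq₃ (hf.disjoint_cu p.1) (hS p.1) h1
      (Submodule.zero_mem _) h2 (Submodule.zero_mem _) h3 hv
      (hv'.trans ((congrArg (· + v) (zero_add _)).trans (zero_add v)).symm)).2.2
    have h4 := hrep p c _ ec
    rw [this] at h4
    change tpair p (v, Ψ.ρ p.2 (Pu p (Φ.d p.1 v, 0)).2) ∈ T.u p
    rwa [h4]

theorem mfderiv_pair_curve {α : ℝ → M} {η : ℝ → N} {t : ℝ}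
    (hα : MDifferentiableAt 𝓘(ℝ, ℝ) I α t) (hη : MDifferentiableAt 𝓘(ℝ, ℝ) J η t) :
    mfderiv 𝓘(ℝ, ℝ) (I.prod J) (fun t => (α t, η t)) t (1 : ℝ) =
      tpair (α t, η t) (mfderiv 𝓘(ℝ, ℝ) I α t (1 : ℝ), mfderiv 𝓘(ℝ, ℝ) J η t (1 : ℝ)) := by
  refine tangent_ext (p := (α t, η t)) ?_ ?_
  · rw [horizontalProj_tpair]
    exact (mfderiv_comp_curve (f := Prod.fst) mdifferentiableAt_fst (hα.prodMk hη) 1).symm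
  · rw [verticalProj_tpair]
    exact (mfderiv_comp_curve (f := Prod.snd) mdifferentiableAt_snd (hα.prodMk hη) 1).symm

theorem exists_lift_leaf (Φ : Framing I M W) (Ψ : Framing J N W')
    {L : ∀ x : M, Submodule ℝ (TangentSpace I x)}
    {L' : ∀ p : M × N, Submodule ℝ (TangentSpace (I.prod J) p)} {B : M × N → W →L[ℝ] W'}
    (hB : Continuous B) (hL : ∀ p, ∀ v ∈ L p.1, tpair p (v, Ψ.ρ p.2 (B p (Φ.d p.1 v))) ∈ L' p)
    {γ : ℝ → M} (hγ : ContMDiff 𝓘(ℝ, ℝ) I 1 γ)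
    (hγL : ∀ t ∈ Icc (0 : ℝ) 1, mfderiv 𝓘(ℝ, ℝ) I γ t (1 : ℝ) ∈ L (γ t)) (y₀ : N) {t₀ : ℝ}
    (ht₀ : t₀ ∈ Icc (0 : ℝ) 1) :
    ∀ᶠ t in 𝓝[Icc 0 1] t₀, ∃ y, InLeaf L' (γ t₀, y₀) (γ t, y) := by
  obtain ⟨r, hr, hpeano⟩ := Ψ.exists_integral_curve y₀ Filter.univ_mem
  let om : ℝ → W := deriv (Φ.ι ∘ γ)
  have hom : Continuous om := (Φ.contMDiff.comp hγ).contDiff.continuous_deriv le_rfl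
  have homd : ∀ t, Φ.d (γ t) (mfderiv 𝓘(ℝ, ℝ) I γ t (1 : ℝ)) = om t := fun t =>
    (hasDerivAt_comp_curve Φ.contMDiff (hγ.mdifferentiableAt one_ne_zero)).deriv.symm
  have hβ : Continuous fun q : ℝ × N => B (γ q.1, q.2) (om q.1) :=
    (hB.comp ((hγ.continuous.comp continuous_fst).prodMk continuous_snd)).clm_apply
      (hom.comp continuous_fst)
  obtain ⟨C, hC⟩ := (isCompact_Icc.prod isCompact_univ).exists_bound_of_continuousOn
    (hβ.continuousOn (s := Icc (0 : ℝ) 1 ×ˢ univ))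
  have hC0 : 0 ≤ C := (norm_nonneg _).trans (hC (t₀, y₀) ⟨ht₀, trivial⟩)
  filter_upwards [self_mem_nhdsWithin, nhdsWithin_le_nhds (Metric.ball_mem_nhds t₀
    (show 0 < r / (C + 1) by positivity))] with t ht htr
  rw [Metric.mem_ball, Real.dist_eq, lt_div_iff₀ (by positivity)] at htr
  let c : ℝ → ℝ := fun s => t₀ + projIcc (0 : ℝ) 1 zero_le_one s * (t - t₀)
  have hc : Continuous c := by fun_prop
  have hcm : ∀ s, c s ∈ Icc (0 : ℝ) 1 := fun s =>
    (convex_Icc (0 : ℝ) 1).add_smul_sub_mem ht₀ ht (projIcc (0 : ℝ) 1 zero_le_one s).2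
  have hce : ∀ s ∈ Icc (0 : ℝ) 1, c s = t₀ + s * (t - t₀) := fun s hs => by
    simp only [c, projIcc_of_mem zero_le_one hs]
  obtain ⟨η, hη0, hη⟩ := hpeano y₀ (by simpa using hr)
    (fun s y => (t - t₀) • B (γ (c s), y) (om (c s)))
    (continuous_const.smul (hβ.comp (f := fun q : ℝ × N => (c q.1, q.2)) (by fun_prop))).continuousOn
    (fun s y _ => by
      rw [norm_smul, Real.norm_eq_abs]
      have := mul_le_mul_of_nonneg_left (hC (c s, y) ⟨hcm s, trivial⟩) (abs_nonneg (t - t₀))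
      refine this.trans ?_
      linarith [abs_nonneg (t - t₀)])
  have hd : ∀ s : ℝ, HasDerivAt (fun s : ℝ => t₀ + s * (t - t₀)) (t - t₀) s := fun s => by
    simpa using ((hasDerivAt_id s).mul_const (t - t₀)).const_add t₀
  have hα : ContMDiff 𝓘(ℝ, ℝ) I 1 (γ ∘ fun s : ℝ => t₀ + s * (t - t₀)) :=
    hγ.comp (ContDiff.contMDiff (by fun_prop))
  have := InLeaf.of_contMDiffAt (D := L')
    (γ := fun s => ((γ ∘ fun s : ℝ => t₀ + s * (t - t₀)) s, η s))
    (fun s hs => hα.contMDiffAt.prodMk (hη s hs).2.1) fun s hs => by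
      obtain ⟨-, h1, h2⟩ := hη s hs
      rw [mfderiv_pair_curve (hα.mdifferentiableAt one_ne_zero)
        (h1.mdifferentiableAt one_ne_zero), h2, mfderiv_comp_real (hd s)
        (hγ.mdifferentiableAt one_ne_zero), hce s hs]
      simp only [Function.comp]
      rw [← homd, map_smul, ← Prod.smul_mk, map_smul]
      refine Submodule.smul_mem _ _ (hL (γ (t₀ + s * (t - t₀)), η s) _ (hγL _ ?_))
      rw [← hce s hs]
      exact hcm s
  refine ⟨η 1, ?_⟩
  simpa [hη0] using this

end Lifting

end PHCocycle

namespace PHCocycle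

/-! ### Solving the cohomological equation upstairs -/

section Solvable

variable {E : Type*} [NormedAddCommGroup E] [NormedSpace ℝ E] [FiniteDimensional ℝ E]
  {H : Type*} [TopologicalSpace H] {I : ModelWithCorners ℝ E H}
  {M : Type*} [TopologicalSpace M] [ChartedSpace H M] [IsManifold I 1 M] [BoundarylessManifold I M]
  [CompactSpace M] [T2Space M]
  {F : Type*} [NormedAddCommGroup F] [NormedSpace ℝ F] [FiniteDimensional ℝ F]
  {H' : Type*} [TopologicalSpace H'] {J : ModelWithCorners ℝ F H'}
  {N : Type*} [TopologicalSpace N] [ChartedSpace H' N] [IsManifold J 1 N] [BoundarylessManifold J N]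
  [CompactSpace N] [T2Space N]
  {W : Type*} [NormedAddCommGroup W] [NormedSpace ℝ W] [FiniteDimensional ℝ W]
  {W' : Type*} [NormedAddCommGroup W'] [NormedSpace ℝ W'] [FiniteDimensional ℝ W']
  {f : M ≃ₘ^1⟮I, I⟯ M} {S : Splitting I M} {m : Metric I M}
  {ft : (M × N) ≃ₘ^1⟮I.prod J, I.prod J⟯ (M × N)} {g : M → N ≃ₘ^1⟮J, J⟯ N}
  {Vs Vu : M → ∀ y : N, Submodule ℝ (TangentSpace J y)}

theorem holLeg_fst (hff : ∀ p, (ft p).1 = f p.1) (ψ : M → ℝ) (σ : Leg) (p q : M × N) :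
    holLeg ft (fun p => ψ p.1) σ p q = holLeg f ψ σ p.1 q.1 := by
  have h1 : ∀ n p, (ft^[n] p).1 = f^[n] p.1 := fun n p =>
    Function.Semiconj.iterate_right (f := Prod.fst) (ga := ft) (gb := f) hff n p
  have h2 : ∀ n p, (ft.symm^[n] p).1 = f.symm^[n] p.1 := fun n p =>
    Function.Semiconj.iterate_right (f := Prod.fst) (ga := ft.symm) (gb := f.symm)
      (fun p => f.injective (show f (ft.symm p).1 = f (f.symm p.1) by rw [← hff, ft.apply_symm_apply, f.apply_symm_apply])) n p
  cases σ
  · change holS ft (fun p => ψ p.1) p q = holS f ψ p.1 q.1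
    simp only [holS, h1]
  · change holU ft (fun p => ψ p.1) p q = holU f ψ p.1 q.1
    simp only [holU, h2]

/-- `su`-sequences of the base lift, and holonomies are related by the transfer function. -/
theorem HolRel.lift (Φ : Framing I M W) (Ψ : Framing J N W')
    (hf : IsPartiallyHyperbolicFor m f S) (hff : ∀ p, (ft p).1 = f p.1)
    {T : Splitting (I.prod J) (M × N)}
    (hT : T.IsInduced S Vs Vu) {G : Metric (I.prod J) (M × N)}
    (hTG : IsPartiallyHyperbolicFor G ft T) {φ k : M × N → ℝ} {ψ : M → ℝ}
    (hφ : ContMDiff (I.prod J) 𝓘(ℝ, ℝ) 1 φ) (hψ : ContMDiff I 𝓘(ℝ, ℝ) 1 ψ) (hk : Continuous k)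
    (hkr : ∀ x y z, HolRel ft T φ (x, y) (x, z) (k (x, z) - k (x, y)))
    (e : ∀ p, φ p = k (ft p) - k p + ψ p.1) {x x' : M} {c : ℝ} (h : HolRel f S ψ x x' c)
    (y y' : N) : HolRel ft T φ (x, y) (x', y') (c + (k (x', y') - k (x, y))) := by
  obtain ⟨lam, hG⟩ := hTG.exists_isHyperbolicPair (Φ.prod Ψ)
  obtain ⟨lam', hm⟩ := hf.exists_isHyperbolicPair Φ
  have hHφ := hG.hasHol (Φ.prod Ψ) hφ
  have hHψ := hG.hasHol (Φ.prod Ψ) (hψ.comp (contMDiff_fst (I := I) (J := J) (M := M) (N := N)))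
  have hHψ' := hm.hasHol Φ hψ
  induction h generalizing y' with
  | refl => exact (hkr x y y').cast (by ring)
  | @step z z' c σ _ hzz ih =>
    obtain ⟨B, hB, hBL⟩ := hT.exists_lift Φ Ψ hf hTG σ
    obtain ⟨γ, hγ, rfl, rfl, hγL⟩ := hzz
    have hleaf : ∀ s ∈ Icc (0 : ℝ) 1, ∀ t ∈ Icc (0 : ℝ) 1, InLeaf (S.leaf σ) (γ s) (γ t) :=
      fun s hs t ht => InLeaf.of_curve hγ hγL hs ht
    have key := isPreconnected_Icc.induction₂ (s := Icc (0 : ℝ) 1)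
      (fun s t => HolRel ft T φ (γ s, y) (γ t, y)
        (holLeg f ψ σ (γ s) (γ t) + (k (γ t, y) - k (γ s, y))))
      (fun s hs => by
        filter_upwards [exists_lift_leaf Φ Ψ hB hBL hγ hγL y hs] with t ⟨y₁, hy⟩
        refine ((HolRel.of_leg hy).trans (hkr (γ t) y₁ y)).cast ?_
        rw [hG.holLeg_of_cohomologous (Φ.prod Ψ) hHφ hHψ hk e hy]
        have := holLeg_fst hff ψ σ (γ s, y) (γ t, y₁)
        simp only [Function.comp_def, this]
        ring)
      (fun r s t hr hs ht h1 h2 => (h1.trans h2).cast (by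
        rw [hHψ'.holLeg_add (hleaf r hr s hs) (hleaf s hs t ht)]; ring))
      (fun s t hs ht h1 => h1.symm.cast (by rw [holLeg_symm f ψ σ (γ s) (γ t)]; ring))
      (show (0 : ℝ) ∈ Icc (0 : ℝ) 1 by simp) (show (1 : ℝ) ∈ Icc (0 : ℝ) 1 by simp)
    exact (((ih y).trans key).trans (hkr (γ 1) y y')).cast (by ring)

end Solvable

section Main

variable {E : Type*} [NormedAddCommGroup E] [NormedSpace ℝ E] [FiniteDimensional ℝ E]
  {H : Type*} [TopologicalSpace H] {I : ModelWithCorners ℝ E H}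
  {M : Type*} [TopologicalSpace M] [ChartedSpace H M] [IsManifold I ∞ M] [IsManifold I 1 M]
  [BoundarylessManifold I M] [CompactSpace M] [T2Space M]
  {F : Type*} [NormedAddCommGroup F] [NormedSpace ℝ F] [FiniteDimensional ℝ F]
  {H' : Type*} [TopologicalSpace H'] {J : ModelWithCorners ℝ F H'}
  {N : Type*} [TopologicalSpace N] [ChartedSpace H' N] [IsManifold J ∞ N] [IsManifold J 1 N]
  [BoundarylessManifold J N] [CompactSpace N] [T2Space N] [ConnectedSpace N]
  [MeasurableSpace N] [BorelSpace N]
  {W : Type*} [NormedAddCommGroup W] [NormedSpace ℝ W] [FiniteDimensional ℝ W]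
  {W' : Type*} [NormedAddCommGroup W'] [NormedSpace ℝ W'] [FiniteDimensional ℝ W']
  {f : M ≃ₘ^1⟮I, I⟯ M} {S : Splitting I M} {m : Metric I M}
  {ft : (M × N) ≃ₘ^1⟮I.prod J, I.prod J⟯ (M × N)} {g : M → N ≃ₘ^1⟮J, J⟯ N}
  {Vs Vu : M → ∀ y : N, Submodule ℝ (TangentSpace J y)} {h : Metric (I.prod J) (M × N)}

theorem CohomologicalEquationSolvable.extension {R : ℕ∞} (hR : 1 ≤ R)
    (hsolv : CohomologicalEquationSolvable R f S) (Φ : Framing I M W) (Ψ : Framing J N W')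
    (hf : IsPartiallyHyperbolicFor m f S) (hft : ∀ x y, ft (x, y) = (f x, g x y))
    (hfib : IsDominatingHyperbolicFibre m h f S g Vs Vu) {T : Splitting (I.prod J) (M × N)}
    (hT : T.IsInduced S Vs Vu) (hTp : IsPartiallyHyperbolic ft T) (μ : Measure N)
    [IsProbabilityMeasure μ] (hμ : ∀ x, MeasurePreserving (g x) μ μ) :
    CohomologicalEquationSolvable R ft T := by
  intro φ hφR hpcf
  have hR' : ((1 : ℕ∞) : WithTop ℕ∞) ≤ R := by exact_mod_cast hR
  obtain ⟨G, hTG⟩ := hTp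
  have hφ := hφR.of_le hR'
  obtain ⟨k, hk, hkr, e⟩ := exists_fibre_transfer Φ Ψ hf hft hfib hT hTG μ hμ hφ hpcf
  have hψR := contMDiff_integral_param μ hφR
  have hψ := hψR.of_le hR'
  obtain ⟨y₀⟩ : Nonempty N := inferInstance
  obtain ⟨u, K, hu, huK⟩ := hsolv _ hψR (trivialPCF_iff.2 fun x c hc => by
    have := HolRel.lift Φ Ψ hf (fun p => congrArg Prod.fst (hft p.1 p.2)) hT hTG hφ hψ hk hkr e hc
      y₀ y₀
    simpa using trivialPCF_iff.1 hpcf _ _ this)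
  refine ⟨fun p => k p + u p.1, K, hk.add (hu.comp continuous_fst), fun p => ?_⟩
  have h1 : (ft p).1 = f p.1 := congrArg Prod.fst (hft p.1 p.2)
  rw [e p, huK]
  simp only [h1]
  ring

end Main

end PHCocycle

namespace PHCocycle

/-! ### The set of coboundaries is closed -/

section Closed

variable {E : Type*} [NormedAddCommGroup E] [NormedSpace ℝ E]
  {H : Type*} [TopologicalSpace H] {I : ModelWithCorners ℝ E H}
  {X : Type*} [TopologicalSpace X] [ChartedSpace H X] [IsManifold I 1 X]
  [CompactSpace X] [T2Space X]
  {W : Type*} [NormedAddCommGroup W] [NormedSpace ℝ W] [FiniteDimensional ℝ W]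
  {G : Metric I X} {F : X ≃ₘ^1⟮I, I⟯ X} {T : Splitting I X} {lam : ℝ} {φ : X → ℝ}

theorem holLeg_zero (F : X ≃ₘ^1⟮I, I⟯ X) (σ : Leg) (x y : X) : holLeg F (fun _ => 0) σ x y = 0 := by
  cases σ
  · change holS F (fun _ => 0) x y = 0
    simp [holS]
  · change holU F (fun _ => 0) x y = 0
    simp [holU]

/-- A `C¹`-small perturbation of a coboundary has nearly trivial holonomies. -/
theorem HolRel.exists_abs_sub_le (hG : IsHyperbolicPair G F T lam) (Θ : Framing I X W)
    (hφ : ContMDiff I 𝓘(ℝ, ℝ) 1 φ) {x y : X} {c : ℝ} (h : HolRel F T φ x y c) :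
    ∃ C, ∀ (χ u : X → ℝ) (ε : ℝ), 0 ≤ ε → ContMDiff I 𝓘(ℝ, ℝ) 1 χ → Continuous u →
      (∀ p, χ p = u (F p) - u p) →
      (∀ p v, ‖vderiv I (fun p => φ p - χ p) p v‖ ≤ ε * G.len v) → |c - (u y - u x)| ≤ C * ε := by
  induction h with
  | refl => exact ⟨0, fun χ u ε _ _ _ _ _ => by simp⟩
  | @step y z c σ _ hyz ih =>
    obtain ⟨C, hC⟩ := ih
    obtain ⟨γ, ℓ, hγ, rfl, rfl⟩ := hyz.exists_isLeafCurve G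
    refine ⟨C + ℓ * (1 + (1 - lam)⁻¹), fun χ u ε hε hχ hu e hd => ?_⟩
    have h1 := hC χ u ε hε hχ hu e hd
    have hφ' := hG.hasHol Θ hφ
    have hχ' := hG.hasHol Θ hχ
    have h2 := hG.holLeg_of_cohomologous Θ hχ' (hG.hasHol Θ contMDiff_const) hu
      (χ := fun _ => 0) (fun p => by rw [e, add_zero]) hyz
    rw [holLeg_zero, zero_add] at h2
    have h3 := hG.abs_holLeg_le (hφ.sub hχ) hε hd hγ
    rw [hφ'.holLeg_sub hχ' hyz, h2] at h3
    calc |c + holLeg F φ σ (γ 0) (γ 1) - (u (γ 1) - u x)|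
        = |(c - (u (γ 0) - u x)) + (holLeg F φ σ (γ 0) (γ 1) - (u (γ 1) - u (γ 0)))| := by
          congr 1; ring
      _ ≤ C * ε + ε * ℓ * (1 + (1 - lam)⁻¹) := (abs_add_le _ _).trans (add_le_add h1 h3)
      _ = _ := by ring

theorem abs_le_of_cohomologous [Nonempty X] {h : X → ℝ} (hh : Continuous h) {K ε : ℝ} {F : X → X}
    (hK : ∀ p, |h (F p) - h p + K| ≤ ε) : |K| ≤ ε := by
  obtain ⟨p, -, hp⟩ := isCompact_univ.exists_isMaxOn univ_nonempty hh.continuousOn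
  obtain ⟨q, -, hq⟩ := isCompact_univ.exists_isMinOn univ_nonempty hh.continuousOn
  have h1 := abs_le.1 (hK p)
  have h2 := abs_le.1 (hK q)
  have h3 : h (F p) ≤ h p := hp (mem_univ _)
  have h4 : h q ≤ h (F q) := hq (mem_univ _)
  exact abs_le.2 ⟨by linarith, by linarith⟩

/-- Functions in the closure of the coboundaries are approximated by coboundaries. -/
theorem exists_isCoboundary_near (Θ : Framing I X W) (G : Metric I X) {R : ℕ∞} (hR : 1 ≤ R)
    {φ : ContMDiffMap I 𝓘(ℝ, ℝ) X ℝ R}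
    (hφ : φ ∈ closure[c1Topology R] {φ : ContMDiffMap I 𝓘(ℝ, ℝ) X ℝ R | IsCoboundary F φ}) {ε : ℝ}
    (hε : 0 < ε) :
    ∃ χ : ContMDiffMap I 𝓘(ℝ, ℝ) X ℝ R, IsCoboundary F χ ∧ (∀ p, |φ p - χ p| ≤ ε) ∧
      ∀ p v, ‖vderiv I (fun p => φ p - χ p) p v‖ ≤ ε * G.len v := by
  have hR' : (1 : WithTop ℕ∞) ≤ R := by exact_mod_cast hR
  obtain ⟨c, _, hc, _, hcd⟩ := exists_norm_d_le Θ G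
  let K : Set (TangentBundle I X) := (fun q : X × W => (⟨q.1, Θ.ρ q.1 q.2⟩ : TangentBundle I X)) ''
    (univ ×ˢ Metric.closedBall 0 c⁻¹)
  have hK : IsCompact K := (isCompact_univ.prod
    (have := FiniteDimensional.proper ℝ W; isCompact_closedBall _ _)).image Θ.cont
  have hKm : ∀ p (v : TangentSpace I p), G.len v ≤ 1 → (⟨p, v⟩ : TangentBundle I X) ∈ K := by
    intro p v hv
    refine ⟨(p, Θ.d p v), ⟨trivial, ?_⟩, congrArg (TotalSpace.mk p) (Θ.ρ_d p v)⟩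
    rw [mem_closedBall_zero_iff, ← one_div, le_div_iff₀' hc]
    exact (hcd p v).1.trans hv
  let _ := c1Topology (I := I) (M := X) R
  have hne := mem_closure_iff_nhdsWithin_neBot.1 hφ
  have ht := (continuous_induced_dom (t := inferInstance)
    (f := fun φ : ContMDiffMap I 𝓘(ℝ, ℝ) X ℝ R => ((UniformFun.ofFun φ : X →ᵤ ℝ),
      (UniformOnFun.ofFun {C | IsCompact C}
        (fun v : TangentBundle I X => (mfderiv I 𝓘(ℝ, ℝ) φ v.1 v.2 : ℝ)) :
        TangentBundle I X →ᵤ[{C | IsCompact C}] ℝ)))).tendsto φ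
  have ht' := ht.mono_left (nhdsWithin_le_nhds
    (s := {φ : ContMDiffMap I 𝓘(ℝ, ℝ) X ℝ R | IsCoboundary F φ}))
  have h1 := UniformFun.tendsto_iff_tendstoUniformly.1 (Filter.Tendsto.fst_nhds ht')
  have h2 := UniformOnFun.tendsto_iff_tendstoUniformlyOn.1 (Filter.Tendsto.snd_nhds ht') K hK
  obtain ⟨χ, ⟨hχ, hχ1⟩, hχ2⟩ := ((eventually_mem_nhdsWithin.and
    (Metric.tendstoUniformly_iff.1 h1 ε hε)).and (Metric.tendstoUniformlyOn_iff.1 h2 ε hε)).exists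
  refine ⟨χ, hχ, fun p => (hχ1 p).le, fun p v => ?_⟩
  have hd := vderiv_sub (φ.contMDiff.of_le hR') (χ.contMDiff.of_le hR') p
  have hunit : ∀ w : TangentSpace I p, G.len w ≤ 1 →
      ‖vderiv I (fun p => φ p - χ p) p w‖ ≤ ε := fun w hw => by
    rw [hd]
    exact (hχ2 ⟨p, w⟩ (hKm p w hw)).le
  rcases eq_or_ne v 0 with rfl | hv
  · rw [map_zero, norm_zero]
    exact mul_nonneg hε.le (G.len_nonneg _)
  · have hl := G.len_pos hv
    have h3 := hunit ((G.len v)⁻¹ • v) (by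
      rw [Metric.len_smul, abs_of_pos (inv_pos.2 hl), inv_mul_cancel₀ hl.ne'])
    rw [map_smul, norm_smul, norm_inv, Real.norm_of_nonneg hl.le, inv_mul_le_iff₀ hl] at h3
    linarith

theorem IsPartiallyHyperbolic.isCocycleStable (Θ : Framing I X W) {R : ℕ∞} (hR : 1 ≤ R)
    (hT : IsPartiallyHyperbolic F T) (hsolv : CohomologicalEquationSolvable R F T) :
    IsCocycleStable R F T := by
  refine ⟨hsolv, @isClosed_of_closure_subset _ (c1Topology R) _ fun φ hφ => ?_⟩
  have hR' : (1 : WithTop ℕ∞) ≤ R := by exact_mod_cast hR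
  obtain ⟨G, hTG⟩ := hT
  obtain ⟨lam, hG⟩ := hTG.exists_isHyperbolicPair Θ
  obtain ⟨u, K, hu, huK⟩ := hsolv φ φ.contMDiff (trivialPCF_iff.2 fun x c hc => by
    obtain ⟨C, hC⟩ := hc.exists_abs_sub_le hG Θ (φ.contMDiff.of_le hR')
    refine abs_nonpos_iff.1 (le_of_forall_pos_le_add fun η hη => ?_)
    obtain ⟨χ, ⟨w, hw, e⟩, -, hd⟩ := exists_isCoboundary_near Θ G hR hφ
      (ε := η / (|C| + 1)) (by positivity)
    have h1 := hC χ w _ (by positivity) (χ.contMDiff.of_le hR') hw e hd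
    rw [sub_self, sub_zero] at h1
    refine h1.trans ?_
    rw [zero_add, mul_div_assoc', div_le_iff₀ (by positivity)]
    nlinarith [le_abs_self C])
  rcases isEmpty_or_nonempty X with hX | hX
  · exact ⟨u, hu, isEmptyElim⟩
  have hK : K = 0 := by
    refine abs_nonpos_iff.1 (le_of_forall_pos_le_add fun η hη => ?_)
    obtain ⟨χ, ⟨w, hw, e⟩, hd, -⟩ := exists_isCoboundary_near Θ G hR hφ hη
    rw [zero_add]
    refine abs_le_of_cohomologous (h := fun p => u p - w p) (F := F) (hu.sub hw) fun p => ?_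
    refine le_of_eq_of_le ?_ (hd p)
    rw [huK, e]
    congr 1
    ring
  exact ⟨u, hu, fun p => by rw [huK, hK, add_zero]⟩

end Closed

end PHCocycle
theorem mainTheorem9
    {E : Type*} [NormedAddCommGroup E] [NormedSpace ℝ E] [FiniteDimensional ℝ E]
    {H : Type*} [TopologicalSpace H] {I : ModelWithCorners ℝ E H}
    {M : Type*} [TopologicalSpace M] [ChartedSpace H M] [IsManifold I ∞ M]
    [BoundarylessManifold I M] [CompactSpace M] [T2Space M]
    {F : Type*} [NormedAddCommGroup F] [NormedSpace ℝ F] [FiniteDimensional ℝ F]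
    {H' : Type*} [TopologicalSpace H'] {J : ModelWithCorners ℝ F H'}
    {N : Type*} [TopologicalSpace N] [ChartedSpace H' N] [IsManifold J ∞ N]
    [BoundarylessManifold J N] [CompactSpace N] [T2Space N] [ConnectedSpace N]
    [MeasurableSpace N] [BorelSpace N]
    (R : ℕ∞) (hR : 1 ≤ R)
    -- the partially hyperbolic base
    (f : M ≃ₘ^1⟮I, I⟯ M) (S : PHCocycle.Splitting I M) (m : PHCocycle.Metric I M)
    (hf : PHCocycle.IsPartiallyHyperbolicFor m f S)
    (hsolv : PHCocycle.CohomologicalEquationSolvable R f S)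
    -- the hyperbolic extension
    (ft : (M × N) ≃ₘ^1⟮I.prod J, I.prod J⟯ (M × N)) (g : M → N ≃ₘ^1⟮J, J⟯ N)
    (hft : ∀ x y, ft (x, y) = (f x, g x y))
    (Vs Vu : M → ∀ y : N, Submodule ℝ (TangentSpace J y))
    (h : PHCocycle.Metric (I.prod J) (M × N))
    (hfib : PHCocycle.IsDominatingHyperbolicFibre m h f S g Vs Vu)
    -- the common invariant probability measure
    (μ : Measure N) [IsProbabilityMeasure μ] (hμ : ∀ x, MeasurePreserving (g x) μ μ) :
    ∃ T : PHCocycle.Splitting (I.prod J) (M × N),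
      T.IsInduced S Vs Vu ∧ PHCocycle.IsPartiallyHyperbolic ft T ∧
        PHCocycle.IsCocycleStable R ft T := by
  have hI : IsManifold I 1 M := IsManifold.of_le (n := ∞) (by norm_cast)
  have hJ : IsManifold J 1 N := IsManifold.of_le (n := ∞) (by norm_cast)
  obtain ⟨_, ⟨Φ⟩⟩ := PHCocycle.exists_framing I M
  obtain ⟨_, ⟨Ψ⟩⟩ := PHCocycle.exists_framing J N
  obtain ⟨T, hT, hTp⟩ := PHCocycle.exists_induced_splitting Φ Ψ hf hft hfib
  exact ⟨T, hT, hTp, hTp.isCocycleStable (Φ.prod Ψ) hR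
    (hsolv.extension hR Φ Ψ hf hft hfib hT hTp μ hμ)⟩
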